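/- Let $(C,J)$ be a site and let $\mathsf T$ be the topos of sheaves of sets on it. **Conventions.** A crossed module $G_\bullet=(\partial\colon G_1\to G_0)$ of $\mathsf T$ consists of two sheaves of groups, a homomorphism $\partial$ and a right action $(g,x)\mapsto g^x$ of $G_0$ on $G_1$ by automorphisms with $\partial(g^x)=x^{-1}(\partial g)x$ and $g^{\partial h}=h^{-1}gh$. It is braided if it has a map $\{-,-\}\colon G_0\times G_0\to G_1$ with $\partial\{x,y\}=y^{-1}x^{-1}yx$, $\{x,yz\}=\{x,y\}^z\{x,z\}$, $\{xy,z\}=\{y,z\}\{x,z\}^y$, $\{x,\partial h\}=h^{-1}h^x$, $\{\partial g,y\}=(g^y)^{-1}g$. It defines a strict (braided) monoidal prestack of groupoids: objects over $U$ are the $x\in G_0(U)$, morphisms $x\to x'$ are the $g\in G_1(U)$ with $x'=x\,\partial g$, the tensor product is the product of $G_0$ on objects and $g\otimes h=g^{x_2}h$ on morphisms $g\colon x_1\to x_1'$, $h\colon x_2\to x_2'$, and the braiding is $\{x,y\}\colon xy\to yx$. A group-like stack is a stack in groupoids over $(C,J)$ with a monoidal structure compatible with restriction for which all left and right translations are equivalences.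 A presentation of a group-like stack $\mathscr G$ by $G_\bullet$ is a monoidal morphism $\pi$ from this prestack to $\mathscr G$ that exhibits $\mathscr G$ as its associated stack (fully faithful over each $U$, locally essentially surjective); if $G_\bullet$ and $\mathscr G$ are braided, $\pi$ is required to be braided. Let $\mathscr H,\mathscr K$ be group-like stacks and $\mathscr G$ a braided group-like stack, with presentations by crossed modules $H_\bullet$, $K_\bullet$ and a braided crossed module $G_\bullet$ of $\mathsf T$. **Biadditive functors.** $\mathrm{Biadd}(\mathscr H,\mathscr K;\mathscr G)$ is the category of morphisms of stacks $F\colon\mathscr H\times\mathscr K\to\mathscr G$ with a monoidal structure in each variable, natural in the other one and compatible with restriction, such that the two composites $(F(X,Y)F(X',Y))(F(X,Y')F(X',Y'))\to F(XX',YY')$, one multiplying first in the first variable, the other first interchanging the two inner factors by the braiding and then multiplying first in the second variable, coincide, and such that the two isomorphisms $1\to F(1,1)$ coincide; morphisms are the natural transformations, compatible with restriction, that are monoidal in each variable. It is pointed by the constant functor with value the unit object. **Butterflies.** A $(G_1,G_0)$-torsor over a sheaf $X$ is a right $G_1$-torsor $E\to X$ with a map $\jmath\colon E\to G_0$ such that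 $\jmath(eg)=\jmath(e)\,\partial g$. A biextension of $(H_0,K_0)$ by $G_\bullet$ is a $(G_1,G_0)$-torsor $E$ over $H_0\times K_0$ with associative partial products $\times_1\colon E\times_{K_0}E\to E$ and $\times_2\colon E\times_{H_0}E\to E$ lifting the products of $H_0$, resp. $K_0$, such that, for $i=1,2$, $\jmath(e\times_i e')=\jmath(e)\jmath(e')$, $e\times_i(e'g)=(e\times_i e')g$, $(eg)\times_i e'=(e\times_i e')g^{\jmath(e')}$, and which are compatible through the braiding: $$(a\times_1a')\times_2(b\times_1b')=\bigl((a\times_2b)\times_1(a'\times_2b')\bigr)\,\bigl(\{\jmath(a'),\jmath(b)\}^{\jmath(b')}\bigr)^{-1}$$ for $a,a',b,b'$ over $(y,z),(y',z),(y,z'),(y',z')$. A butterfly is such a biextension with sections $s_1\colon H_1\times K_0\to E$ and $s_2\colon H_0\times K_1\to E$ over $\partial\times\mathrm{id}$ and $\mathrm{id}\times\partial$ which trivialize the pulled-back biextensions ($\jmath\circ s_i=1$, and each $s_i$ is multiplicative in both variables), agree on $H_1\times K_1$, that is $s_1(h,\partial k)=s_2(\partial h,k)$, and satisfy $s_1(h,z)\times_1e=e\times_1s_1(h^y,z)$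 and $s_2(y,k)\times_2e=e\times_2s_2(y,k^z)$ for $e\in E$ over $(y,z)$. Morphisms of butterflies are maps over $H_0\times K_0$ preserving all the structure. $\mathrm{Bfl}(H_\bullet,K_\bullet;G_\bullet)$ denotes the resulting category, pointed by the trivial butterfly $H_0\times K_0\times G_1$. **Theorem.** $\mathrm{Bfl}(H_\bullet,K_\bullet;G_\bullet)$ and $\mathrm{Biadd}(\mathscr H,\mathscr K;\mathscr G)$ are groupoids, and there is an equivalence of pointed groupoids $$u\colon \mathrm{Bfl}(H_\bullet,K_\bullet;G_\bullet)\overset{\sim}{\longrightarrow}\mathrm{Biadd}(\mathscr H,\mathscr K;\mathscr G).$$ Here $u(E)$ is represented by $E$, naturally in $E$: its restriction to $H_0\times K_0$ along the presentations sends $(y,z)$ to the object of $\mathscr G$ given by the torsor $E_{y,z}$; that is, points $e$ of $E_{y,z}$ give isomorphisms $u(E)(\pi y,\pi z)\to\pi(\jmath(e))$, compatible with the $G_1$-action, restriction, the two products and the trivializations. The same holds over a variable base: the groupoids $\mathrm{Bfl}(H_\bullet|_S,K_\bullet|_S;G_\bullet|_S)$ and $\mathrm{Biadd}(\mathscr H|_S,\mathscr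 K|_S;\mathscr G|_S)$, for $S\in\mathsf T$, are the fibres of two categories fibred in groupoids over $\mathsf T$, and $u$ is the fibre over the terminal object of an equivalence between these fibred categories (the stacks of butterflies and of biadditive functors) over $\mathsf T$, which preserves the distinguished points compatibly with base change. -/

import Mathlib

open CategoryTheory Opposite MonoidalCategory

attribute [-instance] CategoryTheory.catToReflQuiver

universe v u w v₁ u₁ v₂ u₂ u₃

namespace BiaddBfl

/-- A crossed module `∂ : G₁ → G₀` of the topos of `w`-small sheaves on the site `(C, J)`: two
sheaves of groups, a homomorphism `∂ = d`, and a right action `act g x = g ^ x` of `G₀` on `G₁`,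
all compatible with restriction, with `∂ (g ^ x) = x⁻¹ (∂ g) x` and `g ^ (∂ h) = h⁻¹ g h`. -/
structure CrossedModule {C : Type u} [Category.{v} C] (J : GrothendieckTopology C) where
  G₁ : Cᵒᵖ ⥤ GrpCat.{w}
  G₀ : Cᵒᵖ ⥤ GrpCat.{w}
  isSheaf₁ : Presheaf.IsSheaf J (G₁ ⋙ forget GrpCat)
  isSheaf₀ : Presheaf.IsSheaf J (G₀ ⋙ forget GrpCat)
  d : ∀ {U : C}, G₁.obj (op U) →* G₀.obj (op U)
  act : ∀ {U : C}, G₁.obj (op U) → G₀.obj (op U) → G₁.obj (op U)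
  d_res : ∀ {U V : C} (f : V ⟶ U) (g : G₁.obj (op U)), d (G₁.map f.op g) = G₀.map f.op (d g)
  act_res : ∀ {U V : C} (f : V ⟶ U) (g : G₁.obj (op U)) (x : G₀.obj (op U)),
    act (G₁.map f.op g) (G₀.map f.op x) = G₁.map f.op (act g x)
  act_one : ∀ {U : C} (g : G₁.obj (op U)), act g 1 = g
  act_mul : ∀ {U : C} (g : G₁.obj (op U)) (x y : G₀.obj (op U)), act g (x * y) = act (act g x) y
  mul_act : ∀ {U : C} (g h : G₁.obj (op U)) (x : G₀.obj (op U)),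
    act (g * h) x = act g x * act h x
  d_act : ∀ {U : C} (g : G₁.obj (op U)) (x : G₀.obj (op U)), d (act g x) = x⁻¹ * d g * x
  act_d : ∀ {U : C} (g h : G₁.obj (op U)), act g (d h) = h⁻¹ * g * h

variable {C : Type u} [Category.{v} C] {J : GrothendieckTopology C}

namespace CrossedModule

lemma one_act (M : CrossedModule.{v,u,w} J) {U : C} (x : M.G₀.obj (op U)) :
    M.act 1 x = 1 := by
  have h := M.mul_act 1 1 x
  rw [mul_one] at h
  exact left_eq_mul.mp h

/-- The objects of the groupoid `Γ(U)` attached to a crossed module: sections of `G₀` over `U`. -/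
structure Pt (M : CrossedModule.{v,u,w} J) (U : C) where
  pt : M.G₀.obj (op U)

variable (M : CrossedModule.{v,u,w} J)

/-- Morphisms `x ⟶ y` of `Γ(U)`: sections `g` of `G₁` with `y = x ∂g`. -/
@[ext]
structure Pt.Hom {M : CrossedModule.{v,u,w} J} {U : C} (x y : M.Pt U) where
  elt : M.G₁.obj (op U)
  eq : y.pt = x.pt * M.d elt

instance (U : C) : Category (M.Pt U) where
  Hom x y := Pt.Hom x y
  id x := ⟨1, by simp⟩
  comp g h := ⟨g.elt * h.elt, by rw [h.eq, g.eq, map_mul, mul_assoc]⟩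
  id_comp _ := Pt.Hom.ext (one_mul _)
  comp_id _ := Pt.Hom.ext (mul_one _)
  assoc _ _ _ := Pt.Hom.ext (mul_assoc _ _ _)

variable {M} in
@[ext]
lemma Pt.hom_ext {U : C} {x y : M.Pt U} {g h : x ⟶ y} (e : g.elt = h.elt) : g = h :=
  Pt.Hom.ext e

@[simp] lemma Pt.id_elt {U : C} (x : M.Pt U) : Pt.Hom.elt (𝟙 x) = 1 := rfl
@[simp] lemma Pt.comp_elt {U : C} {x y z : M.Pt U} (g : x ⟶ y) (h : y ⟶ z) :
    Pt.Hom.elt (g ≫ h) = g.elt * h.elt := rfl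

/-- Equal points are joined by the unit element -/
def Pt.isoOfEq {M : CrossedModule.{v,u,w} J} {U : C} {x y : M.Pt U} (h : x.pt = y.pt) : x ≅ y where
  hom := ⟨1, by simp [h]⟩
  inv := ⟨1, by simp [h]⟩
  hom_inv_id := Pt.Hom.ext (mul_one _)
  inv_hom_id := Pt.Hom.ext (mul_one _)

@[simp] lemma Pt.isoOfEq_hom_elt {U : C} {x y : M.Pt U} (h : x.pt = y.pt) :
    Pt.Hom.elt (Pt.isoOfEq h).hom = 1 := rfl
@[simp] lemma Pt.isoOfEq_inv_elt {U : C} {x y : M.Pt U} (h : x.pt = y.pt) :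
    Pt.Hom.elt (Pt.isoOfEq h).inv = 1 := rfl

lemma d_act' {U : C} (g : M.G₁.obj (op U)) (x : M.G₀.obj (op U)) :
    x * M.d (M.act g x) = M.d g * x := by rw [M.d_act]; group

/-- The strict monoidal structure of `Γ(U)`: the product of `G₀` on objects, and
`g ⊗ h = g ^ x₂ · h` on morphisms `g : x₁ ⟶ y₁`, `h : x₂ ⟶ y₂`. -/
instance (U : C) : MonoidalCategory (M.Pt U) where
  tensorObj x y := ⟨x.pt * y.pt⟩
  whiskerLeft x _ _ g := ⟨g.elt, by simp [g.eq, mul_assoc]⟩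
  whiskerRight g y := ⟨M.act g.elt y.pt, by simp [g.eq, mul_assoc, d_act']⟩
  tensorHom {x₁ y₁ x₂ y₂} g h := ⟨M.act g.elt x₂.pt * h.elt, by
    simp only [g.eq, h.eq, map_mul, mul_assoc]; rw [← mul_assoc x₂.pt, d_act', mul_assoc]⟩
  tensorUnit := ⟨1⟩
  associator x y z := Pt.isoOfEq (mul_assoc _ _ _)
  leftUnitor x := Pt.isoOfEq (one_mul _)
  rightUnitor x := Pt.isoOfEq (mul_one _)
  tensorHom_def g h := Pt.Hom.ext rfl
  id_tensorHom_id x y := Pt.Hom.ext (by simp [one_act])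
  tensorHom_comp_tensorHom {x₁ y₁ z₁ x₂ y₂ z₂} f₁ f₂ g₁ g₂ := Pt.Hom.ext (by
    simp only [Pt.comp_elt, f₂.eq, act_mul, mul_act, act_d]; group)
  whiskerLeft_id _ _ := Pt.Hom.ext rfl
  id_whiskerRight _ _ := Pt.Hom.ext (one_act _ _)
  associator_naturality f₁ f₂ f₃ := Pt.Hom.ext (by
    simp [act_mul, mul_act, mul_assoc])
  leftUnitor_naturality f := Pt.Hom.ext (by simp)
  rightUnitor_naturality f := Pt.Hom.ext (by simp [act_one])
  pentagon _ _ _ _ := Pt.Hom.ext (by simp [one_act])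
  triangle _ _ := Pt.Hom.ext (by simp [one_act])

variable {M} in
@[simp] lemma Pt.tensor_pt {U : C} (x y : M.Pt U) : (x ⊗ y).pt = x.pt * y.pt := rfl
variable {M} in
@[simp] lemma Pt.unit_pt {U : C} : (𝟙_ (M.Pt U)).pt = 1 := rfl


@[simp] lemma Pt.tensorHom_elt {U : C} {x₁ y₁ x₂ y₂ : M.Pt U} (g : x₁ ⟶ y₁) (h : x₂ ⟶ y₂) :
    Pt.Hom.elt (g ⊗ₘ h) = M.act g.elt x₂.pt * h.elt := rfl
@[simp] lemma Pt.whiskerLeft_elt {U : C} (x : M.Pt U) {y z : M.Pt U} (g : y ⟶ z) :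
    Pt.Hom.elt (x ◁ g) = g.elt := rfl
@[simp] lemma Pt.whiskerRight_elt {U : C} {x y : M.Pt U} (g : x ⟶ y) (z : M.Pt U) :
    Pt.Hom.elt (g ▷ z) = M.act g.elt z.pt := rfl

/-- Restriction of the groupoid of points. -/
def ptRes {U V : C} (f : V ⟶ U) : M.Pt U ⥤ M.Pt V where
  obj x := ⟨M.G₀.map f.op x.pt⟩
  map g := ⟨M.G₁.map f.op g.elt, by rw [g.eq, map_mul, d_res]⟩
  map_id _ := Pt.Hom.ext (map_one _)
  map_comp _ _ := Pt.Hom.ext (map_mul _ _ _)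

@[simp] lemma ptRes_obj_pt {U V : C} (f : V ⟶ U) (x : M.Pt U) :
    ((M.ptRes f).obj x).pt = M.G₀.map f.op x.pt := rfl
@[simp] lemma ptRes_map_elt {U V : C} (f : V ⟶ U) {x y : M.Pt U} (g : x ⟶ y) :
    Pt.Hom.elt ((M.ptRes f).map g) = M.G₁.map f.op g.elt := rfl

instance {U V : C} (f : V ⟶ U) : (M.ptRes f).Monoidal :=
  Functor.CoreMonoidal.toMonoidal
    { εIso := Pt.isoOfEq (map_one (M.G₀.map f.op).hom).symm
      μIso := fun x y => Pt.isoOfEq (map_mul (M.G₀.map f.op).hom x.pt y.pt).symm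
      μIso_hom_natural_left := fun g y => Pt.Hom.ext (by
        change M.act (M.G₁.map f.op g.elt) (M.G₀.map f.op y.pt) * 1 =
          1 * M.G₁.map f.op (M.act g.elt y.pt)
        rw [act_res, mul_one, one_mul])
      μIso_hom_natural_right := fun x g => Pt.Hom.ext (by
        change M.G₁.map f.op g.elt * 1 = 1 * M.G₁.map f.op g.elt
        rw [mul_one, one_mul])
      associativity := fun x y z => Pt.Hom.ext (by
        change M.act 1 _ * (1 * M.G₁.map f.op 1) = 1 * (1 * 1)
        rw [one_act, map_one])
      left_unitality := fun x => Pt.Hom.ext (by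
        change 1 = M.act 1 _ * (1 * M.G₁.map f.op 1)
        rw [one_act, map_one]; simp)
      right_unitality := fun x => Pt.Hom.ext (by
        change 1 = 1 * (1 * M.G₁.map f.op 1)
        rw [map_one]; simp) }

@[simp] lemma ptRes_ε_elt {U V : C} (f : V ⟶ U) :
    Pt.Hom.elt (Functor.LaxMonoidal.ε (M.ptRes f)) = 1 := rfl
@[simp] lemma ptRes_μ_elt {U V : C} (f : V ⟶ U) (x y : M.Pt U) :
    Pt.Hom.elt (Functor.LaxMonoidal.μ (M.ptRes f) x y) = 1 := rfl

def ptResId (U : C) : M.ptRes (𝟙 U) ≅ 𝟭 (M.Pt U) :=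
  NatIso.ofComponents (fun x => Pt.isoOfEq (by simp)) (fun g => Pt.Hom.ext (by simp))

def ptResComp {U V W : C} (f : V ⟶ U) (g : W ⟶ V) : M.ptRes (g ≫ f) ≅ M.ptRes f ⋙ M.ptRes g :=
  NatIso.ofComponents (fun x => Pt.isoOfEq (by simp)) (fun a => Pt.Hom.ext (by
    change M.G₁.map (g ≫ f).op a.elt * 1 = 1 * M.G₁.map g.op (M.G₁.map f.op a.elt)
    simp))

@[simp] lemma ptResId_hom_elt (U : C) (x : M.Pt U) :
    Pt.Hom.elt ((M.ptResId U).hom.app x) = 1 := rfl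
@[simp] lemma ptResComp_hom_elt {U V W : C} (f : V ⟶ U) (g : W ⟶ V) (x : M.Pt U) :
    Pt.Hom.elt ((M.ptResComp f g).hom.app x) = 1 := rfl
@[simp] lemma ptResComp_inv_elt {U V W : C} (f : V ⟶ U) (g : W ⟶ V) (x : M.Pt U) :
    Pt.Hom.elt ((M.ptResComp f g).inv.app x) = 1 := rfl

lemma Pt.eqToHom_elt {U : C} {x y : M.Pt U} (h : x = y) :
    Pt.Hom.elt (eqToHom h) = 1 := by
  subst h; rfl

end CrossedModule

open CrossedModule in
/-- The prestack `U ↦ Γ(U)`. -/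
def CrossedModule.pseudo (M : CrossedModule.{v,u,w} J) : Pseudofunctor (LocallyDiscrete Cᵒᵖ) Cat.{w, w} :=
  LocallyDiscrete.mkPseudofunctor
    (fun U => Cat.of (M.Pt U.unop))
    (fun f => (M.ptRes f.unop).toCatHom)
    (fun U => Cat.Hom.isoMk (M.ptResId U.unop))
    (fun f g => Cat.Hom.isoMk (M.ptResComp f.unop g.unop))
    (fun f g h => Cat.Hom₂.ext (NatTrans.ext (funext fun x => Pt.Hom.ext (by
      rw [Cat.eqToHom_app]
      refine Eq.trans ?_ (Pt.eqToHom_elt M _).symm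
      change 1 * (M.G₁.map h.unop.op 1 * (1 * (1 * 1))) = 1
      rw [map_one]; simp))))
    (fun f => Cat.Hom₂.ext (NatTrans.ext (funext fun x => Pt.Hom.ext (by
      rw [Cat.eqToHom_app]
      refine Eq.trans ?_ (Pt.eqToHom_elt M _).symm
      change 1 * (M.G₁.map f.unop.op 1 * 1) = 1
      rw [map_one]; simp))))
    (fun f => Cat.Hom₂.ext (NatTrans.ext (funext fun x => Pt.Hom.ext (by
      rw [Cat.eqToHom_app]
      refine Eq.trans ?_ (Pt.eqToHom_elt M _).symm
      change (1 * (1 * 1) : M.G₁.obj _) = 1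
      simp))))


/-- A category fibred over `C`, as a pseudofunctor `Cᵒᵖ ⥤ Cat`. -/
abbrev Prestack (C : Type u) [Category.{v} C] :=
  Pseudofunctor (LocallyDiscrete Cᵒᵖ) Cat.{v₁, u₁}

namespace Prestack

variable (P : Prestack.{v, u, v₁, u₁} C)

abbrev Fib (U : C) : Type u₁ := P.obj (.mk (op U))

abbrev res {U V : C} (f : V ⟶ U) : P.Fib U ⥤ P.Fib V := (P.map f.op.toLoc).toFunctor

def resId (U : C) : P.res (𝟙 U) ≅ 𝟭 (P.Fib U) := Cat.Hom.toNatIso (P.mapId (.mk (op U)))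

def resComp {U V W : C} (f : V ⟶ U) (g : W ⟶ V) : P.res (g ≫ f) ≅ P.res f ⋙ P.res g :=
  Cat.Hom.toNatIso (P.mapComp f.op.toLoc g.op.toLoc)

end Prestack

/-- A prestack with monoidal fibres, monoidal restriction functors and monoidal coherence
isomorphisms. -/
structure MonoidalPrestack (C : Type u) [Category.{v} C] where
  toPrestack : Prestack.{v, u, v₁, u₁} C
  [monoidal : ∀ U : C, MonoidalCategory (toPrestack.Fib U)]
  [resMonoidal : ∀ {U V : C} (f : V ⟶ U), (toPrestack.res f).Monoidal]
  resId_isMonoidal : ∀ U : C, NatTrans.IsMonoidal (toPrestack.resId U).hom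
  resComp_isMonoidal : ∀ {U V W : C} (f : V ⟶ U) (g : W ⟶ V),
    NatTrans.IsMonoidal (toPrestack.resComp f g).hom

attribute [instance] MonoidalPrestack.monoidal MonoidalPrestack.resMonoidal
  MonoidalPrestack.resId_isMonoidal MonoidalPrestack.resComp_isMonoidal

namespace MonoidalPrestack

variable (P : MonoidalPrestack.{v, u, v₁, u₁} C)

abbrev Fib (U : C) : Type u₁ := P.toPrestack.Fib U

abbrev res {U V : C} (f : V ⟶ U) : P.Fib U ⥤ P.Fib V := P.toPrestack.res f

abbrev resId (U : C) : P.res (𝟙 U) ≅ 𝟭 (P.Fib U) := P.toPrestack.resId U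

abbrev resComp {U V W : C} (f : V ⟶ U) (g : W ⟶ V) : P.res (g ≫ f) ≅ P.res f ⋙ P.res g :=
  P.toPrestack.resComp f g

/-- A group-like stack: a stack in groupoids whose translation functors are equivalences. -/
structure IsGroupLikeStack (J : GrothendieckTopology C) : Prop where
  isStack : P.toPrestack.IsStack J
  isGroupoid : ∀ U : C, IsGroupoid (P.Fib U)
  tensorLeft_isEquivalence : ∀ {U : C} (X : P.Fib U), (tensorLeft X).IsEquivalence
  tensorRight_isEquivalence : ∀ {U : C} (X : P.Fib U), (tensorRight X).IsEquivalence

end MonoidalPrestack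

/-- A monoidal prestack whose fibres are braided, compatibly with restriction. -/
structure BraidedPrestack (C : Type u) [Category.{v} C] extends
    MonoidalPrestack.{v, u, v₁, u₁} C where
  [braided : ∀ U : C, BraidedCategory (toPrestack.Fib U)]
  res_braided : ∀ {U V : C} (f : V ⟶ U) (X Y : toPrestack.Fib U),
    Functor.LaxMonoidal.μ (toPrestack.res f) X Y ≫ (toPrestack.res f).map (β_ X Y).hom =
      (β_ _ _).hom ≫ Functor.LaxMonoidal.μ (toPrestack.res f) Y X

attribute [instance] BraidedPrestack.braided

/-- A morphism of prestacks (a pseudonatural transformation) with a monoidal structure. -/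
structure MonoidalMorphism (P : MonoidalPrestack.{v, u, v₁, u₁} C)
    (Q : MonoidalPrestack.{v, u, v₂, u₂} C) where
  functor : ∀ U : C, P.Fib U ⥤ Q.Fib U
  [monoidal : ∀ U : C, (functor U).Monoidal]
  resIso : ∀ {U V : C} (f : V ⟶ U), functor U ⋙ Q.res f ≅ P.res f ⋙ functor V
  resIso_isMonoidal : ∀ {U V : C} (f : V ⟶ U), NatTrans.IsMonoidal (resIso f).hom
  resIso_id : ∀ {U : C} (X : P.Fib U),
    (resIso (𝟙 U)).hom.app X ≫ (functor U).map ((P.resId U).hom.app X) =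
      (Q.resId U).hom.app ((functor U).obj X)
  resIso_comp : ∀ {U V W : C} (f : V ⟶ U) (g : W ⟶ V) (X : P.Fib U),
    (resIso (g ≫ f)).hom.app X ≫ (functor W).map ((P.resComp f g).hom.app X) =
      (Q.resComp f g).hom.app ((functor U).obj X) ≫ (Q.res g).map ((resIso f).hom.app X) ≫
        (resIso g).hom.app ((P.res f).obj X)

attribute [instance] MonoidalMorphism.monoidal

/-- The morphism respects the braidings. -/
def MonoidalMorphism.IsBraided {P : BraidedPrestack.{v, u, v₁, u₁} C}
    {Q : BraidedPrestack.{v, u, v₂, u₂} C}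
    (F : MonoidalMorphism P.toMonoidalPrestack Q.toMonoidalPrestack) : Prop :=
  ∀ {U : C} (X Y : P.Fib U),
    Functor.LaxMonoidal.μ (F.functor U) X Y ≫ (F.functor U).map (β_ X Y).hom =
      (β_ _ _).hom ≫ Functor.LaxMonoidal.μ (F.functor U) Y X

/-- The morphism is fully faithful on every fibre and locally essentially surjective. When `Q` is a
stack, this says that `F` exhibits `Q` as the stack associated with `P`. -/
structure MonoidalMorphism.IsLocalEquivalence {P : MonoidalPrestack.{v, u, v₁, u₁} C}
    {Q : MonoidalPrestack.{v, u, v₂, u₂} C} (F : MonoidalMorphism P Q)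
    (J : GrothendieckTopology C) : Prop where
  full : ∀ U : C, (F.functor U).Full
  faithful : ∀ U : C, (F.functor U).Faithful
  locally_surjective : ∀ {U : C} (Y : Q.Fib U), ∃ R ∈ J U, ∀ {V : C} (f : V ⟶ U), R.arrows f →
    ∃ X : P.Fib V, Nonempty ((F.functor V).obj X ≅ (Q.res f).obj Y)

instance (M : CrossedModule.{v, u, w} J) (U : C) : MonoidalCategory (Prestack.Fib M.pseudo U) :=
  inferInstanceAs (MonoidalCategory (M.Pt U))

instance (M : CrossedModule.{v, u, w} J) {U V : C} (f : V ⟶ U) :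
    (Prestack.res M.pseudo f).Monoidal :=
  inferInstanceAs (M.ptRes f).Monoidal

/-- The group-like prestack of a crossed module; a presentation of a group-like stack `𝓠` by the
crossed module `M` is a local equivalence `M.prestack ⟶ 𝓠`. -/
def CrossedModule.prestack (M : CrossedModule.{v, u, w} J) :
    MonoidalPrestack.{v, u, w, w} C where
  toPrestack := M.pseudo
  resId_isMonoidal U :=
    { unit := CrossedModule.Pt.Hom.ext (by change (1 * 1 : M.G₁.obj _) = 1; simp)
      tensor := fun X Y => CrossedModule.Pt.Hom.ext (by
        change (1 * 1 : M.G₁.obj _) = (M.act 1 _ * 1) * 1; simp [CrossedModule.one_act]) }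
  resComp_isMonoidal f g :=
    { unit := CrossedModule.Pt.Hom.ext (by
        change (1 * 1 : M.G₁.obj _) = 1 * M.G₁.map g.op 1; rw [map_one])
      tensor := fun X Y => CrossedModule.Pt.Hom.ext (by
        change (1 * 1 : M.G₁.obj _) = (M.act 1 _ * 1) * (1 * M.G₁.map g.op 1)
        rw [CrossedModule.one_act, map_one]; simp) }

/-- A braided crossed module: a crossed module with a bracket `br x y = {x, y}`, `G₀ × G₀ → G₁`,
subject to the equations that make `{x, y} : x y ⟶ y x` a braiding of the associated groupoid. -/
structure BraidedCrossedModule {C : Type u} [Category.{v} C] (J : GrothendieckTopology C) extends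
    CrossedModule.{v, u, w} J where
  br : ∀ {U : C}, G₀.obj (op U) → G₀.obj (op U) → G₁.obj (op U)
  br_res : ∀ {U V : C} (f : V ⟶ U) (x y : G₀.obj (op U)),
    br (G₀.map f.op x) (G₀.map f.op y) = G₁.map f.op (br x y)
  d_br : ∀ {U : C} (x y : G₀.obj (op U)), d (br x y) = y⁻¹ * x⁻¹ * y * x
  br_mul : ∀ {U : C} (x y z : G₀.obj (op U)), br x (y * z) = act (br x y) z * br x z
  mul_br : ∀ {U : C} (x y z : G₀.obj (op U)), br (x * y) z = br y z * act (br x z) y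
  br_d : ∀ {U : C} (x : G₀.obj (op U)) (h : G₁.obj (op U)), br x (d h) = h⁻¹ * act h x
  d_br' : ∀ {U : C} (g : G₁.obj (op U)) (y : G₀.obj (op U)), br (d g) y = (act g y)⁻¹ * g

variable (M : BraidedCrossedModule.{v, u, w} J)

open CrossedModule in
def BraidedCrossedModule.braiding {U : C} (x y : M.Pt U) : x ⊗ y ≅ y ⊗ x where
  hom := ⟨M.br x.pt y.pt, by simp [M.d_br, mul_assoc]⟩
  inv := ⟨(M.br x.pt y.pt)⁻¹, by simp [M.d_br, mul_assoc]⟩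
  hom_inv_id := Pt.Hom.ext (mul_inv_cancel _)
  inv_hom_id := Pt.Hom.ext (inv_mul_cancel _)

open CrossedModule in
instance (U : C) : BraidedCategory (M.Pt U) where
  braiding x y := M.braiding x y
  braiding_naturality_right x y z g := Pt.Hom.ext (by
    change g.elt * M.br x.pt z.pt = M.br x.pt y.pt * M.act g.elt x.pt
    rw [g.eq, M.br_mul, M.br_d, M.act_d]; group)
  braiding_naturality_left {x y} g z := Pt.Hom.ext (by
    change M.act g.elt z.pt * M.br y.pt z.pt = M.br x.pt z.pt * g.elt
    rw [g.eq, M.mul_br, M.d_br', M.act_d]; group)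
  hexagon_forward x y z := Pt.Hom.ext (by
    change 1 * (M.br x.pt (y.pt * z.pt) * 1) = M.act (M.br x.pt y.pt) z.pt * (1 * M.br x.pt z.pt)
    rw [M.br_mul]; group)
  hexagon_reverse x y z := Pt.Hom.ext (by
    change 1 * (M.br (x.pt * y.pt) z.pt * 1) = M.br y.pt z.pt * (1 * M.act (M.br x.pt z.pt) y.pt)
    rw [M.mul_br]; group)

/-- The braided prestack of a braided crossed module. -/
def BraidedCrossedModule.braidedPrestack : BraidedPrestack.{v, u, w, w} C where
  toMonoidalPrestack := M.toCrossedModule.prestack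
  braided U := inferInstanceAs (BraidedCategory (M.Pt U))
  res_braided f X Y := CrossedModule.Pt.Hom.ext (by
    change 1 * M.G₁.map f.op (M.br X.pt Y.pt) = M.br (M.G₀.map f.op X.pt) (M.G₀.map f.op Y.pt) * 1
    rw [M.br_res]; simp)


/-! ### Biadditive functors -/

/-- A biadditive structure on a bifunctor: it is monoidal in each variable (for each fixed value of
the other one, and naturally in it), and the two ways of expanding `F (X ⊗ X', Y ⊗ Y')` agree up to
the braiding of the target; `tensorμ` is the interchange of the two inner factors. -/
class Biadditive {A : Type u₁} [Category.{v₁} A] [MonoidalCategory A]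
    {B : Type u₂} [Category.{v₂} B] [MonoidalCategory B]
    {D : Type u₃} [Category.{w} D] [MonoidalCategory D] [BraidedCategory D]
    (F : A ⥤ B ⥤ D) where
  [mon₁ : ∀ Y : B, (F.flip.obj Y).Monoidal]
  [mon₂ : ∀ X : A, (F.obj X).Monoidal]
  natural₁ : ∀ {Y Y' : B} (b : Y ⟶ Y'), NatTrans.IsMonoidal (F.flip.map b)
  natural₂ : ∀ {X X' : A} (a : X ⟶ X'), NatTrans.IsMonoidal (F.map a)
  interchange : ∀ (X X' : A) (Y Y' : B),
    (Functor.LaxMonoidal.μ (F.flip.obj Y) X X' ⊗ₘ Functor.LaxMonoidal.μ (F.flip.obj Y') X X') ≫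
        Functor.LaxMonoidal.μ (F.obj (X ⊗ X')) Y Y' =
      tensorμ ((F.obj X).obj Y) ((F.obj X').obj Y) ((F.obj X).obj Y') ((F.obj X').obj Y') ≫
        (Functor.LaxMonoidal.μ (F.obj X) Y Y' ⊗ₘ Functor.LaxMonoidal.μ (F.obj X') Y Y') ≫
        Functor.LaxMonoidal.μ (F.flip.obj (Y ⊗ Y')) X X'
  unit_eq : (Functor.LaxMonoidal.ε (F.flip.obj (𝟙_ B)) : 𝟙_ D ⟶ (F.obj (𝟙_ A)).obj (𝟙_ B)) =
    Functor.LaxMonoidal.ε (F.obj (𝟙_ A))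

attribute [instance] Biadditive.mon₁ Biadditive.mon₂

/-- A biadditive functor `𝓗|S × 𝓚|S → 𝓖|S` over a sheaf `S`: for every section `s` of `S` over `U` a
biadditive functor `𝓗(U) × 𝓚(U) → 𝓖(U)`, with coherent isomorphisms expressing the compatibility with
restriction. For `S` terminal this is a biadditive functor of stacks `𝓗 × 𝓚 → 𝓖`. -/
structure BiaddFunctor (S : Sheaf J (Type w)) (𝓗 : MonoidalPrestack.{v, u, v₁, u₁} C)
    (𝓚 : MonoidalPrestack.{v, u, v₂, u₂} C) (𝓖 : BraidedPrestack.{v, u, w, u₃} C) where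
  functor : ∀ {U : C}, S.obj.obj (op U) → (𝓗.Fib U ⥤ 𝓚.Fib U ⥤ 𝓖.Fib U)
  [biadditive : ∀ {U : C} (s : S.obj.obj (op U)), Biadditive (functor s)]
  resIso : ∀ {U V : C} (f : V ⟶ U) (s : S.obj.obj (op U)) (t : S.obj.obj (op V)),
    S.obj.map f.op s = t →
    (functor s ⋙ (Functor.whiskeringRight _ _ _).obj (𝓖.res f) ≅
      𝓗.res f ⋙ functor t ⋙ (Functor.whiskeringLeft _ _ _).obj (𝓚.res f))
  resIso_isMonoidal₁ : ∀ {U V : C} (f : V ⟶ U) (s : S.obj.obj (op U)) (t : S.obj.obj (op V))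
    (h : S.obj.map f.op s = t) (Y : 𝓚.Fib U),
    NatTrans.IsMonoidal (F₁ := (functor s).flip.obj Y ⋙ 𝓖.res f)
      (F₂ := 𝓗.res f ⋙ (functor t).flip.obj ((𝓚.res f).obj Y))
      (((flipFunctor _ _ _).map (resIso f s t h).hom).app Y)
  resIso_isMonoidal₂ : ∀ {U V : C} (f : V ⟶ U) (s : S.obj.obj (op U)) (t : S.obj.obj (op V))
    (h : S.obj.map f.op s = t) (X : 𝓗.Fib U),
    NatTrans.IsMonoidal (F₁ := (functor s).obj X ⋙ 𝓖.res f)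
      (F₂ := 𝓚.res f ⋙ (functor t).obj ((𝓗.res f).obj X))
      ((resIso f s t h).hom.app X)
  resIso_id : ∀ {U : C} (s : S.obj.obj (op U)) (h : S.obj.map (𝟙 U).op s = s)
    (X : 𝓗.Fib U) (Y : 𝓚.Fib U),
    ((resIso (𝟙 U) s s h).hom.app X).app Y ≫
        ((functor s).map ((𝓗.resId U).hom.app X)).app ((𝓚.res (𝟙 U)).obj Y) ≫
        ((functor s).obj X).map ((𝓚.resId U).hom.app Y) =
      (𝓖.resId U).hom.app (((functor s).obj X).obj Y)
  resIso_comp : ∀ {U V W : C} (f : V ⟶ U) (g : W ⟶ V) (s : S.obj.obj (op U))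
    (t : S.obj.obj (op V)) (r : S.obj.obj (op W)) (h : S.obj.map f.op s = t)
    (h' : S.obj.map g.op t = r) (h'' : S.obj.map (g ≫ f).op s = r) (X : 𝓗.Fib U) (Y : 𝓚.Fib U),
    ((resIso (g ≫ f) s r h'').hom.app X).app Y ≫
        ((functor r).map ((𝓗.resComp f g).hom.app X)).app ((𝓚.res (g ≫ f)).obj Y) ≫
        ((functor r).obj ((𝓗.res g).obj ((𝓗.res f).obj X))).map ((𝓚.resComp f g).hom.app Y) =
      (𝓖.resComp f g).hom.app (((functor s).obj X).obj Y) ≫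
        (𝓖.res g).map (((resIso f s t h).hom.app X).app Y) ≫
        ((resIso g t r h').hom.app ((𝓗.res f).obj X)).app ((𝓚.res f).obj Y)

attribute [instance] BiaddFunctor.biadditive

namespace BiaddFunctor

variable {𝓗 : MonoidalPrestack.{v, u, v₁, u₁} C} {𝓚 : MonoidalPrestack.{v, u, v₂, u₂} C}
  {𝓖 : BraidedPrestack.{v, u, w, u₃} C} {S S' S'' : Sheaf J (Type w)}

/-- Morphisms `F' → F` over `p : S' ⟶ S` in the category fibred over the topos: morphisms of
biadditive functors `F' ⟶ p^* F` over `S'`. -/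
@[ext]
structure HomOver (p : S' ⟶ S) (F' : BiaddFunctor S' 𝓗 𝓚 𝓖) (F : BiaddFunctor S 𝓗 𝓚 𝓖) where
  app : ∀ {U : C} (s : S'.obj.obj (op U)), F'.functor s ⟶ F.functor (p.hom.app (op U) s)
  isMonoidal₁ : ∀ {U : C} (s : S'.obj.obj (op U)) (Y : 𝓚.Fib U),
    NatTrans.IsMonoidal (F₁ := (F'.functor s).flip.obj Y)
      (F₂ := (F.functor (p.hom.app (op U) s)).flip.obj Y) (((flipFunctor _ _ _).map (app s)).app Y)
  isMonoidal₂ : ∀ {U : C} (s : S'.obj.obj (op U)) (X : 𝓗.Fib U),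
    NatTrans.IsMonoidal ((app s).app X)
  res : ∀ {U V : C} (f : V ⟶ U) (s : S'.obj.obj (op U)) (t : S'.obj.obj (op V))
    (h : S'.obj.map f.op s = t)
    (h' : S.obj.map f.op (p.hom.app (op U) s) = p.hom.app (op V) t)
    (X : 𝓗.Fib U) (Y : 𝓚.Fib U),
    ((F'.resIso f s t h).hom.app X).app Y ≫
        ((app t).app ((𝓗.res f).obj X)).app ((𝓚.res f).obj Y) =
      (𝓖.res f).map (((app s).app X).app Y) ≫
        ((F.resIso f (p.hom.app (op U) s) (p.hom.app (op V) t) h').hom.app X).app Y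

def HomOver.id (F : BiaddFunctor S 𝓗 𝓚 𝓖) : HomOver (𝟙 S) F F where
  app s := 𝟙 (F.functor s)
  isMonoidal₁ s Y := NatTrans.IsMonoidal.id (F₁ := (F.functor s).flip.obj Y)
  isMonoidal₂ s X := NatTrans.IsMonoidal.id (F₁ := (F.functor s).obj X)
  res f s t _ h' X Y := (Category.comp_id _).trans
    ((congrArg (· ≫ ((F.resIso f s t h').hom.app X).app Y) ((𝓖.res f).map_id _)).trans
      (Category.id_comp _)).symm

def HomOver.comp {p : S'' ⟶ S'} {q : S' ⟶ S} {F'' : BiaddFunctor S'' 𝓗 𝓚 𝓖}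
    {F' : BiaddFunctor S' 𝓗 𝓚 𝓖} {F : BiaddFunctor S 𝓗 𝓚 𝓖} (φ : HomOver p F'' F')
    (ψ : HomOver q F' F) : HomOver (p ≫ q) F'' F where
  app s := φ.app s ≫ ψ.app (p.hom.app _ s)
  isMonoidal₁ s Y :=
    haveI := φ.isMonoidal₁ s Y
    haveI := ψ.isMonoidal₁ (p.hom.app _ s) Y
    NatTrans.IsMonoidal.comp (F₁ := (F''.functor s).flip.obj Y)
      (F₂ := (F'.functor (p.hom.app _ s)).flip.obj Y)
      (F₃ := (F.functor (q.hom.app _ (p.hom.app _ s))).flip.obj Y)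
      (((flipFunctor _ _ _).map (φ.app s)).app Y)
      (((flipFunctor _ _ _).map (ψ.app (p.hom.app _ s))).app Y)
  isMonoidal₂ s X :=
    haveI := φ.isMonoidal₂ s X
    haveI := ψ.isMonoidal₂ (p.hom.app _ s) X
    NatTrans.IsMonoidal.comp ((φ.app s).app X) ((ψ.app (p.hom.app _ s)).app X)
  res {U V} f s t h h' X Y := by
    have e : S'.obj.map f.op (p.hom.app (op U) s) = p.hom.app (op V) t := by
      rw [← h]; exact (NatTrans.naturality_apply p.hom f.op s).symm
    have h₁ := φ.res f s t h e X Y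
    have h₂ := ψ.res f (p.hom.app (op U) s) (p.hom.app (op V) t) e h' X Y
    refine ((Category.assoc _ _ _).symm.trans (congrArg (· ≫ _) h₁)).trans ?_
    refine (Category.assoc _ _ _).trans ((congrArg (_ ≫ ·) h₂).trans ?_)
    refine (Category.assoc _ _ _).symm.trans ?_
    exact congrArg (· ≫ _) ((𝓖.res f).map_comp _ _).symm

instance : Category (BiaddFunctor S 𝓗 𝓚 𝓖) where
  Hom F F' := HomOver (𝟙 S) F F'
  id F := HomOver.id F
  comp φ ψ := (HomOver.comp φ ψ : HomOver (𝟙 S ≫ 𝟙 S) _ _)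
  id_comp φ := HomOver.ext (funext fun _ => funext fun s => Category.id_comp (φ.app s))
  comp_id φ := HomOver.ext (funext fun _ => funext fun s => Category.comp_id (φ.app s))
  assoc φ ψ χ := HomOver.ext (funext fun _ => funext fun s =>
    Category.assoc (φ.app s) (ψ.app s) (χ.app s))

end BiaddFunctor

section Trivial

variable {A : Type u₁} [Category.{v₁} A] [MonoidalCategory A]
  {B : Type u₂} [Category.{v₂} B] [MonoidalCategory B]
  {D : Type u₃} [Category.{w} D] [MonoidalCategory D]

/-- The constant functor with value the unit object is monoidal. -/
@[reducible]
def constUnitMonoidal (A : Type u₁) [Category.{v₁} A] [MonoidalCategory A]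
    (D : Type u₃) [Category.{w} D] [MonoidalCategory D] :
    ((Functor.const A).obj (𝟙_ D)).Monoidal :=
  Functor.CoreMonoidal.toMonoidal
    { εIso := Iso.refl _
      μIso := fun _ _ => λ_ (𝟙_ D)
      μIso_hom_natural_left := fun _ _ => by simp
      μIso_hom_natural_right := fun _ _ => by simp
      associativity := fun _ _ _ => by
        simp [unitors_equal]
      left_unitality := fun _ => by simp
      right_unitality := fun _ => by simp [unitors_equal] }

variable [BraidedCategory D]

variable (A B D) in
abbrev trivialBifunctor : A ⥤ B ⥤ D := (Functor.const A).obj ((Functor.const B).obj (𝟙_ D))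

instance (Y : B) : ((trivialBifunctor A B D).flip.obj Y).Monoidal := constUnitMonoidal A D

instance (X : A) : ((trivialBifunctor A B D).obj X).Monoidal := constUnitMonoidal B D

instance : Biadditive (trivialBifunctor A B D) where
  natural₁ b :=
    { unit := Category.comp_id _
      tensor := fun X X' => by
        change (λ_ (𝟙_ D)).hom ≫ 𝟙 (𝟙_ D) = (𝟙 (𝟙_ D) ⊗ₘ 𝟙 (𝟙_ D)) ≫ (λ_ (𝟙_ D)).hom
        simp }
  natural₂ a :=
    { unit := Category.comp_id _
      tensor := fun Y Y' => by
        change (λ_ (𝟙_ D)).hom ≫ 𝟙 (𝟙_ D) = (𝟙 (𝟙_ D) ⊗ₘ 𝟙 (𝟙_ D)) ≫ (λ_ (𝟙_ D)).hom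
        simp }
  interchange X X' Y Y' := by
    change ((λ_ (𝟙_ D)).hom ⊗ₘ (λ_ (𝟙_ D)).hom) ≫ (λ_ (𝟙_ D)).hom =
      tensorμ (𝟙_ D) (𝟙_ D) (𝟙_ D) (𝟙_ D) ≫ ((λ_ (𝟙_ D)).hom ⊗ₘ (λ_ (𝟙_ D)).hom) ≫ (λ_ (𝟙_ D)).hom
    have h : (β_ (𝟙_ D) (𝟙_ D)).hom = 𝟙 _ := by
      rw [braiding_tensorUnit_left, unitors_equal, Iso.hom_inv_id]
    have h' : tensorμ (𝟙_ D) (𝟙_ D) (𝟙_ D) (𝟙_ D) = 𝟙 _ := by simp [tensorμ, h]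
    rw [h', Category.id_comp]
  unit_eq := rfl

end Trivial


namespace BiaddFunctor

variable {𝓗 : MonoidalPrestack.{v, u, v₁, u₁} C} {𝓚 : MonoidalPrestack.{v, u, v₂, u₂} C}
  {𝓖 : BraidedPrestack.{v, u, w, u₃} C} {S S' : Sheaf J (Type w)}

/-- The restriction isomorphisms of the constant functor with value the unit object. -/
def trivialResIso (𝓗 : MonoidalPrestack.{v, u, v₁, u₁} C) (𝓚 : MonoidalPrestack.{v, u, v₂, u₂} C)
    (𝓖 : BraidedPrestack.{v, u, w, u₃} C) {U V : C} (f : V ⟶ U) :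
    trivialBifunctor (𝓗.Fib U) (𝓚.Fib U) (𝓖.Fib U) ⋙
        (Functor.whiskeringRight _ _ _).obj (𝓖.res f) ≅
      𝓗.res f ⋙ trivialBifunctor (𝓗.Fib V) (𝓚.Fib V) (𝓖.Fib V) ⋙
        (Functor.whiskeringLeft _ _ _).obj (𝓚.res f) :=
  NatIso.ofComponents (fun _ => NatIso.ofComponents
    (fun _ => (Functor.Monoidal.εIso (𝓖.res f)).symm)
    (fun _ => by
      change (𝓖.res f).map (𝟙 _) ≫ Functor.OplaxMonoidal.η (𝓖.res f) =
        Functor.OplaxMonoidal.η (𝓖.res f) ≫ 𝟙 _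
      rw [(𝓖.res f).map_id, Category.id_comp, Category.comp_id]))
    (fun _ => NatTrans.ext (funext fun _ => by
      change (𝓖.res f).map (𝟙 _) ≫ Functor.OplaxMonoidal.η (𝓖.res f) =
        Functor.OplaxMonoidal.η (𝓖.res f) ≫ 𝟙 _
      rw [(𝓖.res f).map_id, Category.id_comp, Category.comp_id]))

lemma μ_res_unit {U V : C} (f : V ⟶ U) :
    (Functor.LaxMonoidal.μ (𝓖.res f) (𝟙_ _) (𝟙_ _) ≫ (𝓖.res f).map (λ_ (𝟙_ (𝓖.Fib U))).hom) ≫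
        Functor.OplaxMonoidal.η (𝓖.res f) =
      (Functor.OplaxMonoidal.η (𝓖.res f) ⊗ₘ Functor.OplaxMonoidal.η (𝓖.res f)) ≫
        ((λ_ (𝟙_ (𝓖.Fib V))).hom ≫ 𝟙 _) := by
  have h := Functor.LaxMonoidal.left_unitality (𝓖.res f) (𝟙_ _)
  have h' : Functor.LaxMonoidal.μ (𝓖.res f) (𝟙_ _) (𝟙_ _) ≫
      (𝓖.res f).map (λ_ (𝟙_ (𝓖.Fib U))).hom =
      Functor.OplaxMonoidal.η (𝓖.res f) ▷ _ ≫ (λ_ _).hom := by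
    rw [h, ← Category.assoc, ← comp_whiskerRight, Functor.Monoidal.η_ε, id_whiskerRight,
      Category.id_comp]
  rw [h', Category.comp_id, MonoidalCategory.tensorHom_def, Category.assoc, Category.assoc,
    ← leftUnitor_naturality]

/-- The trivial biadditive functor, constant with value the unit object. -/
def trivial (S : Sheaf J (Type w)) (𝓗 : MonoidalPrestack.{v, u, v₁, u₁} C)
    (𝓚 : MonoidalPrestack.{v, u, v₂, u₂} C) (𝓖 : BraidedPrestack.{v, u, w, u₃} C) :
    BiaddFunctor S 𝓗 𝓚 𝓖 where
  functor _ := trivialBifunctor _ _ _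
  resIso f _ _ _ := trivialResIso 𝓗 𝓚 𝓖 f
  resIso_isMonoidal₁ {U V} f _ _ _ Y :=
    { unit := by
        change (Functor.LaxMonoidal.ε (𝓖.res f) ≫ (𝓖.res f).map (𝟙 _)) ≫
          Functor.OplaxMonoidal.η (𝓖.res f) = 𝟙 _ ≫ 𝟙 _
        rw [(𝓖.res f).map_id, Category.comp_id, Functor.Monoidal.ε_η, Category.comp_id]
      tensor := fun X X' => μ_res_unit f }
  resIso_isMonoidal₂ {U V} f _ _ _ X :=
    { unit := by
        change (Functor.LaxMonoidal.ε (𝓖.res f) ≫ (𝓖.res f).map (𝟙 _)) ≫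
          Functor.OplaxMonoidal.η (𝓖.res f) = 𝟙 _ ≫ 𝟙 _
        rw [(𝓖.res f).map_id, Category.comp_id, Functor.Monoidal.ε_η, Category.comp_id]
      tensor := fun X X' => μ_res_unit f }
  resIso_id {U} s h X Y := by
    have h₁ := NatTrans.IsMonoidal.unit (τ := (𝓖.resId U).hom)
    change Functor.LaxMonoidal.ε (𝓖.res (𝟙 U)) ≫ _ = 𝟙 _ at h₁
    change Functor.OplaxMonoidal.η (𝓖.res (𝟙 U)) ≫ 𝟙 _ ≫ 𝟙 _ = (𝓖.resId U).hom.app (𝟙_ _)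
    rw [Category.comp_id, Category.comp_id, ← cancel_epi (Functor.LaxMonoidal.ε (𝓖.res (𝟙 U))),
      Functor.Monoidal.ε_η]
    exact h₁.symm
  resIso_comp {U V W} f g s t r h h' h'' X Y := by
    have h₁ := NatTrans.IsMonoidal.unit (τ := (𝓖.resComp f g).hom)
    change Functor.LaxMonoidal.ε (𝓖.res (g ≫ f)) ≫ _ =
      Functor.LaxMonoidal.ε (𝓖.res g) ≫ (𝓖.res g).map (Functor.LaxMonoidal.ε (𝓖.res f)) at h₁
    change Functor.OplaxMonoidal.η (𝓖.res (g ≫ f)) ≫ 𝟙 _ ≫ 𝟙 _ =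
      (𝓖.resComp f g).hom.app (𝟙_ _) ≫ (𝓖.res g).map (Functor.OplaxMonoidal.η (𝓖.res f)) ≫
        Functor.OplaxMonoidal.η (𝓖.res g)
    rw [Category.comp_id, Category.comp_id, ← cancel_epi (Functor.LaxMonoidal.ε (𝓖.res (g ≫ f))),
      Functor.Monoidal.ε_η, ← Category.assoc, h₁, Category.assoc, ← Category.assoc ((𝓖.res g).map _),
      ← (𝓖.res g).map_comp, Functor.Monoidal.ε_η, (𝓖.res g).map_id, Category.id_comp,
      Functor.Monoidal.ε_η]

def trivialMap (p : S' ⟶ S) (𝓗 : MonoidalPrestack.{v, u, v₁, u₁} C)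
    (𝓚 : MonoidalPrestack.{v, u, v₂, u₂} C) (𝓖 : BraidedPrestack.{v, u, w, u₃} C) :
    HomOver p (trivial S' 𝓗 𝓚 𝓖) (trivial S 𝓗 𝓚 𝓖) where
  app s := 𝟙 (trivialBifunctor _ _ _)
  isMonoidal₁ {U} s Y := NatTrans.IsMonoidal.id
    (F₁ := (trivialBifunctor (𝓗.Fib U) (𝓚.Fib U) (𝓖.Fib U)).flip.obj Y)
  isMonoidal₂ {U} s X := NatTrans.IsMonoidal.id
    (F₁ := (trivialBifunctor (𝓗.Fib U) (𝓚.Fib U) (𝓖.Fib U)).obj X)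
  res f _ _ _ _ X Y := (Category.comp_id _).trans
    ((congrArg (· ≫ ((trivialResIso 𝓗 𝓚 𝓖 f).hom.app X).app Y) ((𝓖.res f).map_id _)).trans
      (Category.id_comp _)).symm

end BiaddFunctor


/-! ### Butterflies -/

/-- A `(G₁, G₀)`-torsor `E` over `S × H × K`: a sheaf over `S × H × K` with a right action of `G₁`,
simply transitive on the fibres, which has sections locally, and an equivariant section
`sec : E → G₀`, that is, `sec (e g) = sec e · ∂g`. -/
structure Torsor (S : Sheaf J (Type w)) (H K : Cᵒᵖ ⥤ GrpCat.{w})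
    (G : CrossedModule.{v, u, w} J) where
  E : Sheaf J (Type w)
  base : ∀ {U : C}, E.obj.obj (op U) → S.obj.obj (op U)
  fst : ∀ {U : C}, E.obj.obj (op U) → H.obj (op U)
  snd : ∀ {U : C}, E.obj.obj (op U) → K.obj (op U)
  act : ∀ {U : C}, E.obj.obj (op U) → G.G₁.obj (op U) → E.obj.obj (op U)
  sec : ∀ {U : C}, E.obj.obj (op U) → G.G₀.obj (op U)
  base_res : ∀ {U V : C} (f : V ⟶ U) (e : E.obj.obj (op U)),
    base (E.obj.map f.op e) = S.obj.map f.op (base e)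
  fst_res : ∀ {U V : C} (f : V ⟶ U) (e : E.obj.obj (op U)),
    fst (E.obj.map f.op e) = H.map f.op (fst e)
  snd_res : ∀ {U V : C} (f : V ⟶ U) (e : E.obj.obj (op U)),
    snd (E.obj.map f.op e) = K.map f.op (snd e)
  act_res : ∀ {U V : C} (f : V ⟶ U) (e : E.obj.obj (op U)) (g : G.G₁.obj (op U)),
    act (E.obj.map f.op e) (G.G₁.map f.op g) = E.obj.map f.op (act e g)
  sec_res : ∀ {U V : C} (f : V ⟶ U) (e : E.obj.obj (op U)),
    sec (E.obj.map f.op e) = G.G₀.map f.op (sec e)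
  base_act : ∀ {U : C} (e : E.obj.obj (op U)) (g : G.G₁.obj (op U)), base (act e g) = base e
  fst_act : ∀ {U : C} (e : E.obj.obj (op U)) (g : G.G₁.obj (op U)), fst (act e g) = fst e
  snd_act : ∀ {U : C} (e : E.obj.obj (op U)) (g : G.G₁.obj (op U)), snd (act e g) = snd e
  act_one : ∀ {U : C} (e : E.obj.obj (op U)), act e 1 = e
  act_mul : ∀ {U : C} (e : E.obj.obj (op U)) (g g' : G.G₁.obj (op U)),
    act e (g * g') = act (act e g) g'
  simply_transitive : ∀ {U : C} (e e' : E.obj.obj (op U)),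
    base e = base e' → fst e = fst e' → snd e = snd e' → ∃! g : G.G₁.obj (op U), act e g = e'
  locally_nonempty : ∀ {U : C} (s : S.obj.obj (op U)) (y : H.obj (op U)) (z : K.obj (op U)),
    ∃ R ∈ J U, ∀ {V : C} (f : V ⟶ U), R.arrows f → ∃ e : E.obj.obj (op V),
      base e = S.obj.map f.op s ∧ fst e = H.map f.op y ∧ snd e = K.map f.op z
  sec_act : ∀ {U : C} (e : E.obj.obj (op U)) (g : G.G₁.obj (op U)),
    sec (act e g) = sec e * G.d g

namespace Torsor

variable {S : Sheaf J (Type w)} {H K : Cᵒᵖ ⥤ GrpCat.{w}} {G : CrossedModule.{v, u, w} J}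
  (T : Torsor S H K G)

abbrev Sec (U : C) : Type w := T.E.obj.obj (op U)

abbrev res {U V : C} (f : V ⟶ U) (e : T.Sec U) : T.Sec V := T.E.obj.map f.op e

/-- The domain `E ×_K E` of the first partial product. -/
def Comp₁ {U : C} (e e' : T.Sec U) : Prop := T.base e = T.base e' ∧ T.snd e = T.snd e'

/-- The domain `E ×_H E` of the second partial product. -/
def Comp₂ {U : C} (e e' : T.Sec U) : Prop := T.base e = T.base e' ∧ T.fst e = T.fst e'

end Torsor

/-- A biextension of `(H, K)` by the braided crossed module `G`, over `S`: a `(G₁, G₀)`-torsor over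
`H × K` with two associative partial products, lifting the products of `H` and of `K`. Each is a
morphism of `(G₁, G₀)`-torsors from the contracted product, whose left `G₁`-action is `g e = e g ^ (sec e)`;
this is the content of `sec_mul`, `mul_act` and `act_mul`. The two products are compatible through the braiding
of `(G₁, G₀)`-torsors. -/
structure Biextension (S : Sheaf J (Type w)) (H K : Cᵒᵖ ⥤ GrpCat.{w})
    (G : BraidedCrossedModule.{v, u, w} J) extends Torsor S H K G.toCrossedModule where
  mul₁ : ∀ {U : C} (e e' : toTorsor.Sec U), toTorsor.Comp₁ e e' → toTorsor.Sec U
  base_mul₁ : ∀ {U : C} (e e' : toTorsor.Sec U) (c : toTorsor.Comp₁ e e'),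
    base (mul₁ e e' c) = base e
  fst_mul₁ : ∀ {U : C} (e e' : toTorsor.Sec U) (c : toTorsor.Comp₁ e e'),
    fst (mul₁ e e' c) = fst e * fst e'
  snd_mul₁ : ∀ {U : C} (e e' : toTorsor.Sec U) (c : toTorsor.Comp₁ e e'),
    snd (mul₁ e e' c) = snd e
  mul₁_res : ∀ {U V : C} (f : V ⟶ U) (e e' : toTorsor.Sec U) (c : toTorsor.Comp₁ e e')
    (c' : toTorsor.Comp₁ (toTorsor.res f e) (toTorsor.res f e')),
    mul₁ (toTorsor.res f e) (toTorsor.res f e') c' = toTorsor.res f (mul₁ e e' c)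
  mul₁_assoc : ∀ {U : C} (e₁ e₂ e₃ : toTorsor.Sec U) (c₁₂ : toTorsor.Comp₁ e₁ e₂)
    (c₂₃ : toTorsor.Comp₁ e₂ e₃) (c : toTorsor.Comp₁ (mul₁ e₁ e₂ c₁₂) e₃)
    (c' : toTorsor.Comp₁ e₁ (mul₁ e₂ e₃ c₂₃)),
    mul₁ (mul₁ e₁ e₂ c₁₂) e₃ c = mul₁ e₁ (mul₁ e₂ e₃ c₂₃) c'
  sec_mul₁ : ∀ {U : C} (e e' : toTorsor.Sec U) (c : toTorsor.Comp₁ e e'),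
    sec (mul₁ e e' c) = sec e * sec e'
  mul₁_act : ∀ {U : C} (e e' : toTorsor.Sec U) (g : G.G₁.obj (op U)) (c : toTorsor.Comp₁ e e')
    (c' : toTorsor.Comp₁ e (act e' g)), mul₁ e (act e' g) c' = act (mul₁ e e' c) g
  act_mul₁ : ∀ {U : C} (e e' : toTorsor.Sec U) (g : G.G₁.obj (op U)) (c : toTorsor.Comp₁ e e')
    (c' : toTorsor.Comp₁ (act e g) e'),
    mul₁ (act e g) e' c' = act (mul₁ e e' c) (G.act g (sec e'))
  mul₂ : ∀ {U : C} (e e' : toTorsor.Sec U), toTorsor.Comp₂ e e' → toTorsor.Sec U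
  base_mul₂ : ∀ {U : C} (e e' : toTorsor.Sec U) (c : toTorsor.Comp₂ e e'),
    base (mul₂ e e' c) = base e
  fst_mul₂ : ∀ {U : C} (e e' : toTorsor.Sec U) (c : toTorsor.Comp₂ e e'),
    fst (mul₂ e e' c) = fst e
  snd_mul₂ : ∀ {U : C} (e e' : toTorsor.Sec U) (c : toTorsor.Comp₂ e e'),
    snd (mul₂ e e' c) = snd e * snd e'
  mul₂_res : ∀ {U V : C} (f : V ⟶ U) (e e' : toTorsor.Sec U) (c : toTorsor.Comp₂ e e')
    (c' : toTorsor.Comp₂ (toTorsor.res f e) (toTorsor.res f e')),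
    mul₂ (toTorsor.res f e) (toTorsor.res f e') c' = toTorsor.res f (mul₂ e e' c)
  mul₂_assoc : ∀ {U : C} (e₁ e₂ e₃ : toTorsor.Sec U) (c₁₂ : toTorsor.Comp₂ e₁ e₂)
    (c₂₃ : toTorsor.Comp₂ e₂ e₃) (c : toTorsor.Comp₂ (mul₂ e₁ e₂ c₁₂) e₃)
    (c' : toTorsor.Comp₂ e₁ (mul₂ e₂ e₃ c₂₃)),
    mul₂ (mul₂ e₁ e₂ c₁₂) e₃ c = mul₂ e₁ (mul₂ e₂ e₃ c₂₃) c'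
  sec_mul₂ : ∀ {U : C} (e e' : toTorsor.Sec U) (c : toTorsor.Comp₂ e e'),
    sec (mul₂ e e' c) = sec e * sec e'
  mul₂_act : ∀ {U : C} (e e' : toTorsor.Sec U) (g : G.G₁.obj (op U)) (c : toTorsor.Comp₂ e e')
    (c' : toTorsor.Comp₂ e (act e' g)), mul₂ e (act e' g) c' = act (mul₂ e e' c) g
  act_mul₂ : ∀ {U : C} (e e' : toTorsor.Sec U) (g : G.G₁.obj (op U)) (c : toTorsor.Comp₂ e e')
    (c' : toTorsor.Comp₂ (act e g) e'),
    mul₂ (act e g) e' c' = act (mul₂ e e' c) (G.act g (sec e'))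
  interchange : ∀ {U : C} (a a' b b' : toTorsor.Sec U)
    (c₁ : toTorsor.Comp₁ a a') (c₂ : toTorsor.Comp₁ b b')
    (c₃ : toTorsor.Comp₂ (mul₁ a a' c₁) (mul₁ b b' c₂))
    (c₄ : toTorsor.Comp₂ a b) (c₅ : toTorsor.Comp₂ a' b')
    (c₆ : toTorsor.Comp₁ (mul₂ a b c₄) (mul₂ a' b' c₅)),
    mul₂ (mul₁ a a' c₁) (mul₁ b b' c₂) c₃ =
      act (mul₁ (mul₂ a b c₄) (mul₂ a' b' c₅) c₆) (G.act (G.br (sec a') (sec b)) (sec b'))⁻¹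

/-- A butterfly: a biextension `E` of `(H₀, K₀)` by `G` with trivializations `s₁`, `s₂`, as a
biextension, of its pullbacks to `H₁ × K₀` and `H₀ × K₁`, which agree on `H₁ × K₁` and satisfy
`s₁(h, z) e = e s₁(h ^ y, z)` and `s₂(y, k) e = e s₂(y, k ^ z)` for `e` over `(y, z)`. -/
structure Butterfly (S : Sheaf J (Type w)) (H K : CrossedModule.{v, u, w} J)
    (G : BraidedCrossedModule.{v, u, w} J) extends Biextension S H.G₀ K.G₀ G where
  s₁ : ∀ {U : C}, S.obj.obj (op U) → H.G₁.obj (op U) → K.G₀.obj (op U) → toTorsor.Sec U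
  s₁_res : ∀ {U V : C} (f : V ⟶ U) (s : S.obj.obj (op U)) (h : H.G₁.obj (op U))
    (z : K.G₀.obj (op U)),
    s₁ (S.obj.map f.op s) (H.G₁.map f.op h) (K.G₀.map f.op z) = toTorsor.res f (s₁ s h z)
  base_s₁ : ∀ {U : C} (s : S.obj.obj (op U)) (h : H.G₁.obj (op U)) (z : K.G₀.obj (op U)),
    base (s₁ s h z) = s
  fst_s₁ : ∀ {U : C} (s : S.obj.obj (op U)) (h : H.G₁.obj (op U)) (z : K.G₀.obj (op U)),
    fst (s₁ s h z) = H.d h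
  snd_s₁ : ∀ {U : C} (s : S.obj.obj (op U)) (h : H.G₁.obj (op U)) (z : K.G₀.obj (op U)),
    snd (s₁ s h z) = z
  sec_s₁ : ∀ {U : C} (s : S.obj.obj (op U)) (h : H.G₁.obj (op U)) (z : K.G₀.obj (op U)),
    sec (s₁ s h z) = 1
  s₁_mul₁ : ∀ {U : C} (s : S.obj.obj (op U)) (h h' : H.G₁.obj (op U)) (z : K.G₀.obj (op U))
    (c : toTorsor.Comp₁ (s₁ s h z) (s₁ s h' z)),
    mul₁ (s₁ s h z) (s₁ s h' z) c = s₁ s (h * h') z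
  s₁_mul₂ : ∀ {U : C} (s : S.obj.obj (op U)) (h : H.G₁.obj (op U)) (z z' : K.G₀.obj (op U))
    (c : toTorsor.Comp₂ (s₁ s h z) (s₁ s h z')),
    mul₂ (s₁ s h z) (s₁ s h z') c = s₁ s h (z * z')
  s₂ : ∀ {U : C}, S.obj.obj (op U) → H.G₀.obj (op U) → K.G₁.obj (op U) → toTorsor.Sec U
  s₂_res : ∀ {U V : C} (f : V ⟶ U) (s : S.obj.obj (op U)) (y : H.G₀.obj (op U))
    (k : K.G₁.obj (op U)),
    s₂ (S.obj.map f.op s) (H.G₀.map f.op y) (K.G₁.map f.op k) = toTorsor.res f (s₂ s y k)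
  base_s₂ : ∀ {U : C} (s : S.obj.obj (op U)) (y : H.G₀.obj (op U)) (k : K.G₁.obj (op U)),
    base (s₂ s y k) = s
  fst_s₂ : ∀ {U : C} (s : S.obj.obj (op U)) (y : H.G₀.obj (op U)) (k : K.G₁.obj (op U)),
    fst (s₂ s y k) = y
  snd_s₂ : ∀ {U : C} (s : S.obj.obj (op U)) (y : H.G₀.obj (op U)) (k : K.G₁.obj (op U)),
    snd (s₂ s y k) = K.d k
  sec_s₂ : ∀ {U : C} (s : S.obj.obj (op U)) (y : H.G₀.obj (op U)) (k : K.G₁.obj (op U)),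
    sec (s₂ s y k) = 1
  s₂_mul₁ : ∀ {U : C} (s : S.obj.obj (op U)) (y y' : H.G₀.obj (op U)) (k : K.G₁.obj (op U))
    (c : toTorsor.Comp₁ (s₂ s y k) (s₂ s y' k)),
    mul₁ (s₂ s y k) (s₂ s y' k) c = s₂ s (y * y') k
  s₂_mul₂ : ∀ {U : C} (s : S.obj.obj (op U)) (y : H.G₀.obj (op U)) (k k' : K.G₁.obj (op U))
    (c : toTorsor.Comp₂ (s₂ s y k) (s₂ s y k')),
    mul₂ (s₂ s y k) (s₂ s y k') c = s₂ s y (k * k')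
  restriction : ∀ {U : C} (s : S.obj.obj (op U)) (h : H.G₁.obj (op U)) (k : K.G₁.obj (op U)),
    s₁ s h (K.d k) = s₂ s (H.d h) k
  compatibility₁ : ∀ {U : C} (h : H.G₁.obj (op U)) (e : toTorsor.Sec U)
    (c : toTorsor.Comp₁ (s₁ (base e) h (snd e)) e)
    (c' : toTorsor.Comp₁ e (s₁ (base e) (H.act h (fst e)) (snd e))),
    mul₁ (s₁ (base e) h (snd e)) e c = mul₁ e (s₁ (base e) (H.act h (fst e)) (snd e)) c'
  compatibility₂ : ∀ {U : C} (k : K.G₁.obj (op U)) (e : toTorsor.Sec U)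
    (c : toTorsor.Comp₂ (s₂ (base e) (fst e) k) e)
    (c' : toTorsor.Comp₂ e (s₂ (base e) (fst e) (K.act k (snd e)))),
    mul₂ (s₂ (base e) (fst e) k) e c = mul₂ e (s₂ (base e) (fst e) (K.act k (snd e))) c'

namespace Butterfly

variable {H K : CrossedModule.{v, u, w} J} {G : BraidedCrossedModule.{v, u, w} J}
  {S S' S'' : Sheaf J (Type w)}

/-- Morphisms `E' → E` over `p : S' ⟶ S` in the category fibred over the topos: morphisms of
butterflies `E' ⟶ p^* E` over `S'`, that is, maps of sheaves preserving all the structure. -/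
@[ext]
structure HomOver (p : S' ⟶ S) (E' : Butterfly S' H K G) (E : Butterfly S H K G) where
  app : ∀ {U : C}, E'.Sec U → E.Sec U
  res : ∀ {U V : C} (f : V ⟶ U) (e : E'.Sec U), app (E'.res f e) = E.res f (app e)
  base : ∀ {U : C} (e : E'.Sec U), E.base (app e) = p.hom.app (op U) (E'.base e)
  fst : ∀ {U : C} (e : E'.Sec U), E.fst (app e) = E'.fst e
  snd : ∀ {U : C} (e : E'.Sec U), E.snd (app e) = E'.snd e
  act : ∀ {U : C} (e : E'.Sec U) (g : G.G₁.obj (op U)), app (E'.act e g) = E.act (app e) g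
  sec : ∀ {U : C} (e : E'.Sec U), E.sec (app e) = E'.sec e
  mul₁ : ∀ {U : C} (e e' : E'.Sec U) (c : E'.Comp₁ e e') (c' : E.Comp₁ (app e) (app e')),
    app (E'.mul₁ e e' c) = E.mul₁ (app e) (app e') c'
  mul₂ : ∀ {U : C} (e e' : E'.Sec U) (c : E'.Comp₂ e e') (c' : E.Comp₂ (app e) (app e')),
    app (E'.mul₂ e e' c) = E.mul₂ (app e) (app e') c'
  s₁ : ∀ {U : C} (s : S'.obj.obj (op U)) (h : H.G₁.obj (op U)) (z : K.G₀.obj (op U)),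
    app (E'.s₁ s h z) = E.s₁ (p.hom.app (op U) s) h z
  s₂ : ∀ {U : C} (s : S'.obj.obj (op U)) (y : H.G₀.obj (op U)) (k : K.G₁.obj (op U)),
    app (E'.s₂ s y k) = E.s₂ (p.hom.app (op U) s) y k

def HomOver.id (E : Butterfly S H K G) : HomOver (𝟙 S) E E where
  app e := e
  res _ _ := rfl
  base _ := rfl
  fst _ := rfl
  snd _ := rfl
  act _ _ := rfl
  sec _ := rfl
  mul₁ _ _ _ _ := rfl
  mul₂ _ _ _ _ := rfl
  s₁ _ _ _ := rfl
  s₂ _ _ _ := rfl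

def HomOver.comp {p : S'' ⟶ S'} {q : S' ⟶ S} {E'' : Butterfly S'' H K G}
    {E' : Butterfly S' H K G} {E : Butterfly S H K G} (φ : HomOver p E'' E')
    (ψ : HomOver q E' E) : HomOver (p ≫ q) E'' E where
  app e := ψ.app (φ.app e)
  res f e := by rw [φ.res, ψ.res]
  base e := by rw [ψ.base, φ.base]; rfl
  fst e := by rw [ψ.fst, φ.fst]
  snd e := by rw [ψ.snd, φ.snd]
  act e g := by rw [φ.act, ψ.act]
  sec e := by rw [ψ.sec, φ.sec]
  mul₁ e e' c c' := by
    have c₁ : E'.Comp₁ (φ.app e) (φ.app e') :=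
      ⟨by rw [φ.base, φ.base, c.1], by rw [φ.snd, φ.snd, c.2]⟩
    rw [φ.mul₁ e e' c c₁, ψ.mul₁ _ _ c₁ c']
  mul₂ e e' c c' := by
    have c₁ : E'.Comp₂ (φ.app e) (φ.app e') :=
      ⟨by rw [φ.base, φ.base, c.1], by rw [φ.fst, φ.fst, c.2]⟩
    rw [φ.mul₂ e e' c c₁, ψ.mul₂ _ _ c₁ c']
  s₁ s h z := by rw [φ.s₁, ψ.s₁]; rfl
  s₂ s y k := by rw [φ.s₂, ψ.s₂]; rfl

instance : Category (Butterfly S H K G) where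
  Hom E E' := HomOver (𝟙 S) E E'
  id E := HomOver.id E
  comp φ ψ := (HomOver.comp φ ψ : HomOver (𝟙 S ≫ 𝟙 S) _ _)
  id_comp _ := rfl
  comp_id _ := rfl
  assoc _ _ _ := rfl

end Butterfly

def prodPresheaf (P Q : Cᵒᵖ ⥤ Type w) : Cᵒᵖ ⥤ Type w where
  obj U := P.obj U × Q.obj U
  map f := ↾fun a => (P.map f a.1, Q.map f a.2)
  map_id U := by ext a <;> simp
  map_comp f g := by ext a <;> simp

lemma prodPresheaf_isSheaf {P Q : Cᵒᵖ ⥤ Type w} (hP : Presheaf.IsSheaf J P)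
    (hQ : Presheaf.IsSheaf J Q) : Presheaf.IsSheaf J (prodPresheaf P Q) := by
  rw [isSheaf_iff_isSheaf_of_type] at *
  intro U R hR x hx
  have cP : Presieve.FamilyOfElements.Compatible (P := P) (fun V f hf => (x f hf).1) :=
    fun _ _ _ g₁ g₂ f₁ f₂ h₁ h₂ e => congrArg Prod.fst (hx g₁ g₂ h₁ h₂ e)
  have cQ : Presieve.FamilyOfElements.Compatible (P := Q) (fun V f hf => (x f hf).2) :=
    fun _ _ _ g₁ g₂ f₁ f₂ h₁ h₂ e => congrArg Prod.snd (hx g₁ g₂ h₁ h₂ e)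
  obtain ⟨a, ha, ha'⟩ := hP R hR _ cP
  obtain ⟨b, hb, hb'⟩ := hQ R hR _ cQ
  refine ⟨(a, b), fun V f hf => Prod.ext (ha f hf) (hb f hf), fun c hc => Prod.ext ?_ ?_⟩
  · exact ha' c.1 fun V f hf => congrArg Prod.fst (hc f hf)
  · exact hb' c.2 fun V f hf => congrArg Prod.snd (hc f hf)

namespace Butterfly

variable {S S' : Sheaf J (Type w)}

lemma quad {α β γ δ : Type*} {e e' : α × β × γ × δ} (h₁ : e.1 = e'.1) (h₂ : e.2.1 = e'.2.1)
    (h₃ : e.2.2.1 = e'.2.2.1) (h₄ : e.2.2.2 = e'.2.2.2) : e = e' :=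
  Prod.ext h₁ (Prod.ext h₂ (Prod.ext h₃ h₄))

lemma trivial_act_mul (G : CrossedModule.{v, u, w} J) {U : C} (a a' g : G.G₁.obj (op U)) :
    a * g * a' = a * a' * G.act g (G.d a') := by
  rw [G.act_d]; group

lemma trivial_interchange (G : BraidedCrossedModule.{v, u, w} J) {U : C}
    (a a' b b' : G.G₁.obj (op U)) :
    a * a' * (b * b') =
      a * b * (a' * b') * (G.act (G.br (G.d a') (G.d b)) (G.d b'))⁻¹ := by
  rw [G.d_br', G.act_d, G.act_d]; group

/-- The trivial butterfly `S × H₀ × K₀ × G₁`. -/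
def trivial (S : Sheaf J (Type w)) (H K : CrossedModule.{v, u, w} J)
    (G : BraidedCrossedModule.{v, u, w} J) : Butterfly S H K G where
  E := ⟨prodPresheaf S.obj (prodPresheaf (H.G₀ ⋙ forget GrpCat)
      (prodPresheaf (K.G₀ ⋙ forget GrpCat) (G.G₁ ⋙ forget GrpCat))),
    prodPresheaf_isSheaf S.property (prodPresheaf_isSheaf H.isSheaf₀
      (prodPresheaf_isSheaf K.isSheaf₀ G.isSheaf₁))⟩
  base e := e.1
  fst e := e.2.1
  snd e := e.2.2.1
  sec e := G.d e.2.2.2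
  act e g := ⟨e.1, e.2.1, e.2.2.1, e.2.2.2 * g⟩
  base_res _ _ := rfl
  fst_res _ _ := rfl
  snd_res _ _ := rfl
  act_res f e g := quad rfl rfl rfl (map_mul (G.G₁.map f.op).hom e.2.2.2 g).symm
  sec_res f e := G.d_res f e.2.2.2
  base_act _ _ := rfl
  fst_act _ _ := rfl
  snd_act _ _ := rfl
  act_one e := quad rfl rfl rfl (mul_one (M := G.G₁.obj _) e.2.2.2)
  act_mul e g g' := quad rfl rfl rfl (mul_assoc (G := G.G₁.obj _) e.2.2.2 g g').symm
  simply_transitive {U} e e' h₁ h₂ h₃ := by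
    refine ⟨((e.2.2.2 : G.G₁.obj (op U))⁻¹ * (e'.2.2.2 : G.G₁.obj (op U)) : G.G₁.obj (op U)),
      quad h₁ h₂ h₃ (mul_inv_cancel_left (G := G.G₁.obj (op U)) e.2.2.2 e'.2.2.2), fun g hg => ?_⟩
    exact eq_inv_mul_of_mul_eq (G := G.G₁.obj (op U)) (congrArg (fun x => x.2.2.2) hg)
  locally_nonempty s y z := ⟨⊤, J.top_mem _, fun f _ =>
    ⟨⟨S.obj.map f.op s, H.G₀.map f.op y, K.G₀.map f.op z, (1 : G.G₁.obj _)⟩, rfl, rfl, rfl⟩⟩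
  sec_act e g := map_mul G.d e.2.2.2 g
  mul₁ e e' _ := ⟨e.1, e.2.1 * e'.2.1, e.2.2.1, e.2.2.2 * e'.2.2.2⟩
  mul₂ e e' _ := ⟨e.1, e.2.1, e.2.2.1 * e'.2.2.1, e.2.2.2 * e'.2.2.2⟩
  base_mul₁ _ _ _ := rfl
  fst_mul₁ _ _ _ := rfl
  snd_mul₁ _ _ _ := rfl
  mul₁_res f e e' c c' := quad rfl (map_mul (H.G₀.map f.op).hom e.2.1 e'.2.1).symm rfl
    (map_mul (G.G₁.map f.op).hom e.2.2.2 e'.2.2.2).symm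
  mul₁_assoc _ _ _ _ _ _ _ := quad rfl (mul_assoc (G := H.G₀.obj _) _ _ _) rfl
    (mul_assoc (G := G.G₁.obj _) _ _ _)
  sec_mul₁ _ _ _ := map_mul G.d _ _
  mul₁_act e e' g c c' := quad rfl rfl rfl (mul_assoc (G := G.G₁.obj _) _ _ _).symm
  act_mul₁ e e' g c c' := quad rfl rfl rfl (trivial_act_mul G.toCrossedModule e.2.2.2 e'.2.2.2 g)
  base_mul₂ _ _ _ := rfl
  fst_mul₂ _ _ _ := rfl
  snd_mul₂ _ _ _ := rfl
  mul₂_res f e e' c c' := quad rfl rfl (map_mul (K.G₀.map f.op).hom e.2.2.1 e'.2.2.1).symm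
    (map_mul (G.G₁.map f.op).hom e.2.2.2 e'.2.2.2).symm
  mul₂_assoc _ _ _ _ _ _ _ := quad rfl rfl (mul_assoc (G := K.G₀.obj _) _ _ _)
    (mul_assoc (G := G.G₁.obj _) _ _ _)
  sec_mul₂ _ _ _ := map_mul G.d _ _
  mul₂_act e e' g c c' := quad rfl rfl rfl (mul_assoc (G := G.G₁.obj _) _ _ _).symm
  act_mul₂ e e' g c c' := quad rfl rfl rfl (trivial_act_mul G.toCrossedModule e.2.2.2 e'.2.2.2 g)
  interchange a a' b b' c₁ c₂ c₃ c₄ c₅ c₆ := quad rfl rfl rfl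
    (trivial_interchange G a.2.2.2 a'.2.2.2 b.2.2.2 b'.2.2.2)
  s₁ s h z := ⟨s, H.d h, z, (1 : G.G₁.obj _)⟩
  s₂ s y k := ⟨s, y, K.d k, (1 : G.G₁.obj _)⟩
  s₁_res f s h z := quad rfl (H.d_res f h) rfl (map_one (G.G₁.map f.op).hom).symm
  base_s₁ _ _ _ := rfl
  fst_s₁ _ _ _ := rfl
  snd_s₁ _ _ _ := rfl
  sec_s₁ _ _ _ := map_one G.d
  s₁_mul₁ s h h' z c := quad rfl (map_mul H.d h h').symm rfl (mul_one (M := G.G₁.obj _) 1)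
  s₁_mul₂ s h z z' c := quad rfl rfl rfl (mul_one (M := G.G₁.obj _) 1)
  s₂_res f s y k := quad rfl rfl (K.d_res f k) (map_one (G.G₁.map f.op).hom).symm
  base_s₂ _ _ _ := rfl
  fst_s₂ _ _ _ := rfl
  snd_s₂ _ _ _ := rfl
  sec_s₂ _ _ _ := map_one G.d
  s₂_mul₁ s y y' k c := quad rfl rfl rfl (mul_one (M := G.G₁.obj _) 1)
  s₂_mul₂ s y k k' c := quad rfl rfl (map_mul K.d k k').symm (mul_one (M := G.G₁.obj _) 1)
  restriction _ _ _ := rfl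
  compatibility₁ h e c c' := quad rfl (CrossedModule.d_act' H h e.2.1).symm rfl
    ((one_mul (M := G.G₁.obj _) _).trans (mul_one (M := G.G₁.obj _) _).symm)
  compatibility₂ k e c c' := quad rfl rfl (CrossedModule.d_act' K k e.2.2.1).symm
    ((one_mul (M := G.G₁.obj _) _).trans (mul_one (M := G.G₁.obj _) _).symm)

def trivialMap (p : S' ⟶ S) (H K : CrossedModule.{v, u, w} J)
    (G : BraidedCrossedModule.{v, u, w} J) : HomOver p (trivial S' H K G) (trivial S H K G) where
  app {U} e := ⟨p.hom.app (op U) e.1, e.2⟩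
  res f e := quad (NatTrans.naturality_apply p.hom f.op e.1) rfl rfl rfl
  base _ := rfl
  fst _ := rfl
  snd _ := rfl
  act _ _ := rfl
  sec _ := rfl
  mul₁ _ _ _ _ := rfl
  mul₂ _ _ _ _ := rfl
  s₁ _ _ _ := rfl
  s₂ _ _ _ := rfl

end Butterfly


/-! ### Morphisms of stacks -/

section

variable (H K : CrossedModule.{v, u, w} J) (G : BraidedCrossedModule.{v, u, w} J)
  (𝓗 : MonoidalPrestack.{v, u, v₁, u₁} C) (𝓚 : MonoidalPrestack.{v, u, v₂, u₂} C)
  (𝓖 : BraidedPrestack.{v, u, w, u₃} C)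

/-- A functor over the topos, from the fibred category of butterflies to that of biadditive
functors. -/
structure FiberedFunctor where
  obj : ∀ {S : Sheaf J (Type w)}, Butterfly S H K G → BiaddFunctor S 𝓗 𝓚 𝓖
  map : ∀ {S' S : Sheaf J (Type w)} {p : S' ⟶ S} {E' : Butterfly S' H K G}
    {E : Butterfly S H K G}, Butterfly.HomOver p E' E → BiaddFunctor.HomOver p (obj E') (obj E)
  map_id : ∀ {S : Sheaf J (Type w)} (E : Butterfly S H K G),
    map (Butterfly.HomOver.id E) = BiaddFunctor.HomOver.id (obj E)
  map_comp : ∀ {S'' S' S : Sheaf J (Type w)} {p : S'' ⟶ S'} {q : S' ⟶ S}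
    {E'' : Butterfly S'' H K G} {E' : Butterfly S' H K G} {E : Butterfly S H K G}
    (φ : Butterfly.HomOver p E'' E') (ψ : Butterfly.HomOver q E' E),
    map (φ.comp ψ) = (map φ).comp (map ψ)

end

namespace FiberedFunctor

variable {H K : CrossedModule.{v, u, w} J} {G : BraidedCrossedModule.{v, u, w} J}
  {𝓗 : MonoidalPrestack.{v, u, v₁, u₁} C} {𝓚 : MonoidalPrestack.{v, u, v₂, u₂} C}
  {𝓖 : BraidedPrestack.{v, u, w, u₃} C} (F : FiberedFunctor H K G 𝓗 𝓚 𝓖)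

/-- The functor induced on the fibres over `S`. -/
def onFiber (S : Sheaf J (Type w)) : Butterfly S H K G ⥤ BiaddFunctor S 𝓗 𝓚 𝓖 where
  obj E := F.obj E
  map φ := F.map φ
  map_id E := F.map_id E
  map_comp φ ψ := F.map_comp φ ψ

/-- The functor is an equivalence of fibred categories. -/
structure IsEquivalence : Prop where
  bijective : ∀ {S' S : Sheaf J (Type w)} (p : S' ⟶ S) (E' : Butterfly S' H K G)
    (E : Butterfly S H K G),
    Function.Bijective (F.map : Butterfly.HomOver p E' E → _)
  essSurj : ∀ (S : Sheaf J (Type w)) (B : BiaddFunctor S 𝓗 𝓚 𝓖),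
    ∃ E : Butterfly S H K G, Nonempty (F.obj E ≅ B)

/-- The functor respects the distinguished points, compatibly with base change. -/
def IsPointed : Prop :=
  ∃ i : ∀ S : Sheaf J (Type w), F.obj (Butterfly.trivial S H K G) ≅ BiaddFunctor.trivial S 𝓗 𝓚 𝓖,
    ∀ {S' S : Sheaf J (Type w)} (p : S' ⟶ S),
      BiaddFunctor.HomOver.comp (F.map (Butterfly.trivialMap p H K G)) (i S).hom =
        (BiaddFunctor.HomOver.comp (i S').hom (BiaddFunctor.trivialMap p 𝓗 𝓚 𝓖) :
          BiaddFunctor.HomOver (𝟙 S' ≫ p) _ _)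

end FiberedFunctor

section

variable {M : CrossedModule.{v, u, w} J} {Q : MonoidalPrestack.{v, u, v₁, u₁} C}
  (π : MonoidalMorphism M.prestack Q) {U : C}

/-- The object of the stack defined by a section of `G₀`. -/
def MonoidalMorphism.pt (x : M.G₀.obj (op U)) : Q.Fib U :=
  (π.functor U).obj (⟨x⟩ : M.Pt U)

/-- The morphism defined by a section `g` of `G₁`, from the object of `x` to that of `x ∂g`. -/
def MonoidalMorphism.ptMap {x x' : M.G₀.obj (op U)} (g : M.G₁.obj (op U)) (h : x' = x * M.d g) :
    π.pt x ⟶ π.pt x' :=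
  (π.functor U).map (X := (⟨x⟩ : M.Pt U)) (Y := (⟨x'⟩ : M.Pt U)) (⟨g, h⟩ : CrossedModule.Pt.Hom _ _)

def MonoidalMorphism.ptMul (x y : M.G₀.obj (op U)) : π.pt x ⊗ π.pt y ⟶ π.pt (x * y) :=
  Functor.LaxMonoidal.μ (π.functor U) (⟨x⟩ : M.Pt U) (⟨y⟩ : M.Pt U)

def MonoidalMorphism.ptOne : 𝟙_ (Q.Fib U) ⟶ π.pt (1 : M.G₀.obj (op U)) :=
  Functor.LaxMonoidal.ε (π.functor U)

def MonoidalMorphism.ptRes {V : C} (f : V ⟶ U) (x : M.G₀.obj (op U)) :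
    (Q.res f).obj (π.pt x) ⟶ π.pt (M.G₀.map f.op x) :=
  (π.resIso f).hom.app (⟨x⟩ : M.Pt U)

end

section

variable {H K : CrossedModule.{v, u, w} J} {G : BraidedCrossedModule.{v, u, w} J}
  {𝓗 : MonoidalPrestack.{v, u, v₁, u₁} C} {𝓚 : MonoidalPrestack.{v, u, v₂, u₂} C}
  {𝓖 : BraidedPrestack.{v, u, w, u₃} C}
  (πH : MonoidalMorphism H.prestack 𝓗) (πK : MonoidalMorphism K.prestack 𝓚)
  (πG : MonoidalMorphism G.toCrossedModule.prestack 𝓖.toMonoidalPrestack)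

/-- The value `F(π y, π z)`. -/
abbrev BiaddFunctor.val {S : Sheaf J (Type w)} (F : BiaddFunctor S 𝓗 𝓚 𝓖) {U : C}
    (s : S.obj.obj (op U)) (y : H.G₀.obj (op U)) (z : K.G₀.obj (op U)) : 𝓖.Fib U :=
  ((F.functor s).obj (πH.pt y)).obj (πK.pt z)

/-- The butterfly `E` represents `F`: the restriction of `F` along the presentations is the biadditive
functor sending `(y, z)` to the torsor `E_{y,z}`. In detail, a point `e` of `E` over `(s, y, z)` gives
an isomorphism `F_s(π y, π z) ⟶ π (sec e)`, compatibly with the action of `G₁`, with restriction, with the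
two products, and with the trivializations, which correspond to the isomorphisms
`F(π ∂h, π z) ≅ F(1, π z) ≅ 1` and `F(π y, π ∂k) ≅ F(π y, 1) ≅ 1`. -/
structure Represents {S : Sheaf J (Type w)} (E : Butterfly S H K G)
    (F : BiaddFunctor S 𝓗 𝓚 𝓖) where
  iso : ∀ {U : C} (e : E.Sec U) (s : S.obj.obj (op U)) (y : H.G₀.obj (op U))
    (z : K.G₀.obj (op U)) (x : G.G₀.obj (op U)),
    E.base e = s → E.fst e = y → E.snd e = z → E.sec e = x → (F.val πH πK s y z ⟶ πG.pt x)
  iso_act : ∀ {U : C} (e : E.Sec U) (g : G.G₁.obj (op U)) (s : S.obj.obj (op U))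
    (y : H.G₀.obj (op U)) (z : K.G₀.obj (op U)) (x x' : G.G₀.obj (op U)) (hs hy hz hx)
    (hs' hy' hz' hx') (h : x' = x * G.d g),
    iso (E.act e g) s y z x' hs' hy' hz' hx' = iso e s y z x hs hy hz hx ≫ πG.ptMap g h
  iso_res : ∀ {U V : C} (f : V ⟶ U) (e : E.Sec U) (s : S.obj.obj (op U))
    (y : H.G₀.obj (op U)) (z : K.G₀.obj (op U)) (x : G.G₀.obj (op U)) (hs hy hz hx)
    (hs' hy' hz' hx'),
    (𝓖.res f).map (iso e s y z x hs hy hz hx) ≫ πG.ptRes f x =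
      ((F.resIso f s (S.obj.map f.op s) rfl).hom.app (πH.pt y)).app (πK.pt z) ≫
        ((F.functor _).map (πH.ptRes f y)).app _ ≫ ((F.functor _).obj _).map (πK.ptRes f z) ≫
        iso (E.res f e) (S.obj.map f.op s) (H.G₀.map f.op y) (K.G₀.map f.op z) (G.G₀.map f.op x)
          hs' hy' hz' hx'
  iso_mul₁ : ∀ {U : C} (e e' : E.Sec U) (c : E.Comp₁ e e') (s : S.obj.obj (op U))
    (y y' : H.G₀.obj (op U)) (z : K.G₀.obj (op U)) (x x' : G.G₀.obj (op U)) (hs hy hz hx)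
    (hs' hy' hz' hx') (hs'' hy'' hz'' hx''),
    Functor.LaxMonoidal.μ ((F.functor s).flip.obj (πK.pt z)) (πH.pt y) (πH.pt y') ≫
        ((F.functor s).map (πH.ptMul y y')).app (πK.pt z) ≫
        iso (E.mul₁ e e' c) s (y * y') z (x * x') hs'' hy'' hz'' hx'' =
      (iso e s y z x hs hy hz hx ⊗ₘ iso e' s y' z x' hs' hy' hz' hx') ≫ πG.ptMul x x'
  iso_mul₂ : ∀ {U : C} (e e' : E.Sec U) (c : E.Comp₂ e e') (s : S.obj.obj (op U))
    (y : H.G₀.obj (op U)) (z z' : K.G₀.obj (op U)) (x x' : G.G₀.obj (op U)) (hs hy hz hx)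
    (hs' hy' hz' hx') (hs'' hy'' hz'' hx''),
    Functor.LaxMonoidal.μ ((F.functor s).obj (πH.pt y)) (πK.pt z) (πK.pt z') ≫
        ((F.functor s).obj (πH.pt y)).map (πK.ptMul z z') ≫
        iso (E.mul₂ e e' c) s y (z * z') (x * x') hs'' hy'' hz'' hx'' =
      (iso e s y z x hs hy hz hx ⊗ₘ iso e' s y z' x' hs' hy' hz' hx') ≫ πG.ptMul x x'
  iso_s₁ : ∀ {U : C} (s : S.obj.obj (op U)) (h : H.G₁.obj (op U)) (z : K.G₀.obj (op U))
    (h₁ : H.d h = 1 * H.d h),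
    Functor.LaxMonoidal.ε ((F.functor s).flip.obj (πK.pt z)) ≫
        ((F.functor s).map (πH.ptOne ≫ πH.ptMap h h₁)).app (πK.pt z) ≫
        iso (E.s₁ s h z) s (H.d h) z 1 (E.base_s₁ s h z) (E.fst_s₁ s h z) (E.snd_s₁ s h z)
          (E.sec_s₁ s h z) = πG.ptOne
  iso_s₂ : ∀ {U : C} (s : S.obj.obj (op U)) (y : H.G₀.obj (op U)) (k : K.G₁.obj (op U))
    (h₁ : K.d k = 1 * K.d k),
    Functor.LaxMonoidal.ε ((F.functor s).obj (πH.pt y)) ≫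
        ((F.functor s).obj (πH.pt y)).map (πK.ptOne ≫ πK.ptMap k h₁) ≫
        iso (E.s₂ s y k) s y (K.d k) 1 (E.base_s₂ s y k) (E.fst_s₂ s y k) (E.snd_s₂ s y k)
          (E.sec_s₂ s y k) = πG.ptOne

/-- Each `u(E)` is represented by `E`, naturally in `E`. -/
def FiberedFunctor.Realizes (u : FiberedFunctor H K G 𝓗 𝓚 𝓖) : Prop :=
  ∃ r : ∀ {S : Sheaf J (Type w)} (E : Butterfly S H K G), Represents πH πK πG E (u.obj E),
    ∀ {S' S : Sheaf J (Type w)} (p : S' ⟶ S) (E' : Butterfly S' H K G) (E : Butterfly S H K G)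
      (φ : Butterfly.HomOver p E' E) {U : C} (e : E'.Sec U) (s : S'.obj.obj (op U))
      (y : H.G₀.obj (op U)) (z : K.G₀.obj (op U)) (x : G.G₀.obj (op U)) (hs hy hz hx)
      (hs' hy' hz' hx'),
      (((u.map φ).app s).app (πH.pt y)).app (πK.pt z) ≫
          (r E).iso (φ.app e) (p.hom.app (op U) s) y z x hs' hy' hz' hx' =
        (r E').iso e s y z x hs hy hz hx

end

section

variable (H K : CrossedModule.{v, u, w} J) (G : BraidedCrossedModule.{v, u, w} J)
  (𝓗 : MonoidalPrestack.{v, u, v₁, u₁} C) (𝓚 : MonoidalPrestack.{v, u, v₂, u₂} C)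
  (𝓖 : BraidedPrestack.{v, u, w, u₃} C)

/-- Butterflies over variable `S` form a category fibred in groupoids over the topos: base changes
exist, and all morphisms are cartesian. -/
structure Butterfly.IsFibredInGroupoids : Prop where
  lift : ∀ {S' S : Sheaf J (Type w)} (p : S' ⟶ S) (E : Butterfly S H K G),
    ∃ E' : Butterfly S' H K G, Nonempty (Butterfly.HomOver p E' E)
  cartesian : ∀ {S'' S' S : Sheaf J (Type w)} (p : S'' ⟶ S') (q : S' ⟶ S)
    {E'' : Butterfly S'' H K G} {E' : Butterfly S' H K G} {E : Butterfly S H K G}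
    (ψ : Butterfly.HomOver q E' E) (χ : Butterfly.HomOver (p ≫ q) E'' E),
    ∃! φ : Butterfly.HomOver p E'' E', φ.comp ψ = χ

/-- Biadditive functors over variable `S` form a category fibred in groupoids over the topos `Sh(C, J)`. -/
structure BiaddFunctor.IsFibredInGroupoids (J : GrothendieckTopology C) : Prop where
  lift : ∀ {S' S : Sheaf J (Type w)} (p : S' ⟶ S) (F : BiaddFunctor S 𝓗 𝓚 𝓖),
    ∃ F' : BiaddFunctor S' 𝓗 𝓚 𝓖, Nonempty (BiaddFunctor.HomOver p F' F)
  cartesian : ∀ {S'' S' S : Sheaf J (Type w)} (p : S'' ⟶ S') (q : S' ⟶ S)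
    {F'' : BiaddFunctor S'' 𝓗 𝓚 𝓖} {F' : BiaddFunctor S' 𝓗 𝓚 𝓖} {F : BiaddFunctor S 𝓗 𝓚 𝓖}
    (ψ : BiaddFunctor.HomOver q F' F) (χ : BiaddFunctor.HomOver (p ≫ q) F'' F),
    ∃! φ : BiaddFunctor.HomOver p F'' F', φ.comp ψ = χ

/-- The terminal sheaf. -/
def point (J : GrothendieckTopology C) : Sheaf J (Type w) :=
  ⟨(Functor.const _).obj PUnit, by
    rw [isSheaf_iff_isSheaf_of_type]
    exact fun _ _ _ _ _ => ⟨PUnit.unit, fun _ _ _ => rfl, fun _ _ => rfl⟩⟩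

/-- The groupoid of butterflies. -/
abbrev Bfl := Butterfly (point J) H K G

/-- The groupoid of biadditive functors `𝓗 × 𝓚 → 𝓖`. -/
abbrev Biadd (J : GrothendieckTopology C) := BiaddFunctor (point.{v, u, w} J) 𝓗 𝓚 𝓖

end

end BiaddBfl

namespace BiaddBfl

/-! ### Frames along a pair of monoidal functors -/

section Frames

variable {𝒜 : Type*} [Category* 𝒜] {ℬ : Type*} [Category* ℬ] {𝒬 : Type*} [Category* 𝒬]
  (L : 𝒜 ⥤ ℬ) (R : 𝒬 ⥤ ℬ)

/-- A morphism `(φ, g) : a ⟶ b` of the comma category of `L` and `R`. -/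
def Sq {X Y : 𝒜} {p q : 𝒬} (φ : X ⟶ Y) (g : p ⟶ q) (a : L.obj X ⟶ R.obj p)
    (b : L.obj Y ⟶ R.obj q) : Prop :=
  L.map φ ≫ b = a ≫ R.map g

variable {L R}

lemma Sq.id {X : 𝒜} {p : 𝒬} (a : L.obj X ⟶ R.obj p) : Sq L R (𝟙 X) (𝟙 p) a a := by
  simp [Sq]

lemma Sq.comp {X Y Z : 𝒜} {p q r : 𝒬} {φ : X ⟶ Y} {ψ : Y ⟶ Z} {g : p ⟶ q} {g' : q ⟶ r}
    {a : L.obj X ⟶ R.obj p} {b : L.obj Y ⟶ R.obj q} {c : L.obj Z ⟶ R.obj r}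
    (h : Sq L R φ g a b) (h' : Sq L R ψ g' b c) : Sq L R (φ ≫ ψ) (g ≫ g') a c := by
  unfold Sq at *
  rw [L.map_comp, Category.assoc, h', reassoc_of% h, R.map_comp]

lemma Sq.inv {X Y : 𝒜} {p q : 𝒬} {φ : X ⟶ Y} {g : p ⟶ q} [IsIso φ] [IsIso g]
    {a : L.obj X ⟶ R.obj p} {b : L.obj Y ⟶ R.obj q} (h : Sq L R φ g a b) :
    Sq L R (CategoryTheory.inv φ) (CategoryTheory.inv g) b a := by
  unfold Sq at *
  rw [← cancel_epi (L.map φ), reassoc_of% h, ← L.map_comp_assoc, ← R.map_comp]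
  simp

lemma Sq.isoInv {X Y : 𝒜} {p q : 𝒬} {φ : X ≅ Y} {g : p ≅ q}
    {a : L.obj X ⟶ R.obj p} {b : L.obj Y ⟶ R.obj q} (h : Sq L R φ.hom g.hom a b) :
    Sq L R φ.inv g.inv b a := by
  simpa using h.inv

variable [MonoidalCategory 𝒜] [MonoidalCategory ℬ] [MonoidalCategory 𝒬] [L.Monoidal] [R.Monoidal]

open Functor.LaxMonoidal Functor.OplaxMonoidal

/-- The tensor product of two frames. -/
def tens {X Y : 𝒜} {p q : 𝒬} (a : L.obj X ⟶ R.obj p) (b : L.obj Y ⟶ R.obj q) :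
    L.obj (X ⊗ Y) ⟶ R.obj (p ⊗ q) :=
  δ L X Y ≫ (a ⊗ₘ b) ≫ μ R p q

variable (L R) in
/-- The frame of the unit object. -/
def unitFrame : L.obj (𝟙_ 𝒜) ⟶ R.obj (𝟙_ 𝒬) := η L ≫ ε R

lemma μ_tens {X Y : 𝒜} {p q : 𝒬} (a : L.obj X ⟶ R.obj p) (b : L.obj Y ⟶ R.obj q) :
    μ L X Y ≫ tens a b = (a ⊗ₘ b) ≫ μ R p q := by
  simp [tens]

lemma eq_tens {X Y : 𝒜} {p q : 𝒬} {a : L.obj X ⟶ R.obj p} {b : L.obj Y ⟶ R.obj q}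
    {c : L.obj (X ⊗ Y) ⟶ R.obj (p ⊗ q)} (h : μ L X Y ≫ c = (a ⊗ₘ b) ≫ μ R p q) :
    c = tens a b := by
  rw [← cancel_epi (μ L X Y), h, μ_tens]

lemma ε_unitFrame : ε L ≫ unitFrame L R = ε R := by simp [unitFrame]

lemma eq_unitFrame {c : L.obj (𝟙_ 𝒜) ⟶ R.obj (𝟙_ 𝒬)} (h : ε L ≫ c = ε R) :
    c = unitFrame L R := by
  rw [← cancel_epi (ε L), h, ε_unitFrame]

lemma Sq.tens {X Y X' Y' : 𝒜} {p q p' q' : 𝒬} {φ : X ⟶ Y} {g : p ⟶ q} {φ' : X' ⟶ Y'}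
    {g' : p' ⟶ q'} {a : L.obj X ⟶ R.obj p} {b : L.obj Y ⟶ R.obj q} {a' : L.obj X' ⟶ R.obj p'}
    {b' : L.obj Y' ⟶ R.obj q'} (h : Sq L R φ g a b) (h' : Sq L R φ' g' a' b') :
    Sq L R (φ ⊗ₘ φ') (g ⊗ₘ g') (BiaddBfl.tens a a') (BiaddBfl.tens b b') := by
  unfold Sq BiaddBfl.tens at *
  rw [← δ_natural_assoc, Category.assoc, Category.assoc, ← μ_natural,
    tensorHom_comp_tensorHom_assoc, tensorHom_comp_tensorHom_assoc, h, h']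

lemma Sq.whiskerRight {X Y X' : 𝒜} {p q p' : 𝒬} {φ : X ⟶ Y} {g : p ⟶ q}
    {a : L.obj X ⟶ R.obj p} {b : L.obj Y ⟶ R.obj q} (h : Sq L R φ g a b)
    (a' : L.obj X' ⟶ R.obj p') :
    Sq L R (φ ▷ X') (g ▷ p') (BiaddBfl.tens a a') (BiaddBfl.tens b a') := by
  rw [← tensorHom_id, ← tensorHom_id]
  exact h.tens (.id a')

lemma Sq.whiskerLeft {X Y X' : 𝒜} {p q p' : 𝒬} {φ : X ⟶ Y} {g : p ⟶ q}
    {a : L.obj X ⟶ R.obj p} {b : L.obj Y ⟶ R.obj q} (a' : L.obj X' ⟶ R.obj p')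
    (h : Sq L R φ g a b) :
    Sq L R (X' ◁ φ) (p' ◁ g) (BiaddBfl.tens a' a) (BiaddBfl.tens a' b) := by
  rw [← id_tensorHom, ← id_tensorHom]
  exact (Sq.id a').tens h

lemma Sq.associator {X Y Z : 𝒜} {p q r : 𝒬} (a : L.obj X ⟶ R.obj p) (b : L.obj Y ⟶ R.obj q)
    (c : L.obj Z ⟶ R.obj r) :
    Sq L R (α_ X Y Z).hom (α_ p q r).hom (BiaddBfl.tens (BiaddBfl.tens a b) c)
      (BiaddBfl.tens a (BiaddBfl.tens b c)) := by
  unfold Sq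
  have h₁ : μ L X Y ▷ L.obj Z ≫ μ L (X ⊗ Y) Z ≫ BiaddBfl.tens (BiaddBfl.tens a b) c =
      ((a ⊗ₘ b) ⊗ₘ c) ≫ μ R p q ▷ R.obj r ≫ μ R (p ⊗ q) r := by
    rw [μ_tens, ← tensorHom_id, ← tensorHom_id, tensorHom_comp_tensorHom_assoc, μ_tens,
      tensorHom_comp_tensorHom_assoc, Category.id_comp, Category.comp_id]
  have h₂ : L.obj X ◁ μ L Y Z ≫ μ L X (Y ⊗ Z) ≫ BiaddBfl.tens a (BiaddBfl.tens b c) =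
      (a ⊗ₘ (b ⊗ₘ c)) ≫ R.obj p ◁ μ R q r ≫ μ R p (q ⊗ r) := by
    rw [μ_tens, ← id_tensorHom, ← id_tensorHom, tensorHom_comp_tensorHom_assoc, μ_tens,
      tensorHom_comp_tensorHom_assoc, Category.id_comp, Category.comp_id]
  rw [← cancel_epi (μ L (X ⊗ Y) Z), ← cancel_epi (μ L X Y ▷ L.obj Z),
    Functor.LaxMonoidal.associativity_assoc, h₂, reassoc_of% h₁,
    Functor.LaxMonoidal.associativity, associator_naturality_assoc]

lemma Sq.leftUnitor {X : 𝒜} {p : 𝒬} (a : L.obj X ⟶ R.obj p) :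
    Sq L R (λ_ X).hom (λ_ p).hom (BiaddBfl.tens (unitFrame L R) a) a := by
  unfold Sq
  rw [← cancel_epi (μ L (𝟙_ 𝒜) X), ← cancel_epi (ε L ▷ L.obj X),
    ← Functor.LaxMonoidal.left_unitality_assoc, reassoc_of% μ_tens (unitFrame L R) a,
    ← tensorHom_id, tensorHom_comp_tensorHom_assoc, ε_unitFrame, Category.id_comp,
    tensorHom_def'_assoc, ← Functor.LaxMonoidal.left_unitality, leftUnitor_naturality]

lemma Sq.rightUnitor {X : 𝒜} {p : 𝒬} (a : L.obj X ⟶ R.obj p) :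
    Sq L R (ρ_ X).hom (ρ_ p).hom (BiaddBfl.tens a (unitFrame L R)) a := by
  unfold Sq
  rw [← cancel_epi (μ L X (𝟙_ 𝒜)), ← cancel_epi (L.obj X ◁ ε L),
    ← Functor.LaxMonoidal.right_unitality_assoc, reassoc_of% μ_tens a (unitFrame L R),
    ← id_tensorHom, tensorHom_comp_tensorHom_assoc, ε_unitFrame, Category.id_comp,
    tensorHom_def_assoc, ← Functor.LaxMonoidal.right_unitality, rightUnitor_naturality]

section Braided

variable [BraidedCategory 𝒜] [BraidedCategory ℬ] [BraidedCategory 𝒬]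

lemma Sq.braiding
    (hL : ∀ X Y : 𝒜, μ L X Y ≫ L.map (β_ X Y).hom = (β_ _ _).hom ≫ μ L Y X)
    (hR : ∀ p q : 𝒬, μ R p q ≫ R.map (β_ p q).hom = (β_ _ _).hom ≫ μ R q p)
    {X Y : 𝒜} {p q : 𝒬} (a : L.obj X ⟶ R.obj p) (b : L.obj Y ⟶ R.obj q) :
    Sq L R (β_ X Y).hom (β_ p q).hom (BiaddBfl.tens a b) (BiaddBfl.tens b a) := by
  unfold Sq
  rw [← cancel_epi (μ L X Y), reassoc_of% hL, μ_tens, reassoc_of% μ_tens a b, hR,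
    BraidedCategory.braiding_naturality_assoc]

lemma Sq.tensorμ
    (hL : ∀ X Y : 𝒜, μ L X Y ≫ L.map (β_ X Y).hom = (β_ _ _).hom ≫ μ L Y X)
    (hR : ∀ p q : 𝒬, μ R p q ≫ R.map (β_ p q).hom = (β_ _ _).hom ≫ μ R q p)
    {X₁ X₂ Y₁ Y₂ : 𝒜} {p₁ p₂ q₁ q₂ : 𝒬} (a₁ : L.obj X₁ ⟶ R.obj p₁)
    (a₂ : L.obj X₂ ⟶ R.obj p₂) (b₁ : L.obj Y₁ ⟶ R.obj q₁) (b₂ : L.obj Y₂ ⟶ R.obj q₂) :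
    Sq L R (tensorμ X₁ X₂ Y₁ Y₂) (tensorμ p₁ p₂ q₁ q₂)
      (BiaddBfl.tens (BiaddBfl.tens a₁ a₂) (BiaddBfl.tens b₁ b₂))
      (BiaddBfl.tens (BiaddBfl.tens a₁ b₁) (BiaddBfl.tens a₂ b₂)) := by
  unfold MonoidalCategory.tensorμ
  exact (Sq.associator _ _ _).comp <|
    (Sq.whiskerLeft a₁ (Sq.isoInv (Sq.associator a₂ b₁ b₂))).comp <|
    (Sq.whiskerLeft a₁ (Sq.whiskerRight (Sq.braiding hL hR a₂ b₁) b₂)).comp <|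
    (Sq.whiskerLeft a₁ (Sq.associator b₁ a₂ b₂)).comp <|
    (Sq.isoInv (Sq.associator a₁ b₁ (BiaddBfl.tens a₂ b₂)))

end Braided

end Frames

end BiaddBfl

namespace BiaddBfl

/-! ### Descent in a stack -/

namespace Prestack

variable {C : Type u} [Category.{v} C] {J : GrothendieckTopology C} (P : Prestack.{v, u, v₁, u₁} C)

/-- The isomorphism `q^* ≅ g^* f^*` for `g ≫ f = q`. -/
def resCompEq {U V W : C} {f : V ⟶ U} {g : W ⟶ V} {q : W ⟶ U} (h : g ≫ f = q) :
    P.res q ≅ P.res f ⋙ P.res g :=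
  Cat.Hom.toNatIso (P.mapComp' f.op.toLoc g.op.toLoc q.op.toLoc (by subst h; rfl))

lemma resCompEq_rfl {U V W : C} (f : V ⟶ U) (g : W ⟶ V) :
    P.resCompEq (rfl : g ≫ f = g ≫ f) = P.resComp f g := by
  unfold resCompEq resComp
  congr 1
  exact P.mapComp'_eq_mapComp _ _

lemma resCompEq_id_right {U V : C} (f : V ⟶ U) (h : 𝟙 V ≫ f = f) (A : P.Fib U) :
    (P.resCompEq h).hom.app A ≫ (P.resId V).hom.app ((P.res f).obj A) = 𝟙 _ := by
  have e : (P.resCompEq h).hom.app A = (P.resId V).inv.app ((P.res f).obj A) :=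
    P.mapComp'_comp_id_hom_app f.op.toLoc A
  rw [e]
  exact Iso.inv_hom_id_app (P.resId V) _

lemma resCompEq_id_left {U V : C} (f : V ⟶ U) (h : f ≫ 𝟙 U = f) (A : P.Fib U) :
    (P.resCompEq h).hom.app A ≫ (P.res f).map ((P.resId U).hom.app A) = 𝟙 _ := by
  have e : (P.resCompEq h).hom.app A = (P.res f).map ((P.resId U).inv.app A) :=
    P.mapComp'_id_comp_hom_app f.op.toLoc A
  rw [e]
  refine Eq.trans ((P.res f).map_comp _ _).symm ?_
  exact Eq.trans (congrArg (P.res f).map (Iso.inv_hom_id_app (P.resId U) A)) ((P.res f).map_id _)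

lemma resCompEq_assoc {U V W Z : C} {f : V ⟶ U} {g : W ⟶ V} {k : Z ⟶ W} {gf : W ⟶ U} {kg : Z ⟶ V}
    {q : Z ⟶ U} (h₁ : g ≫ f = gf) (h₂ : k ≫ g = kg) (h₃ : k ≫ gf = q) (h₄ : kg ≫ f = q)
    (A : P.Fib U) :
    (P.resCompEq h₃).hom.app A ≫ (P.res k).map ((P.resCompEq h₁).hom.app A) =
      (P.resCompEq h₄).hom.app A ≫ (P.resCompEq h₂).hom.app ((P.res f).obj A) := by
  exact P.mapComp'₀₂₃_hom_comp_mapComp'_hom_whiskerRight_app f.op.toLoc g.op.toLoc k.op.toLoc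
    gf.op.toLoc kg.op.toLoc q.op.toLoc (by subst h₁; rfl) (by subst h₂; rfl) (by subst h₃; rfl) A

variable {P} {ι : Type*} {U : C} {X : ι → C} {f : ∀ i, X i ⟶ U}

lemma existsUnique_hom [P.IsStack J] (hf : Sieve.ofArrows X f ∈ J U) {A B : P.Fib U}
    (ψ : ∀ i, (P.res (f i)).obj A ⟶ (P.res (f i)).obj B)
    (H : ∀ {W : C} (q : W ⟶ U) (i₁ i₂ : ι) (f₁ : W ⟶ X i₁) (f₂ : W ⟶ X i₂) (h₁ : f₁ ≫ f i₁ = q)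
      (h₂ : f₂ ≫ f i₂ = q),
      (P.resCompEq h₁).hom.app A ≫ (P.res f₁).map (ψ i₁) ≫ (P.resCompEq h₁).inv.app B =
        (P.resCompEq h₂).hom.app A ≫ (P.res f₂).map (ψ i₂) ≫ (P.resCompEq h₂).inv.app B) :
    ∃! φ : A ⟶ B, ∀ i, (P.res (f i)).map φ = ψ i := by
  have := P.isEquivalence_toDescentData f hf
  let θ : (P.toDescentData f).obj A ⟶ (P.toDescentData f).obj B :=
    { hom := ψ
      comm := fun W q i₁ i₂ f₁ f₂ h₁ h₂ => by
        have h := H q i₁ i₂ f₁ f₂ h₁ h₂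
        rw [← cancel_epi ((P.resCompEq h₁).inv.app A), Iso.inv_hom_id_app_assoc,
          ← cancel_mono ((P.resCompEq h₂).hom.app B)] at h
        simp only [Category.assoc, Iso.inv_hom_id_app] at h
        refine Eq.trans h ?_
        refine (congrArg (_ ≫ ·) (congrArg (_ ≫ ·) (Category.comp_id _))).trans
          (Category.assoc _ _ _).symm }
  refine ⟨(P.toDescentData f).preimage θ, fun i => ?_, fun φ hφ => ?_⟩
  · exact congrFun (congrArg Pseudofunctor.DescentData.Hom.hom ((P.toDescentData f).map_preimage θ)) i
  · apply (P.toDescentData f).map_injective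
    rw [Functor.map_preimage]
    exact Pseudofunctor.DescentData.hom_ext hφ

lemma exists_obj [P.IsStack J] (hf : Sieve.ofArrows X f ∈ J U) (D : P.DescentData f) :
    ∃ (A : P.Fib U) (Φ : ∀ i, (P.res (f i)).obj A ⟶ D.obj i),
      ∀ {W : C} (q : W ⟶ U) (i₁ i₂ : ι) (f₁ : W ⟶ X i₁) (f₂ : W ⟶ X i₂) (h₁ : f₁ ≫ f i₁ = q)
        (h₂ : f₂ ≫ f i₂ = q),
        (P.resCompEq h₁).hom.app A ≫ (P.res f₁).map (Φ i₁) ≫ D.hom q f₁ f₂ h₁ h₂ =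
          (P.resCompEq h₂).hom.app A ≫ (P.res f₂).map (Φ i₂) := by
  have := P.isEquivalence_toDescentData f hf
  let e := (P.toDescentData f).objObjPreimageIso D
  refine ⟨(P.toDescentData f).objPreimage D, e.hom.hom, fun {W} q i₁ i₂ f₁ f₂ h₁ h₂ => ?_⟩
  refine Eq.trans (congrArg (_ ≫ ·) (e.hom.comm q f₁ f₂ h₁ h₂)) ?_
  refine Eq.trans ?_ (Iso.hom_inv_id_app_assoc (P.resCompEq h₁) _ _)
  exact congrArg (_ ≫ ·) (Category.assoc _ _ _)

end Prestack

end BiaddBfl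

namespace BiaddBfl

/-! ### Frames of the objects of a presented stack -/

lemma MonoidalPrestack.IsGroupLikeStack.isIso {C : Type u} [Category.{v} C]
    {J : GrothendieckTopology C} {Q : MonoidalPrestack.{v, u, v₁, u₁} C} (hQ : Q.IsGroupLikeStack J)
    {U : C} {X Y : Q.Fib U} (φ : X ⟶ Y) : IsIso φ :=
  (hQ.isGroupoid U).all_isIso φ

namespace MonoidalMorphism

open Functor.LaxMonoidal Functor.OplaxMonoidal CrossedModule

variable {C : Type u} [Category.{v} C] {J : GrothendieckTopology C}
  {M : CrossedModule.{v, u, w} J} {Q : MonoidalPrestack.{v, u, v₁, u₁} C}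
  (π : MonoidalMorphism M.prestack Q)

/-- The functor of points of a presentation over `V`. -/
def fn (V : C) : M.Pt V ⥤ Q.Fib V := π.functor V

instance (V : C) : (π.fn V).Monoidal := π.monoidal V

/-- The restriction isomorphisms of a presentation. -/
def fnRes {V W : C} (g : W ⟶ V) : π.fn V ⋙ Q.res g ≅ M.ptRes g ⋙ π.fn W := π.resIso g

instance {V W : C} (g : W ⟶ V) : NatTrans.IsMonoidal (π.fnRes g).hom := π.resIso_isMonoidal g

lemma fnRes_id {V : C} (y : M.Pt V) :
    (π.fnRes (𝟙 V)).hom.app y ≫ (π.fn V).map ((M.ptResId V).hom.app y) =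
      (Q.resId V).hom.app ((π.fn V).obj y) :=
  π.resIso_id (U := V) y

lemma fnRes_comp {U V W : C} (f : V ⟶ U) (g : W ⟶ V) (y : M.Pt U) :
    (π.fnRes (g ≫ f)).hom.app y ≫ (π.fn W).map ((M.ptResComp f g).hom.app y) =
      (Q.resComp f g).hom.app ((π.fn U).obj y) ≫ (Q.res g).map ((π.fnRes f).hom.app y) ≫
        (π.fnRes g).hom.app ((M.ptRes f).obj y) :=
  π.resIso_comp f g y

/-- A frame, over `f : V ⟶ U`, of an object `X` over `U`: an isomorphism of the restriction of `X`
to `V` with a point of the presentation. -/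
abbrev Frame {U V : C} (f : V ⟶ U) (X : Q.Fib U) (y : M.Pt V) :=
  (Q.res f).obj X ⟶ (π.fn V).obj y

variable {π}

/-- Restriction of frames. -/
def fres {U V W : C} {f : V ⟶ U} {g : W ⟶ V} {q : W ⟶ U} (h : g ≫ f = q) {X : Q.Fib U}
    {y : M.Pt V} (a : π.Frame f X y) : π.Frame q X ((M.ptRes g).obj y) :=
  (Q.toPrestack.resCompEq h).hom.app X ≫ (Q.res g).map a ≫ (π.fnRes g).hom.app y

variable {U V W Z : C} {f : V ⟶ U} {g : W ⟶ V} {q : W ⟶ U} (h : g ≫ f = q)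

lemma fres_sq {X X' : Q.Fib U} {y y' : M.Pt V} {φ : X ⟶ X'} {m : y ⟶ y'} {a : π.Frame f X y}
    {a' : π.Frame f X' y'} (s : Sq (Q.res f) (π.fn V) φ m a a') :
    Sq (Q.res q) (π.fn W) φ ((M.ptRes g).map m) (fres h a) (fres h a') := by
  have e₁ := (Q.toPrestack.resCompEq h).hom.naturality φ
  have e₂ := (π.fnRes g).hom.naturality m
  unfold Sq at *
  dsimp only [Functor.comp_map, fres] at *
  rw [reassoc_of% e₁, Category.assoc, Category.assoc, ← e₂, ← Functor.map_comp_assoc, s,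
    Functor.map_comp_assoc]

lemma fres_comp_map {X : Q.Fib U} {y y' : M.Pt V} (a : π.Frame f X y) (m : y ⟶ y') :
    fres h (a ≫ (π.fn V).map m) = fres h a ≫ (π.fn W).map ((M.ptRes g).map m) := by
  have e := fres_sq h (φ := 𝟙 X) (m := m) (a := a) (a' := a ≫ (π.fn V).map m) (by simp [Sq])
  simpa [Sq] using e

lemma fres_res_map_comp {X X' : Q.Fib U} {y : M.Pt V} (φ : X ⟶ X') (a : π.Frame f X' y) :
    fres h ((Q.res f).map φ ≫ a) = (Q.res q).map φ ≫ fres h a := by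
  have e := fres_sq h (φ := φ) (m := 𝟙 y) (a := (Q.res f).map φ ≫ a) (a' := a) (by simp [Sq])
  simpa [Sq] using e.symm

lemma fres_tens {X X' : Q.Fib U} {y y' : M.Pt V} (a : π.Frame f X y) (a' : π.Frame f X' y') :
    tens (fres h a) (fres h a') ≫ (π.fn W).map (μ (M.ptRes g) y y') = fres h (tens a a') := by
  subst h
  have e₁ := NatTrans.IsMonoidal.tensor (τ := (Q.resComp f g).hom) X X'
  have e₂ := NatTrans.IsMonoidal.tensor (τ := (π.fnRes g).hom) y y'
  simp only [Functor.LaxMonoidal.comp_μ, Functor.comp_obj] at e₁ e₂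
  rw [← cancel_epi (μ (Q.res (g ≫ f)) X X'), reassoc_of% μ_tens (fres rfl a) (fres rfl a')]
  unfold fres
  rw [Prestack.resCompEq_rfl, reassoc_of% e₁]
  have e₃ : (Q.res g).map (μ (Q.res f) X X') ≫ (Q.res g).map (tens a a') =
      (Q.res g).map (a ⊗ₘ a') ≫ (Q.res g).map (μ (π.fn V) y y') := by
    rw [← Functor.map_comp, μ_tens, Functor.map_comp]
  rw [reassoc_of% e₃, ← μ_natural_assoc, ← Category.assoc (μ (Q.res g) _ _), e₂]
  simp only [← tensorHom_comp_tensorHom, Category.assoc]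

lemma fres_unit : unitFrame (Q.res q) (π.fn W) ≫ (π.fn W).map (ε (M.ptRes g)) =
    fres h (unitFrame (Q.res f) (π.fn V)) := by
  subst h
  have e₁ := NatTrans.IsMonoidal.unit (τ := (Q.resComp f g).hom)
  have e₂ := NatTrans.IsMonoidal.unit (τ := (π.fnRes g).hom)
  simp only [Functor.LaxMonoidal.comp_ε, Functor.comp_obj] at e₁ e₂
  rw [← cancel_epi (ε (Q.res (g ≫ f))), reassoc_of% ε_unitFrame (L := Q.res (g ≫ f)) (R := π.fn W)]
  unfold fres
  rw [Prestack.resCompEq_rfl, reassoc_of% e₁]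
  rw [← Functor.map_comp_assoc, ε_unitFrame, ← e₂, Category.assoc]

lemma fres_fres {k : Z ⟶ W} {q' : Z ⟶ U} (h' : k ≫ q = q') (h'' : (k ≫ g) ≫ f = q') {X : Q.Fib U}
    {y : M.Pt V} (a : π.Frame f X y) :
    fres h'' a ≫ (π.fn Z).map ((M.ptResComp g k).hom.app y) = fres h' (fres h a) := by
  have e₁ := Q.toPrestack.resCompEq_assoc h rfl h' h'' X
  have e₂ := (Q.resComp g k).hom.naturality a
  unfold fres
  rw [Category.assoc, Category.assoc, fnRes_comp, Functor.map_comp, Functor.map_comp,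
    Category.assoc, Category.assoc, reassoc_of% e₁, Prestack.resCompEq_rfl]
  erw [reassoc_of% e₂]

lemma fres_id (h : 𝟙 V ≫ f = f) {X : Q.Fib U} {y : M.Pt V} (a : π.Frame f X y) :
    fres h a ≫ (π.fn V).map ((M.ptResId V).hom.app y) = a := by
  have e₁ := Q.toPrestack.resCompEq_id_right f h X
  have e₂ := (Q.resId V).hom.naturality a
  unfold fres
  rw [Category.assoc, Category.assoc, fnRes_id]
  erw [e₂]
  rw [reassoc_of% e₁]
  rfl

variable (π) in
/-- The tautological frame of a point of the presentation. -/
def ptFrame (g : W ⟶ V) (y : M.Pt V) : π.Frame g ((π.fn V).obj y) ((M.ptRes g).obj y) :=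
  (π.fnRes g).hom.app y

lemma fres_ptFrame {k : Z ⟶ W} (y : M.Pt V) :
    fres rfl (π.ptFrame g y) =
      π.ptFrame (k ≫ g) y ≫ (π.fn Z).map ((M.ptResComp g k).hom.app y) := by
  unfold ptFrame
  rw [fnRes_comp]
  unfold fres
  rw [Prestack.resCompEq_rfl]

end MonoidalMorphism

end BiaddBfl

namespace BiaddBfl

namespace MonoidalMorphism

open CrossedModule

variable {C : Type u} [Category.{v} C] {J : GrothendieckTopology C}
  {M : CrossedModule.{v, u, w} J} {Q : MonoidalPrestack.{v, u, v₁, u₁} C}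
  {π : MonoidalMorphism M.prestack Q}

section

variable (hπ : π.IsLocalEquivalence J)
include hπ

lemma fn_full (V : C) : (π.fn V).Full := hπ.full V

lemma fn_faithful (V : C) : (π.fn V).Faithful := hπ.faithful V

lemma exists_frame {U : C} (X : Q.Fib U) :
    ∃ R ∈ J U, ∀ {V : C} (f : V ⟶ U), R.arrows f → ∃ y : M.Pt V, Nonempty (π.Frame f X y) := by
  obtain ⟨R, hR, H⟩ := hπ.locally_surjective X
  refine ⟨R, hR, fun f hf => ?_⟩
  obtain ⟨y, ⟨i⟩⟩ := H f hf
  exact ⟨y, ⟨i.inv⟩⟩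

variable (hQ : Q.IsGroupLikeStack J)
include hQ

lemma exists_transition {U V : C} {f : V ⟶ U} {X : Q.Fib U} {y y' : M.Pt V} (a : π.Frame f X y)
    (a' : π.Frame f X y') : ∃ m : y ⟶ y', a ≫ (π.fn V).map m = a' := by
  have := fn_full hπ V
  have := hQ.isIso a
  exact ⟨(π.fn V).preimage (CategoryTheory.inv a ≫ a'), by simp⟩

lemma frame_map_injective {U V : C} {f : V ⟶ U} {X : Q.Fib U} {y y' : M.Pt V} (a : π.Frame f X y)
    {m m' : y ⟶ y'} (h : a ≫ (π.fn V).map m = a ≫ (π.fn V).map m') : m = m' := by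
  have := fn_faithful hπ V
  have := hQ.isIso a
  exact (π.fn V).map_injective ((cancel_epi a).1 h)

lemma exists_sq {U V : C} {f : V ⟶ U} {X X' : Q.Fib U} {y y' : M.Pt V} (φ : X ⟶ X')
    (a : π.Frame f X y) (a' : π.Frame f X' y') :
    ∃ m : y ⟶ y', Sq (Q.res f) (π.fn V) φ m a a' := by
  obtain ⟨m, hm⟩ := exists_transition hπ hQ a ((Q.res f).map φ ≫ a')
  exact ⟨m, hm.symm⟩

end

section

variable (hQ : Q.IsGroupLikeStack J)
include hQ

lemma _root_.BiaddBfl.MonoidalPrestack.IsGroupLikeStack.hom_ext {U : C} {A B : Q.Fib U}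
    {φ ψ : A ⟶ B} {R : Sieve U} (hR : R ∈ J U)
    (H : ∀ {V : C} (f : V ⟶ U), R.arrows f → (Q.res f).map φ = (Q.res f).map ψ) : φ = ψ := by
  have := hQ.isStack
  have hR' : Sieve.ofArrows (fun i : R.arrows.category => i.obj.left) (fun i => i.obj.hom) ∈ J U := by
    refine J.superset_covering (fun V f hf => ?_) hR
    exact ⟨V, 𝟙 V, f, ⟨(⟨Over.mk f, hf⟩ : R.arrows.category)⟩, by simp⟩
  refine (Prestack.existsUnique_hom (P := Q.toPrestack) hR'
    (fun i => (Q.res i.obj.hom).map ψ) ?_).unique (fun i => H _ i.property) (fun i => rfl)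
  intro W q i₁ i₂ f₁ f₂ h₁ h₂
  have e₁ := (Q.toPrestack.resCompEq h₁).hom.naturality ψ
  have e₂ := (Q.toPrestack.resCompEq h₂).hom.naturality ψ
  dsimp only [Functor.comp_map] at e₁ e₂
  rw [← reassoc_of% e₁, ← reassoc_of% e₂]
  simp

lemma hom_ext_of_sq {U : C} {A B : Q.Fib U} {φ ψ : A ⟶ B} {R : Sieve U} (hR : R ∈ J U)
    (H : ∀ {V : C} (f : V ⟶ U), R.arrows f → ∃ (y y' : M.Pt V) (a : π.Frame f A y)
      (b : π.Frame f B y') (m : y ⟶ y'), Sq (Q.res f) (π.fn V) φ m a b ∧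
        Sq (Q.res f) (π.fn V) ψ m a b) : φ = ψ := by
  refine hQ.hom_ext hR fun {V} f hf => ?_
  obtain ⟨y, y', a, b, m, h₁, h₂⟩ := H f hf
  have := hQ.isIso b
  rw [← cancel_mono b]
  exact h₁.trans h₂.symm

/-- Morphisms are constructed locally on frames. -/
lemma existsUnique_of_frames {U : C} {A B : Q.Fib U} (T : ∀ {V : C}, (V ⟶ U) → Type*)
    (x : ∀ {V : C} {f : V ⟶ U}, T f → M.Pt V)
    (Φ : ∀ {V : C} {f : V ⟶ U} (τ : T f), π.Frame f A (x τ))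
    (Ψ : ∀ {V : C} {f : V ⟶ U} (τ : T f), π.Frame f B (x τ))
    (trans : ∀ {V : C} {f : V ⟶ U} (τ τ' : T f), ∃ m : x τ ⟶ x τ',
      Φ τ ≫ (π.fn V).map m = Φ τ' ∧ Ψ τ ≫ (π.fn V).map m = Ψ τ')
    (restr : ∀ {V W : C} {f : V ⟶ U} (τ : T f) (g : W ⟶ V) (q : W ⟶ U) (h : g ≫ f = q),
      ∃ (τ' : T q) (m : x τ' ⟶ (M.ptRes g).obj (x τ)),
        Φ τ' ≫ (π.fn W).map m = fres h (Φ τ) ∧ Ψ τ' ≫ (π.fn W).map m = fres h (Ψ τ))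
    (loc : ∃ R ∈ J U, ∀ {V : C} (f : V ⟶ U), R.arrows f → Nonempty (T f)) :
    ∃! φ : A ⟶ B, ∀ {V : C} {f : V ⟶ U} (τ : T f), (Q.res f).map φ ≫ Ψ τ = Φ τ := by
  have := hQ.isStack
  have iso {V : C} {f : V ⟶ U} (τ : T f) : IsIso (Ψ τ) := hQ.isIso _
  obtain ⟨R, hR, loc⟩ := loc
  let ι := Σ (V : C) (f : V ⟶ U), T f
  have hf : Sieve.ofArrows (fun i : ι => i.1) (fun i => i.2.1) ∈ J U := by
    refine J.superset_covering (fun V f hf => ?_) hR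
    exact ⟨V, 𝟙 V, f, ⟨(⟨V, f, (loc f hf).some⟩ : ι)⟩, by simp⟩
  obtain ⟨φ, hφ, hφ'⟩ := Prestack.existsUnique_hom (P := Q.toPrestack) hf
    (fun i => Φ i.2.2 ≫ CategoryTheory.inv (Ψ i.2.2)) (by
      have key {V W : C} {f : V ⟶ U} (τ : T f) (g : W ⟶ V) (q : W ⟶ U) (h : g ≫ f = q) (τ' : T q) :
          (Q.toPrestack.resCompEq h).hom.app A ≫ (Q.res g).map (Φ τ ≫ CategoryTheory.inv (Ψ τ)) ≫
            (Q.toPrestack.resCompEq h).inv.app B = Φ τ' ≫ CategoryTheory.inv (Ψ τ') := by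
        obtain ⟨τ₁, m₁, e₁, e₁'⟩ := restr τ g q h
        obtain ⟨m₂, e₂, e₂'⟩ := trans τ₁ τ'
        have : IsIso ((π.fn W).map m₁) := hQ.isIso _
        have e₃ : (Q.toPrestack.resCompEq h).hom.app A ≫
            (Q.res g).map (Φ τ ≫ CategoryTheory.inv (Ψ τ)) ≫
            (Q.toPrestack.resCompEq h).inv.app B ≫ Ψ τ₁ ≫ (π.fn W).map m₁ =
            Φ τ₁ ≫ (π.fn W).map m₁ := by
          rw [e₁, e₁']
          unfold fres
          rw [Iso.inv_hom_id_app_assoc, ← Functor.map_comp_assoc, Category.assoc,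
            IsIso.inv_hom_id, Category.comp_id]
        rw [← cancel_mono (Ψ τ'), Category.assoc, Category.assoc, Category.assoc,
          IsIso.inv_hom_id, Category.comp_id, ← e₂, ← e₂']
        rw [← Category.assoc _ (Ψ τ₁), ← Category.assoc _ (_ ≫ Ψ τ₁),
          ← Category.assoc _ (_ ≫ _ ≫ Ψ τ₁)]
        congr 1
        rw [← cancel_mono ((π.fn W).map m₁), ← e₃]
        simp only [Category.assoc]
      intro W q i₁ i₂ f₁ f₂ h₁ h₂
      obtain ⟨τ', -⟩ := restr i₁.2.2 f₁ q h₁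
      exact (key i₁.2.2 f₁ q h₁ τ').trans (key i₂.2.2 f₂ q h₂ τ').symm)
  refine ⟨φ, fun {V f} τ => ?_, fun φ' h' => hφ' φ' fun i => ?_⟩
  · rw [hφ ⟨V, f, τ⟩]
    simp
  · rw [← h' i.2.2]
    simp

/-- Objects are constructed by gluing points of the presentation along a cocycle. -/
lemma exists_obj_of_cocycle {ι : Type*} {U : C} {X : ι → C} {f : ∀ i, X i ⟶ U}
    (hf : Sieve.ofArrows X f ∈ J U) (x : ∀ i, M.Pt (X i))
    (t : ∀ {W : C} (q : W ⟶ U) (i₁ i₂ : ι) (f₁ : W ⟶ X i₁) (f₂ : W ⟶ X i₂) (_ : f₁ ≫ f i₁ = q)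
      (_ : f₂ ≫ f i₂ = q), (M.ptRes f₁).obj (x i₁) ⟶ (M.ptRes f₂).obj (x i₂))
    (self : ∀ {W : C} (q : W ⟶ U) (i : ι) (g : W ⟶ X i) (h : g ≫ f i = q),
      t q i i g g h h = 𝟙 _)
    (comp : ∀ {W : C} (q : W ⟶ U) (i₁ i₂ i₃ : ι) (f₁ : W ⟶ X i₁) (f₂ : W ⟶ X i₂) (f₃ : W ⟶ X i₃)
      (h₁ : f₁ ≫ f i₁ = q) (h₂ : f₂ ≫ f i₂ = q) (h₃ : f₃ ≫ f i₃ = q),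
      t q i₁ i₂ f₁ f₂ h₁ h₂ ≫ t q i₂ i₃ f₂ f₃ h₂ h₃ = t q i₁ i₃ f₁ f₃ h₁ h₃)
    (res : ∀ {W W' : C} (g : W' ⟶ W) (q : W ⟶ U) (q' : W' ⟶ U) (_ : g ≫ q = q') (i₁ i₂ : ι)
      (f₁ : W ⟶ X i₁) (f₂ : W ⟶ X i₂) (h₁ : f₁ ≫ f i₁ = q) (h₂ : f₂ ≫ f i₂ = q)
      (h₁' : (g ≫ f₁) ≫ f i₁ = q') (h₂' : (g ≫ f₂) ≫ f i₂ = q'),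
      (t q' i₁ i₂ (g ≫ f₁) (g ≫ f₂) h₁' h₂').elt = M.G₁.map g.op (t q i₁ i₂ f₁ f₂ h₁ h₂).elt) :
    ∃ (A : Q.Fib U) (Φ : ∀ i, π.Frame (f i) A (x i)),
      ∀ {W : C} (q : W ⟶ U) (i₁ i₂ : ι) (f₁ : W ⟶ X i₁) (f₂ : W ⟶ X i₂) (h₁ : f₁ ≫ f i₁ = q)
        (h₂ : f₂ ≫ f i₂ = q),
        fres h₁ (Φ i₁) ≫ (π.fn W).map (t q i₁ i₂ f₁ f₂ h₁ h₂) = fres h₂ (Φ i₂) := by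
  have := hQ.isStack
  let D : Q.toPrestack.DescentData f :=
    { obj := fun i => (π.fn (X i)).obj (x i)
      hom := fun W q i₁ i₂ f₁ f₂ h₁ h₂ => (π.fnRes f₁).hom.app (x i₁) ≫
        (π.fn W).map (t q i₁ i₂ f₁ f₂ h₁ h₂) ≫ (π.fnRes f₂).inv.app (x i₂)
      hom_self := fun W q i g hg => by
        rw [self, CategoryTheory.Functor.map_id]
        erw [Category.id_comp]
        exact Iso.hom_inv_id_app (π.fnRes g) (x i)
      hom_comp := fun W q i₁ i₂ i₃ f₁ f₂ f₃ h₁ h₂ h₃ => by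
        rw [← comp q i₁ i₂ i₃ f₁ f₂ f₃ h₁ h₂ h₃, Functor.map_comp]
        simp
      pullHom_hom := fun W' W g q q' hq i₁ i₂ f₁ f₂ h₁ h₂ gf₁ gf₂ hg₁ hg₂ => by
        subst hg₁ hg₂
        have e₁ := fres_ptFrame (π := π) (g := f₁) (k := g) (x i₁)
        have e₂ := fres_ptFrame (π := π) (g := f₂) (k := g) (x i₂)
        have h₁' : (g ≫ f₁) ≫ f i₁ = q' := by rw [Category.assoc, h₁, hq]
        have h₂' : (g ≫ f₂) ≫ f i₂ = q' := by rw [Category.assoc, h₂, hq]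
        have e₃ : (M.ptResComp f₁ g).hom.app (x i₁) ≫ (M.ptRes g).map (t q i₁ i₂ f₁ f₂ h₁ h₂) =
            t q' i₁ i₂ (g ≫ f₁) (g ≫ f₂) h₁' h₂' ≫ (M.ptResComp f₂ g).hom.app (x i₂) := by
          ext
          rw [Pt.comp_elt, Pt.comp_elt, ptRes_map_elt, res g q q' hq i₁ i₂ f₁ f₂ h₁ h₂ h₁' h₂']
          simp
        have e₄ := (π.fnRes g).hom.naturality (t q i₁ i₂ f₁ f₂ h₁ h₂)
        have : IsIso (fres rfl (π.ptFrame f₂ (x i₂)) : π.Frame (g ≫ f₂) _ _) := hQ.isIso _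
        change (Q.toPrestack.resCompEq rfl).hom.app _ ≫ (Q.res g).map _ ≫
          (Q.toPrestack.resCompEq rfl).inv.app _ = _
        rw [← cancel_mono (fres rfl (π.ptFrame f₂ (x i₂)) : π.Frame (g ≫ f₂) _ _)]
        trans (fres rfl (π.ptFrame f₁ (x i₁)) : π.Frame (g ≫ f₁) _ _) ≫
          (π.fn W').map ((M.ptRes g).map (t q i₁ i₂ f₁ f₂ h₁ h₂))
        · unfold fres ptFrame
          dsimp only [Functor.comp_map] at e₄
          simp only [Category.assoc, Iso.inv_hom_id_app_assoc, ← e₄]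
          rw [← Functor.map_comp_assoc, ← Functor.map_comp_assoc]
          simp only [Category.assoc, Iso.inv_hom_id_app]
          erw [Category.comp_id]
        · rw [e₁, e₂, Category.assoc, ← Functor.map_comp, e₃, Functor.map_comp]
          unfold ptFrame
          simp only [Category.assoc, Iso.inv_hom_id_app_assoc] }
  obtain ⟨A, Φ, H⟩ := Prestack.exists_obj (P := Q.toPrestack) hf D
  refine ⟨A, Φ, fun {W} q i₁ i₂ f₁ f₂ h₁ h₂ => ?_⟩
  have h := H q i₁ i₂ f₁ f₂ h₁ h₂
  dsimp only [D] at h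
  unfold fres
  rw [Category.assoc, Category.assoc]
  have h' := congrArg (· ≫ (π.fnRes f₂).hom.app (x i₂)) h
  simp only [Category.assoc, Iso.inv_hom_id_app] at h'
  refine Eq.trans ?_ h'
  refine congrArg (_ ≫ ·) (congrArg (_ ≫ ·) (congrArg (_ ≫ ·) ?_))
  exact (Category.comp_id _).symm

end

end MonoidalMorphism

end BiaddBfl

namespace BiaddBfl

/-! ### The calculus of points of a butterfly -/

lemma BraidedCrossedModule.br_one {C : Type u} [Category.{v} C] {J : GrothendieckTopology C}
    (G : BraidedCrossedModule.{v, u, w} J) {U : C} (x : G.G₀.obj (op U)) : G.br x 1 = 1 := by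
  have h := G.br_d x 1
  rwa [map_one, inv_one, one_mul, G.one_act] at h

lemma BraidedCrossedModule.one_br {C : Type u} [Category.{v} C] {J : GrothendieckTopology C}
    (G : BraidedCrossedModule.{v, u, w} J) {U : C} (x : G.G₀.obj (op U)) : G.br 1 x = 1 := by
  have h := G.d_br' 1 x
  rwa [map_one, mul_one, G.one_act, inv_one] at h

namespace Butterfly

open Functor.LaxMonoidal CrossedModule

variable {C : Type u} [Category.{v} C] {J : GrothendieckTopology C} {S : Sheaf J (Type w)}
  {H K : CrossedModule.{v, u, w} J} {G : BraidedCrossedModule.{v, u, w} J}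
  (E : Butterfly S H K G)

/-- The points of the butterfly over given sections of `S`, `H₀`, `K₀` and `G₀`. -/
@[ext]
structure Over {V : C} (s : S.obj.obj (op V)) (y : H.Pt V) (z : K.Pt V) (x : G.Pt V) where
  val : E.Sec V
  base_eq : E.base val = s
  fst_eq : E.fst val = y.pt
  snd_eq : E.snd val = z.pt
  sec_eq : E.sec val = x.pt

namespace Over

variable {E} {V : C} {s : S.obj.obj (op V)} {y y' y'' : H.Pt V} {z z' z'' : K.Pt V}
  {x x' x'' : G.Pt V}

lemma comp₁ (e : E.Over s y z x) (e' : E.Over s y' z x') : E.Comp₁ e.val e'.val :=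
  ⟨by rw [e.base_eq, e'.base_eq], by rw [e.snd_eq, e'.snd_eq]⟩

lemma comp₂ (e : E.Over s y z x) (e' : E.Over s y z' x') : E.Comp₂ e.val e'.val :=
  ⟨by rw [e.base_eq, e'.base_eq], by rw [e.fst_eq, e'.fst_eq]⟩

/-- The action of a morphism of `G`. -/
def act (e : E.Over s y z x) (m : x ⟶ x') : E.Over s y z x' where
  val := E.act e.val m.elt
  base_eq := by rw [E.base_act, e.base_eq]
  fst_eq := by rw [E.fst_act, e.fst_eq]
  snd_eq := by rw [E.snd_act, e.snd_eq]
  sec_eq := by rw [E.sec_act, e.sec_eq, m.eq]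

@[simp] lemma act_id (e : E.Over s y z x) : e.act (𝟙 x) = e := Over.ext (E.act_one _)

lemma act_comp (e : E.Over s y z x) (m : x ⟶ x') (m' : x' ⟶ x'') :
    e.act (m ≫ m') = (e.act m).act m' := Over.ext (E.act_mul _ _ _)

lemma existsUnique_act (e : E.Over s y z x) (e' : E.Over s y z x') :
    ∃! m : x ⟶ x', e.act m = e' := by
  obtain ⟨g, hg, hg'⟩ := E.simply_transitive e.val e'.val (by rw [e.base_eq, e'.base_eq])
    (by rw [e.fst_eq, e'.fst_eq]) (by rw [e.snd_eq, e'.snd_eq])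
  refine ⟨⟨g, ?_⟩, Over.ext hg, fun m hm => Pt.hom_ext (hg' _ (congrArg Over.val hm))⟩
  rw [← e'.sec_eq, ← hg, E.sec_act, e.sec_eq]

lemma act_injective (e : E.Over s y z x) {m m' : x ⟶ x'} (h : e.act m = e.act m') : m = m' :=
  (e.existsUnique_act (e.act m')).unique h rfl

/-- Points are determined by their underlying sections, and transported along equalities. -/
def copy (e : E.Over s y z x) {y₁ : H.Pt V} {z₁ : K.Pt V} {x₁ : G.Pt V} (hy : y.pt = y₁.pt)
    (hz : z.pt = z₁.pt) (hx : x.pt = x₁.pt) : E.Over s y₁ z₁ x₁ :=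
  ⟨e.val, e.base_eq, e.fst_eq.trans hy, e.snd_eq.trans hz, e.sec_eq.trans hx⟩

/-- Restriction of points. -/
def res (e : E.Over s y z x) {W : C} (f : W ⟶ V) {t : S.obj.obj (op W)}
    (ht : S.obj.map f.op s = t) :
    E.Over t ((H.ptRes f).obj y) ((K.ptRes f).obj z) ((G.ptRes f).obj x) where
  val := E.res f e.val
  base_eq := by rw [E.base_res, e.base_eq, ht]
  fst_eq := by rw [E.fst_res, e.fst_eq]; rfl
  snd_eq := by rw [E.snd_res, e.snd_eq]; rfl
  sec_eq := by rw [E.sec_res, e.sec_eq]; rfl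

lemma act_res (e : E.Over s y z x) (m : x ⟶ x') {W : C} (f : W ⟶ V) {t : S.obj.obj (op W)}
    (ht : S.obj.map f.op s = t) : (e.act m).res f ht = (e.res f ht).act ((G.ptRes f).map m) :=
  Over.ext (E.act_res f _ _).symm

/-- The first partial product. -/
def mul₁ (e : E.Over s y z x) (e' : E.Over s y' z x') : E.Over s (y ⊗ y') z (x ⊗ x') where
  val := E.mul₁ e.val e'.val (e.comp₁ e')
  base_eq := by rw [E.base_mul₁, e.base_eq]
  fst_eq := by rw [E.fst_mul₁, e.fst_eq, e'.fst_eq]; rfl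
  snd_eq := by rw [E.snd_mul₁, e.snd_eq]
  sec_eq := by rw [E.sec_mul₁, e.sec_eq, e'.sec_eq]; rfl

lemma mul₁_val_congr {e₁ : E.Over s y z x} {e₁' : E.Over s y' z x'} {y₂ y₂' : H.Pt V} {z₂ : K.Pt V}
    {x₂ x₂' : G.Pt V} {e₂ : E.Over s y₂ z₂ x₂} {e₂' : E.Over s y₂' z₂ x₂'} (h : e₁.val = e₂.val)
    (h' : e₁'.val = e₂'.val) : (e₁.mul₁ e₁').val = (e₂.mul₁ e₂').val := by
  unfold mul₁
  simp only [h, h']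

lemma mul₁_assoc_val (e : E.Over s y z x) (e' : E.Over s y' z x') (e'' : E.Over s y'' z x'') :
    ((e.mul₁ e').mul₁ e'').val = (e.mul₁ (e'.mul₁ e'')).val :=
  E.mul₁_assoc _ _ _ _ _ _ _

lemma mul₁_act {x₁ x₁' : G.Pt V} (e : E.Over s y z x) (m : x ⟶ x₁) (e' : E.Over s y' z x')
    (m' : x' ⟶ x₁') : (e.act m).mul₁ (e'.act m') = (e.mul₁ e').act (m ⊗ₘ m') := by
  refine Over.ext ?_
  have h := E.mul₁_act (E.act e.val m.elt) e'.val m'.elt ((e.act m).comp₁ e')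
    ((e.act m).comp₁ (e'.act m'))
  refine h.trans ?_
  rw [E.act_mul₁ e.val e'.val m.elt (e.comp₁ e') ((e.act m).comp₁ e'), ← E.act_mul, e'.sec_eq]
  rfl

lemma mul₁_res_val (e : E.Over s y z x) (e' : E.Over s y' z x') {W : C} (f : W ⟶ V)
    {t : S.obj.obj (op W)} (ht : S.obj.map f.op s = t) :
    ((e.res f ht).mul₁ (e'.res f ht)).val = ((e.mul₁ e').res f ht).val :=
  E.mul₁_res f _ _ _ _

/-- The points of the first trivialization. -/
def triv₁ (E : Butterfly S H K G) (s : S.obj.obj (op V)) (h : H.G₁.obj (op V)) (z : K.Pt V) :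
    E.Over s ⟨H.d h⟩ z (𝟙_ (G.Pt V)) :=
  ⟨E.s₁ s h z.pt, E.base_s₁ _ _ _, E.fst_s₁ _ _ _, E.snd_s₁ _ _ _, E.sec_s₁ _ _ _⟩

/-- The action of a morphism of `H`. -/
def move₁ (e : E.Over s y z x) (h : y ⟶ y') : E.Over s y' z x :=
  (e.mul₁ (triv₁ E s h.elt z)).copy h.eq.symm rfl (mul_one _)

lemma move₁_act (e : E.Over s y z x) (h : y ⟶ y') (m : x ⟶ x') :
    (e.act m).move₁ h = (e.move₁ h).act m := by
  refine Over.ext ?_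
  have := congrArg Over.val (mul₁_act e m (triv₁ E s h.elt z) (𝟙 _))
  rw [act_id] at this
  refine this.trans ?_
  change E.act _ (G.act m.elt 1 * 1) = E.act _ m.elt
  rw [mul_one, G.act_one]
  rfl

lemma move₁_comp (e : E.Over s y z x) (h : y ⟶ y') (h' : y' ⟶ y'') :
    e.move₁ (h ≫ h') = (e.move₁ h).move₁ h' := by
  refine Over.ext ?_
  have := mul₁_assoc_val e (triv₁ E s h.elt z) (triv₁ E s h'.elt z)
  refine Eq.trans ?_ (this.symm.trans ?_)
  · refine mul₁_val_congr rfl ?_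
    exact (E.s₁_mul₁ s h.elt h'.elt z.pt ((triv₁ E s h.elt z).comp₁ (triv₁ E s h'.elt z))).symm
  · exact mul₁_val_congr rfl rfl

lemma move₁_id (e : E.Over s y z x) : e.move₁ (𝟙 y) = e := by
  obtain ⟨m, hm, -⟩ := e.existsUnique_act (e.move₁ (𝟙 y))
  have h₁ : (e.move₁ (𝟙 y)).move₁ (𝟙 y) = e.move₁ (𝟙 y) := by
    rw [← move₁_comp, Category.comp_id]
  rw [← hm, move₁_act, ← hm, ← act_comp] at h₁
  have h₂ := e.act_injective h₁
  have h₃ : m = 𝟙 x := by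
    refine Pt.hom_ext ?_
    have h₄ := congrArg Pt.Hom.elt h₂
    rw [Pt.comp_elt] at h₄
    exact mul_eq_left.mp h₄
  rw [← hm, h₃, act_id]

lemma triv₁_mul₁_val (e : E.Over s y z x) (h : H.G₁.obj (op V)) :
    ((triv₁ E s h z).mul₁ e).val = (e.mul₁ (triv₁ E s (H.act h y.pt) z)).val := by
  have c₁ : E.Comp₁ (E.s₁ (E.base e.val) h (E.snd e.val)) e.val := ⟨E.base_s₁ _ _ _, E.snd_s₁ _ _ _⟩
  have c₂ : E.Comp₁ e.val (E.s₁ (E.base e.val) (H.act h (E.fst e.val)) (E.snd e.val)) :=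
    ⟨(E.base_s₁ _ _ _).symm, (E.snd_s₁ _ _ _).symm⟩
  have := E.compatibility₁ h e.val c₁ c₂
  unfold mul₁ triv₁
  simpa only [e.base_eq, e.fst_eq, e.snd_eq] using this

lemma mul₁_move₁ {y₁ y₁' : H.Pt V} (e : E.Over s y z x) (h : y ⟶ y₁) (e' : E.Over s y' z x')
    (h' : y' ⟶ y₁') : (e.move₁ h).mul₁ (e'.move₁ h') = (e.mul₁ e').move₁ (h ⊗ₘ h') := by
  refine Over.ext ?_
  let t := triv₁ E s h.elt z
  let t' := triv₁ E s h'.elt z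
  let t₁ := triv₁ E s (H.act h.elt y'.pt) z
  calc ((e.move₁ h).mul₁ (e'.move₁ h')).val = ((e.mul₁ t).mul₁ (e'.mul₁ t')).val :=
        mul₁_val_congr rfl rfl
    _ = (e.mul₁ (t.mul₁ (e'.mul₁ t'))).val := mul₁_assoc_val _ _ _
    _ = (e.mul₁ ((t.mul₁ e').mul₁ t')).val := mul₁_val_congr rfl (mul₁_assoc_val _ _ _).symm
    _ = (e.mul₁ ((e'.mul₁ t₁).mul₁ t')).val :=
        mul₁_val_congr rfl (mul₁_val_congr (triv₁_mul₁_val e' h.elt) rfl)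
    _ = (e.mul₁ (e'.mul₁ (t₁.mul₁ t'))).val := mul₁_val_congr rfl (mul₁_assoc_val _ _ _)
    _ = ((e.mul₁ e').mul₁ (t₁.mul₁ t')).val := (mul₁_assoc_val _ _ _).symm
    _ = ((e.mul₁ e').move₁ (h ⊗ₘ h')).val := mul₁_val_congr rfl
        (e₂' := triv₁ E s (H.act h.elt y'.pt * h'.elt) z) (E.s₁_mul₁ _ _ _ _ (t₁.comp₁ t'))

lemma move₁_res (e : E.Over s y z x) (h : y ⟶ y') {W : C} (f : W ⟶ V)
    {t : S.obj.obj (op W)} (ht : S.obj.map f.op s = t) :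
    (e.move₁ h).res f ht = (e.res f ht).move₁ ((H.ptRes f).map h) := by
  refine Over.ext ((mul₁_res_val e (triv₁ E s h.elt z) f ht).symm.trans ?_)
  refine mul₁_val_congr rfl ?_
  subst ht
  exact (E.s₁_res f s h.elt z.pt).symm

variable (E s z) in
/-- The neutral point for the first product. -/
def one₁ : E.Over s (𝟙_ (H.Pt V)) z (𝟙_ (G.Pt V)) :=
  (triv₁ E s 1 z).copy (map_one H.d) rfl rfl

lemma mul₁_one₁_val (e : E.Over s y z x) : (e.mul₁ (one₁ E s z)).val = e.val :=
  (mul₁_val_congr rfl rfl).trans (congrArg Over.val e.move₁_id)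

lemma one₁_mul₁_val (e : E.Over s y z x) : ((one₁ E s z).mul₁ e).val = e.val := by
  refine ((mul₁_val_congr rfl rfl).trans (triv₁_mul₁_val e 1)).trans ?_
  refine Eq.trans (mul₁_val_congr rfl ?_) (congrArg Over.val e.move₁_id)
  rw [H.one_act]
  rfl

lemma triv₁_eq_move₁ (h : H.G₁.obj (op V)) :
    triv₁ E s h z = (one₁ E s z).move₁ ⟨h, (one_mul _).symm⟩ := by
  refine Over.ext ?_
  exact (one₁_mul₁_val (triv₁ E s h z)).symm

lemma one₁_res {W : C} (f : W ⟶ V) {t : S.obj.obj (op W)} (ht : S.obj.map f.op s = t) :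
    ((one₁ E s z).res f ht).val = (one₁ E t ((K.ptRes f).obj z)).val := by
  subst ht
  refine (E.s₁_res f s 1 z.pt).symm.trans ?_
  rw [map_one]
  rfl

/-- The second partial product. -/
def mul₂ (e : E.Over s y z x) (e' : E.Over s y z' x') : E.Over s y (z ⊗ z') (x ⊗ x') where
  val := E.mul₂ e.val e'.val (e.comp₂ e')
  base_eq := by rw [E.base_mul₂, e.base_eq]
  snd_eq := by rw [E.snd_mul₂, e.snd_eq, e'.snd_eq]; rfl
  fst_eq := by rw [E.fst_mul₂, e.fst_eq]
  sec_eq := by rw [E.sec_mul₂, e.sec_eq, e'.sec_eq]; rfl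

lemma mul₂_val_congr {e₁ : E.Over s y z x} {e₁' : E.Over s y z' x'} {z₂ z₂' : K.Pt V} {y₂ : H.Pt V}
    {x₂ x₂' : G.Pt V} {e₂ : E.Over s y₂ z₂ x₂} {e₂' : E.Over s y₂ z₂' x₂'} (k : e₁.val = e₂.val)
    (k' : e₁'.val = e₂'.val) : (e₁.mul₂ e₁').val = (e₂.mul₂ e₂').val := by
  unfold mul₂
  simp only [k, k']

lemma mul₂_assoc_val (e : E.Over s y z x) (e' : E.Over s y z' x') (e'' : E.Over s y z'' x'') :
    ((e.mul₂ e').mul₂ e'').val = (e.mul₂ (e'.mul₂ e'')).val :=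
  E.mul₂_assoc _ _ _ _ _ _ _

lemma mul₂_act {x₁ x₁' : G.Pt V} (e : E.Over s y z x) (m : x ⟶ x₁) (e' : E.Over s y z' x')
    (m' : x' ⟶ x₁') : (e.act m).mul₂ (e'.act m') = (e.mul₂ e').act (m ⊗ₘ m') := by
  refine Over.ext ?_
  have k := E.mul₂_act (E.act e.val m.elt) e'.val m'.elt ((e.act m).comp₂ e')
    ((e.act m).comp₂ (e'.act m'))
  refine k.trans ?_
  rw [E.act_mul₂ e.val e'.val m.elt (e.comp₂ e') ((e.act m).comp₂ e'), ← E.act_mul, e'.sec_eq]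
  rfl

lemma mul₂_res_val (e : E.Over s y z x) (e' : E.Over s y z' x') {W : C} (f : W ⟶ V)
    {t : S.obj.obj (op W)} (ht : S.obj.map f.op s = t) :
    ((e.res f ht).mul₂ (e'.res f ht)).val = ((e.mul₂ e').res f ht).val :=
  E.mul₂_res f _ _ _ _

/-- The points of the second trivialization. -/
def triv₂ (E : Butterfly S H K G) (s : S.obj.obj (op V)) (y : H.Pt V) (k : K.G₁.obj (op V)) :
    E.Over s y ⟨K.d k⟩ (𝟙_ (G.Pt V)) :=
  ⟨E.s₂ s y.pt k, E.base_s₂ _ _ _, E.fst_s₂ _ _ _, E.snd_s₂ _ _ _, E.sec_s₂ _ _ _⟩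

/-- The action of a morphism of `K`. -/
def move₂ (e : E.Over s y z x) (k : z ⟶ z') : E.Over s y z' x :=
  (e.mul₂ (triv₂ E s y k.elt)).copy rfl k.eq.symm (mul_one _)

lemma move₂_act (e : E.Over s y z x) (k : z ⟶ z') (m : x ⟶ x') :
    (e.act m).move₂ k = (e.move₂ k).act m := by
  refine Over.ext ?_
  have := congrArg Over.val (mul₂_act e m (triv₂ E s y k.elt) (𝟙 _))
  rw [act_id] at this
  refine this.trans ?_
  change E.act _ (G.act m.elt 1 * 1) = E.act _ m.elt
  rw [mul_one, G.act_one]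
  rfl

lemma move₂_comp (e : E.Over s y z x) (k : z ⟶ z') (k' : z' ⟶ z'') :
    e.move₂ (k ≫ k') = (e.move₂ k).move₂ k' := by
  refine Over.ext ?_
  have := mul₂_assoc_val e (triv₂ E s y k.elt) (triv₂ E s y k'.elt)
  refine Eq.trans ?_ (this.symm.trans ?_)
  · refine mul₂_val_congr rfl ?_
    exact (E.s₂_mul₂ s y.pt k.elt k'.elt ((triv₂ E s y k.elt).comp₂ (triv₂ E s y k'.elt))).symm
  · exact mul₂_val_congr rfl rfl

lemma move₂_id (e : E.Over s y z x) : e.move₂ (𝟙 z) = e := by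
  obtain ⟨m, hm, -⟩ := e.existsUnique_act (e.move₂ (𝟙 z))
  have h₁ : (e.move₂ (𝟙 z)).move₂ (𝟙 z) = e.move₂ (𝟙 z) := by
    rw [← move₂_comp, Category.comp_id]
  rw [← hm, move₂_act, ← hm, ← act_comp] at h₁
  have h₂ := e.act_injective h₁
  have k₃ : m = 𝟙 x := by
    refine Pt.hom_ext ?_
    have k₄ := congrArg Pt.Hom.elt h₂
    rw [Pt.comp_elt] at k₄
    exact mul_eq_left.mp k₄
  rw [← hm, k₃, act_id]

lemma triv₂_mul₂_val (e : E.Over s y z x) (k : K.G₁.obj (op V)) :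
    ((triv₂ E s y k).mul₂ e).val = (e.mul₂ (triv₂ E s y (K.act k z.pt))).val := by
  have c₁ : E.Comp₂ (E.s₂ (E.base e.val) (E.fst e.val) k) e.val := ⟨E.base_s₂ _ _ _, E.fst_s₂ _ _ _⟩
  have c₂ : E.Comp₂ e.val (E.s₂ (E.base e.val) (E.fst e.val) (K.act k (E.snd e.val))) :=
    ⟨(E.base_s₂ _ _ _).symm, (E.fst_s₂ _ _ _).symm⟩
  have := E.compatibility₂ k e.val c₁ c₂
  unfold mul₂ triv₂
  simpa only [e.base_eq, e.snd_eq, e.fst_eq] using this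

lemma mul₂_move₂ {z₁ z₁' : K.Pt V} (e : E.Over s y z x) (k : z ⟶ z₁) (e' : E.Over s y z' x')
    (k' : z' ⟶ z₁') : (e.move₂ k).mul₂ (e'.move₂ k') = (e.mul₂ e').move₂ (k ⊗ₘ k') := by
  refine Over.ext ?_
  let t := triv₂ E s y k.elt
  let t' := triv₂ E s y k'.elt
  let t₁ := triv₂ E s y (K.act k.elt z'.pt)
  calc ((e.move₂ k).mul₂ (e'.move₂ k')).val = ((e.mul₂ t).mul₂ (e'.mul₂ t')).val :=
        mul₂_val_congr rfl rfl
    _ = (e.mul₂ (t.mul₂ (e'.mul₂ t'))).val := mul₂_assoc_val _ _ _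
    _ = (e.mul₂ ((t.mul₂ e').mul₂ t')).val := mul₂_val_congr rfl (mul₂_assoc_val _ _ _).symm
    _ = (e.mul₂ ((e'.mul₂ t₁).mul₂ t')).val :=
        mul₂_val_congr rfl (mul₂_val_congr (triv₂_mul₂_val e' k.elt) rfl)
    _ = (e.mul₂ (e'.mul₂ (t₁.mul₂ t'))).val := mul₂_val_congr rfl (mul₂_assoc_val _ _ _)
    _ = ((e.mul₂ e').mul₂ (t₁.mul₂ t')).val := (mul₂_assoc_val _ _ _).symm
    _ = ((e.mul₂ e').move₂ (k ⊗ₘ k')).val := mul₂_val_congr rfl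
        (e₂' := triv₂ E s y (K.act k.elt z'.pt * k'.elt)) (E.s₂_mul₂ _ _ _ _ (t₁.comp₂ t'))

lemma move₂_res (e : E.Over s y z x) (k : z ⟶ z') {W : C} (f : W ⟶ V)
    {t : S.obj.obj (op W)} (ht : S.obj.map f.op s = t) :
    (e.move₂ k).res f ht = (e.res f ht).move₂ ((K.ptRes f).map k) := by
  refine Over.ext ((mul₂_res_val e (triv₂ E s y k.elt) f ht).symm.trans ?_)
  refine mul₂_val_congr rfl ?_
  subst ht
  exact (E.s₂_res f s y.pt k.elt).symm

variable (E s y) in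
/-- The neutral point for the second product. -/
def one₂ : E.Over s y (𝟙_ (K.Pt V)) (𝟙_ (G.Pt V)) :=
  (triv₂ E s y 1).copy rfl (map_one K.d) rfl

lemma mul₂_one₂_val (e : E.Over s y z x) : (e.mul₂ (one₂ E s y)).val = e.val :=
  (mul₂_val_congr rfl rfl).trans (congrArg Over.val e.move₂_id)

lemma one₂_mul₂_val (e : E.Over s y z x) : ((one₂ E s y).mul₂ e).val = e.val := by
  refine ((mul₂_val_congr rfl rfl).trans (triv₂_mul₂_val e 1)).trans ?_
  refine Eq.trans (mul₂_val_congr rfl ?_) (congrArg Over.val e.move₂_id)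
  rw [K.one_act]
  rfl

lemma triv₂_eq_move₂ (k : K.G₁.obj (op V)) :
    triv₂ E s y k = (one₂ E s y).move₂ ⟨k, (one_mul _).symm⟩ := by
  refine Over.ext ?_
  exact (one₂_mul₂_val (triv₂ E s y k)).symm

lemma one₂_res {W : C} (f : W ⟶ V) {t : S.obj.obj (op W)} (ht : S.obj.map f.op s = t) :
    ((one₂ E s y).res f ht).val = (one₂ E t ((H.ptRes f).obj y)).val := by
  subst ht
  refine (E.s₂_res f s y.pt 1).symm.trans ?_
  rw [map_one]
  rfl

/-! The two structures interact. -/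

lemma interchange (a : E.Over s y z x) {xa xb xc : G.Pt V} (a' : E.Over s y' z xa)
    (b : E.Over s y z' xb) (b' : E.Over s y' z' xc) :
    ((a.mul₁ a').mul₂ (b.mul₁ b')).act (tensorμ x xa xb xc) =
      (a.mul₂ b).mul₁ (a'.mul₂ b') := by
  refine Over.ext ?_
  have h := E.interchange a.val a'.val b.val b'.val (a.comp₁ a') (b.comp₁ b')
    ((a.mul₁ a').comp₂ (b.mul₁ b')) (a.comp₂ b) (a'.comp₂ b')
    ((a.mul₂ b).comp₁ (a'.mul₂ b'))
  have hm : Pt.Hom.elt (tensorμ x xa xb xc) = G.act (G.br xa.pt xb.pt) xc.pt := by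
    change 1 * (1 * (G.act (G.br xa.pt xb.pt) xc.pt * (1 * 1))) = _
    simp
  change E.act (E.mul₂ (E.mul₁ a.val a'.val _) (E.mul₁ b.val b'.val _) _)
    (Pt.Hom.elt (tensorμ x xa xb xc)) = E.mul₁ (E.mul₂ a.val b.val _) (E.mul₂ a'.val b'.val _) _
  rw [h, ← E.act_mul, hm, a'.sec_eq, b.sec_eq, b'.sec_eq, inv_mul_cancel, E.act_one]

lemma interchange_of_right_unit (a : E.Over s y z x) (a' : E.Over s y' z x')
    {b : E.Over s y z' (𝟙_ (G.Pt V))} {b' : E.Over s y' z' x''} :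
    ((a.mul₁ a').mul₂ (b.mul₁ b')).val = ((a.mul₂ b).mul₁ (a'.mul₂ b')).val := by
  rw [← interchange a a' b b']
  have hm : Pt.Hom.elt (tensorμ x x' (𝟙_ (G.Pt V)) x'') = 1 := by
    change 1 * (1 * (G.act (G.br x'.pt 1) x''.pt * (1 * 1))) = _
    simp [G.br_one, G.one_act]
  change _ = E.act _ (Pt.Hom.elt (tensorμ x x' (𝟙_ (G.Pt V)) x''))
  rw [hm, E.act_one]

lemma interchange_of_left_unit (a : E.Over s y z x) (a' : E.Over s y' z (𝟙_ (G.Pt V)))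
    {b : E.Over s y z' x'} {b' : E.Over s y' z' x''} :
    ((a.mul₁ a').mul₂ (b.mul₁ b')).val = ((a.mul₂ b).mul₁ (a'.mul₂ b')).val := by
  rw [← interchange a a' b b']
  have hm : Pt.Hom.elt (tensorμ x (𝟙_ (G.Pt V)) x' x'') = 1 := by
    change 1 * (1 * (G.act (G.br 1 x'.pt) x''.pt * (1 * 1))) = _
    simp [G.one_br, G.one_act]
  change _ = E.act _ (Pt.Hom.elt (tensorμ x (𝟙_ (G.Pt V)) x' x''))
  rw [hm, E.act_one]

lemma mul₁_move₂ (e : E.Over s y z x) (e' : E.Over s y' z x') (k : z ⟶ z') :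
    (e.move₂ k).mul₁ (e'.move₂ k) = (e.mul₁ e').move₂ k := by
  refine Over.ext ?_
  refine (mul₁_val_congr rfl rfl).trans ((interchange_of_right_unit e e').symm.trans ?_)
  exact mul₂_val_congr rfl (E.s₂_mul₁ s y.pt y'.pt k.elt
    ((triv₂ E s y k.elt).comp₁ (triv₂ E s y' k.elt)))

lemma mul₂_move₁ (e : E.Over s y z x) (e' : E.Over s y z' x') (h : y ⟶ y') :
    (e.move₁ h).mul₂ (e'.move₁ h) = (e.mul₂ e').move₁ h := by
  refine Over.ext ?_
  refine (mul₂_val_congr rfl rfl).trans ((interchange_of_left_unit e _).trans ?_)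
  exact mul₁_val_congr rfl (E.s₁_mul₂ s h.elt z.pt z'.pt
    ((triv₁ E s h.elt z).comp₂ (triv₁ E s h.elt z')))

lemma one₁_one₂ : one₁ E s (𝟙_ (K.Pt V)) = one₂ E s (𝟙_ (H.Pt V)) := by
  refine Over.ext ?_
  have h := E.restriction s 1 1
  rw [map_one, map_one] at h
  exact h

lemma one₁_move₂ (k : z ⟶ z') : (one₁ E s z).move₂ k = one₁ E s z' := by
  refine Over.ext ?_
  have h₁ := E.restriction s 1 k.elt
  have h₂ := E.s₁_mul₂ s 1 z.pt (K.d k.elt) ((triv₁ E s 1 z).comp₂ (triv₁ E s 1 ⟨K.d k.elt⟩))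
  refine Eq.trans ?_ (h₂.trans ?_)
  · change _ = ((one₁ E s z).mul₂ (one₁ E s ⟨K.d k.elt⟩)).val
    refine mul₂_val_congr rfl ?_
    rw [map_one] at h₁
    exact h₁.symm
  · rw [← k.eq]
    rfl

lemma one₂_move₁ (h : y ⟶ y') : (one₂ E s y).move₁ h = one₂ E s y' := by
  refine Over.ext ?_
  have h₁ := E.restriction s h.elt 1
  have h₂ := E.s₂_mul₁ s y.pt (H.d h.elt) 1 ((triv₂ E s y 1).comp₁ (triv₂ E s ⟨H.d h.elt⟩ 1))
  refine Eq.trans ?_ (h₂.trans ?_)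
  · change _ = ((one₂ E s y).mul₁ (one₂ E s ⟨H.d h.elt⟩)).val
    refine mul₁_val_congr rfl ?_
    rw [map_one] at h₁
    exact h₁
  · rw [← h.eq]
    rfl

lemma triv₁_move₂ (h : H.G₁.obj (op V)) (k : z ⟶ z') :
    (triv₁ E s h z).move₂ k = triv₁ E s h z' := by
  refine Over.ext ?_
  have h₂ := E.s₁_mul₂ s h z.pt (K.d k.elt) ((triv₁ E s h z).comp₂ (triv₁ E s h ⟨K.d k.elt⟩))
  refine Eq.trans ?_ (h₂.trans ?_)
  · change _ = ((triv₁ E s h z).mul₂ (triv₁ E s h ⟨K.d k.elt⟩)).val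
    exact mul₂_val_congr rfl (E.restriction s h k.elt).symm
  · rw [← k.eq]
    rfl

lemma move₁_move₂ (e : E.Over s y z x) (h : y ⟶ y') (k : z ⟶ z') :
    (e.move₁ h).move₂ k = (e.move₂ k).move₁ h := by
  refine Over.ext ?_
  have h₁ := congrArg Over.val (mul₁_move₂ e (triv₁ E s h.elt z) k)
  refine Eq.trans ?_ (h₁.symm.trans (mul₁_val_congr rfl ?_))
  · refine mul₂_val_congr rfl ?_
    change (E.s₂ s y'.pt k.elt) = E.s₂ s (y.pt * H.d h.elt) k.elt
    rw [h.eq]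
  · rw [triv₁_move₂]

end Over

end Butterfly

end BiaddBfl

namespace BiaddBfl

section Sheaves

variable {C : Type u} [Category.{v} C] {J : GrothendieckTopology C}

lemma eq_of_locally_eq {P : Cᵒᵖ ⥤ Type w} (hP : Presheaf.IsSheaf J P) {U : C} {a b : P.obj (op U)}
    {R : Sieve U} (hR : R ∈ J U)
    (h : ∀ {V : C} (f : V ⟶ U), R.arrows f → P.map f.op a = P.map f.op b) : a = b := by
  rw [isSheaf_iff_isSheaf_of_type] at hP
  exact (hP R hR).isSeparatedFor.ext fun _ f hf => h f hf

lemma exists_of_locally_unique {P : Cᵒᵖ ⥤ Type w} (hP : Presheaf.IsSheaf J P) {U : C}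
    (p : ∀ {V : C}, (V ⟶ U) → P.obj (op V) → Prop)
    (hp : ∀ {V W : C} (f : V ⟶ U) (g : W ⟶ V) (a : P.obj (op V)), p f a → p (g ≫ f) (P.map g.op a))
    (hu : ∀ {V : C} (f : V ⟶ U) (a b : P.obj (op V)), p f a → p f b → a = b)
    {R : Sieve U} (hR : R ∈ J U) (hl : ∀ {V : C} (f : V ⟶ U), R.arrows f → ∃ a, p f a) :
    ∃ a : P.obj (op U), ∀ {V : C} (f : V ⟶ U), R.arrows f → p f (P.map f.op a) := by
  rw [isSheaf_iff_isSheaf_of_type] at hP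
  choose x hx using @hl
  have hc : Presieve.FamilyOfElements.Compatible (P := P) (R := R.arrows) (fun V f hf => x f hf) := by
    intro Y₁ Y₂ Z g₁ g₂ f₁ f₂ h₁ h₂ e
    have k₁ := hp f₁ g₁ _ (hx f₁ h₁)
    have k₂ := hp f₂ g₂ _ (hx f₂ h₂)
    rw [← e] at k₂
    exact hu _ _ _ k₁ k₂
  obtain ⟨a, ha, -⟩ := hP R hR _ hc
  refine ⟨a, fun f hf => ?_⟩
  rw [ha f hf]
  exact hx f hf

end Sheaves

namespace Butterfly

open Functor.LaxMonoidal CrossedModule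

variable {C : Type u} [Category.{v} C] {J : GrothendieckTopology C} {S S' S'' : Sheaf J (Type w)}
  {H K : CrossedModule.{v, u, w} J} {G : BraidedCrossedModule.{v, u, w} J}

namespace Over

variable {E : Butterfly S H K G} {V : C} {s : S.obj.obj (op V)} {y y' y'' : H.Pt V}
  {z z' z'' : K.Pt V} {x x' x'' : G.Pt V}

/-- The action of a triple of morphisms. -/
def tr (h : y ⟶ y') (k : z ⟶ z') (m : x ⟶ x') (e : E.Over s y z x) : E.Over s y' z' x' :=
  ((e.move₁ h).move₂ k).act m

lemma tr_id (e : E.Over s y z x) : e.tr (𝟙 y) (𝟙 z) (𝟙 x) = e := by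
  rw [tr, move₁_id, move₂_id, act_id]

lemma tr_id_id (e : E.Over s y z x) (m : x ⟶ x') : e.tr (𝟙 y) (𝟙 z) m = e.act m := by
  rw [tr, move₁_id, move₂_id]

lemma tr_tr (h : y ⟶ y') (k : z ⟶ z') (m : x ⟶ x') (h' : y' ⟶ y'') (k' : z' ⟶ z'')
    (m' : x' ⟶ x'') (e : E.Over s y z x) :
    (e.tr h k m).tr h' k' m' = e.tr (h ≫ h') (k ≫ k') (m ≫ m') := by
  simp only [tr, move₁_act, move₂_act, move₁_comp, move₂_comp, act_comp, move₁_move₂]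

lemma tr_res (h : y ⟶ y') (k : z ⟶ z') (m : x ⟶ x') (e : E.Over s y z x) {W : C} (f : W ⟶ V)
    {t : S.obj.obj (op W)} (ht : S.obj.map f.op s = t) :
    (e.tr h k m).res f ht =
      (e.res f ht).tr ((H.ptRes f).map h) ((K.ptRes f).map k) ((G.ptRes f).map m) := by
  rw [tr, act_res, move₂_res, move₁_res, tr]

lemma mul₁_tr {y₁ y₁' : H.Pt V} {x₁ x₁' : G.Pt V} (h : y ⟶ y') (h' : y₁ ⟶ y₁') (k : z ⟶ z')
    (m : x ⟶ x') (m' : x₁ ⟶ x₁') (e : E.Over s y z x) (e' : E.Over s y₁ z x₁) :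
    (e.tr h k m).mul₁ (e'.tr h' k m') = (e.mul₁ e').tr (h ⊗ₘ h') k (m ⊗ₘ m') := by
  rw [tr, tr, mul₁_act, mul₁_move₂, mul₁_move₁, tr]

lemma mul₂_tr {z₁ z₁' : K.Pt V} {x₁ x₁' : G.Pt V} (h : y ⟶ y') (k : z ⟶ z') (k' : z₁ ⟶ z₁')
    (m : x ⟶ x') (m' : x₁ ⟶ x₁') (e : E.Over s y z x) (e' : E.Over s y z₁ x₁) :
    (e.tr h k m).mul₂ (e'.tr h k' m') = (e.mul₂ e').tr h (k ⊗ₘ k') (m ⊗ₘ m') := by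
  rw [tr, tr, mul₂_act, mul₂_move₂, mul₂_move₁, tr]

lemma exists_tr (h : y ⟶ y') (k : z ⟶ z') (e : E.Over s y z x) (e' : E.Over s y' z' x') :
    ∃ m : x ⟶ x', e.tr h k m = e' :=
  (existsUnique_act _ e').exists

lemma tr_injective {h : y ⟶ y'} {k : z ⟶ z'} {e : E.Over s y z x} {m m' : x ⟶ x'}
    (hm : e.tr h k m = e.tr h k m') : m = m' :=
  act_injective _ hm

lemma move₁_val_of_elt (e : E.Over s y z x) (h : y ⟶ y') (hh : h.elt = 1) :
    (e.move₁ h).val = e.val := by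
  refine Eq.trans ?_ (congrArg Over.val e.move₁_id)
  exact mul₁_val_congr rfl (by rw [hh]; rfl)

lemma move₂_val_of_elt (e : E.Over s y z x) (k : z ⟶ z') (hk : k.elt = 1) :
    (e.move₂ k).val = e.val := by
  refine Eq.trans ?_ (congrArg Over.val e.move₂_id)
  exact mul₂_val_congr rfl (by rw [hk]; rfl)

lemma tr_val_of_elt (h : y ⟶ y') (k : z ⟶ z') (m : x ⟶ x') (e : E.Over s y z x)
    (hh : h.elt = 1) (hk : k.elt = 1) (hm : m.elt = 1) : (e.tr h k m).val = e.val := by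
  rw [tr]
  change E.act _ m.elt = _
  rw [hm, E.act_one, move₂_val_of_elt _ _ hk, move₁_val_of_elt _ _ hh]

lemma tr_eq_of_elt (h : y ⟶ y') (k : z ⟶ z') (m : x ⟶ x') {e : E.Over s y z x}
    {e' : E.Over s y' z' x'} (he : e.val = e'.val)
    (hh : h.elt = 1) (hk : k.elt = 1) (hm : m.elt = 1) : e.tr h k m = e' :=
  Over.ext ((tr_val_of_elt h k m e hh hk hm).trans he)

variable (E) in
lemma exists_locally (s : S.obj.obj (op V)) (y : H.Pt V) (z : K.Pt V) :
    ∃ R ∈ J V, ∀ {W : C} (f : W ⟶ V), R.arrows f → ∃ x : G.Pt W,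
      Nonempty (E.Over (S.obj.map f.op s) ((H.ptRes f).obj y) ((K.ptRes f).obj z) x) := by
  obtain ⟨R, hR, h⟩ := E.locally_nonempty s y.pt z.pt
  refine ⟨R, hR, fun f hf => ?_⟩
  obtain ⟨e, h₁, h₂, h₃⟩ := h f hf
  exact ⟨⟨E.sec e⟩, ⟨⟨e, h₁, h₂, h₃, rfl⟩⟩⟩

end Over

/-! ### Base change of butterflies -/

section BaseChange

lemma HomOver.ext_of_app_eq {q : S' ⟶ S} {E' : Butterfly S' H K G} {E : Butterfly S H K G}
    (ψ : HomOver q E' E) {U : C} {e e' : E'.Sec U} (hb : E'.base e = E'.base e')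
    (h : ψ.app e = ψ.app e') : e = e' := by
  obtain ⟨g, hg, -⟩ := E'.simply_transitive e e' hb
    (by rw [← ψ.fst, ← ψ.fst, h]) (by rw [← ψ.snd, ← ψ.snd, h])
  have h₁ : E.act (ψ.app e) g = ψ.app e := by rw [← ψ.act, hg, h]
  have h₂ : g = 1 :=
    (E.simply_transitive (ψ.app e) (ψ.app e) rfl rfl rfl).unique h₁ (E.act_one _)
  rw [← hg, h₂, E'.act_one]

lemma HomOver.exists_app_eq {q : S' ⟶ S} {E' : Butterfly S' H K G} {E : Butterfly S H K G}
    (ψ : HomOver q E' E) {U : C} (s : S'.obj.obj (op U)) (e : E.Sec U)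
    (hs : q.hom.app (op U) s = E.base e) : ∃ e' : E'.Sec U, E'.base e' = s ∧ ψ.app e' = e := by
  obtain ⟨R, hR, hl⟩ := E'.locally_nonempty s (E.fst e) (E.snd e)
  obtain ⟨a, ha⟩ := exists_of_locally_unique E'.E.property (U := U)
    (fun f e' => E'.base e' = S'.obj.map f.op s ∧ ψ.app e' = E.res f e)
    (fun f g e' h => ⟨by rw [E'.base_res, h.1]; simp, by rw [ψ.res, h.2]; simp [Torsor.res]⟩)
    (fun f e₁ e₂ h₁ h₂ => ψ.ext_of_app_eq (h₁.1.trans h₂.1.symm) (h₁.2.trans h₂.2.symm))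
    hR (fun f hf => by
      obtain ⟨e₀, h₁, h₂, h₃⟩ := hl f hf
      obtain ⟨g, hg, -⟩ := E.simply_transitive (ψ.app e₀) (E.res f e)
        (by rw [ψ.base, h₁, E.base_res, ← hs]; exact NatTrans.naturality_apply q.hom f.op s)
        (by rw [ψ.fst, h₂, E.fst_res]) (by rw [ψ.snd, h₃, E.snd_res])
      exact ⟨E'.act e₀ g, by rw [E'.base_act, h₁], by rw [ψ.act, hg]⟩)
  refine ⟨a, eq_of_locally_eq S'.property hR fun f hf => ?_,
    eq_of_locally_eq E.E.property hR fun f hf => ?_⟩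
  · rw [← E'.base_res]
    exact (ha f hf).1
  · exact (ψ.res f a).symm.trans (ha f hf).2

lemma HomOver.existsUnique_comp {p : S'' ⟶ S'} {q : S' ⟶ S} {E'' : Butterfly S'' H K G}
    {E' : Butterfly S' H K G} {E : Butterfly S H K G} (ψ : HomOver q E' E)
    (χ : HomOver (p ≫ q) E'' E) : ∃! φ : HomOver p E'' E', φ.comp ψ = χ := by
  have ex {U : C} (e : E''.Sec U) := ψ.exists_app_eq (p.hom.app (op U) (E''.base e)) (χ.app e)
    (χ.base e).symm
  choose φ hb hφ using @ex
  have hf {U : C} (e : E''.Sec U) : E'.fst (φ e) = E''.fst e := by rw [← ψ.fst, hφ, χ.fst]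
  have hs {U : C} (e : E''.Sec U) : E'.snd (φ e) = E''.snd e := by rw [← ψ.snd, hφ, χ.snd]
  refine ⟨⟨φ, fun {U V} f e => ?_, hb, hf, hs, fun e g => ?_, fun e => ?_, fun e e' c c' => ?_,
    fun e e' c c' => ?_, fun s h z => ?_, fun s y k => ?_⟩, ?_, fun φ' h => ?_⟩
  · refine ψ.ext_of_app_eq ?_ ?_
    · rw [hb, E''.base_res, E'.base_res, hb]
      exact NatTrans.naturality_apply p.hom f.op _
    · rw [hφ, χ.res, ψ.res, hφ]
  · refine ψ.ext_of_app_eq ?_ ?_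
    · rw [hb, E''.base_act, E'.base_act, hb]
    · rw [hφ, χ.act, ψ.act, hφ]
  · rw [← ψ.sec, hφ, χ.sec]
  · refine ψ.ext_of_app_eq ?_ ?_
    · rw [hb, E''.base_mul₁, E'.base_mul₁, hb]
    · have c₁ : E.Comp₁ (ψ.app (φ e)) (ψ.app (φ e')) :=
        ⟨by rw [ψ.base, ψ.base, c'.1], by rw [ψ.snd, ψ.snd, c'.2]⟩
      have c₂ : E.Comp₁ (χ.app e) (χ.app e') := by rw [← hφ, ← hφ]; exact c₁
      rw [hφ, χ.mul₁ e e' c c₂, ψ.mul₁ _ _ c' c₁]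
      simp only [hφ]
  · refine ψ.ext_of_app_eq ?_ ?_
    · rw [hb, E''.base_mul₂, E'.base_mul₂, hb]
    · have c₁ : E.Comp₂ (ψ.app (φ e)) (ψ.app (φ e')) :=
        ⟨by rw [ψ.base, ψ.base, c'.1], by rw [ψ.fst, ψ.fst, c'.2]⟩
      have c₂ : E.Comp₂ (χ.app e) (χ.app e') := by rw [← hφ, ← hφ]; exact c₁
      rw [hφ, χ.mul₂ e e' c c₂, ψ.mul₂ _ _ c' c₁]
      simp only [hφ]
  · refine ψ.ext_of_app_eq ?_ ?_
    · rw [hb, E''.base_s₁, E'.base_s₁]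
    · rw [hφ, χ.s₁, ψ.s₁]
      rfl
  · refine ψ.ext_of_app_eq ?_ ?_
    · rw [hb, E''.base_s₂, E'.base_s₂]
    · rw [hφ, χ.s₂, ψ.s₂]
      rfl
  · exact HomOver.ext (funext fun U => funext fun e => hφ e)
  · refine HomOver.ext (funext fun U => funext fun e => ψ.ext_of_app_eq ?_ ?_)
    · rw [φ'.base, hb]
    · subst h
      exact (hφ e).symm

lemma isGroupoid (S : Sheaf J (Type w)) (H K : CrossedModule.{v, u, w} J)
    (G : BraidedCrossedModule.{v, u, w} J) : IsGroupoid (Butterfly S H K G) := by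
  refine ⟨fun {E' E} ψ => ?_⟩
  obtain ⟨φ, hφ, -⟩ := HomOver.existsUnique_comp (p := 𝟙 S) (q := 𝟙 S) (E'' := E) ψ (HomOver.id E)
  have h₁ : (φ : E ⟶ E') ≫ ψ = 𝟙 E := hφ
  have h₂ : ψ ≫ (φ : E ⟶ E') = 𝟙 E' :=
    (HomOver.existsUnique_comp (p := 𝟙 S) (q := 𝟙 S) (E'' := E') ψ ψ).unique
      (show (ψ ≫ (φ : E ⟶ E')) ≫ ψ = ψ by rw [Category.assoc, h₁, Category.comp_id])
      (show 𝟙 E' ≫ ψ = ψ by rw [Category.id_comp])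
  exact ⟨φ, h₂, h₁⟩

/-- The presheaf underlying the base change of a butterfly. -/
def pullbackPresheaf (p : S' ⟶ S) (E : Butterfly S H K G) : Cᵒᵖ ⥤ Type w where
  obj U := {a : S'.obj.obj U × E.E.obj.obj U // E.base (U := U.unop) a.2 = p.hom.app U a.1}
  map {U V} f := ↾fun a => ⟨(S'.obj.map f a.1.1, E.E.obj.map f a.1.2), by
    refine (E.base_res f.unop a.1.2).trans ((congrArg (S.obj.map f) a.2).trans ?_)
    exact (NatTrans.naturality_apply p.hom f _).symm⟩
  map_id U := by ext a <;> simp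
  map_comp f g := by ext a <;> simp

lemma pullbackPresheaf_isSheaf (p : S' ⟶ S) (E : Butterfly S H K G) :
    Presheaf.IsSheaf J (pullbackPresheaf p E) := by
  have hS := S'.property
  have hE := E.E.property
  rw [isSheaf_iff_isSheaf_of_type] at *
  intro U R hR x hx
  have cS : Presieve.FamilyOfElements.Compatible (P := S'.obj) (fun V f hf => (x f hf).1.1) :=
    fun _ _ _ g₁ g₂ f₁ f₂ h₁ h₂ e => congrArg (fun a => a.1.1) (hx g₁ g₂ h₁ h₂ e)
  have cE : Presieve.FamilyOfElements.Compatible (P := E.E.obj) (fun V f hf => (x f hf).1.2) :=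
    fun _ _ _ g₁ g₂ f₁ f₂ h₁ h₂ e => congrArg (fun a => a.1.2) (hx g₁ g₂ h₁ h₂ e)
  obtain ⟨a, ha, ha'⟩ := hS R hR _ cS
  obtain ⟨b, hb, hb'⟩ := hE R hR _ cE
  refine ⟨⟨(a, b), eq_of_locally_eq S.property hR fun f hf => ?_⟩,
    fun V f hf => Subtype.ext (Prod.ext (ha f hf) (hb f hf)), fun c hc => Subtype.ext (Prod.ext ?_ ?_)⟩
  · refine (E.base_res f b).symm.trans ?_
    refine Eq.trans ?_ (NatTrans.naturality_apply p.hom f.op a)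
    rw [ha f hf]
    refine Eq.trans ?_ (x f hf).2
    exact congrArg E.base (hb f hf)
  · exact ha' c.1.1 fun V f hf => congrArg (fun a => a.1.1) (hc f hf)
  · exact hb' c.1.2 fun V f hf => congrArg (fun a => a.1.2) (hc f hf)

lemma pullback_ext {p : S' ⟶ S} {E : Butterfly S H K G} {U : C}
    {a b : (pullbackPresheaf p E).obj (op U)} (h₁ : a.1.1 = b.1.1) (h₂ : a.1.2 = b.1.2) : a = b :=
  Subtype.ext (Prod.ext h₁ h₂)

/-- The base change of a butterfly. -/
def pullback (p : S' ⟶ S) (E : Butterfly S H K G) : Butterfly S' H K G where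
  E := ⟨pullbackPresheaf p E, pullbackPresheaf_isSheaf p E⟩
  base e := e.1.1
  fst e := E.fst e.1.2
  snd e := E.snd e.1.2
  sec e := E.sec e.1.2
  act e g := ⟨(e.1.1, E.act e.1.2 g), (E.base_act _ _).trans e.2⟩
  base_res _ _ := rfl
  fst_res f e := E.fst_res f e.1.2
  snd_res f e := E.snd_res f e.1.2
  act_res f e g := pullback_ext rfl (E.act_res f e.1.2 g)
  sec_res f e := E.sec_res f e.1.2
  base_act _ _ := rfl
  fst_act _ _ := E.fst_act _ _
  snd_act _ _ := E.snd_act _ _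
  act_one e := pullback_ext rfl (E.act_one _)
  act_mul e g g' := pullback_ext rfl (E.act_mul _ _ _)
  simply_transitive {U} e e' h₁ h₂ h₃ := by
    obtain ⟨g, hg, hg'⟩ := E.simply_transitive e.1.2 e'.1.2
      (by rw [e.2, e'.2]; exact congrArg (p.hom.app (op U)) h₁) h₂ h₃
    exact ⟨g, pullback_ext h₁ hg, fun g₁ h => hg' g₁ (congrArg (fun a => a.1.2) h)⟩
  locally_nonempty {U} s y z := by
    obtain ⟨R, hR, h⟩ := E.locally_nonempty (p.hom.app (op U) s) y z
    refine ⟨R, hR, fun f hf => ?_⟩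
    obtain ⟨e, h₁, h₂, h₃⟩ := h f hf
    exact ⟨⟨(S'.obj.map f.op s, e), h₁.trans (NatTrans.naturality_apply p.hom f.op s).symm⟩,
      rfl, h₂, h₃⟩
  sec_act _ _ := E.sec_act _ _
  mul₁ {U} e e' c := ⟨(e.1.1, E.mul₁ e.1.2 e'.1.2
    ⟨by rw [e.2, e'.2]; exact congrArg (p.hom.app (op U)) c.1, c.2⟩), (E.base_mul₁ _ _ _).trans e.2⟩
  mul₂ {U} e e' c := ⟨(e.1.1, E.mul₂ e.1.2 e'.1.2
    ⟨by rw [e.2, e'.2]; exact congrArg (p.hom.app (op U)) c.1, c.2⟩), (E.base_mul₂ _ _ _).trans e.2⟩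
  base_mul₁ _ _ _ := rfl
  fst_mul₁ _ _ _ := E.fst_mul₁ _ _ _
  snd_mul₁ _ _ _ := E.snd_mul₁ _ _ _
  mul₁_res f e e' c c' := pullback_ext rfl (E.mul₁_res f _ _ _ _)
  mul₁_assoc _ _ _ _ _ _ _ := pullback_ext rfl (E.mul₁_assoc _ _ _ _ _ _ _)
  sec_mul₁ _ _ _ := E.sec_mul₁ _ _ _
  mul₁_act _ _ _ _ _ := pullback_ext rfl (E.mul₁_act _ _ _ _ _)
  act_mul₁ _ _ _ _ _ := pullback_ext rfl (E.act_mul₁ _ _ _ _ _)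
  base_mul₂ _ _ _ := rfl
  fst_mul₂ _ _ _ := E.fst_mul₂ _ _ _
  snd_mul₂ _ _ _ := E.snd_mul₂ _ _ _
  mul₂_res f e e' c c' := pullback_ext rfl (E.mul₂_res f _ _ _ _)
  mul₂_assoc _ _ _ _ _ _ _ := pullback_ext rfl (E.mul₂_assoc _ _ _ _ _ _ _)
  sec_mul₂ _ _ _ := E.sec_mul₂ _ _ _
  mul₂_act _ _ _ _ _ := pullback_ext rfl (E.mul₂_act _ _ _ _ _)
  act_mul₂ _ _ _ _ _ := pullback_ext rfl (E.act_mul₂ _ _ _ _ _)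
  interchange a a' b b' c₁ c₂ c₃ c₄ c₅ c₆ := pullback_ext rfl (E.interchange _ _ _ _ _ _ _ _ _ _)
  s₁ {U} s h z := ⟨(s, E.s₁ (p.hom.app (op U) s) h z), E.base_s₁ _ _ _⟩
  s₂ {U} s y k := ⟨(s, E.s₂ (p.hom.app (op U) s) y k), E.base_s₂ _ _ _⟩
  s₁_res f s h z := pullback_ext rfl
    (Eq.trans (congrArg (fun t => E.s₁ t _ _) (NatTrans.naturality_apply p.hom f.op s))
      (E.s₁_res f _ h z))
  base_s₁ _ _ _ := rfl
  fst_s₁ _ _ _ := E.fst_s₁ _ _ _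
  snd_s₁ _ _ _ := E.snd_s₁ _ _ _
  sec_s₁ _ _ _ := E.sec_s₁ _ _ _
  s₁_mul₁ _ _ _ _ _ := pullback_ext rfl (E.s₁_mul₁ _ _ _ _ _)
  s₁_mul₂ _ _ _ _ _ := pullback_ext rfl (E.s₁_mul₂ _ _ _ _ _)
  s₂_res f s y k := pullback_ext rfl
    (Eq.trans (congrArg (fun t => E.s₂ t _ _) (NatTrans.naturality_apply p.hom f.op s))
      (E.s₂_res f _ y k))
  base_s₂ _ _ _ := rfl
  fst_s₂ _ _ _ := E.fst_s₂ _ _ _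
  snd_s₂ _ _ _ := E.snd_s₂ _ _ _
  sec_s₂ _ _ _ := E.sec_s₂ _ _ _
  s₂_mul₁ _ _ _ _ _ := pullback_ext rfl (E.s₂_mul₁ _ _ _ _ _)
  s₂_mul₂ _ _ _ _ _ := pullback_ext rfl (E.s₂_mul₂ _ _ _ _ _)
  restriction _ _ _ := pullback_ext rfl (E.restriction _ _ _)
  compatibility₁ h e c c' := pullback_ext rfl (by
    dsimp only
    simp only [← e.2]
    exact E.compatibility₁ _ _ _ _)
  compatibility₂ k e c c' := pullback_ext rfl (by
    dsimp only
    simp only [← e.2]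
    exact E.compatibility₂ _ _ _ _)

/-- The projection of the base change of a butterfly. -/
def pullbackMap (p : S' ⟶ S) (E : Butterfly S H K G) : HomOver p (E.pullback p) E where
  app e := e.1.2
  res _ _ := rfl
  base e := e.2
  fst _ := rfl
  snd _ := rfl
  act _ _ := rfl
  sec _ := rfl
  mul₁ _ _ _ _ := rfl
  mul₂ _ _ _ _ := rfl
  s₁ _ _ _ := rfl
  s₂ _ _ _ := rfl

lemma isFibredInGroupoids (H K : CrossedModule.{v, u, w} J)
    (G : BraidedCrossedModule.{v, u, w} J) : IsFibredInGroupoids H K G where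
  lift p E := ⟨E.pullback p, ⟨pullbackMap p E⟩⟩
  cartesian _ _ _ _ _ ψ χ := ψ.existsUnique_comp χ

end BaseChange

end Butterfly

end BiaddBfl

namespace BiaddBfl

open Functor.LaxMonoidal in
lemma isMonoidal_of_comp {A : Type*} [Category* A] [MonoidalCategory A] {D : Type*} [Category* D]
    [MonoidalCategory D] {F₁ F₂ F₃ : A ⥤ D} [F₁.Monoidal] [F₂.Monoidal] [F₃.Monoidal]
    (τ : F₁ ⟶ F₂) (σ : F₂ ⟶ F₃) [∀ X, Mono (σ.app X)] (hτσ : NatTrans.IsMonoidal (τ ≫ σ))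
    [NatTrans.IsMonoidal σ] : NatTrans.IsMonoidal τ where
  unit := by
    have h₁ := NatTrans.IsMonoidal.unit (τ := τ ≫ σ)
    have h₂ := NatTrans.IsMonoidal.unit (τ := σ)
    rw [← cancel_mono (σ.app _), Category.assoc, ← NatTrans.comp_app, h₁, h₂]
  tensor X Y := by
    have h₁ := NatTrans.IsMonoidal.tensor (τ := τ ≫ σ) X Y
    have h₂ := NatTrans.IsMonoidal.tensor (τ := σ) X Y
    rw [← cancel_mono (σ.app _), Category.assoc, ← NatTrans.comp_app, h₁, Category.assoc, h₂,
      NatTrans.comp_app, NatTrans.comp_app, ← tensorHom_comp_tensorHom, Category.assoc]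

namespace BiaddFunctor

variable {C : Type u} [Category.{v} C] {J : GrothendieckTopology C}
  {𝓗 : MonoidalPrestack.{v, u, v₁, u₁} C} {𝓚 : MonoidalPrestack.{v, u, v₂, u₂} C}
  {𝓖 : BraidedPrestack.{v, u, w, u₃} C} {S S' S'' : Sheaf J (Type w)}

lemma hom_res {p : S' ⟶ S} {U V : C} (f : V ⟶ U) {s : S'.obj.obj (op U)} {t : S'.obj.obj (op V)}
    (h : S'.obj.map f.op s = t) : S.obj.map f.op (p.hom.app (op U) s) = p.hom.app (op V) t := by
  rw [← h]
  exact (NatTrans.naturality_apply p.hom f.op s).symm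

/-- The base change of a biadditive functor. -/
def pullback (p : S' ⟶ S) (F : BiaddFunctor S 𝓗 𝓚 𝓖) : BiaddFunctor S' 𝓗 𝓚 𝓖 where
  functor {U} s := F.functor (p.hom.app (op U) s)
  resIso {U V} f s t h := F.resIso f (p.hom.app (op U) s) (p.hom.app (op V) t) (hom_res f h)
  resIso_isMonoidal₁ f _ _ h Y := F.resIso_isMonoidal₁ f _ _ (hom_res f h) Y
  resIso_isMonoidal₂ f _ _ h X := F.resIso_isMonoidal₂ f _ _ (hom_res f h) X
  resIso_id _ h X Y := F.resIso_id _ (hom_res _ h) X Y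
  resIso_comp f g _ _ _ h h' h'' X Y :=
    F.resIso_comp f g _ _ _ (hom_res _ h) (hom_res _ h') (hom_res _ h'') X Y

/-- The projection of the base change of a biadditive functor. -/
def pullbackMap (p : S' ⟶ S) (F : BiaddFunctor S 𝓗 𝓚 𝓖) : HomOver p (F.pullback p) F where
  app {U} s := 𝟙 (F.functor (p.hom.app (op U) s))
  isMonoidal₁ s Y := NatTrans.IsMonoidal.id (F₁ := (F.functor (p.hom.app _ s)).flip.obj Y)
  isMonoidal₂ s X := NatTrans.IsMonoidal.id (F₁ := (F.functor (p.hom.app _ s)).obj X)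
  res {U V} f s t _ h' X Y := (Category.comp_id _).trans
    ((congrArg (· ≫ ((F.resIso f (p.hom.app (op U) s) (p.hom.app (op V) t) h').hom.app X).app Y)
      ((𝓖.res f).map_id _)).trans (Category.id_comp _)).symm

variable (h𝓖 : 𝓖.toMonoidalPrestack.IsGroupLikeStack J)
include h𝓖

lemma HomOver.existsUnique_comp {p : S'' ⟶ S'} {q : S' ⟶ S} {F'' : BiaddFunctor S'' 𝓗 𝓚 𝓖}
    {F' : BiaddFunctor S' 𝓗 𝓚 𝓖} {F : BiaddFunctor S 𝓗 𝓚 𝓖} (ψ : HomOver q F' F)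
    (χ : HomOver (p ≫ q) F'' F) : ∃! φ : HomOver p F'' F', φ.comp ψ = χ := by
  have iso₁ {U : C} (s : S'.obj.obj (op U)) (X : 𝓗.Fib U) (Y : 𝓚.Fib U) :
      IsIso (((ψ.app s).app X).app Y) := h𝓖.isIso _
  have iso₂ {U : C} (s : S'.obj.obj (op U)) (X : 𝓗.Fib U) : IsIso ((ψ.app s).app X) :=
    NatIso.isIso_of_isIso_app _
  have iso₃ {U : C} (s : S'.obj.obj (op U)) : IsIso (ψ.app s) := NatIso.isIso_of_isIso_app _
  let φ {U : C} (s : S''.obj.obj (op U)) : F''.functor s ⟶ F'.functor (p.hom.app (op U) s) :=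
    (χ.app s : F''.functor s ⟶ F.functor (q.hom.app (op U) (p.hom.app (op U) s))) ≫
      @CategoryTheory.inv _ _ _ _ (ψ.app (p.hom.app (op U) s)) (iso₃ _)
  have hφ {U : C} (s : S''.obj.obj (op U)) : φ s ≫ ψ.app (p.hom.app (op U) s) = χ.app s :=
    (Category.assoc _ _ _).trans ((congrArg (χ.app s ≫ ·)
      (@IsIso.inv_hom_id _ _ _ _ (ψ.app (p.hom.app (op U) s)) (iso₃ _))).trans (Category.comp_id _))
  have hφ' {U : C} (s : S''.obj.obj (op U)) (X : 𝓗.Fib U) (Y : 𝓚.Fib U) :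
      ((φ s).app X).app Y ≫ ((ψ.app (p.hom.app (op U) s)).app X).app Y =
        ((χ.app s).app X).app Y := by
    rw [← hφ]
    rfl
  refine ⟨⟨φ, fun {U} s Y => ?_, fun {U} s X => ?_, fun {U V} f s t h h' X Y => ?_⟩, ?_, ?_⟩
  · have := ψ.isMonoidal₁ (p.hom.app (op U) s) Y
    have h := χ.isMonoidal₁ s Y
    rw [← hφ s] at h
    have iso (X : 𝓗.Fib U) : Mono (((((flipFunctor _ _ _).map (ψ.app (p.hom.app (op U) s))).app Y :
        (F'.functor (p.hom.app (op U) s)).flip.obj Y ⟶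
          (F.functor (q.hom.app (op U) (p.hom.app (op U) s))).flip.obj Y)).app X) := by
      have := iso₁ (p.hom.app (op U) s) X Y
      exact inferInstanceAs (Mono (((ψ.app (p.hom.app (op U) s)).app X).app Y))
    exact isMonoidal_of_comp (F₁ := (F''.functor s).flip.obj Y)
      (F₂ := (F'.functor (p.hom.app (op U) s)).flip.obj Y)
      (F₃ := (F.functor (q.hom.app (op U) (p.hom.app (op U) s))).flip.obj Y)
      (((flipFunctor _ _ _).map (φ s)).app Y)
      (((flipFunctor _ _ _).map (ψ.app (p.hom.app (op U) s))).app Y)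
      (hτσ := h)
  · have := ψ.isMonoidal₂ (p.hom.app (op U) s) X
    have h := χ.isMonoidal₂ s X
    rw [← hφ s] at h
    exact isMonoidal_of_comp ((φ s).app X) ((ψ.app (p.hom.app (op U) s)).app X) (hτσ := h)
  · have e : S.obj.map f.op (q.hom.app (op U) (p.hom.app (op U) s)) =
        q.hom.app (op V) (p.hom.app (op V) t) := hom_res f h'
    have h₁ := ψ.res f _ _ h' e X Y
    have h₂ := χ.res f s t h e X Y
    have := iso₁ (p.hom.app (op V) t) ((𝓗.res f).obj X) ((𝓚.res f).obj Y)
    rw [← cancel_mono (((ψ.app (p.hom.app (op V) t)).app ((𝓗.res f).obj X)).app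
      ((𝓚.res f).obj Y)), Category.assoc, Category.assoc]
    refine (congrArg (_ ≫ ·) (hφ' t _ _)).trans (h₂.trans ?_)
    refine Eq.trans ?_ (congrArg (_ ≫ ·) h₁.symm)
    refine Eq.trans ?_ (Category.assoc _ _ _)
    refine congrArg (· ≫ _) ?_
    refine Eq.trans ?_ ((𝓖.res f).map_comp _ _)
    exact congrArg (𝓖.res f).map (hφ' s X Y).symm
  · exact HomOver.ext (funext fun U => funext fun s => hφ s)
  · intro φ' h
    subst h
    refine HomOver.ext (funext fun U => funext fun s => ?_)
    exact (cancel_mono (ψ.app (p.hom.app (op U) s))).1 (hφ s).symm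

lemma isGroupoid (S : Sheaf J (Type w)) : IsGroupoid (BiaddFunctor S 𝓗 𝓚 𝓖) := by
  refine ⟨fun {E' E} ψ => ?_⟩
  obtain ⟨φ, hφ, -⟩ :=
    HomOver.existsUnique_comp h𝓖 (p := 𝟙 S) (q := 𝟙 S) (F'' := E) ψ (HomOver.id E)
  have h₁ : (φ : E ⟶ E') ≫ ψ = 𝟙 E := hφ
  have h₂ : ψ ≫ (φ : E ⟶ E') = 𝟙 E' :=
    (HomOver.existsUnique_comp h𝓖 (p := 𝟙 S) (q := 𝟙 S) (F'' := E') ψ ψ).unique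
      (show (ψ ≫ (φ : E ⟶ E')) ≫ ψ = ψ by rw [Category.assoc, h₁, Category.comp_id])
      (show 𝟙 E' ≫ ψ = ψ by rw [Category.id_comp])
  exact ⟨φ, h₂, h₁⟩

lemma isFibredInGroupoids : IsFibredInGroupoids 𝓗 𝓚 𝓖 J where
  lift p F := ⟨F.pullback p, ⟨pullbackMap p F⟩⟩
  cartesian _ _ _ _ _ ψ χ := ψ.existsUnique_comp h𝓖 χ

end BiaddFunctor

end BiaddBfl

namespace BiaddBfl

open Functor.LaxMonoidal CrossedModule

/-! ### Bifunctors and biadditive functors -/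

section Bifunctor

variable {A : Type u₁} [Category.{v₁} A] {B : Type u₂} [Category.{v₂} B] {D : Type u₃}
  [Category.{w} D] (F : A ⥤ B ⥤ D)

/-- The action of a bifunctor on a pair of morphisms. -/
def bimap {X X' : A} {Y Y' : B} (a : X ⟶ X') (b : Y ⟶ Y') :
    (F.obj X).obj Y ⟶ (F.obj X').obj Y' :=
  (F.map a).app Y ≫ (F.obj X').map b

lemma bimap_id (X : A) (Y : B) : bimap F (𝟙 X) (𝟙 Y) = 𝟙 _ := by simp [bimap]

lemma bimap_comp {X X' X'' : A} {Y Y' Y'' : B} (a : X ⟶ X') (a' : X' ⟶ X'') (b : Y ⟶ Y')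
    (b' : Y' ⟶ Y'') : bimap F (a ≫ a') (b ≫ b') = bimap F a b ≫ bimap F a' b' := by
  simp [bimap]

lemma bimap_id_right {X X' : A} (a : X ⟶ X') (Y : B) : bimap F a (𝟙 Y) = (F.map a).app Y := by
  simp [bimap]

lemma bimap_id_left (X : A) {Y Y' : B} (b : Y ⟶ Y') : bimap F (𝟙 X) b = (F.obj X).map b := by
  simp [bimap]

variable [MonoidalCategory A] [MonoidalCategory B] [MonoidalCategory D] [BraidedCategory D]
  [Biadditive F]

/-- The multiplication in the first variable. -/
def bμ₁ (X X' : A) (Y : B) : (F.obj X).obj Y ⊗ (F.obj X').obj Y ⟶ (F.obj (X ⊗ X')).obj Y :=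
  μ (F.flip.obj Y) X X'

/-- The multiplication in the second variable. -/
def bμ₂ (X : A) (Y Y' : B) : (F.obj X).obj Y ⊗ (F.obj X).obj Y' ⟶ (F.obj X).obj (Y ⊗ Y') :=
  μ (F.obj X) Y Y'

/-- The unit in the first variable. -/
def bε₁ (Y : B) : 𝟙_ D ⟶ (F.obj (𝟙_ A)).obj Y := ε (F.flip.obj Y)

/-- The unit in the second variable. -/
def bε₂ (X : A) : 𝟙_ D ⟶ (F.obj X).obj (𝟙_ B) := ε (F.obj X)

lemma bμ₁_natural {X X' X₁ X₁' : A} {Y Y' : B} (a : X ⟶ X₁) (a' : X' ⟶ X₁') (b : Y ⟶ Y') :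
    bμ₁ F X X' Y ≫ bimap F (a ⊗ₘ a') b = (bimap F a b ⊗ₘ bimap F a' b) ≫ bμ₁ F X₁ X₁' Y' := by
  have h₁ := μ_natural (F.flip.obj Y) a a'
  have h₂ := (Biadditive.natural₁ (F := F) b).tensor X₁ X₁'
  unfold bimap bμ₁
  dsimp only [Functor.flip_obj_map, Functor.flip_map_app, Functor.flip_obj_obj] at h₁ h₂
  rw [← tensorHom_comp_tensorHom, Category.assoc]
  refine Eq.trans ?_ (congrArg (_ ≫ ·) h₂)
  refine Eq.trans (Category.assoc _ _ _).symm (Eq.trans ?_ (Category.assoc _ _ _))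
  exact congrArg (· ≫ _) h₁.symm

lemma bμ₂_natural {X X' : A} {Y Y' Y₁ Y₁' : B} (a : X ⟶ X') (b : Y ⟶ Y₁) (b' : Y' ⟶ Y₁') :
    bμ₂ F X Y Y' ≫ bimap F a (b ⊗ₘ b') = (bimap F a b ⊗ₘ bimap F a b') ≫ bμ₂ F X' Y₁ Y₁' := by
  have h₁ := μ_natural (F.obj X') b b'
  have h₂ := (Biadditive.natural₂ (F := F) a).tensor Y Y'
  unfold bimap bμ₂
  rw [← tensorHom_comp_tensorHom, Category.assoc, h₁, reassoc_of% h₂]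

lemma bε₁_natural {Y Y' : B} (b : Y ⟶ Y') : bε₁ F Y ≫ bimap F (𝟙 _) b = bε₁ F Y' := by
  have h := (Biadditive.natural₁ (F := F) b).unit
  rw [bimap_id_left]
  exact h

lemma bε₂_natural {X X' : A} (a : X ⟶ X') : bε₂ F X ≫ bimap F a (𝟙 _) = bε₂ F X' := by
  have h := (Biadditive.natural₂ (F := F) a).unit
  rw [bimap_id_right]
  exact h

end Bifunctor

section Represents

variable {C : Type u} [Category.{v} C] {J : GrothendieckTopology C} {S : Sheaf J (Type w)}
  {H K : CrossedModule.{v, u, w} J} {G : BraidedCrossedModule.{v, u, w} J}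
  {𝓗 : MonoidalPrestack.{v, u, v₁, u₁} C} {𝓚 : MonoidalPrestack.{v, u, v₂, u₂} C}
  {𝓖 : BraidedPrestack.{v, u, w, u₃} C}
  {πH : MonoidalMorphism H.prestack 𝓗} {πK : MonoidalMorphism K.prestack 𝓚}
  {πG : MonoidalMorphism G.toCrossedModule.prestack 𝓖.toMonoidalPrestack}
  {E : Butterfly S H K G} {F : BiaddFunctor S 𝓗 𝓚 𝓖} (r : Represents πH πK πG E F)

namespace Represents

variable {U : C} {s : S.obj.obj (op U)} {y y' : H.Pt U} {z z' : K.Pt U} {x x' : G.Pt U}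

/-- The isomorphism given by a point of the butterfly. -/
def riso (e : E.Over s y z x) :
    ((F.functor s).obj ((πH.fn U).obj y)).obj ((πK.fn U).obj z) ⟶ (πG.fn U).obj x :=
  r.iso e.val s y.pt z.pt x.pt e.base_eq e.fst_eq e.snd_eq e.sec_eq

lemma riso_act (e : E.Over s y z x) (m : x ⟶ x') :
    r.riso (e.act m) = r.riso e ≫ (πG.fn U).map m :=
  r.iso_act e.val m.elt s y.pt z.pt x.pt x'.pt _ _ _ _ _ _ _ _ m.eq

lemma riso_mul₁ (e : E.Over s y z x) (e' : E.Over s y' z x') :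
    bμ₁ (F.functor s) _ _ _ ≫ ((F.functor s).map (μ (πH.fn U) y y')).app _ ≫
      r.riso (e.mul₁ e') = (r.riso e ⊗ₘ r.riso e') ≫ μ (πG.fn U) x x' :=
  r.iso_mul₁ e.val e'.val (e.comp₁ e') s y.pt y'.pt z.pt x.pt x'.pt _ _ _ _ _ _ _ _ _ _ _ _

lemma riso_mul₂ (e : E.Over s y z x) (e' : E.Over s y z' x') :
    bμ₂ (F.functor s) _ _ _ ≫ ((F.functor s).obj _).map (μ (πK.fn U) z z') ≫
      r.riso (e.mul₂ e') = (r.riso e ⊗ₘ r.riso e') ≫ μ (πG.fn U) x x' :=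
  r.iso_mul₂ e.val e'.val (e.comp₂ e') s y.pt z.pt z'.pt x.pt x'.pt _ _ _ _ _ _ _ _ _ _ _ _

lemma riso_copy (e : E.Over s y z x) {y₁ : H.Pt U} {z₁ : K.Pt U} {x₁ : G.Pt U} (h : y ⟶ y₁)
    (k : z ⟶ z₁) (m : x ⟶ x₁) (hy : y.pt = y₁.pt) (hz : z.pt = z₁.pt) (hx : x.pt = x₁.pt)
    (hh : h.elt = 1) (hk : k.elt = 1) (hm : m.elt = 1) :
    bimap (F.functor s) ((πH.fn U).map h) ((πK.fn U).map k) ≫ r.riso (e.copy hy hz hx) =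
      r.riso e ≫ (πG.fn U).map m := by
  obtain ⟨y⟩ := y
  obtain ⟨z⟩ := z
  obtain ⟨x⟩ := x
  obtain ⟨y₁⟩ := y₁
  obtain ⟨z₁⟩ := z₁
  obtain ⟨x₁⟩ := x₁
  dsimp only at hy hz hx
  subst hy hz hx
  obtain rfl : h = 𝟙 _ := Pt.hom_ext hh
  obtain rfl : k = 𝟙 _ := Pt.hom_ext hk
  obtain rfl : m = 𝟙 _ := Pt.hom_ext hm
  rw [CategoryTheory.Functor.map_id, CategoryTheory.Functor.map_id, CategoryTheory.Functor.map_id, bimap_id, Category.id_comp, Category.comp_id]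
  rfl

/-- The restriction of a biadditive functor along the presentations, in the first variable. -/
abbrev _root_.BiaddBfl.BiaddFunctor.along₁ (πH : MonoidalMorphism H.prestack 𝓗)
    (πK : MonoidalMorphism K.prestack 𝓚) (F : BiaddFunctor S 𝓗 𝓚 𝓖)
    (s : S.obj.obj (op U)) (z : K.Pt U) : H.Pt U ⥤ 𝓖.Fib U :=
  πH.fn U ⋙ (F.functor s).flip.obj ((πK.fn U).obj z)

/-- The restriction of a biadditive functor along the presentations, in the second variable. -/
abbrev _root_.BiaddBfl.BiaddFunctor.along₂ (πH : MonoidalMorphism H.prestack 𝓗)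
    (πK : MonoidalMorphism K.prestack 𝓚) (F : BiaddFunctor S 𝓗 𝓚 𝓖)
    (s : S.obj.obj (op U)) (y : H.Pt U) : K.Pt U ⥤ 𝓖.Fib U :=
  πK.fn U ⋙ (F.functor s).obj ((πH.fn U).obj y)

lemma riso_mul₁_eq_tens (e : E.Over s y z x) (e' : E.Over s y' z x') :
    r.riso (e.mul₁ e') = tens (L := F.along₁ πH πK s z) (R := πG.fn U) (r.riso e) (r.riso e') :=
  eq_tens (L := F.along₁ πH πK s z) ((Category.assoc _ _ _).trans (r.riso_mul₁ e e'))

lemma riso_mul₂_eq_tens (e : E.Over s y z x) (e' : E.Over s y z' x') :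
    r.riso (e.mul₂ e') = tens (L := F.along₂ πH πK s y) (R := πG.fn U) (r.riso e) (r.riso e') :=
  eq_tens (L := F.along₂ πH πK s y) ((Category.assoc _ _ _).trans (r.riso_mul₂ e e'))

lemma riso_triv₁ (h : H.G₁.obj (op U)) (m : 𝟙_ (H.Pt U) ⟶ ⟨H.d h⟩) (hm : m.elt = h) :
    Sq (F.along₁ πH πK s z) (πG.fn U) m (𝟙 _) (unitFrame _ _) (r.riso (.triv₁ E s h z)) := by
  obtain ⟨g, hg⟩ := m
  dsimp only at hm
  subst hm
  have h₂ := r.iso_s₁ s g z.pt hg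
  unfold Sq
  rw [CategoryTheory.Functor.map_id, Category.comp_id]
  refine eq_unitFrame ?_
  refine Eq.trans ?_ h₂
  refine (Category.assoc _ _ _).trans (congrArg (_ ≫ ·) ?_)
  refine (Category.assoc _ _ _).symm.trans (congrArg (· ≫ _) ?_)
  exact (NatTrans.congr_app ((F.functor s).map_comp _ _) _).symm

lemma riso_triv₂ (k : K.G₁.obj (op U)) (m : 𝟙_ (K.Pt U) ⟶ ⟨K.d k⟩) (hm : m.elt = k) :
    Sq (F.along₂ πH πK s y) (πG.fn U) m (𝟙 _) (unitFrame _ _) (r.riso (.triv₂ E s y k)) := by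
  obtain ⟨g, hg⟩ := m
  dsimp only at hm
  subst hm
  have h₂ := r.iso_s₂ s y.pt g hg
  unfold Sq
  rw [CategoryTheory.Functor.map_id, Category.comp_id]
  refine eq_unitFrame ?_
  refine Eq.trans ?_ h₂
  refine (Category.assoc _ _ _).trans (congrArg (_ ≫ ·) ?_)
  refine (Category.assoc _ _ _).symm.trans (congrArg (· ≫ _) ?_)
  exact (((F.functor s).obj _).map_comp _ _).symm

lemma riso_move₁ (e : E.Over s y z x) (h : y ⟶ y') :
    bimap (F.functor s) ((πH.fn U).map h) (𝟙 _) ≫ r.riso (e.move₁ h) = r.riso e := by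
  let m : 𝟙_ (H.Pt U) ⟶ ⟨H.d h.elt⟩ := ⟨h.elt, (one_mul _).symm⟩
  have h₁ := (Sq.isoInv (Sq.rightUnitor (L := F.along₁ πH πK s z) (r.riso e))).comp
    (Sq.whiskerLeft (L := F.along₁ πH πK s z) (X' := y) (r.riso e) (r.riso_triv₁ (s := s) (z := z) h.elt m rfl))
  rw [← riso_mul₁_eq_tens] at h₁
  let h' : (y ⊗ ⟨H.d h.elt⟩ : H.Pt U) ⟶ y' := ⟨1, by simp [h.eq]⟩
  let k' : x ⊗ 𝟙_ _ ⟶ x := (ρ_ x).hom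
  have h₂ := r.riso_copy (e.mul₁ (.triv₁ E s h.elt z)) h' (𝟙 z) k' h.eq.symm rfl (mul_one _) rfl rfl
    rfl
  rw [CategoryTheory.Functor.map_id, bimap_id_right] at h₂
  have h₃ := h₁.comp (show Sq (F.along₁ πH πK s z) (πG.fn U) h' k' _ (r.riso (e.move₁ h)) from h₂)
  have e₁ : ((ρ_ y).inv ≫ y ◁ m) ≫ h' = h := Pt.hom_ext (by
    change (1 * h.elt) * 1 = h.elt
    simp)
  have e₂ : ((ρ_ x).inv ≫ x ◁ 𝟙 _) ≫ k' = 𝟙 x := by simp [k']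
  rw [e₁, e₂] at h₃
  unfold Sq at h₃
  rw [CategoryTheory.Functor.map_id, Category.comp_id] at h₃
  rw [bimap_id_right]
  exact h₃

lemma riso_move₂ (e : E.Over s y z x) (k : z ⟶ z') :
    bimap (F.functor s) (𝟙 _) ((πK.fn U).map k) ≫ r.riso (e.move₂ k) = r.riso e := by
  let m : 𝟙_ (K.Pt U) ⟶ ⟨K.d k.elt⟩ := ⟨k.elt, (one_mul _).symm⟩
  have h₁ := (Sq.isoInv (Sq.rightUnitor (L := F.along₂ πH πK s y) (r.riso e))).comp
    (Sq.whiskerLeft (L := F.along₂ πH πK s y) (X' := z) (r.riso e) (r.riso_triv₂ (s := s) (y := y) k.elt m rfl))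
  rw [← riso_mul₂_eq_tens] at h₁
  let h' : (z ⊗ ⟨K.d k.elt⟩ : K.Pt U) ⟶ z' := ⟨1, by simp [k.eq]⟩
  let k' : x ⊗ 𝟙_ _ ⟶ x := (ρ_ x).hom
  have h₂ := r.riso_copy (e.mul₂ (.triv₂ E s y k.elt)) (𝟙 y) h' k' rfl k.eq.symm (mul_one _) rfl rfl
    rfl
  rw [CategoryTheory.Functor.map_id, bimap_id_left] at h₂
  have h₃ := h₁.comp (show Sq (F.along₂ πH πK s y) (πG.fn U) h' k' _ (r.riso (e.move₂ k)) from h₂)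
  have e₁ : ((ρ_ z).inv ≫ z ◁ m) ≫ h' = k := Pt.hom_ext (by
    change (1 * k.elt) * 1 = k.elt
    simp)
  have e₂ : ((ρ_ x).inv ≫ x ◁ 𝟙 _) ≫ k' = 𝟙 x := by simp [k']
  rw [e₁, e₂] at h₃
  unfold Sq at h₃
  rw [CategoryTheory.Functor.map_id, Category.comp_id] at h₃
  rw [bimap_id_left]
  exact h₃

lemma riso_tr (h : y ⟶ y') (k : z ⟶ z') (m : x ⟶ x') (e : E.Over s y z x) :
    bimap (F.functor s) ((πH.fn U).map h) ((πK.fn U).map k) ≫ r.riso (e.tr h k m) =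
      r.riso e ≫ (πG.fn U).map m := by
  rw [Butterfly.Over.tr, riso_act, ← r.riso_move₁ e h, ← r.riso_move₂ (e.move₁ h) k]
  have e₁ := bimap_comp (F.functor s) ((πH.fn U).map h) (𝟙 _) (𝟙 _) ((πK.fn U).map k)
  rw [Category.comp_id, Category.id_comp] at e₁
  rw [e₁]
  simp only [Category.assoc]

lemma riso_one₁ : Sq (F.along₁ πH πK s z) (πG.fn U) (𝟙 _) (𝟙 _) (unitFrame _ _)
    (r.riso (.one₁ E s z)) := by
  let m : 𝟙_ (H.Pt U) ⟶ ⟨H.d 1⟩ := ⟨1, (one_mul _).symm⟩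
  let m' : (⟨H.d 1⟩ : H.Pt U) ⟶ 𝟙_ (H.Pt U) := ⟨1, by simp⟩
  have h₁ := r.riso_triv₁ (s := s) (z := z) 1 m rfl
  have h₂ := r.riso_copy (.triv₁ E s 1 z) m' (𝟙 z) (𝟙 _) (map_one H.d) rfl rfl rfl rfl rfl
  rw [CategoryTheory.Functor.map_id, bimap_id_right] at h₂
  have h₃ := h₁.comp (show Sq (F.along₁ πH πK s z) (πG.fn U) m' (𝟙 _) _ (r.riso (.one₁ E s z))
    from h₂)
  have e₁ : m ≫ m' = 𝟙 _ := Pt.hom_ext (mul_one _)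
  rwa [e₁, Category.comp_id] at h₃

lemma riso_one₂ : Sq (F.along₂ πH πK s y) (πG.fn U) (𝟙 _) (𝟙 _) (unitFrame _ _)
    (r.riso (.one₂ E s y)) := by
  let m : 𝟙_ (K.Pt U) ⟶ ⟨K.d 1⟩ := ⟨1, (one_mul _).symm⟩
  let m' : (⟨K.d 1⟩ : K.Pt U) ⟶ 𝟙_ (K.Pt U) := ⟨1, by simp⟩
  have h₁ := r.riso_triv₂ (s := s) (y := y) 1 m rfl
  have h₂ := r.riso_copy (.triv₂ E s y 1) (𝟙 y) m' (𝟙 _) rfl (map_one K.d) rfl rfl rfl rfl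
  rw [CategoryTheory.Functor.map_id, bimap_id_left] at h₂
  have h₃ := h₁.comp (show Sq (F.along₂ πH πK s y) (πG.fn U) m' (𝟙 _) _ (r.riso (.one₂ E s y))
    from h₂)
  have e₁ : m ≫ m' = 𝟙 _ := Pt.hom_ext (mul_one _)
  rwa [e₁, Category.comp_id] at h₃

end Represents

end Represents

end BiaddBfl

namespace BiaddBfl

namespace MonoidalMorphism

open Functor.LaxMonoidal Functor.OplaxMonoidal CrossedModule

/-! ### Frames of restrictions -/

variable {C : Type u} [Category.{v} C] {J : GrothendieckTopology C}
  {M : CrossedModule.{v, u, w} J} {Q : MonoidalPrestack.{v, u, v₁, u₁} C}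
  {π : MonoidalMorphism M.prestack Q} {U V W Z : C} {g : V ⟶ U} {f : W ⟶ V} {q : W ⟶ U}
  (h : f ≫ g = q)

/-- A frame over a composite, as a frame of the restriction. -/
def down {X : Q.Fib U} {y : M.Pt W} (a : π.Frame q X y) : π.Frame f ((Q.res g).obj X) y :=
  (Q.toPrestack.resCompEq h).inv.app X ≫ a

lemma down_comp {X : Q.Fib U} {y y' : M.Pt W} (a : π.Frame q X y) (m : y ⟶ y') :
    down h (a ≫ (π.fn W).map m) = down h a ≫ (π.fn W).map m :=
  (Category.assoc _ _ _).symm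

lemma down_sq {X X' : Q.Fib U} {y y' : M.Pt W} {φ : X ⟶ X'} {m : y ⟶ y'} {a : π.Frame q X y}
    {b : π.Frame q X' y'} (s : Sq (Q.res q) (π.fn W) φ m a b) :
    Sq (Q.res f) (π.fn W) ((Q.res g).map φ) m (down h a) (down h b) := by
  have e := (Q.toPrestack.resCompEq h).inv.naturality φ
  unfold Sq down at *
  dsimp only [Functor.comp_map] at e
  rw [reassoc_of% e, s, Category.assoc]

lemma μ_down {X X' : Q.Fib U} {y y' : M.Pt W} (a : π.Frame q X y) (b : π.Frame q X' y') :
    Sq (Q.res f) (π.fn W) (μ (Q.res g) X X') (𝟙 _) (tens (down h a) (down h b))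
      (down h (tens a b)) := by
  subst h
  have e₁ := NatTrans.IsMonoidal.tensor (τ := (Q.resComp g f).hom) X X'
  simp only [Functor.LaxMonoidal.comp_μ, Functor.comp_obj] at e₁
  unfold Sq
  rw [CategoryTheory.Functor.map_id, Category.comp_id]
  refine eq_tens ?_
  unfold down
  rw [Prestack.resCompEq_rfl, ← tensorHom_comp_tensorHom_assoc, ← μ_tens]
  have e₂ : μ (Q.res f) ((Q.res g).obj X) ((Q.res g).obj X') ≫ (Q.res f).map (μ (Q.res g) X X') =
      ((Q.resComp g f).inv.app X ⊗ₘ (Q.resComp g f).inv.app X') ≫ μ (Q.res (f ≫ g)) X X' ≫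
        (Q.resComp g f).hom.app (X ⊗ X') := by
    rw [e₁, tensorHom_comp_tensorHom_assoc, Iso.inv_hom_id_app, Iso.inv_hom_id_app]
    erw [id_tensorHom_id, Category.id_comp]
  rw [reassoc_of% e₂, Iso.hom_inv_id_app_assoc]

lemma ε_down : Sq (Q.res f) (π.fn W) (ε (Q.res g)) (𝟙 _) (unitFrame (Q.res f) (π.fn W))
    (down h (unitFrame (Q.res q) (π.fn W))) := by
  subst h
  have e₁ := NatTrans.IsMonoidal.unit (τ := (Q.resComp g f).hom)
  simp only [Functor.LaxMonoidal.comp_ε, Functor.comp_obj] at e₁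
  unfold Sq
  rw [CategoryTheory.Functor.map_id, Category.comp_id]
  refine eq_unitFrame ?_
  unfold down
  rw [Prestack.resCompEq_rfl, ← Category.assoc, ← e₁, Category.assoc, Iso.hom_inv_id_app_assoc,
    ε_unitFrame]

lemma resId_down {f : V ⟶ U} (h : f ≫ 𝟙 U = f) {X : Q.Fib U} {y : M.Pt V} (a : π.Frame f X y) :
    Sq (Q.res f) (π.fn V) ((Q.resId U).hom.app X) (𝟙 _) (down h a) a := by
  have e := Q.toPrestack.resCompEq_id_left f h X
  unfold Sq down
  rw [CategoryTheory.Functor.map_id, Category.comp_id,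
    ← cancel_epi ((Q.toPrestack.resCompEq h).hom.app X), Iso.hom_inv_id_app_assoc]
  exact (Category.assoc _ _ _).symm.trans ((congrArg (· ≫ a) e).trans (Category.id_comp _))

lemma resComp_down {k : Z ⟶ W} {r : Z ⟶ V} {q' : Z ⟶ U} (h₁ : k ≫ f = r) (h₂ : r ≫ g = q')
    (h₃ : k ≫ f ≫ g = q') {X : Q.Fib U} {y : M.Pt Z} (a : π.Frame q' X y) :
    Sq (Q.res k) (π.fn Z) ((Q.resComp g f).hom.app X) (𝟙 _) (down h₃ a) (down h₁ (down h₂ a)) := by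
  have e := Q.toPrestack.resCompEq_assoc rfl h₁ h₃ h₂ X
  rw [Prestack.resCompEq_rfl] at e
  unfold Sq down
  rw [CategoryTheory.Functor.map_id, Category.comp_id,
    ← cancel_epi ((Q.toPrestack.resCompEq h₃).hom.app X), Iso.hom_inv_id_app_assoc]
  refine (Category.assoc _ _ _).symm.trans ((congrArg (· ≫ _) e).trans ?_)
  refine (Category.assoc _ _ _).trans ?_
  rw [Iso.hom_inv_id_app_assoc, Iso.hom_inv_id_app_assoc]

lemma fres_down {k : Z ⟶ W} {r : Z ⟶ V} {q' : Z ⟶ U} (h₁ : k ≫ f = r) (h₂ : r ≫ g = q')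
    (h₃ : k ≫ q = q') {X : Q.Fib U} {y : M.Pt W} (a : π.Frame q X y) :
    fres h₁ (down h a) = down h₂ (fres h₃ a) := by
  have e := Q.toPrestack.resCompEq_assoc h h₁ h₃ h₂ X
  unfold fres down
  rw [← cancel_epi ((Q.toPrestack.resCompEq h₂).hom.app X), Iso.hom_inv_id_app_assoc, ← reassoc_of% e,
    ← Functor.map_comp_assoc, Iso.hom_inv_id_app_assoc]

end MonoidalMorphism

end BiaddBfl

namespace BiaddBfl

open Functor.LaxMonoidal CrossedModule MonoidalMorphism

/-! ### Framings of biadditive functors by butterflies -/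

/-- A presentation of a group-like stack by a crossed module. -/
structure MonoidalMorphism.IsPresentation {C : Type u} [Category.{v} C] {J : GrothendieckTopology C}
    {M : CrossedModule.{v, u, w} J} {Q : MonoidalPrestack.{v, u, v₁, u₁} C}
    (π : MonoidalMorphism M.prestack Q) : Prop where
  loc : π.IsLocalEquivalence J
  stack : Q.IsGroupLikeStack J

variable {C : Type u} [Category.{v} C] {J : GrothendieckTopology C}

section FrameSieve

variable {M : CrossedModule.{v, u, w} J} {Q : MonoidalPrestack.{v, u, v₁, u₁} C}
  (π : MonoidalMorphism M.prestack Q)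

/-- The sieve of the arrows over which an object has a frame. -/
def MonoidalMorphism.frameSieve {U : C} (X : Q.Fib U) : Sieve U where
  arrows V f := ∃ y : M.Pt V, Nonempty (π.Frame f X y)
  downward_closed := by
    rintro V W f ⟨y, ⟨a⟩⟩ g
    exact ⟨_, ⟨fres rfl a⟩⟩

variable {π}

lemma MonoidalMorphism.IsPresentation.frameSieve_mem (hπ : π.IsPresentation) {U : C} (X : Q.Fib U) :
    π.frameSieve X ∈ J U := by
  obtain ⟨R, hR, h⟩ := exists_frame hπ.loc X
  exact J.superset_covering (fun V f hf => h f hf) hR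

end FrameSieve

/-- The data of a biadditive functor, without its laws. -/
structure PreBiadd (S : Sheaf J (Type w)) (𝓗 : MonoidalPrestack.{v, u, v₁, u₁} C)
    (𝓚 : MonoidalPrestack.{v, u, v₂, u₂} C) (𝓖 : BraidedPrestack.{v, u, w, u₃} C) where
  val : ∀ {U : C}, S.obj.obj (op U) → 𝓗.Fib U → 𝓚.Fib U → 𝓖.Fib U
  mp : ∀ {U : C} (s : S.obj.obj (op U)) {X X' : 𝓗.Fib U} {Y Y' : 𝓚.Fib U} (_ : X ⟶ X')
    (_ : Y ⟶ Y'), val s X Y ⟶ val s X' Y'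
  m₁ : ∀ {U : C} (s : S.obj.obj (op U)) (X X' : 𝓗.Fib U) (Y : 𝓚.Fib U),
    val s X Y ⊗ val s X' Y ⟶ val s (X ⊗ X') Y
  m₂ : ∀ {U : C} (s : S.obj.obj (op U)) (X : 𝓗.Fib U) (Y Y' : 𝓚.Fib U),
    val s X Y ⊗ val s X Y' ⟶ val s X (Y ⊗ Y')
  e₁ : ∀ {U : C} (s : S.obj.obj (op U)) (Y : 𝓚.Fib U), 𝟙_ _ ⟶ val s (𝟙_ _) Y
  e₂ : ∀ {U : C} (s : S.obj.obj (op U)) (X : 𝓗.Fib U), 𝟙_ _ ⟶ val s X (𝟙_ _)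
  rs : ∀ {U V : C} (f : V ⟶ U) {s : S.obj.obj (op U)} {t : S.obj.obj (op V)}
    (_ : S.obj.map f.op s = t) (X : 𝓗.Fib U) (Y : 𝓚.Fib U),
    (𝓖.res f).obj (val s X Y) ⟶ val t ((𝓗.res f).obj X) ((𝓚.res f).obj Y)

variable {S S' S'' : Sheaf J (Type w)}
  {H K : CrossedModule.{v, u, w} J} {G : BraidedCrossedModule.{v, u, w} J}
  {𝓗 : MonoidalPrestack.{v, u, v₁, u₁} C} {𝓚 : MonoidalPrestack.{v, u, v₂, u₂} C}
  {𝓖 : BraidedPrestack.{v, u, w, u₃} C}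

/-- The data underlying a biadditive functor. -/
abbrev BiaddFunctor.pre (F : BiaddFunctor S 𝓗 𝓚 𝓖) : PreBiadd S 𝓗 𝓚 𝓖 where
  val s X Y := ((F.functor s).obj X).obj Y
  mp s _ _ _ _ a b := bimap (F.functor s) a b
  m₁ s X X' Y := bμ₁ (F.functor s) X X' Y
  m₂ s X Y Y' := bμ₂ (F.functor s) X Y Y'
  e₁ s Y := bε₁ (F.functor s) Y
  e₂ s X := bε₂ (F.functor s) X
  rs f s t h X Y := ((F.resIso f s t h).hom.app X).app Y

variable (πH : MonoidalMorphism H.prestack 𝓗) (πK : MonoidalMorphism K.prestack 𝓚)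
  (πG : MonoidalMorphism G.toCrossedModule.prestack 𝓖.toMonoidalPrestack)

/-- A coherent system of frames, given by the points of a butterfly, of a family of objects. -/
structure FrameSystem (E : Butterfly S H K G)
    (A : ∀ {U : C}, S.obj.obj (op U) → 𝓗.Fib U → 𝓚.Fib U → 𝓖.Fib U) where
  fr : ∀ {U V : C} {f : V ⟶ U} {s : S.obj.obj (op U)} {t : S.obj.obj (op V)}
    (_ : S.obj.map f.op s = t) {X : 𝓗.Fib U} {Y : 𝓚.Fib U} {y : H.Pt V} {z : K.Pt V} {x : G.Pt V}
    (_ : πH.Frame f X y) (_ : πK.Frame f Y z) (_ : E.Over t y z x), πG.Frame f (A s X Y) x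
  fr_tr : ∀ {U V : C} {f : V ⟶ U} {s : S.obj.obj (op U)} {t : S.obj.obj (op V)}
    (ht : S.obj.map f.op s = t) {X : 𝓗.Fib U} {Y : 𝓚.Fib U} {y y' : H.Pt V} {z z' : K.Pt V}
    {x x' : G.Pt V} (α : πH.Frame f X y) (β : πK.Frame f Y z) (e : E.Over t y z x) (h : y ⟶ y')
    (k : z ⟶ z') (m : x ⟶ x'),
    fr ht (α ≫ (πH.fn V).map h) (β ≫ (πK.fn V).map k) (e.tr h k m) =
      fr ht α β e ≫ (πG.fn V).map m
  fr_res : ∀ {U V W : C} {f : V ⟶ U} {g : W ⟶ V} {q : W ⟶ U} (hq : g ≫ f = q)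
    {s : S.obj.obj (op U)} {t : S.obj.obj (op V)} {r : S.obj.obj (op W)}
    (ht : S.obj.map f.op s = t) (hr : S.obj.map g.op t = r) (hr' : S.obj.map q.op s = r)
    {X : 𝓗.Fib U} {Y : 𝓚.Fib U} {y : H.Pt V} {z : K.Pt V} {x : G.Pt V} (α : πH.Frame f X y)
    (β : πK.Frame f Y z) (e : E.Over t y z x),
    fr hr' (fres hq α) (fres hq β) (e.res g hr) = fres hq (fr ht α β e)

/-- A system of frames which is compatible with the operations of a biadditive functor. -/
structure Framing (E : Butterfly S H K G) (D : PreBiadd S 𝓗 𝓚 𝓖) extends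
    FrameSystem πH πK πG E D.val where
  mp_sq : ∀ {U V : C} {f : V ⟶ U} {s : S.obj.obj (op U)} {t : S.obj.obj (op V)}
    (ht : S.obj.map f.op s = t) {X X' : 𝓗.Fib U} {Y Y' : 𝓚.Fib U} {y y' : H.Pt V} {z z' : K.Pt V}
    {x x' : G.Pt V} {a : X ⟶ X'} {b : Y ⟶ Y'} {α : πH.Frame f X y} {α' : πH.Frame f X' y'}
    {β : πK.Frame f Y z} {β' : πK.Frame f Y' z'} {h : y ⟶ y'} {k : z ⟶ z'} {m : x ⟶ x'}
    {e : E.Over t y z x} {e' : E.Over t y' z' x'}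
    (_ : Sq (𝓗.res f) (πH.fn V) a h α α') (_ : Sq (𝓚.res f) (πK.fn V) b k β β')
    (_ : e.tr h k m = e'),
    Sq (𝓖.res f) (πG.fn V) (D.mp s a b) m (fr ht α β e) (fr ht α' β' e')
  m₁_sq : ∀ {U V : C} {f : V ⟶ U} {s : S.obj.obj (op U)} {t : S.obj.obj (op V)}
    (ht : S.obj.map f.op s = t) {X X' : 𝓗.Fib U} {Y : 𝓚.Fib U} {y y' : H.Pt V} {z : K.Pt V}
    {x x' : G.Pt V} (α : πH.Frame f X y) (α' : πH.Frame f X' y') (β : πK.Frame f Y z)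
    (e : E.Over t y z x) (e' : E.Over t y' z x'),
    Sq (𝓖.res f) (πG.fn V) (D.m₁ s X X' Y) (𝟙 _) (tens (fr ht α β e) (fr ht α' β e'))
      (fr ht (tens α α') β (e.mul₁ e'))
  m₂_sq : ∀ {U V : C} {f : V ⟶ U} {s : S.obj.obj (op U)} {t : S.obj.obj (op V)}
    (ht : S.obj.map f.op s = t) {X : 𝓗.Fib U} {Y Y' : 𝓚.Fib U} {y : H.Pt V} {z z' : K.Pt V}
    {x x' : G.Pt V} (α : πH.Frame f X y) (β : πK.Frame f Y z) (β' : πK.Frame f Y' z')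
    (e : E.Over t y z x) (e' : E.Over t y z' x'),
    Sq (𝓖.res f) (πG.fn V) (D.m₂ s X Y Y') (𝟙 _) (tens (fr ht α β e) (fr ht α β' e'))
      (fr ht α (tens β β') (e.mul₂ e'))
  e₁_sq : ∀ {U V : C} {f : V ⟶ U} {s : S.obj.obj (op U)} {t : S.obj.obj (op V)}
    (ht : S.obj.map f.op s = t) {Y : 𝓚.Fib U} {z : K.Pt V} (β : πK.Frame f Y z),
    Sq (𝓖.res f) (πG.fn V) (D.e₁ s Y) (𝟙 _) (unitFrame _ _)
      (fr ht (unitFrame _ _) β (.one₁ E t z))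
  e₂_sq : ∀ {U V : C} {f : V ⟶ U} {s : S.obj.obj (op U)} {t : S.obj.obj (op V)}
    (ht : S.obj.map f.op s = t) {X : 𝓗.Fib U} {y : H.Pt V} (α : πH.Frame f X y),
    Sq (𝓖.res f) (πG.fn V) (D.e₂ s X) (𝟙 _) (unitFrame _ _)
      (fr ht α (unitFrame _ _) (.one₂ E t y))
  rs_sq : ∀ {U V W : C} {g : V ⟶ U} {f : W ⟶ V} {q : W ⟶ U} (hq : f ≫ g = q)
    {s : S.obj.obj (op U)} {t : S.obj.obj (op V)} {r : S.obj.obj (op W)}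
    (ht : S.obj.map g.op s = t) (hr : S.obj.map f.op t = r) (hr' : S.obj.map q.op s = r)
    {X : 𝓗.Fib U} {Y : 𝓚.Fib U} {y : H.Pt W} {z : K.Pt W} {x : G.Pt W} (α : πH.Frame q X y)
    (β : πK.Frame q Y z) (e : E.Over r y z x),
    Sq (𝓖.res f) (πG.fn W) (D.rs g ht X Y) (𝟙 _) (down hq (fr hr' α β e))
      (fr hr (down hq α) (down hq β) e)

section ChartSieve

/-- The sieve of the arrows over which a pair of objects has frames joined by a point of the
butterfly. -/
def chartSieve (E : Butterfly S H K G) {U : C} (s : S.obj.obj (op U)) (X : 𝓗.Fib U)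
    (Y : 𝓚.Fib U) : Sieve U where
  arrows V f := ∃ (y : H.Pt V) (z : K.Pt V) (x : G.Pt V) (_ : πH.Frame f X y)
    (_ : πK.Frame f Y z), Nonempty (E.Over (S.obj.map f.op s) y z x)
  downward_closed := by
    rintro V W f ⟨y, z, x, α, β, ⟨e⟩⟩ g
    exact ⟨_, _, _, fres rfl α, fres rfl β, ⟨e.res g (by simp)⟩⟩

variable {πH πK} (pH : πH.IsPresentation) (pK : πK.IsPresentation)
include pH pK

lemma chartSieve_mem (E : Butterfly S H K G) {U : C} (s : S.obj.obj (op U)) (X : 𝓗.Fib U)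
    (Y : 𝓚.Fib U) : chartSieve πH πK E s X Y ∈ J U := by
  refine J.transitive (J.intersection_covering (pH.frameSieve_mem X) (pK.frameSieve_mem Y)) _ ?_
  rintro V f ⟨⟨y, ⟨α⟩⟩, ⟨z, ⟨β⟩⟩⟩
  obtain ⟨R, hR, h⟩ := Butterfly.Over.exists_locally E (S.obj.map f.op s) y z
  refine J.superset_covering (fun W g hg => ?_) hR
  obtain ⟨x, ⟨e⟩⟩ := h g hg
  exact ⟨_, _, x, fres rfl α, fres rfl β, ⟨⟨e.val, by rw [e.base_eq]; simp, e.fst_eq, e.snd_eq,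
    e.sec_eq⟩⟩⟩

lemma exists_over {E : Butterfly S H K G} {U V : C} {f : V ⟶ U} {s : S.obj.obj (op U)}
    {t : S.obj.obj (op V)} (ht : S.obj.map f.op s = t) {X : 𝓗.Fib U} {Y : 𝓚.Fib U} {y : H.Pt V}
    {z : K.Pt V} (hf : (chartSieve πH πK E s X Y).arrows f) (α : πH.Frame f X y)
    (β : πK.Frame f Y z) : ∃ x : G.Pt V, Nonempty (E.Over t y z x) := by
  subst ht
  obtain ⟨y', z', x, α', β', ⟨e⟩⟩ := hf
  obtain ⟨h, -⟩ := exists_transition pH.loc pH.stack α' α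
  obtain ⟨k, -⟩ := exists_transition pK.loc pK.stack β' β
  exact ⟨x, ⟨e.tr h k (𝟙 x)⟩⟩

end ChartSieve

end BiaddBfl

namespace BiaddBfl

open Functor.LaxMonoidal CrossedModule MonoidalMorphism

variable {C : Type u} [Category.{v} C] {J : GrothendieckTopology C} {S S' S'' : Sheaf J (Type w)}
  {H K : CrossedModule.{v, u, w} J} {G : BraidedCrossedModule.{v, u, w} J}
  {𝓗 : MonoidalPrestack.{v, u, v₁, u₁} C} {𝓚 : MonoidalPrestack.{v, u, v₂, u₂} C}
  {𝓖 : BraidedPrestack.{v, u, w, u₃} C}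

namespace BiaddFunctor

variable (F : BiaddFunctor S 𝓗 𝓚 𝓖) {U V W : C}

/-- The components of the restriction isomorphisms. -/
def rs (f : V ⟶ U) {s : S.obj.obj (op U)} {t : S.obj.obj (op V)} (h : S.obj.map f.op s = t)
    (X : 𝓗.Fib U) (Y : 𝓚.Fib U) : (𝓖.res f).obj (((F.functor s).obj X).obj Y) ⟶
      ((F.functor t).obj ((𝓗.res f).obj X)).obj ((𝓚.res f).obj Y) :=
  ((F.resIso f s t h).hom.app X).app Y

lemma rs_natural (f : V ⟶ U) {s : S.obj.obj (op U)} {t : S.obj.obj (op V)}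
    (h : S.obj.map f.op s = t) {X X' : 𝓗.Fib U} {Y Y' : 𝓚.Fib U} (a : X ⟶ X') (b : Y ⟶ Y') :
    (𝓖.res f).map (bimap (F.functor s) a b) ≫ F.rs f h X' Y' =
      F.rs f h X Y ≫ bimap (F.functor t) ((𝓗.res f).map a) ((𝓚.res f).map b) := by
  have h₁ := NatTrans.congr_app ((F.resIso f s t h).hom.naturality a) Y
  have h₂ := ((F.resIso f s t h).hom.app X').naturality b
  unfold bimap rs
  dsimp at h₁ h₂
  rw [Functor.map_comp, Category.assoc, h₂, reassoc_of% h₁]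

lemma rs_id {s : S.obj.obj (op U)} (h : S.obj.map (𝟙 U).op s = s) (X : 𝓗.Fib U) (Y : 𝓚.Fib U) :
    F.rs (𝟙 U) h X Y ≫ bimap (F.functor s) ((𝓗.resId U).hom.app X) ((𝓚.resId U).hom.app Y) =
      (𝓖.resId U).hom.app _ :=
  F.resIso_id s h X Y

lemma rs_comp (f : V ⟶ U) (g : W ⟶ V) {s : S.obj.obj (op U)} {t : S.obj.obj (op V)}
    {r : S.obj.obj (op W)} (h : S.obj.map f.op s = t) (h' : S.obj.map g.op t = r)
    (h'' : S.obj.map (g ≫ f).op s = r) (X : 𝓗.Fib U) (Y : 𝓚.Fib U) :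
    F.rs (g ≫ f) h'' X Y ≫
        bimap (F.functor r) ((𝓗.resComp f g).hom.app X) ((𝓚.resComp f g).hom.app Y) =
      (𝓖.resComp f g).hom.app _ ≫ (𝓖.res g).map (F.rs f h X Y) ≫ F.rs g h' _ _ :=
  F.resIso_comp f g s t r h h' h'' X Y

lemma rs_mul₁ (f : V ⟶ U) {s : S.obj.obj (op U)} {t : S.obj.obj (op V)}
    (h : S.obj.map f.op s = t) (X X' : 𝓗.Fib U) (Y : 𝓚.Fib U) :
    μ (𝓖.res f) _ _ ≫ (𝓖.res f).map (bμ₁ (F.functor s) X X' Y) ≫ F.rs f h (X ⊗ X') Y =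
      (F.rs f h X Y ⊗ₘ F.rs f h X' Y) ≫ bμ₁ (F.functor t) _ _ _ ≫
        bimap (F.functor t) (μ (𝓗.res f) X X') (𝟙 _) := by
  have h := (F.resIso_isMonoidal₁ f s t h Y).tensor X X'
  rw [bimap_id_right]
  exact (Category.assoc _ _ _).symm.trans h

lemma rs_mul₂ (f : V ⟶ U) {s : S.obj.obj (op U)} {t : S.obj.obj (op V)}
    (h : S.obj.map f.op s = t) (X : 𝓗.Fib U) (Y Y' : 𝓚.Fib U) :
    μ (𝓖.res f) _ _ ≫ (𝓖.res f).map (bμ₂ (F.functor s) X Y Y') ≫ F.rs f h X (Y ⊗ Y') =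
      (F.rs f h X Y ⊗ₘ F.rs f h X Y') ≫ bμ₂ (F.functor t) _ _ _ ≫
        bimap (F.functor t) (𝟙 _) (μ (𝓚.res f) Y Y') := by
  have h := (F.resIso_isMonoidal₂ f s t h X).tensor Y Y'
  rw [bimap_id_left]
  exact (Category.assoc _ _ _).symm.trans h

lemma rs_one₁ (f : V ⟶ U) {s : S.obj.obj (op U)} {t : S.obj.obj (op V)}
    (h : S.obj.map f.op s = t) (Y : 𝓚.Fib U) :
    ε (𝓖.res f) ≫ (𝓖.res f).map (bε₁ (F.functor s) Y) ≫ F.rs f h (𝟙_ _) Y =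
      bε₁ (F.functor t) _ ≫ bimap (F.functor t) (ε (𝓗.res f)) (𝟙 _) := by
  have h := (F.resIso_isMonoidal₁ f s t h Y).unit
  rw [bimap_id_right]
  exact (Category.assoc _ _ _).symm.trans h

lemma rs_one₂ (f : V ⟶ U) {s : S.obj.obj (op U)} {t : S.obj.obj (op V)}
    (h : S.obj.map f.op s = t) (X : 𝓗.Fib U) :
    ε (𝓖.res f) ≫ (𝓖.res f).map (bε₂ (F.functor s) X) ≫ F.rs f h X (𝟙_ _) =
      bε₂ (F.functor t) _ ≫ bimap (F.functor t) (𝟙 _) (ε (𝓚.res f)) := by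
  have h := (F.resIso_isMonoidal₂ f s t h X).unit
  rw [bimap_id_left]
  exact (Category.assoc _ _ _).symm.trans h

end BiaddFunctor

variable {πH : MonoidalMorphism H.prestack 𝓗} {πK : MonoidalMorphism K.prestack 𝓚}
  {πG : MonoidalMorphism G.toCrossedModule.prestack 𝓖.toMonoidalPrestack}
  {E : Butterfly S H K G} {F : BiaddFunctor S 𝓗 𝓚 𝓖} (r : Represents πH πK πG E F)

namespace Represents

lemma riso_res {U V : C} (f : V ⟶ U) {s : S.obj.obj (op U)} {t : S.obj.obj (op V)}
    (ht : S.obj.map f.op s = t) {y : H.Pt U} {z : K.Pt U} {x : G.Pt U} (e : E.Over s y z x) :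
    F.rs f ht _ _ ≫ bimap (F.functor t) ((πH.fnRes f).hom.app y) ((πK.fnRes f).hom.app z) ≫
      r.riso (e.res f ht) = (𝓖.res f).map (r.riso e) ≫ (πG.fnRes f).hom.app x := by
  subst ht
  refine Eq.trans ?_ (r.iso_res f e.val s y.pt z.pt x.pt e.base_eq e.fst_eq e.snd_eq e.sec_eq
    (e.res f rfl).base_eq (e.res f rfl).fst_eq (e.res f rfl).snd_eq (e.res f rfl).sec_eq).symm
  exact congrArg (_ ≫ ·) (Category.assoc _ _ _)

lemma bε₁_one₁ {U : C} (s : S.obj.obj (op U)) (z : K.Pt U) :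
    bε₁ (F.functor s) _ ≫ bimap (F.functor s) (ε (πH.fn U)) (𝟙 _) ≫ r.riso (.one₁ E s z) =
      ε (πG.fn U) := by
  have h := r.riso_one₁ (s := s) (z := z)
  unfold Sq at h
  rw [CategoryTheory.Functor.map_id, CategoryTheory.Functor.map_id, Category.id_comp,
    Category.comp_id] at h
  refine Eq.trans ?_ (ε_unitFrame (L := F.along₁ πH πK s z))
  rw [← h, bimap_id_right]
  exact (Category.assoc _ _ _).symm

lemma bε₂_one₂ {U : C} (s : S.obj.obj (op U)) (y : H.Pt U) :
    bε₂ (F.functor s) _ ≫ bimap (F.functor s) (𝟙 _) (ε (πK.fn U)) ≫ r.riso (.one₂ E s y) =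
      ε (πG.fn U) := by
  have h := r.riso_one₂ (s := s) (y := y)
  unfold Sq at h
  rw [CategoryTheory.Functor.map_id, CategoryTheory.Functor.map_id, Category.id_comp,
    Category.comp_id] at h
  refine Eq.trans ?_ (ε_unitFrame (L := F.along₂ πH πK s y))
  rw [← h, bimap_id_left]
  exact (Category.assoc _ _ _).symm

/-- The system of frames of a represented biadditive functor. -/
def frameSystem : FrameSystem πH πK πG E F.pre.val where
  fr {_ _ f _ t} ht {X Y _ _ _} α β e := F.rs f ht X Y ≫ bimap (F.functor t) α β ≫ r.riso e
  fr_tr {U V f s t} ht {X Y y y' z z' x x'} α β e h k m := by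
    rw [bimap_comp, Category.assoc, riso_tr]
    simp only [Category.assoc]
  fr_res {U V W f g q} hq {s t t'} ht hr hr' {X Y y z x} α β e := by
    subst hq
    unfold fres
    rw [Prestack.resCompEq_rfl, Prestack.resCompEq_rfl, Prestack.resCompEq_rfl]
    refine (congrArg (_ ≫ ·) (congrArg (· ≫ _) (bimap_comp _ _ _ _ _))).trans ?_
    refine (congrArg (_ ≫ ·) (Category.assoc _ _ _)).trans ((Category.assoc _ _ _).symm.trans ?_)
    refine (congrArg (· ≫ _) (F.rs_comp f g ht hr hr' X Y)).trans ?_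
    refine (Category.assoc _ _ _).trans (congrArg (_ ≫ ·) ?_)
    rw [bimap_comp]
    simp only [Category.assoc, Functor.map_comp]
    rw [← r.riso_res g hr e, ← reassoc_of% F.rs_natural g hr α β]

/-- The framing of a represented biadditive functor. -/
def framing : Framing πH πK πG E F.pre where
  toFrameSystem := r.frameSystem
  mp_sq {U V f s t} ht {X X' Y Y' y y' z z' x x' a b α α' β β' h k m e e'} ha hb he := by
    subst he
    have h₁ := r.frameSystem.fr_tr ht α β e h k m
    unfold Sq at *
    refine Eq.trans ?_ h₁
    refine (Category.assoc _ _ _).symm.trans ((congrArg (· ≫ _) (F.rs_natural f ht a b)).trans ?_)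
    refine (Category.assoc _ _ _).trans (congrArg (_ ≫ ·) ?_)
    refine (Category.assoc _ _ _).symm.trans (congrArg (· ≫ _) ?_)
    rw [← bimap_comp, ha, hb]
  m₁_sq {U V f s t} ht {X X' Y y y' z x x'} α α' β e e' := by
    unfold Sq
    rw [CategoryTheory.Functor.map_id, Category.comp_id]
    refine eq_tens ?_
    have h₁ := F.rs_mul₁ f ht X X' Y
    have h₂ := r.riso_mul₁ e e'
    rw [← bimap_id_right] at h₂
    have h₃ : bimap (F.functor t) (μ (𝓗.res f) X X') (𝟙 _) ≫ bimap (F.functor t) (tens α α') β =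
        bimap (F.functor t) (α ⊗ₘ α') β ≫ bimap (F.functor t) (μ (πH.fn V) y y') (𝟙 _) := by
      rw [← bimap_comp, ← bimap_comp, μ_tens, Category.id_comp, Category.comp_id]
    refine (congrArg (_ ≫ ·) (Category.assoc _ _ _).symm).trans
      ((Category.assoc _ _ _).symm.trans ((congrArg (· ≫ _) h₁).trans ?_))
    rw [Category.assoc, Category.assoc, reassoc_of% h₃, reassoc_of% bμ₁_natural, h₂]
    refine Eq.trans ?_ (congrArg (· ≫ _) (tensorHom_comp_tensorHom _ _ _ _))
    rw [← tensorHom_comp_tensorHom]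
    simp only [Category.assoc]
  m₂_sq {U V f s t} ht {X Y Y' y z z' x x'} α β β' e e' := by
    unfold Sq
    rw [CategoryTheory.Functor.map_id, Category.comp_id]
    refine eq_tens ?_
    have h₁ := F.rs_mul₂ f ht X Y Y'
    have h₂ := r.riso_mul₂ e e'
    rw [← bimap_id_left] at h₂
    have h₃ : bimap (F.functor t) (𝟙 _) (μ (𝓚.res f) Y Y') ≫ bimap (F.functor t) α (tens β β') =
        bimap (F.functor t) α (β ⊗ₘ β') ≫ bimap (F.functor t) (𝟙 _) (μ (πK.fn V) z z') := by
      rw [← bimap_comp, ← bimap_comp, μ_tens, Category.id_comp, Category.comp_id]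
    refine (congrArg (_ ≫ ·) (Category.assoc _ _ _).symm).trans
      ((Category.assoc _ _ _).symm.trans ((congrArg (· ≫ _) h₁).trans ?_))
    rw [Category.assoc, Category.assoc, reassoc_of% h₃, reassoc_of% bμ₂_natural, h₂]
    refine Eq.trans ?_ (congrArg (· ≫ _) (tensorHom_comp_tensorHom _ _ _ _))
    rw [← tensorHom_comp_tensorHom]
    simp only [Category.assoc]
  e₁_sq {U V f s t} ht {Y z} β := by
    unfold Sq
    rw [CategoryTheory.Functor.map_id, Category.comp_id]
    refine eq_unitFrame ?_
    have h₁ := F.rs_one₁ f ht Y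
    have h₃ : bimap (F.functor t) (ε (𝓗.res f)) (𝟙 _) ≫
        bimap (F.functor t) (unitFrame (𝓗.res f) (πH.fn V)) β =
        bimap (F.functor t) (𝟙 _) β ≫ bimap (F.functor t) (ε (πH.fn V)) (𝟙 _) := by
      rw [← bimap_comp, ← bimap_comp, ε_unitFrame, Category.id_comp, Category.comp_id,
        Category.id_comp]
    refine (congrArg (_ ≫ ·) (Category.assoc _ _ _).symm).trans
      ((Category.assoc _ _ _).symm.trans ((congrArg (· ≫ _) h₁).trans ?_))
    rw [Category.assoc, reassoc_of% h₃, reassoc_of% bε₁_natural, bε₁_one₁]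
  e₂_sq {U V f s t} ht {X y} α := by
    unfold Sq
    rw [CategoryTheory.Functor.map_id, Category.comp_id]
    refine eq_unitFrame ?_
    have h₁ := F.rs_one₂ f ht X
    have h₃ : bimap (F.functor t) (𝟙 _) (ε (𝓚.res f)) ≫
        bimap (F.functor t) α (unitFrame (𝓚.res f) (πK.fn V)) =
        bimap (F.functor t) α (𝟙 _) ≫ bimap (F.functor t) (𝟙 _) (ε (πK.fn V)) := by
      rw [← bimap_comp, ← bimap_comp, ε_unitFrame, Category.id_comp, Category.comp_id,
        Category.id_comp]
    refine (congrArg (_ ≫ ·) (Category.assoc _ _ _).symm).trans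
      ((Category.assoc _ _ _).symm.trans ((congrArg (· ≫ _) h₁).trans ?_))
    rw [Category.assoc, reassoc_of% h₃, reassoc_of% bε₂_natural, bε₂_one₂]
  rs_sq {U V W g f q} hq {s t t'} ht hr hr' {X Y y z x} α β e := by
    subst hq
    have h₁ := F.rs_comp g f ht hr hr' X Y
    unfold Sq down
    rw [CategoryTheory.Functor.map_id, Category.comp_id, Prestack.resCompEq_rfl,
      Prestack.resCompEq_rfl, Prestack.resCompEq_rfl]
    change (𝓖.res f).map (F.rs g ht X Y) ≫ F.rs f hr _ _ ≫ bimap _ (_ ≫ α) (_ ≫ β) ≫ r.riso e =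
      (𝓖.resComp g f).inv.app _ ≫ F.rs (f ≫ g) hr' X Y ≫ bimap _ α β ≫ r.riso e
    rw [bimap_comp, ← cancel_epi ((𝓖.resComp g f).hom.app _), Iso.hom_inv_id_app_assoc]
    refine (congrArg (_ ≫ ·) (Category.assoc _ _ _).symm).trans
      ((Category.assoc _ _ _).symm.trans ((congrArg (· ≫ _) h₁.symm).trans ?_))
    refine (Category.assoc _ _ _).trans (congrArg (_ ≫ ·) ?_)
    refine (Category.assoc _ _ _).symm.trans (congrArg (· ≫ _) ?_)
    refine (Category.assoc _ _ _).symm.trans ((congrArg (· ≫ _) (bimap_comp _ _ _ _ _).symm).trans ?_)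
    rw [Iso.hom_inv_id_app, Iso.hom_inv_id_app, bimap_id, Category.id_comp]

end Represents

end BiaddBfl

namespace BiaddBfl

open Functor.LaxMonoidal CrossedModule MonoidalMorphism

variable {C : Type u} [Category.{v} C] {J : GrothendieckTopology C} {S S' S'' : Sheaf J (Type w)}
  {H K : CrossedModule.{v, u, w} J} {G : BraidedCrossedModule.{v, u, w} J}
  {𝓗 : MonoidalPrestack.{v, u, v₁, u₁} C} {𝓚 : MonoidalPrestack.{v, u, v₂, u₂} C}
  {𝓖 : BraidedPrestack.{v, u, w, u₃} C}

lemma Sq.congr {𝒜 : Type*} [Category* 𝒜] {ℬ : Type*} [Category* ℬ] {𝒬 : Type*} [Category* 𝒬]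
    {L : 𝒜 ⥤ ℬ} {R : 𝒬 ⥤ ℬ} {X Y : 𝒜} {p q : 𝒬} {φ : X ⟶ Y} {g g' : p ⟶ q}
    {a : L.obj X ⟶ R.obj p} {b : L.obj Y ⟶ R.obj q} (h : Sq L R φ g a b) (hg : g = g') :
    Sq L R φ g' a b :=
  hg ▸ h

/-! ### Morphisms of butterflies and points -/

namespace Butterfly.HomOver

variable {p : S' ⟶ S} {E' : Butterfly S' H K G} {E : Butterfly S H K G} (φ : HomOver p E' E)
  {U V : C} {s : S'.obj.obj (op U)} {y y' : H.Pt U} {z z' : K.Pt U} {x x' : G.Pt U}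

/-- The action of a morphism of butterflies on points. -/
def onOver (e : E'.Over s y z x) : E.Over (p.hom.app (op U) s) y z x where
  val := φ.app e.val
  base_eq := by rw [φ.base, e.base_eq]
  fst_eq := by rw [φ.fst, e.fst_eq]
  snd_eq := by rw [φ.snd, e.snd_eq]
  sec_eq := by rw [φ.sec, e.sec_eq]

lemma onOver_act (e : E'.Over s y z x) (m : x ⟶ x') : φ.onOver (e.act m) = (φ.onOver e).act m :=
  Over.ext (φ.act _ _)

lemma onOver_mul₁ (e : E'.Over s y z x) (e' : E'.Over s y' z x') :
    φ.onOver (e.mul₁ e') = (φ.onOver e).mul₁ (φ.onOver e') :=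
  Over.ext (φ.mul₁ _ _ _ _)

lemma onOver_mul₂ (e : E'.Over s y z x) (e' : E'.Over s y z' x') :
    φ.onOver (e.mul₂ e') = (φ.onOver e).mul₂ (φ.onOver e') :=
  Over.ext (φ.mul₂ _ _ _ _)

lemma onOver_triv₁ (h : H.G₁.obj (op U)) : φ.onOver (.triv₁ E' s h z) = .triv₁ E _ h z :=
  Over.ext (φ.s₁ _ _ _)

lemma onOver_triv₂ (k : K.G₁.obj (op U)) : φ.onOver (.triv₂ E' s y k) = .triv₂ E _ y k :=
  Over.ext (φ.s₂ _ _ _)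

lemma onOver_move₁ (e : E'.Over s y z x) (h : y ⟶ y') : φ.onOver (e.move₁ h) = (φ.onOver e).move₁ h := by
  refine Over.ext ?_
  refine (congrArg Over.val (φ.onOver_mul₁ e (.triv₁ E' s h.elt z))).trans ?_
  rw [onOver_triv₁]
  rfl

lemma onOver_move₂ (e : E'.Over s y z x) (k : z ⟶ z') : φ.onOver (e.move₂ k) = (φ.onOver e).move₂ k := by
  refine Over.ext ?_
  refine (congrArg Over.val (φ.onOver_mul₂ e (.triv₂ E' s y k.elt))).trans ?_
  rw [onOver_triv₂]
  rfl

lemma onOver_tr (h : y ⟶ y') (k : z ⟶ z') (m : x ⟶ x') (e : E'.Over s y z x) :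
    φ.onOver (e.tr h k m) = (φ.onOver e).tr h k m := by
  rw [Over.tr, onOver_act, onOver_move₂, onOver_move₁, Over.tr]

lemma onOver_one₁ : φ.onOver (.one₁ E' s z) = .one₁ E _ z :=
  Over.ext (φ.s₁ _ _ _)

lemma onOver_one₂ : φ.onOver (.one₂ E' s y) = .one₂ E _ y :=
  Over.ext (φ.s₂ _ _ _)

lemma onOver_res (e : E'.Over s y z x) (f : V ⟶ U) {t : S'.obj.obj (op V)}
    (ht : S'.obj.map f.op s = t) :
    φ.onOver (e.res f ht) = (φ.onOver e).res f (BiaddFunctor.hom_res f ht) :=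
  Over.ext (φ.res _ _)

end Butterfly.HomOver

/-! ### Construction of morphisms -/

/-- A pair of frames joined by a point of the butterfly. -/
structure Chart (πH : MonoidalMorphism H.prestack 𝓗) (πK : MonoidalMorphism K.prestack 𝓚)
    (E : Butterfly S H K G) {U V : C} (f : V ⟶ U) (s : S.obj.obj (op U)) (X : 𝓗.Fib U)
    (Y : 𝓚.Fib U) where
  {y : H.Pt V}
  {z : K.Pt V}
  {x : G.Pt V}
  α : πH.Frame f X y
  β : πK.Frame f Y z
  e : E.Over (S.obj.map f.op s) y z x

variable {πH : MonoidalMorphism H.prestack 𝓗} {πK : MonoidalMorphism K.prestack 𝓚}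
  {πG : MonoidalMorphism G.toCrossedModule.prestack 𝓖.toMonoidalPrestack}
  (pH : πH.IsPresentation) (pK : πK.IsPresentation)
  (h𝓖 : 𝓖.toMonoidalPrestack.IsGroupLikeStack J)

section

variable {p : S' ⟶ S} {E' : Butterfly S' H K G} {E : Butterfly S H K G}
  {A' : ∀ {U : C}, S'.obj.obj (op U) → 𝓗.Fib U → 𝓚.Fib U → 𝓖.Fib U}
  {A : ∀ {U : C}, S.obj.obj (op U) → 𝓗.Fib U → 𝓚.Fib U → 𝓖.Fib U}
  (φ : Butterfly.HomOver p E' E) (Φ' : FrameSystem πH πK πG E' A') (Φ : FrameSystem πH πK πG E A)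

include pH pK h𝓖 in
lemma FrameSystem.existsUnique_hom {U : C} (s : S'.obj.obj (op U)) {X X' : 𝓗.Fib U}
    {Y Y' : 𝓚.Fib U} (a : X ⟶ X') (b : Y ⟶ Y') :
    ∃! θ : A' s X Y ⟶ A (p.hom.app (op U) s) X' Y', ∀ {V : C} {f : V ⟶ U} {t : S'.obj.obj (op V)}
      (ht : S'.obj.map f.op s = t) {y : H.Pt V} {z : K.Pt V} {x : G.Pt V} (α : πH.Frame f X' y)
      (β : πK.Frame f Y' z) (e : E'.Over t y z x),
      (𝓖.res f).map θ ≫ Φ.fr (BiaddFunctor.hom_res f ht) α β (φ.onOver e) =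
        Φ'.fr ht ((𝓗.res f).map a ≫ α) ((𝓚.res f).map b ≫ β) e := by
  obtain ⟨θ, hθ, hu⟩ := existsUnique_of_frames (π := πG) h𝓖 (A := A' s X Y)
    (B := A (p.hom.app (op U) s) X' Y')
    (fun {V} f => Chart πH πK E' f s X' Y') (fun τ => τ.x)
    (fun {V f} τ => Φ'.fr rfl ((𝓗.res f).map a ≫ τ.α) ((𝓚.res f).map b ≫ τ.β) τ.e)
    (fun {V f} τ => Φ.fr (BiaddFunctor.hom_res f rfl) τ.α τ.β (φ.onOver τ.e))
    (fun {V f} τ τ' => by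
      obtain ⟨h, hh⟩ := exists_transition pH.loc pH.stack τ.α τ'.α
      obtain ⟨k, hk⟩ := exists_transition pK.loc pK.stack τ.β τ'.β
      obtain ⟨m, hm⟩ := Butterfly.Over.exists_tr h k τ.e τ'.e
      refine ⟨m, ?_, ?_⟩
      · rw [← Φ'.fr_tr rfl _ _ τ.e h k m, hm, Category.assoc, Category.assoc, hh, hk]
      · rw [← Φ.fr_tr _ _ _ (φ.onOver τ.e) h k m, ← φ.onOver_tr, hm, hh, hk])
    (fun {V W f} τ g q hq => by
      have hr : S'.obj.map g.op (S'.obj.map f.op s) = S'.obj.map q.op s := by rw [← hq]; simp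
      refine ⟨⟨fres hq τ.α, fres hq τ.β, τ.e.res g hr⟩, 𝟙 _, ?_, ?_⟩
      · rw [CategoryTheory.Functor.map_id, Category.comp_id, ← Φ'.fr_res hq rfl hr rfl,
          fres_res_map_comp, fres_res_map_comp]
      · rw [CategoryTheory.Functor.map_id, Category.comp_id,
          ← Φ.fr_res hq _ (BiaddFunctor.hom_res g hr), φ.onOver_res])
    ⟨_, chartSieve_mem pH pK E' s X' Y', fun f hf => by
      obtain ⟨y, z, x, α, β, ⟨e⟩⟩ := hf
      exact ⟨⟨α, β, e⟩⟩⟩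
  refine ⟨θ, fun {V f t} ht {y z x} α β e => ?_, fun θ' h => hu θ' fun τ => h rfl τ.α τ.β τ.e⟩
  subst ht
  exact hθ ⟨α, β, e⟩

end

/-- A morphism of systems of frames, over a morphism of butterflies. -/
def FrameHom {p : S' ⟶ S} {E' : Butterfly S' H K G} {E : Butterfly S H K G}
    {F' : BiaddFunctor S' 𝓗 𝓚 𝓖} {F : BiaddFunctor S 𝓗 𝓚 𝓖} (φ : Butterfly.HomOver p E' E)
    (Φ' : Framing πH πK πG E' F'.pre) (Φ : Framing πH πK πG E F.pre)
    (Θ : BiaddFunctor.HomOver p F' F) : Prop :=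
  ∀ {U V : C} {f : V ⟶ U} {s : S'.obj.obj (op U)} {t : S'.obj.obj (op V)}
    (ht : S'.obj.map f.op s = t) {X : 𝓗.Fib U} {Y : 𝓚.Fib U} {y : H.Pt V} {z : K.Pt V}
    {x : G.Pt V} (α : πH.Frame f X y) (β : πK.Frame f Y z) (e : E'.Over t y z x),
    Sq (𝓖.res f) (πG.fn V) (((Θ.app s).app X).app Y) (𝟙 _) (Φ'.fr ht α β e)
      (Φ.fr (BiaddFunctor.hom_res f ht) α β (φ.onOver e))

section

variable {p : S' ⟶ S} {E' : Butterfly S' H K G} {E : Butterfly S H K G}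
  {F' : BiaddFunctor S' 𝓗 𝓚 𝓖} {F : BiaddFunctor S 𝓗 𝓚 𝓖} (φ : Butterfly.HomOver p E' E)
  (Φ' : Framing πH πK πG E' F'.pre) (Φ : Framing πH πK πG E F.pre)

include pH pK h𝓖

lemma exists_frameHom : ∃ Θ : BiaddFunctor.HomOver p F' F, FrameHom φ Φ' Φ Θ := by
  have key {U : C} (s : S'.obj.obj (op U)) (X : 𝓗.Fib U) (Y : 𝓚.Fib U) :
      ∃ θ : F'.pre.val s X Y ⟶ F.pre.val (p.hom.app (op U) s) X Y,
        ∀ {V : C} {f : V ⟶ U} {t : S'.obj.obj (op V)}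
          (ht : S'.obj.map f.op s = t) {y : H.Pt V} {z : K.Pt V} {x : G.Pt V}
          (α : πH.Frame f X y) (β : πK.Frame f Y z) (e : E'.Over t y z x),
          Sq (𝓖.res f) (πG.fn V) θ (𝟙 _) (Φ'.fr ht α β e)
            (Φ.fr (BiaddFunctor.hom_res f ht) α β (φ.onOver e)) := by
    obtain ⟨θ, hθ, -⟩ := FrameSystem.existsUnique_hom pH pK h𝓖 φ Φ'.toFrameSystem Φ.toFrameSystem s
      (𝟙 X) (𝟙 Y)
    refine ⟨θ, fun {V f t} ht {y z x} α β e => ?_⟩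
    unfold Sq
    rw [CategoryTheory.Functor.map_id, Category.comp_id]
    refine (hθ ht α β e).trans ?_
    rw [CategoryTheory.Functor.map_id, CategoryTheory.Functor.map_id, Category.id_comp,
      Category.id_comp]
  choose θ hθ using @key
  have natural {U : C} (s : S'.obj.obj (op U)) {X X' : 𝓗.Fib U} {Y Y' : 𝓚.Fib U} (a : X ⟶ X')
      (b : Y ⟶ Y') : F'.pre.mp s a b ≫ θ s X' Y' = θ s X Y ≫ F.pre.mp _ a b := by
    refine hom_ext_of_sq (π := πG) h𝓖 (J.intersection_covering (chartSieve_mem pH pK E' s X Y)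
      (J.intersection_covering (pH.frameSieve_mem X') (pK.frameSieve_mem Y'))) ?_
    rintro V f ⟨⟨y, z, x, α, β, ⟨e⟩⟩, ⟨y', ⟨α'⟩⟩, ⟨z', ⟨β'⟩⟩⟩
    obtain ⟨h, hh⟩ := exists_sq pH.loc pH.stack a α α'
    obtain ⟨k, hk⟩ := exists_sq pK.loc pK.stack b β β'
    refine ⟨_, _, _, _, _, (Φ'.mp_sq rfl hh hk rfl).comp (hθ s X' Y' rfl α' β' (e.tr h k (𝟙 x))),
      (hθ s X Y rfl α β e).comp (Φ.mp_sq _ hh hk ?_)⟩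
    rw [φ.onOver_tr]
  have mul₁ {U : C} (s : S'.obj.obj (op U)) (X X' : 𝓗.Fib U) (Y : 𝓚.Fib U) :
      F'.pre.m₁ s X X' Y ≫ θ s (X ⊗ X') Y = (θ s X Y ⊗ₘ θ s X' Y) ≫ F.pre.m₁ _ X X' Y := by
    refine hom_ext_of_sq (π := πG) h𝓖 (J.intersection_covering (chartSieve_mem pH pK E' s X Y)
      (chartSieve_mem pH pK E' s X' Y)) ?_
    rintro V f ⟨⟨y, z, x, α, β, ⟨e⟩⟩, hf'⟩
    obtain ⟨y', -, -, α', -, -⟩ := id hf'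
    obtain ⟨x', ⟨e'⟩⟩ := exists_over pH pK rfl hf' α' β
    have h := hθ _ _ _ rfl (tens α α') β (e.mul₁ e')
    rw [φ.onOver_mul₁] at h
    refine ⟨_, _, _, _, 𝟙 _, ((Φ'.m₁_sq rfl α α' β e e').comp h).congr (by simp),
      (((hθ s X Y rfl α β e).tens (hθ s X' Y rfl α' β e')).comp
        (Φ.m₁_sq _ α α' β (φ.onOver e) (φ.onOver e'))).congr (by simp)⟩
  have mul₂ {U : C} (s : S'.obj.obj (op U)) (X : 𝓗.Fib U) (Y Y' : 𝓚.Fib U) :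
      F'.pre.m₂ s X Y Y' ≫ θ s X (Y ⊗ Y') = (θ s X Y ⊗ₘ θ s X Y') ≫ F.pre.m₂ _ X Y Y' := by
    refine hom_ext_of_sq (π := πG) h𝓖 (J.intersection_covering (chartSieve_mem pH pK E' s X Y)
      (chartSieve_mem pH pK E' s X Y')) ?_
    rintro V f ⟨⟨y, z, x, α, β, ⟨e⟩⟩, hf'⟩
    obtain ⟨-, z', -, -, β', -⟩ := id hf'
    obtain ⟨x', ⟨e'⟩⟩ := exists_over pH pK rfl hf' α β'
    have h := hθ _ _ _ rfl α (tens β β') (e.mul₂ e')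
    rw [φ.onOver_mul₂] at h
    refine ⟨_, _, _, _, 𝟙 _, ((Φ'.m₂_sq rfl α β β' e e').comp h).congr (by simp),
      (((hθ s X Y rfl α β e).tens (hθ s X Y' rfl α β' e')).comp
        (Φ.m₂_sq _ α β β' (φ.onOver e) (φ.onOver e'))).congr (by simp)⟩
  have one₁ {U : C} (s : S'.obj.obj (op U)) (Y : 𝓚.Fib U) :
      F'.pre.e₁ s Y ≫ θ s (𝟙_ _) Y = F.pre.e₁ _ Y := by
    refine hom_ext_of_sq (π := πG) h𝓖 (pK.frameSieve_mem Y) ?_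
    rintro V f ⟨z, ⟨β⟩⟩
    refine ⟨_, _, _, _, _, (Φ'.e₁_sq rfl β).comp (hθ _ _ _ rfl _ β _), ?_⟩
    rw [φ.onOver_one₁, Category.comp_id]
    exact Φ.e₁_sq _ β
  have one₂ {U : C} (s : S'.obj.obj (op U)) (X : 𝓗.Fib U) :
      F'.pre.e₂ s X ≫ θ s X (𝟙_ _) = F.pre.e₂ _ X := by
    refine hom_ext_of_sq (π := πG) h𝓖 (pH.frameSieve_mem X) ?_
    rintro V f ⟨y, ⟨α⟩⟩
    refine ⟨_, _, _, _, _, (Φ'.e₂_sq rfl α).comp (hθ _ _ _ rfl α _ _), ?_⟩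
    rw [φ.onOver_one₂, Category.comp_id]
    exact Φ.e₂_sq _ α
  have res {U V : C} (g : V ⟶ U) (s : S'.obj.obj (op U)) (t : S'.obj.obj (op V))
      (ht : S'.obj.map g.op s = t) (h' : S.obj.map g.op (p.hom.app (op U) s) = p.hom.app (op V) t)
      (X : 𝓗.Fib U) (Y : 𝓚.Fib U) :
      F'.pre.rs g ht X Y ≫ θ t _ _ = (𝓖.res g).map (θ s X Y) ≫ F.pre.rs g h' X Y := by
    refine hom_ext_of_sq (π := πG) h𝓖 (J.pullback_stable g (chartSieve_mem pH pK E' s X Y)) ?_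
    rintro W f ⟨y, z, x, α, β, ⟨e⟩⟩
    have hr : S'.obj.map f.op t = S'.obj.map (f ≫ g).op s := by rw [← ht]; simp
    exact ⟨_, _, _, _, _, (Φ'.rs_sq rfl ht hr rfl α β e).comp (hθ t _ _ hr _ _ e),
      (down_sq rfl (hθ s X Y rfl α β e)).comp (Φ.rs_sq rfl h' _ _ α β (φ.onOver e))⟩
  refine ⟨{
    app := fun {U} s =>
      { app := fun X =>
          { app := fun Y => θ s X Y
            naturality := fun Y Y' b => by
              have h := natural s (𝟙 X) b
              dsimp only [BiaddFunctor.pre] at h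
              rwa [bimap_id_left, bimap_id_left] at h }
        naturality := fun X X' a => NatTrans.ext (funext fun Y => by
          have h := natural s a (𝟙 Y)
          dsimp only [BiaddFunctor.pre] at h
          rwa [bimap_id_right, bimap_id_right] at h) }
    isMonoidal₁ := fun s Y => { unit := one₁ s Y, tensor := fun X X' => mul₁ s X X' Y }
    isMonoidal₂ := fun s X => { unit := one₂ s X, tensor := fun Y Y' => mul₂ s X Y Y' }
    res := fun f s t h h' X Y => res f s t h h' X Y }, fun ht => hθ _ _ _ ht⟩

lemma FrameHom.unique {Θ Θ' : BiaddFunctor.HomOver p F' F} (h : FrameHom φ Φ' Φ Θ)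
    (h' : FrameHom φ Φ' Φ Θ') : Θ = Θ' := by
  refine BiaddFunctor.HomOver.ext (funext fun U => funext fun s => NatTrans.ext (funext fun X =>
    NatTrans.ext (funext fun Y => ?_)))
  refine hom_ext_of_sq (π := πG) h𝓖 (chartSieve_mem pH pK E' s X Y) ?_
  rintro V f ⟨y, z, x, α, β, ⟨e⟩⟩
  exact ⟨_, _, _, _, _, h rfl α β e, h' rfl α β e⟩

end

section Represents

variable {p : S' ⟶ S} {E' : Butterfly S' H K G} {E : Butterfly S H K G}
  {F' : BiaddFunctor S' 𝓗 𝓚 𝓖} {F : BiaddFunctor S 𝓗 𝓚 𝓖} (φ : Butterfly.HomOver p E' E)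
  (r' : Represents πH πK πG E' F') (r : Represents πH πK πG E F)

/-- The morphism of biadditive functors is given on points by the morphism of butterflies. -/
def Represents.Compat (Θ : BiaddFunctor.HomOver p F' F) : Prop :=
  ∀ {U : C} {s : S'.obj.obj (op U)} {y : H.Pt U} {z : K.Pt U} {x : G.Pt U} (e : E'.Over s y z x),
    ((Θ.app s).app ((πH.fn U).obj y)).app ((πK.fn U).obj z) ≫ r.riso (φ.onOver e) = r'.riso e

variable {φ r r'} {Θ : BiaddFunctor.HomOver p F' F}

lemma _root_.BiaddBfl.BiaddFunctor.HomOver.bimap_app (Θ : BiaddFunctor.HomOver p F' F) {U : C}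
    (s : S'.obj.obj (op U)) {X X' : 𝓗.Fib U} {Y Y' : 𝓚.Fib U} (a : X ⟶ X') (b : Y ⟶ Y') :
    bimap (F'.functor s) a b ≫ ((Θ.app s).app X').app Y' =
      ((Θ.app s).app X).app Y ≫ bimap (F.functor _) a b := by
  have h := NatTrans.congr_app ((Θ.app s).naturality a) Y
  dsimp at h
  unfold bimap
  rw [Category.assoc, NatTrans.naturality, reassoc_of% h]

lemma Represents.Compat.frameHom (h : r'.Compat φ r Θ) : FrameHom φ r'.framing r.framing Θ := by
  intro U V f s t ht X Y y z x α β e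
  have h₁ := Θ.res f s t ht (BiaddFunctor.hom_res f ht) X Y
  unfold Sq
  rw [CategoryTheory.Functor.map_id, Category.comp_id]
  change (𝓖.res f).map _ ≫ F.rs f _ X Y ≫ bimap _ α β ≫ r.riso (φ.onOver e) =
    F'.rs f ht X Y ≫ bimap _ α β ≫ r'.riso e
  rw [← h e, reassoc_of% Θ.bimap_app t α β]
  refine (Category.assoc _ _ _).symm.trans ((congrArg (· ≫ _) h₁.symm).trans ?_)
  exact Category.assoc _ _ _

lemma Represents.framing_fr_id {U : C} {s : S.obj.obj (op U)} (hs : S.obj.map (𝟙 U).op s = s)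
    {y : H.Pt U} {z : K.Pt U} {x : G.Pt U} (e : E.Over s y z x) :
    r.framing.fr hs ((𝓗.resId U).hom.app ((πH.fn U).obj y))
      ((𝓚.resId U).hom.app ((πK.fn U).obj z)) e = (𝓖.resId U).hom.app _ ≫ r.riso e := by
  change F.rs (𝟙 U) hs _ _ ≫ bimap _ _ _ ≫ r.riso e = _
  exact (Category.assoc _ _ _).symm.trans (congrArg (· ≫ _) (F.rs_id hs _ _))

lemma FrameHom.compat (h : FrameHom φ r'.framing r.framing Θ) : r'.Compat φ r Θ := by
  intro U s y z x e
  have hs : S'.obj.map (𝟙 U).op s = s := by simp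
  have h₁ := h hs ((𝓗.resId U).hom.app ((πH.fn U).obj y)) ((𝓚.resId U).hom.app ((πK.fn U).obj z)) e
  unfold Sq at h₁
  rw [CategoryTheory.Functor.map_id, Category.comp_id, r'.framing_fr_id, r.framing_fr_id] at h₁
  have h₂ := (𝓖.resId U).hom.naturality (((Θ.app s).app ((πH.fn U).obj y)).app ((πK.fn U).obj z))
  rw [← cancel_epi ((𝓖.resId U).hom.app _)]
  refine Eq.trans ?_ h₁
  exact (Category.assoc _ _ _).symm.trans ((congrArg (· ≫ _) h₂.symm).trans (Category.assoc _ _ _))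

variable (φ r r')

include pH pK h𝓖 in
lemma Represents.existsUnique_compat : ∃! Θ : BiaddFunctor.HomOver p F' F, r'.Compat φ r Θ := by
  obtain ⟨Θ, hΘ⟩ := exists_frameHom pH pK h𝓖 φ r'.framing r.framing
  exact ⟨Θ, hΘ.compat, fun Θ' h => FrameHom.unique pH pK h𝓖 φ _ _ h.frameHom hΘ⟩

end Represents

end BiaddBfl

namespace BiaddBfl

open Functor.LaxMonoidal CrossedModule MonoidalMorphism

variable {C : Type u} [Category.{v} C] {J : GrothendieckTopology C} {S S' S'' : Sheaf J (Type w)}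
  {H K : CrossedModule.{v, u, w} J} {G : BraidedCrossedModule.{v, u, w} J}
  {𝓗 : MonoidalPrestack.{v, u, v₁, u₁} C} {𝓚 : MonoidalPrestack.{v, u, v₂, u₂} C}
  {𝓖 : BraidedPrestack.{v, u, w, u₃} C}

namespace Butterfly.Over

variable {E : Butterfly S H K G} {V W Z : C} {s : S.obj.obj (op V)} {t : S.obj.obj (op W)}
  {r : S.obj.obj (op Z)} {y : H.Pt V} {z : K.Pt V} {x : G.Pt V} (e : E.Over s y z x)

lemma res_tr_ptResId (hs : S.obj.map (𝟙 V).op s = s) :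
    (e.res (𝟙 V) hs).tr ((H.ptResId V).hom.app y) ((K.ptResId V).hom.app z)
      ((G.ptResId V).hom.app x) = e :=
  tr_eq_of_elt _ _ _ (by simp [res, Torsor.res]) rfl rfl rfl

lemma res_tr_ptResComp (f : W ⟶ V) (g : Z ⟶ W) (hf : S.obj.map f.op s = t)
    (hg : S.obj.map g.op t = r) (hgf : S.obj.map (g ≫ f).op s = r) :
    (e.res (g ≫ f) hgf).tr ((H.ptResComp f g).hom.app y) ((K.ptResComp f g).hom.app z)
      ((G.ptResComp f g).hom.app x) = (e.res f hf).res g hg :=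
  tr_eq_of_elt _ _ _ (by simp [res, Torsor.res]) rfl rfl rfl

end Butterfly.Over

variable {πH : MonoidalMorphism H.prestack 𝓗} {πK : MonoidalMorphism K.prestack 𝓚}
  {πG : MonoidalMorphism G.toCrossedModule.prestack 𝓖.toMonoidalPrestack}
  {E : Butterfly S H K G}

section Joins

variable {U V : C} {f : V ⟶ U} {t : S.obj.obj (op V)} {X : 𝓗.Fib U} {Y : 𝓚.Fib U}
  {y y' y'' : H.Pt V} {z z' z'' : K.Pt V} {x x' x'' : G.Pt V}

/-- The morphism is the transition between two pairs of frames joined by points of the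
butterfly. -/
def Joins (α : πH.Frame f X y) (β : πK.Frame f Y z) (e : E.Over t y z x) (α' : πH.Frame f X y')
    (β' : πK.Frame f Y z') (e' : E.Over t y' z' x') (m : x ⟶ x') : Prop :=
  ∃ (h : y ⟶ y') (k : z ⟶ z'), α ≫ (πH.fn V).map h = α' ∧ β ≫ (πK.fn V).map k = β' ∧
    e.tr h k m = e'

variable {α : πH.Frame f X y} {β : πK.Frame f Y z} {e : E.Over t y z x} {α' : πH.Frame f X y'}
  {β' : πK.Frame f Y z'} {e' : E.Over t y' z' x'} {α'' : πH.Frame f X y''}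
  {β'' : πK.Frame f Y z''} {e'' : E.Over t y'' z'' x''}

lemma Joins.refl (α : πH.Frame f X y) (β : πK.Frame f Y z) (e : E.Over t y z x) :
    Joins α β e α β e (𝟙 x) :=
  ⟨𝟙 y, 𝟙 z, by simp, by simp, e.tr_id⟩

lemma Joins.trans {m : x ⟶ x'} {m' : x' ⟶ x''} (h : Joins α β e α' β' e' m)
    (h' : Joins α' β' e' α'' β'' e'' m') : Joins α β e α'' β'' e'' (m ≫ m') := by
  obtain ⟨h₁, k₁, rfl, rfl, rfl⟩ := h
  obtain ⟨h₂, k₂, rfl, rfl, rfl⟩ := h'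
  exact ⟨h₁ ≫ h₂, k₁ ≫ k₂, by simp, by simp, (Butterfly.Over.tr_tr _ _ _ _ _ _ _).symm⟩

lemma Joins.symm {m : x ≅ x'} (h : Joins α β e α' β' e' m.hom) : Joins α' β' e' α β e m.inv := by
  obtain ⟨h, k, rfl, rfl, rfl⟩ := h
  let ih : y' ⟶ y := ⟨h.elt⁻¹, by simp [h.eq]⟩
  let ik : z' ⟶ z := ⟨k.elt⁻¹, by simp [k.eq]⟩
  have eh : h ≫ ih = 𝟙 _ := Pt.hom_ext (mul_inv_cancel _)
  have ek : k ≫ ik = 𝟙 _ := Pt.hom_ext (mul_inv_cancel _)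
  refine ⟨ih, ik, ?_, ?_, ?_⟩
  · rw [Category.assoc, ← Functor.map_comp, eh, CategoryTheory.Functor.map_id, Category.comp_id]
  · rw [Category.assoc, ← Functor.map_comp, ek, CategoryTheory.Functor.map_id, Category.comp_id]
  · rw [Butterfly.Over.tr_tr, eh, ek, Iso.hom_inv_id, Butterfly.Over.tr_id]

lemma Joins.fres {m : x ⟶ x'} (h : Joins α β e α' β' e' m) {W : C} {g : W ⟶ V} {q : W ⟶ U}
    (hq : g ≫ f = q) {r : S.obj.obj (op W)} (hr : S.obj.map g.op t = r) :
    Joins (fres hq α) (fres hq β) (e.res g hr) (fres hq α') (fres hq β') (e'.res g hr)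
      ((G.ptRes g).map m) := by
  obtain ⟨h, k, rfl, rfl, rfl⟩ := h
  exact ⟨(H.ptRes g).map h, (K.ptRes g).map k, (fres_comp_map hq _ _).symm,
    (fres_comp_map hq _ _).symm, (Butterfly.Over.tr_res _ _ _ _ _ _).symm⟩

lemma Joins.resId (hf : 𝟙 V ≫ f = f) (ht : S.obj.map (𝟙 V).op t = t) (α : πH.Frame f X y)
    (β : πK.Frame f Y z) (e : E.Over t y z x) :
    Joins (MonoidalMorphism.fres hf α) (MonoidalMorphism.fres hf β) (e.res (𝟙 V) ht) α β e
      ((G.ptResId V).hom.app x) :=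
  ⟨_, _, fres_id hf α, fres_id hf β, e.res_tr_ptResId ht⟩

lemma Joins.resComp {W Z : C} {g : W ⟶ V} {k : Z ⟶ W} {q : W ⟶ U} {q' : Z ⟶ U} (h : g ≫ f = q)
    (h' : k ≫ q = q') (h'' : (k ≫ g) ≫ f = q') {r : S.obj.obj (op W)} {r' : S.obj.obj (op Z)}
    (hr : S.obj.map g.op t = r) (hr' : S.obj.map k.op r = r')
    (hr'' : S.obj.map (k ≫ g).op t = r') (α : πH.Frame f X y) (β : πK.Frame f Y z)
    (e : E.Over t y z x) :
    Joins (MonoidalMorphism.fres h'' α) (MonoidalMorphism.fres h'' β) (e.res (k ≫ g) hr'')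
      (MonoidalMorphism.fres h' (MonoidalMorphism.fres h α))
      (MonoidalMorphism.fres h' (MonoidalMorphism.fres h β)) ((e.res g hr).res k hr')
      ((G.ptResComp g k).hom.app x) :=
  ⟨_, _, fres_fres h h' h'' α, fres_fres h h' h'' β, e.res_tr_ptResComp g k hr hr' hr''⟩

variable (pH : πH.IsPresentation) (pK : πK.IsPresentation)
include pH pK

lemma exists_joins (α : πH.Frame f X y) (β : πK.Frame f Y z) (e : E.Over t y z x)
    (α' : πH.Frame f X y') (β' : πK.Frame f Y z') (e' : E.Over t y' z' x') :
    ∃ m : x ⟶ x', Joins α β e α' β' e' m := by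
  obtain ⟨h, hh⟩ := exists_transition pH.loc pH.stack α α'
  obtain ⟨k, hk⟩ := exists_transition pK.loc pK.stack β β'
  obtain ⟨m, hm⟩ := Butterfly.Over.exists_tr h k e e'
  exact ⟨m, h, k, hh, hk, hm⟩

lemma Joins.unique {m m' : x ⟶ x'} (h : Joins α β e α' β' e' m) (h' : Joins α β e α' β' e' m') :
    m = m' := by
  obtain ⟨h₁, k₁, e₁, e₂, e₃⟩ := h
  obtain ⟨h₂, k₂, rfl, rfl, e₄⟩ := h'
  obtain rfl := frame_map_injective pH.loc pH.stack α e₁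
  obtain rfl := frame_map_injective pK.loc pK.stack β e₂
  exact Butterfly.Over.tr_injective (e₃.trans e₄.symm)

end Joins

section Values

variable (pH : πH.IsPresentation) (pK : πK.IsPresentation)
  (h𝓖 : 𝓖.toMonoidalPrestack.IsGroupLikeStack J) (E)

include pH pK h𝓖

/-- The values of the biadditive functor of a butterfly. -/
lemma exists_value (πG : MonoidalMorphism G.toCrossedModule.prestack 𝓖.toMonoidalPrestack)
    {U : C} (s : S.obj.obj (op U)) (X : 𝓗.Fib U) (Y : 𝓚.Fib U) :
    ∃ (A : 𝓖.Fib U) (Φ : ∀ {V : C} {f : V ⟶ U} (τ : Chart πH πK E f s X Y), πG.Frame f A τ.x),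
      ∀ {V₁ V₂ W : C} {f₁ : V₁ ⟶ U} {f₂ : V₂ ⟶ U} {g₁ : W ⟶ V₁} {g₂ : W ⟶ V₂} {q : W ⟶ U}
        (h₁ : g₁ ≫ f₁ = q) (h₂ : g₂ ≫ f₂ = q) {r : S.obj.obj (op W)}
        (hr₁ : S.obj.map g₁.op (S.obj.map f₁.op s) = r)
        (hr₂ : S.obj.map g₂.op (S.obj.map f₂.op s) = r)
        (τ₁ : Chart πH πK E f₁ s X Y) (τ₂ : Chart πH πK E f₂ s X Y)
        (m : (G.ptRes g₁).obj τ₁.x ⟶ (G.ptRes g₂).obj τ₂.x)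
        (_ : Joins (fres h₁ τ₁.α) (fres h₁ τ₁.β) (τ₁.e.res g₁ hr₁) (fres h₂ τ₂.α) (fres h₂ τ₂.β)
          (τ₂.e.res g₂ hr₂) m),
        fres h₁ (Φ τ₁) ≫ (πG.fn W).map m = fres h₂ (Φ τ₂) := by
  let ι := Σ (V : C) (f : V ⟶ U), Chart πH πK E f s X Y
  have hf : Sieve.ofArrows (fun i : ι => i.1) (fun i => i.2.1) ∈ J U := by
    refine J.superset_covering (fun V f hf => ?_) (chartSieve_mem pH pK E s X Y)
    obtain ⟨y, z, x, α, β, ⟨e⟩⟩ := hf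
    exact ⟨V, 𝟙 V, f, ⟨(⟨V, f, ⟨α, β, e⟩⟩ : ι)⟩, by simp⟩
  have hr {V W : C} {f : V ⟶ U} {g : W ⟶ V} {q : W ⟶ U} (h : g ≫ f = q) :
      S.obj.map g.op (S.obj.map f.op s) = S.obj.map q.op s := by rw [← h]; simp
  have ex {W : C} (q : W ⟶ U) (i₁ i₂ : ι) (g₁ : W ⟶ i₁.1) (g₂ : W ⟶ i₂.1) (h₁ : g₁ ≫ i₁.2.1 = q)
      (h₂ : g₂ ≫ i₂.2.1 = q) :=
    exists_joins pH pK (fres h₁ i₁.2.2.α) (fres h₁ i₁.2.2.β) (i₁.2.2.e.res g₁ (hr h₁))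
      (fres h₂ i₂.2.2.α) (fres h₂ i₂.2.2.β) (i₂.2.2.e.res g₂ (hr h₂))
  choose t ht using @ex
  obtain ⟨A, Φ, h⟩ := exists_obj_of_cocycle (π := πG) h𝓖 hf (fun i => i.2.2.x) t
    (fun q i g h => (ht q i i g g h h).unique pH pK (Joins.refl _ _ _))
    (fun q i₁ i₂ i₃ g₁ g₂ g₃ h₁ h₂ h₃ => ((ht q i₁ i₂ g₁ g₂ h₁ h₂).trans
      (ht q i₂ i₃ g₂ g₃ h₂ h₃)).unique pH pK (ht q i₁ i₃ g₁ g₃ h₁ h₃))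
    (fun {W W'} g q q' hq i₁ i₂ g₁ g₂ h₁ h₂ h₁' h₂' => by
      have k₁ := Joins.resComp h₁ hq h₁' (hr h₁) (hr hq) (hr h₁') i₁.2.2.α i₁.2.2.β i₁.2.2.e
      have k₂ := Joins.resComp h₂ hq h₂' (hr h₂) (hr hq) (hr h₂') i₂.2.2.α i₂.2.2.β i₂.2.2.e
      have k := ((ht q' i₁ i₂ (g ≫ g₁) (g ≫ g₂) h₁' h₂').trans k₂).unique pH pK
        (k₁.trans ((ht q i₁ i₂ g₁ g₂ h₁ h₂).fres hq (hr hq)))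
      have k' := congrArg Pt.Hom.elt k
      simpa using k')
  refine ⟨A, fun {V f} τ => Φ ⟨V, f, τ⟩, ?_⟩
  intro V₁ V₂ W f₁ f₂ g₁ g₂ q h₁ h₂ r hr₁ hr₂ τ₁ τ₂ m hm
  obtain rfl : S.obj.map q.op s = r := by rw [← hr₁, hr h₁]
  have k := h q ⟨V₁, f₁, τ₁⟩ ⟨V₂, f₂, τ₂⟩ g₁ g₂ h₁ h₂
  rwa [(ht q ⟨V₁, f₁, τ₁⟩ ⟨V₂, f₂, τ₂⟩ g₁ g₂ h₁ h₂).unique pH pK hm] at k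

/-- The points of a butterfly are the frames of a family of objects. -/
lemma exists_frameSystem (πG : MonoidalMorphism G.toCrossedModule.prestack 𝓖.toMonoidalPrestack) :
    ∃ A : ∀ {U : C}, S.obj.obj (op U) → 𝓗.Fib U → 𝓚.Fib U → 𝓖.Fib U,
      Nonempty (FrameSystem πH πK πG E A) := by
  have ex {U : C} (s : S.obj.obj (op U)) (X : 𝓗.Fib U) (Y : 𝓚.Fib U) :=
    exists_value E pH pK h𝓖 πG s X Y
  choose A Φ hΦ using @ex
  let fr {U V : C} {f : V ⟶ U} {s : S.obj.obj (op U)} {t : S.obj.obj (op V)}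
      (ht : S.obj.map f.op s = t) {X : 𝓗.Fib U} {Y : 𝓚.Fib U} {y : H.Pt V} {z : K.Pt V} {x : G.Pt V}
      (α : πH.Frame f X y) (β : πK.Frame f Y z) (e : E.Over t y z x) : πG.Frame f (A s X Y) x :=
    Φ s X Y ⟨α, β, ⟨e.val, e.base_eq.trans ht.symm, e.fst_eq, e.snd_eq, e.sec_eq⟩⟩
  have joins {U V W : C} {f : V ⟶ U} {f' : W ⟶ U} {g : W ⟶ V} (hg : g ≫ f = f')
      {s : S.obj.obj (op U)} {t : S.obj.obj (op V)} {t' : S.obj.obj (op W)}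
      (ht : S.obj.map f.op s = t) (ht' : S.obj.map f'.op s = t') (hr : S.obj.map g.op t = t')
      {X : 𝓗.Fib U} {Y : 𝓚.Fib U} {y : H.Pt V} {z : K.Pt V} {x : G.Pt V} {y' : H.Pt W} {z' : K.Pt W}
      {x' : G.Pt W} {α : πH.Frame f X y} {β : πK.Frame f Y z} {e : E.Over t y z x}
      {α' : πH.Frame f' X y'} {β' : πK.Frame f' Y z'} {e' : E.Over t' y' z' x'}
      {m : (G.ptRes g).obj x ⟶ x'}
      (h : Joins (fres hg α) (fres hg β) (e.res g hr) α' β' e' m) :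
      fres hg (fr ht α β e) ≫ (πG.fn W).map m = fr ht' α' β' e' := by
    subst ht ht'
    have h₁ := Joins.resId (f := f') (by simp) (by simp) α' β' e'
    have h₂ := h.trans (Joins.symm (m := (G.ptResId W).app x') h₁)
    have h₃ := hΦ s X Y hg (Category.id_comp f') hr (by simp) ⟨α, β, e⟩ ⟨α', β', e'⟩ _ h₂
    have h₄ := fres_id (Category.id_comp f') (Φ s X Y ⟨α', β', e'⟩)
    refine Eq.trans ?_ h₄
    rw [← h₃, Category.assoc, ← Functor.map_comp]
    change _ = _ ≫ (πG.fn W).map ((m ≫ (G.ptResId W).inv.app x') ≫ (G.ptResId W).hom.app x')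
    rw [Category.assoc, Iso.inv_hom_id_app]
    erw [Category.comp_id]
  refine ⟨A, ⟨⟨fr, ?_, ?_⟩⟩⟩
  · intro U V f s t ht X Y y y' z z' x x' α β e h k m
    have h₁ := Joins.resId (f := f) (by simp) (by simp) α β e
    have h₂ : Joins α β e (α ≫ (πH.fn V).map h) (β ≫ (πK.fn V).map k) (e.tr h k m) m :=
      ⟨h, k, rfl, rfl, rfl⟩
    rw [← joins (Category.id_comp f) ht ht (by simp) (h₁.trans h₂), Functor.map_comp, ← Category.assoc,
      fres_id]
  · intro U V W f g q hq s t r ht hr hr' X Y y z x α β e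
    have h := joins hq ht hr' hr (Joins.refl (fres hq α) (fres hq β) (e.res g hr))
    rw [← h, CategoryTheory.Functor.map_id, Category.comp_id]

end Values

end BiaddBfl

namespace BiaddBfl

open Functor.LaxMonoidal CrossedModule MonoidalMorphism

variable {C : Type u} [Category.{v} C] {J : GrothendieckTopology C} {S S' S'' : Sheaf J (Type w)}
  {H K : CrossedModule.{v, u, w} J} {G : BraidedCrossedModule.{v, u, w} J}
  {𝓗 : MonoidalPrestack.{v, u, v₁, u₁} C} {𝓚 : MonoidalPrestack.{v, u, v₂, u₂} C}
  {𝓖 : BraidedPrestack.{v, u, w, u₃} C}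

section TensorFrames

variable {M : CrossedModule.{v, u, w} J} {Q : MonoidalPrestack.{v, u, v₁, u₁} C}
  {π : MonoidalMorphism M.prestack Q} {U V W : C} {f : V ⟶ U} {g : W ⟶ V} {q : W ⟶ U}

lemma tens_comp_map {X X' : Q.Fib U} {y y' y₁ y₁' : M.Pt V} (a : π.Frame f X y)
    (a' : π.Frame f X' y') (h : y ⟶ y₁) (h' : y' ⟶ y₁') :
    tens (a ≫ (π.fn V).map h) (a' ≫ (π.fn V).map h') = tens a a' ≫ (π.fn V).map (h ⊗ₘ h') := by
  have e := Sq.tens (L := Q.res f) (R := π.fn V) (φ := 𝟙 X) (g := h) (φ' := 𝟙 X') (g' := h')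
    (a := a) (b := a ≫ (π.fn V).map h) (a' := a') (b' := a' ≫ (π.fn V).map h') (by simp [Sq])
    (by simp [Sq])
  simpa [Sq] using e

end TensorFrames

namespace Butterfly.Over

variable {E : Butterfly S H K G} {V W : C} {s : S.obj.obj (op V)} {t : S.obj.obj (op W)}
  {y y' : H.Pt V} {z z' : K.Pt V} {x x' : G.Pt V}

lemma mul₁_res (e : E.Over s y z x) (e' : E.Over s y' z x') (f : W ⟶ V)
    (ht : S.obj.map f.op s = t) :
    ((e.res f ht).mul₁ (e'.res f ht)).tr (μ (H.ptRes f) y y') (𝟙 _) (μ (G.ptRes f) x x') =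
      (e.mul₁ e').res f ht :=
  tr_eq_of_elt _ _ _ (mul₁_res_val e e' f ht) rfl rfl rfl

lemma mul₂_res (e : E.Over s y z x) (e' : E.Over s y z' x') (f : W ⟶ V)
    (ht : S.obj.map f.op s = t) :
    ((e.res f ht).mul₂ (e'.res f ht)).tr (𝟙 _) (μ (K.ptRes f) z z') (μ (G.ptRes f) x x') =
      (e.mul₂ e').res f ht :=
  tr_eq_of_elt _ _ _ (mul₂_res_val e e' f ht) rfl rfl rfl

lemma one₁_tr_res (z : K.Pt V) (f : W ⟶ V) (ht : S.obj.map f.op s = t) :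
    (one₁ E t ((K.ptRes f).obj z)).tr (Functor.LaxMonoidal.ε (H.ptRes f)) (𝟙 _)
      (Functor.LaxMonoidal.ε (G.ptRes f)) = (one₁ E s z).res f ht :=
  tr_eq_of_elt _ _ _ (one₁_res f ht).symm rfl rfl rfl

lemma one₂_tr_res (y : H.Pt V) (f : W ⟶ V) (ht : S.obj.map f.op s = t) :
    (one₂ E t ((H.ptRes f).obj y)).tr (𝟙 _) (Functor.LaxMonoidal.ε (K.ptRes f))
      (Functor.LaxMonoidal.ε (G.ptRes f)) = (one₂ E s y).res f ht :=
  tr_eq_of_elt _ _ _ (one₂_res f ht).symm rfl rfl rfl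

end Butterfly.Over

variable {πH : MonoidalMorphism H.prestack 𝓗} {πK : MonoidalMorphism K.prestack 𝓚}
  {πG : MonoidalMorphism G.toCrossedModule.prestack 𝓖.toMonoidalPrestack}
  {E : Butterfly S H K G} (pH : πH.IsPresentation) (pK : πK.IsPresentation)
  (h𝓖 : 𝓖.toMonoidalPrestack.IsGroupLikeStack J)

section Operations

variable {A : ∀ {U : C}, S.obj.obj (op U) → 𝓗.Fib U → 𝓚.Fib U → 𝓖.Fib U}
  (Φ : FrameSystem πH πK πG E A) {U : C} (s : S.obj.obj (op U))

lemma map_map_eq {V W : C} {f : V ⟶ U} {g : W ⟶ V} {q : W ⟶ U} (h : g ≫ f = q) :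
    S.obj.map g.op (S.obj.map f.op s) = S.obj.map q.op s := by
  rw [← h]
  simp

include pH pK h𝓖

lemma FrameSystem.exists_mp {X X' : 𝓗.Fib U} {Y Y' : 𝓚.Fib U} (a : X ⟶ X') (b : Y ⟶ Y') :
    ∃ θ : A s X Y ⟶ A s X' Y', ∀ {V : C} {f : V ⟶ U} {t : S.obj.obj (op V)}
      (ht : S.obj.map f.op s = t) {y y' : H.Pt V} {z z' : K.Pt V}
      {x x' : G.Pt V} {α : πH.Frame f X y} {α' : πH.Frame f X' y'}
      {β : πK.Frame f Y z} {β' : πK.Frame f Y' z'} {h : y ⟶ y'} {k : z ⟶ z'} {m : x ⟶ x'}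
      {e : E.Over t y z x} {e' : E.Over t y' z' x'}
      (_ : Sq (𝓗.res f) (πH.fn V) a h α α') (_ : Sq (𝓚.res f) (πK.fn V) b k β β')
      (_ : e.tr h k m = e'),
      Sq (𝓖.res f) (πG.fn V) θ m (Φ.fr ht α β e) (Φ.fr ht α' β' e') := by
  obtain ⟨θ, hθ, -⟩ := FrameSystem.existsUnique_hom pH pK h𝓖 (Butterfly.HomOver.id E) Φ Φ s a b
  refine ⟨θ, fun {V f t} ht {y y' z z' x x' α α' β β' h k m e e'} ha hb he => ?_⟩
  have h₁ := hθ ht α' β' e'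
  unfold Sq at *
  rw [ha, hb, ← he, Φ.fr_tr] at h₁
  rw [← he]
  exact h₁

lemma FrameSystem.exists_m₁ (X X' : 𝓗.Fib U) (Y : 𝓚.Fib U) :
    ∃ θ : A s X Y ⊗ A s X' Y ⟶ A s (X ⊗ X') Y, ∀ {V : C} {f : V ⟶ U} {t : S.obj.obj (op V)}
      (ht : S.obj.map f.op s = t) {y y' : H.Pt V} {z : K.Pt V} {x x' : G.Pt V}
      (α : πH.Frame f X y) (α' : πH.Frame f X' y') (β : πK.Frame f Y z)
      (e : E.Over t y z x) (e' : E.Over t y' z x'),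
      Sq (𝓖.res f) (πG.fn V) θ (𝟙 _) (tens (Φ.fr ht α β e) (Φ.fr ht α' β e'))
        (Φ.fr ht (tens α α') β (e.mul₁ e')) := by
  let T {V : C} (f : V ⟶ U) := Σ (y y' : H.Pt V) (z : K.Pt V) (x x' : G.Pt V),
    πH.Frame f X y × πH.Frame f X' y' × πK.Frame f Y z × E.Over (S.obj.map f.op s) y z x ×
      E.Over (S.obj.map f.op s) y' z x'
  obtain ⟨θ, hθ, -⟩ := existsUnique_of_frames (π := πG) h𝓖 (A := A s X Y ⊗ A s X' Y)
    (B := A s (X ⊗ X') Y) T (fun ⟨_, _, _, x, x', _⟩ => x ⊗ x')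
    (fun ⟨_, _, _, _, _, α, α', β, e, e'⟩ => tens (Φ.fr rfl α β e) (Φ.fr rfl α' β e'))
    (fun ⟨_, _, _, _, _, α, α', β, e, e'⟩ => Φ.fr rfl (tens α α') β (e.mul₁ e'))
    (fun {V f} ⟨_, _, _, _, _, α₁, α₁', β₁, e₁, e₁'⟩ ⟨_, _, _, _, _, α₂, α₂', β₂, e₂, e₂'⟩ => by
      obtain ⟨h, rfl⟩ := exists_transition pH.loc pH.stack α₁ α₂
      obtain ⟨h', rfl⟩ := exists_transition pH.loc pH.stack α₁' α₂'
      obtain ⟨k, rfl⟩ := exists_transition pK.loc pK.stack β₁ β₂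
      obtain ⟨m, rfl⟩ := Butterfly.Over.exists_tr h k e₁ e₂
      obtain ⟨m', rfl⟩ := Butterfly.Over.exists_tr h' k e₁' e₂'
      refine ⟨m ⊗ₘ m', ?_, ?_⟩
      · dsimp only
        rw [Φ.fr_tr, Φ.fr_tr, tens_comp_map]
      · dsimp only
        rw [tens_comp_map, Butterfly.Over.mul₁_tr, Φ.fr_tr])
    (fun {V W f} ⟨_, _, _, _, _, α, α', β, e, e'⟩ g q hq => by
      refine ⟨⟨_, _, _, _, _, fres hq α, fres hq α', fres hq β, e.res g (map_map_eq s hq),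
        e'.res g (map_map_eq s hq)⟩, μ (G.ptRes g) _ _, ?_, ?_⟩
      · dsimp only
        rw [Φ.fr_res hq rfl, Φ.fr_res hq rfl, fres_tens]
      · dsimp only
        rw [← Φ.fr_tr rfl _ _ _ (μ (H.ptRes g) _ _) (𝟙 _), Butterfly.Over.mul₁_res, fres_tens,
          CategoryTheory.Functor.map_id, Category.comp_id, Φ.fr_res hq rfl])
    ⟨_, J.intersection_covering (chartSieve_mem pH pK E s X Y) (chartSieve_mem pH pK E s X' Y), by
      rintro V f ⟨⟨y, z, x, α, β, ⟨e⟩⟩, hf'⟩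
      obtain ⟨y', -, -, α', -, -⟩ := id hf'
      obtain ⟨x', ⟨e'⟩⟩ := exists_over pH pK rfl hf' α' β
      exact ⟨⟨_, _, _, _, _, α, α', β, e, e'⟩⟩⟩
  refine ⟨θ, fun {V f t} ht {y y' z x x'} α α' β e e' => ?_⟩
  subst ht
  unfold Sq
  rw [CategoryTheory.Functor.map_id, Category.comp_id]
  exact hθ ⟨_, _, _, _, _, α, α', β, e, e'⟩

lemma FrameSystem.exists_m₂ (X : 𝓗.Fib U) (Y Y' : 𝓚.Fib U) :
    ∃ θ : A s X Y ⊗ A s X Y' ⟶ A s X (Y ⊗ Y'), ∀ {V : C} {f : V ⟶ U} {t : S.obj.obj (op V)}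
      (ht : S.obj.map f.op s = t) {y : H.Pt V} {z z' : K.Pt V} {x x' : G.Pt V}
      (α : πH.Frame f X y) (β : πK.Frame f Y z) (β' : πK.Frame f Y' z')
      (e : E.Over t y z x) (e' : E.Over t y z' x'),
      Sq (𝓖.res f) (πG.fn V) θ (𝟙 _) (tens (Φ.fr ht α β e) (Φ.fr ht α β' e'))
        (Φ.fr ht α (tens β β') (e.mul₂ e')) := by
  let T {V : C} (f : V ⟶ U) := Σ (y : H.Pt V) (z z' : K.Pt V) (x x' : G.Pt V),
    πH.Frame f X y × πK.Frame f Y z × πK.Frame f Y' z' × E.Over (S.obj.map f.op s) y z x ×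
      E.Over (S.obj.map f.op s) y z' x'
  obtain ⟨θ, hθ, -⟩ := existsUnique_of_frames (π := πG) h𝓖 (A := A s X Y ⊗ A s X Y')
    (B := A s X (Y ⊗ Y')) T (fun ⟨_, _, _, x, x', _⟩ => x ⊗ x')
    (fun ⟨_, _, _, _, _, α, β, β', e, e'⟩ => tens (Φ.fr rfl α β e) (Φ.fr rfl α β' e'))
    (fun ⟨_, _, _, _, _, α, β, β', e, e'⟩ => Φ.fr rfl α (tens β β') (e.mul₂ e'))
    (fun {V f} ⟨_, _, _, _, _, α₁, β₁, β₁', e₁, e₁'⟩ ⟨_, _, _, _, _, α₂, β₂, β₂', e₂, e₂'⟩ => by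
      obtain ⟨h, rfl⟩ := exists_transition pH.loc pH.stack α₁ α₂
      obtain ⟨k, rfl⟩ := exists_transition pK.loc pK.stack β₁ β₂
      obtain ⟨k', rfl⟩ := exists_transition pK.loc pK.stack β₁' β₂'
      obtain ⟨m, rfl⟩ := Butterfly.Over.exists_tr h k e₁ e₂
      obtain ⟨m', rfl⟩ := Butterfly.Over.exists_tr h k' e₁' e₂'
      refine ⟨m ⊗ₘ m', ?_, ?_⟩
      · dsimp only
        rw [Φ.fr_tr, Φ.fr_tr, tens_comp_map]
      · dsimp only
        rw [tens_comp_map, Butterfly.Over.mul₂_tr, Φ.fr_tr])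
    (fun {V W f} ⟨_, _, _, _, _, α, β, β', e, e'⟩ g q hq => by
      refine ⟨⟨_, _, _, _, _, fres hq α, fres hq β, fres hq β', e.res g (map_map_eq s hq),
        e'.res g (map_map_eq s hq)⟩, μ (G.ptRes g) _ _, ?_, ?_⟩
      · dsimp only
        rw [Φ.fr_res hq rfl, Φ.fr_res hq rfl, fres_tens]
      · dsimp only
        rw [← Φ.fr_tr rfl _ _ _ (𝟙 _) (μ (K.ptRes g) _ _), Butterfly.Over.mul₂_res, fres_tens,
          CategoryTheory.Functor.map_id, Category.comp_id, Φ.fr_res hq rfl])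
    ⟨_, J.intersection_covering (chartSieve_mem pH pK E s X Y) (chartSieve_mem pH pK E s X Y'), by
      rintro V f ⟨⟨y, z, x, α, β, ⟨e⟩⟩, hf'⟩
      obtain ⟨-, z', -, -, β', -⟩ := id hf'
      obtain ⟨x', ⟨e'⟩⟩ := exists_over pH pK rfl hf' α β'
      exact ⟨⟨_, _, _, _, _, α, β, β', e, e'⟩⟩⟩
  refine ⟨θ, fun {V f t} ht {y z z' x x'} α β β' e e' => ?_⟩
  subst ht
  unfold Sq
  rw [CategoryTheory.Functor.map_id, Category.comp_id]
  exact hθ ⟨_, _, _, _, _, α, β, β', e, e'⟩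

omit pH in
lemma FrameSystem.exists_e₁ (Y : 𝓚.Fib U) :
    ∃ θ : 𝟙_ _ ⟶ A s (𝟙_ _) Y, ∀ {V : C} {f : V ⟶ U} {t : S.obj.obj (op V)}
      (ht : S.obj.map f.op s = t) {z : K.Pt V} (β : πK.Frame f Y z),
      Sq (𝓖.res f) (πG.fn V) θ (𝟙 _) (unitFrame _ _)
        (Φ.fr ht (unitFrame _ _) β (.one₁ E t z)) := by
  let T {V : C} (f : V ⟶ U) := Σ z : K.Pt V, πK.Frame f Y z
  obtain ⟨θ, hθ, -⟩ := existsUnique_of_frames (π := πG) h𝓖 (A := 𝟙_ _) (B := A s (𝟙_ _) Y) T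
    (fun _ => 𝟙_ _) (fun _ => unitFrame _ _)
    (fun ⟨z, β⟩ => Φ.fr rfl (unitFrame _ _) β (.one₁ E _ z))
    (fun {V f} ⟨z₁, β₁⟩ ⟨z₂, β₂⟩ => by
      obtain ⟨k, rfl⟩ := exists_transition pK.loc pK.stack β₁ β₂
      refine ⟨𝟙 _, by simp, ?_⟩
      dsimp only
      rw [← Φ.fr_tr rfl _ _ _ (𝟙 _) k, Butterfly.Over.tr, Butterfly.Over.move₁_id,
        Butterfly.Over.one₁_move₂, Butterfly.Over.act_id, CategoryTheory.Functor.map_id,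
        Category.comp_id])
    (fun {V W f} ⟨z, β⟩ g q hq => by
      refine ⟨⟨_, fres hq β⟩, Functor.LaxMonoidal.ε (G.ptRes g), fres_unit hq, ?_⟩
      dsimp only
      rw [← Φ.fr_tr rfl _ _ _ (Functor.LaxMonoidal.ε (H.ptRes g)) (𝟙 _),
        Butterfly.Over.one₁_tr_res z g (map_map_eq s hq), fres_unit hq,
        CategoryTheory.Functor.map_id, Category.comp_id, Φ.fr_res hq rfl])
    ⟨_, pK.frameSieve_mem Y, by
      rintro V f ⟨z, ⟨β⟩⟩
      exact ⟨⟨z, β⟩⟩⟩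
  refine ⟨θ, fun {V f t} ht {z} β => ?_⟩
  subst ht
  unfold Sq
  rw [CategoryTheory.Functor.map_id, Category.comp_id]
  exact hθ ⟨z, β⟩

omit pK in
lemma FrameSystem.exists_e₂ (X : 𝓗.Fib U) :
    ∃ θ : 𝟙_ _ ⟶ A s X (𝟙_ _), ∀ {V : C} {f : V ⟶ U} {t : S.obj.obj (op V)}
      (ht : S.obj.map f.op s = t) {y : H.Pt V} (α : πH.Frame f X y),
      Sq (𝓖.res f) (πG.fn V) θ (𝟙 _) (unitFrame _ _)
        (Φ.fr ht α (unitFrame _ _) (.one₂ E t y)) := by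
  let T {V : C} (f : V ⟶ U) := Σ y : H.Pt V, πH.Frame f X y
  obtain ⟨θ, hθ, -⟩ := existsUnique_of_frames (π := πG) h𝓖 (A := 𝟙_ _) (B := A s X (𝟙_ _)) T
    (fun _ => 𝟙_ _) (fun _ => unitFrame _ _)
    (fun ⟨y, α⟩ => Φ.fr rfl α (unitFrame _ _) (.one₂ E _ y))
    (fun {V f} ⟨y₁, α₁⟩ ⟨y₂, α₂⟩ => by
      obtain ⟨h, rfl⟩ := exists_transition pH.loc pH.stack α₁ α₂
      refine ⟨𝟙 _, by simp, ?_⟩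
      dsimp only
      rw [← Φ.fr_tr rfl _ _ _ h (𝟙 _), Butterfly.Over.tr, Butterfly.Over.one₂_move₁,
        Butterfly.Over.move₂_id, Butterfly.Over.act_id, CategoryTheory.Functor.map_id,
        Category.comp_id])
    (fun {V W f} ⟨y, α⟩ g q hq => by
      refine ⟨⟨_, fres hq α⟩, Functor.LaxMonoidal.ε (G.ptRes g), fres_unit hq, ?_⟩
      dsimp only
      rw [← Φ.fr_tr rfl _ _ _ (𝟙 _) (Functor.LaxMonoidal.ε (K.ptRes g)),
        Butterfly.Over.one₂_tr_res y g (map_map_eq s hq), fres_unit hq,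
        CategoryTheory.Functor.map_id, Category.comp_id, Φ.fr_res hq rfl])
    ⟨_, pH.frameSieve_mem X, by
      rintro V f ⟨y, ⟨α⟩⟩
      exact ⟨⟨y, α⟩⟩⟩
  refine ⟨θ, fun {V f t} ht {y} α => ?_⟩
  subst ht
  unfold Sq
  rw [CategoryTheory.Functor.map_id, Category.comp_id]
  exact hθ ⟨y, α⟩

lemma FrameSystem.exists_rs {V : C} (g : V ⟶ U) {s : S.obj.obj (op U)} {t : S.obj.obj (op V)}
    (ht : S.obj.map g.op s = t) (X : 𝓗.Fib U) (Y : 𝓚.Fib U) :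
    ∃ θ : (𝓖.res g).obj (A s X Y) ⟶ A t ((𝓗.res g).obj X) ((𝓚.res g).obj Y),
      ∀ {W : C} {f : W ⟶ V} {q : W ⟶ U} (hq : f ≫ g = q) {r : S.obj.obj (op W)}
        (hr : S.obj.map f.op t = r) (hr' : S.obj.map q.op s = r)
        {y : H.Pt W} {z : K.Pt W} {x : G.Pt W} (α : πH.Frame q X y)
        (β : πK.Frame q Y z) (e : E.Over r y z x),
        Sq (𝓖.res f) (πG.fn W) θ (𝟙 _) (down hq (Φ.fr hr' α β e))
          (Φ.fr hr (down hq α) (down hq β) e) := by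
  have ht' {W : C} (f : W ⟶ V) : S.obj.map f.op t = S.obj.map (f ≫ g).op s := by
    rw [← ht]
    simp
  obtain ⟨θ, hθ, -⟩ := existsUnique_of_frames (π := πG) h𝓖 (A := (𝓖.res g).obj (A s X Y))
    (B := A t ((𝓗.res g).obj X) ((𝓚.res g).obj Y)) (fun f => Chart πH πK E (f ≫ g) s X Y)
    (fun τ => τ.x) (fun τ => down rfl (Φ.fr rfl τ.α τ.β τ.e))
    (fun {W f} τ => Φ.fr (ht' f) (down rfl τ.α) (down rfl τ.β) τ.e)
    (fun {W f} τ τ' => by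
      obtain ⟨m, h, k, e₁, e₂, e₃⟩ := exists_joins pH pK τ.α τ.β τ.e τ'.α τ'.β τ'.e
      refine ⟨m, ?_, ?_⟩
      · rw [← MonoidalMorphism.down_comp, ← Φ.fr_tr rfl τ.α τ.β τ.e h k, e₁, e₂, e₃]
      · rw [← Φ.fr_tr _ _ _ τ.e h k, ← MonoidalMorphism.down_comp, ← MonoidalMorphism.down_comp, e₁, e₂, e₃])
    (fun {W Z f} τ k q hq => by
      have hq' : k ≫ f ≫ g = q ≫ g := by rw [← hq, Category.assoc]
      refine ⟨⟨fres hq' τ.α, fres hq' τ.β, τ.e.res k (map_map_eq s hq')⟩, 𝟙 _, ?_, ?_⟩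
      · rw [CategoryTheory.Functor.map_id, Category.comp_id, Φ.fr_res hq' rfl,
          fres_down rfl hq rfl hq']
      · rw [CategoryTheory.Functor.map_id, Category.comp_id, ← Φ.fr_res hq (ht' f)
          (map_map_eq s hq') (ht' q), fres_down rfl hq rfl hq', fres_down rfl hq rfl hq'])
    ⟨_, J.pullback_stable g (chartSieve_mem pH pK E s X Y), fun f hf => by
      obtain ⟨y, z, x, α, β, ⟨e⟩⟩ := hf
      exact ⟨⟨α, β, e⟩⟩⟩
  refine ⟨θ, fun {W f q} hq {r} hr hr' {y z x} α β e => ?_⟩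
  subst hq hr'
  unfold Sq
  rw [CategoryTheory.Functor.map_id, Category.comp_id]
  exact hθ ⟨α, β, e⟩

end Operations

variable (E πG)
include pH pK h𝓖

/-- The data of the biadditive functor of a butterfly. -/
lemma exists_preBiadd : ∃ D : PreBiadd S 𝓗 𝓚 𝓖, Nonempty (Framing πH πK πG E D) := by
  obtain ⟨A, ⟨Φ⟩⟩ := exists_frameSystem E pH pK h𝓖 πG
  choose mp hmp using fun {U} => @FrameSystem.exists_mp _ _ _ _ _ _ _ _ _ _ _ _ _ _ pH pK h𝓖 _ Φ U
  choose m₁ hm₁ using fun {U} => @FrameSystem.exists_m₁ _ _ _ _ _ _ _ _ _ _ _ _ _ _ pH pK h𝓖 _ Φ U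
  choose m₂ hm₂ using fun {U} => @FrameSystem.exists_m₂ _ _ _ _ _ _ _ _ _ _ _ _ _ _ pH pK h𝓖 _ Φ U
  choose e₁ he₁ using fun {U} => @FrameSystem.exists_e₁ _ _ _ _ _ _ _ _ _ _ _ _ _ _ pK h𝓖 _ Φ U
  choose e₂ he₂ using fun {U} => @FrameSystem.exists_e₂ _ _ _ _ _ _ _ _ _ _ _ _ _ _ pH h𝓖 _ Φ U
  choose rs hrs using fun {U V} => @FrameSystem.exists_rs _ _ _ _ _ _ _ _ _ _ _ _ _ _ pH pK h𝓖 _ Φ U V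
  exact ⟨{ val := A, mp := mp, m₁ := m₁, m₂ := m₂, e₁ := e₁, e₂ := e₂, rs := fun f _ _ => rs f },
    ⟨{ toFrameSystem := Φ
       mp_sq := fun ht _ _ _ _ => hmp _ _ _ ht
       m₁_sq := fun ht _ _ _ => hm₁ _ _ _ _ ht
       m₂_sq := fun ht _ _ _ => hm₂ _ _ _ _ ht
       e₁_sq := fun ht _ _ => he₁ _ _ ht
       e₂_sq := fun ht _ _ => he₂ _ _ ht
       rs_sq := fun hq _ _ _ ht hr hr' _ _ => hrs _ ht _ _ hq hr hr' }⟩⟩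

end BiaddBfl

namespace BiaddBfl

open Functor.LaxMonoidal CrossedModule MonoidalMorphism

variable {C : Type u} [Category.{v} C] {J : GrothendieckTopology C} {S S' S'' : Sheaf J (Type w)}
  {H K : CrossedModule.{v, u, w} J} {G : BraidedCrossedModule.{v, u, w} J}
  {𝓗 : MonoidalPrestack.{v, u, v₁, u₁} C} {𝓚 : MonoidalPrestack.{v, u, v₂, u₂} C}
  {𝓖 : BraidedPrestack.{v, u, w, u₃} C}
  {πH : MonoidalMorphism H.prestack 𝓗} {πK : MonoidalMorphism K.prestack 𝓚}
  {πG : MonoidalMorphism G.toCrossedModule.prestack 𝓖.toMonoidalPrestack}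
  {E : Butterfly S H K G} {D : PreBiadd S 𝓗 𝓚 𝓖}

/-! ### The laws of the biadditive functor of a butterfly -/

namespace Framing

variable (Φ : Framing πH πK πG E D) (pH : πH.IsPresentation) (pK : πK.IsPresentation)
  (h𝓖 : 𝓖.toMonoidalPrestack.IsGroupLikeStack J) {U V W : C} (s : S.obj.obj (op U))
  {X X' X'' X₁ X₁' : 𝓗.Fib U} {Y Y' Y'' Y₁ Y₁' : 𝓚.Fib U}

include Φ pH pK h𝓖

lemma mp_id : D.mp s (𝟙 X) (𝟙 Y) = 𝟙 _ := by
  refine hom_ext_of_sq (π := πG) h𝓖 (chartSieve_mem pH pK E s X Y) ?_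
  rintro V f ⟨y, z, x, α, β, ⟨e⟩⟩
  exact ⟨_, _, _, _, _, Φ.mp_sq rfl (.id α) (.id β) e.tr_id, .id _⟩

lemma mp_comp (a : X ⟶ X') (b : Y ⟶ Y') (a' : X' ⟶ X'') (b' : Y' ⟶ Y'') :
    D.mp s (a ≫ a') (b ≫ b') = D.mp s a b ≫ D.mp s a' b' := by
  refine hom_ext_of_sq (π := πG) h𝓖 (J.intersection_covering (chartSieve_mem pH pK E s X Y)
    (J.intersection_covering (J.intersection_covering (pH.frameSieve_mem X') (pK.frameSieve_mem Y'))
      (J.intersection_covering (pH.frameSieve_mem X'') (pK.frameSieve_mem Y'')))) ?_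
  rintro V f ⟨⟨y, z, x, α, β, ⟨e⟩⟩, ⟨⟨y', ⟨α'⟩⟩, ⟨z', ⟨β'⟩⟩⟩, ⟨y'', ⟨α''⟩⟩, ⟨z'', ⟨β''⟩⟩⟩
  obtain ⟨h, hh⟩ := exists_sq pH.loc pH.stack a α α'
  obtain ⟨k, hk⟩ := exists_sq pK.loc pK.stack b β β'
  obtain ⟨h', hh'⟩ := exists_sq pH.loc pH.stack a' α' α''
  obtain ⟨k', hk'⟩ := exists_sq pK.loc pK.stack b' β' β''
  exact ⟨_, _, _, _, _, Φ.mp_sq rfl (hh.comp hh') (hk.comp hk')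
    (Butterfly.Over.tr_tr h k (𝟙 _) h' k' (𝟙 _) e).symm,
    (Φ.mp_sq rfl hh hk rfl).comp (Φ.mp_sq rfl hh' hk' rfl)⟩

lemma m₁_natural (a : X ⟶ X₁) (a' : X' ⟶ X₁') (b : Y ⟶ Y') :
    D.m₁ s X X' Y ≫ D.mp s (a ⊗ₘ a') b = (D.mp s a b ⊗ₘ D.mp s a' b) ≫ D.m₁ s X₁ X₁' Y' := by
  refine hom_ext_of_sq (π := πG) h𝓖 (J.intersection_covering (J.intersection_covering
    (chartSieve_mem pH pK E s X Y) (chartSieve_mem pH pK E s X' Y)) (J.intersection_covering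
    (pK.frameSieve_mem Y') (J.intersection_covering (pH.frameSieve_mem X₁)
      (pH.frameSieve_mem X₁')))) ?_
  rintro V f ⟨⟨⟨y, z, x, α, β, ⟨e⟩⟩, hf'⟩, ⟨z', ⟨β'⟩⟩, ⟨y₁, ⟨α₁⟩⟩, ⟨y₁', ⟨α₁'⟩⟩⟩
  obtain ⟨y', -, -, α', -, -⟩ := id hf'
  obtain ⟨x', ⟨e'⟩⟩ := exists_over pH pK rfl hf' α' β
  obtain ⟨h, hh⟩ := exists_sq pH.loc pH.stack a α α₁
  obtain ⟨h', hh'⟩ := exists_sq pH.loc pH.stack a' α' α₁'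
  obtain ⟨k, hk⟩ := exists_sq pK.loc pK.stack b β β'
  have hm := Φ.m₁_sq (s := s) rfl α₁ α₁' β' (e.tr h k (𝟙 _)) (e'.tr h' k (𝟙 _))
  rw [Butterfly.Over.mul₁_tr, id_tensorHom_id] at hm
  refine ⟨_, _, _, _, 𝟙 _, ((Φ.m₁_sq rfl α α' β e e').comp (Φ.mp_sq rfl (hh.tens hh') hk rfl)).congr
    (Category.comp_id _), (((Φ.mp_sq rfl hh hk rfl).tens (Φ.mp_sq rfl hh' hk rfl)).comp
      hm).congr (by simp)⟩

lemma m₂_natural (a : X ⟶ X') (b : Y ⟶ Y₁) (b' : Y' ⟶ Y₁') :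
    D.m₂ s X Y Y' ≫ D.mp s a (b ⊗ₘ b') = (D.mp s a b ⊗ₘ D.mp s a b') ≫ D.m₂ s X' Y₁ Y₁' := by
  refine hom_ext_of_sq (π := πG) h𝓖 (J.intersection_covering (J.intersection_covering
    (chartSieve_mem pH pK E s X Y) (chartSieve_mem pH pK E s X Y')) (J.intersection_covering
    (pH.frameSieve_mem X') (J.intersection_covering (pK.frameSieve_mem Y₁)
      (pK.frameSieve_mem Y₁')))) ?_
  rintro V f ⟨⟨⟨y, z, x, α, β, ⟨e⟩⟩, hf'⟩, ⟨y', ⟨α'⟩⟩, ⟨z₁, ⟨β₁⟩⟩, ⟨z₁', ⟨β₁'⟩⟩⟩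
  obtain ⟨-, z', -, -, β', -⟩ := id hf'
  obtain ⟨x', ⟨e'⟩⟩ := exists_over pH pK rfl hf' α β'
  obtain ⟨h, hh⟩ := exists_sq pH.loc pH.stack a α α'
  obtain ⟨k, hk⟩ := exists_sq pK.loc pK.stack b β β₁
  obtain ⟨k', hk'⟩ := exists_sq pK.loc pK.stack b' β' β₁'
  have hm := Φ.m₂_sq (s := s) rfl α' β₁ β₁' (e.tr h k (𝟙 _)) (e'.tr h k' (𝟙 _))
  rw [Butterfly.Over.mul₂_tr, id_tensorHom_id] at hm
  refine ⟨_, _, _, _, 𝟙 _, ((Φ.m₂_sq rfl α β β' e e').comp (Φ.mp_sq rfl hh (hk.tens hk') rfl)).congr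
    (Category.comp_id _), (((Φ.mp_sq rfl hh hk rfl).tens (Φ.mp_sq rfl hh hk' rfl)).comp
      hm).congr (by simp)⟩

omit pH in
lemma e₁_natural (b : Y ⟶ Y') : D.e₁ s Y ≫ D.mp s (𝟙 _) b = D.e₁ s Y' := by
  refine hom_ext_of_sq (π := πG) h𝓖 (J.intersection_covering (pK.frameSieve_mem Y)
    (pK.frameSieve_mem Y')) ?_
  rintro V f ⟨⟨z, ⟨β⟩⟩, ⟨z', ⟨β'⟩⟩⟩
  obtain ⟨k, hk⟩ := exists_sq pK.loc pK.stack b β β'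
  refine ⟨_, _, _, _, 𝟙 _, ((Φ.e₁_sq rfl β).comp (Φ.mp_sq rfl (.id _) hk (m := 𝟙 _) ?_)).congr
    (Category.comp_id _), Φ.e₁_sq rfl β'⟩
  rw [Butterfly.Over.tr, Butterfly.Over.move₁_id, Butterfly.Over.one₁_move₂, Butterfly.Over.act_id]

omit pK in
lemma e₂_natural (a : X ⟶ X') : D.e₂ s X ≫ D.mp s a (𝟙 _) = D.e₂ s X' := by
  refine hom_ext_of_sq (π := πG) h𝓖 (J.intersection_covering (pH.frameSieve_mem X)
    (pH.frameSieve_mem X')) ?_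
  rintro V f ⟨⟨y, ⟨α⟩⟩, ⟨y', ⟨α'⟩⟩⟩
  obtain ⟨h, hh⟩ := exists_sq pH.loc pH.stack a α α'
  refine ⟨_, _, _, _, 𝟙 _, ((Φ.e₂_sq rfl α).comp (Φ.mp_sq rfl hh (.id _) (m := 𝟙 _) ?_)).congr
    (Category.comp_id _), Φ.e₂_sq rfl α'⟩
  rw [Butterfly.Over.tr, Butterfly.Over.one₂_move₁, Butterfly.Over.move₂_id, Butterfly.Over.act_id]

variable (X X' X'') in
lemma m₁_assoc : D.m₁ s X X' Y ▷ D.val s X'' Y ≫ D.m₁ s (X ⊗ X') X'' Y ≫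
    D.mp s (α_ X X' X'').hom (𝟙 Y) = (α_ _ _ _).hom ≫ D.val s X Y ◁ D.m₁ s X' X'' Y ≫
      D.m₁ s X (X' ⊗ X'') Y := by
  refine hom_ext_of_sq (π := πG) h𝓖 (J.intersection_covering (chartSieve_mem pH pK E s X Y)
    (J.intersection_covering (chartSieve_mem pH pK E s X' Y) (chartSieve_mem pH pK E s X'' Y))) ?_
  rintro V f ⟨⟨y, z, x, α, β, ⟨e⟩⟩, hf', hf''⟩
  obtain ⟨y', -, -, α', -, -⟩ := id hf'
  obtain ⟨x', ⟨e'⟩⟩ := exists_over pH pK rfl hf' α' β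
  obtain ⟨y'', -, -, α'', -, -⟩ := id hf''
  obtain ⟨x'', ⟨e''⟩⟩ := exists_over pH pK rfl hf'' α'' β
  exact ⟨_, _, _, _, (α_ x x' x'').hom, ((Sq.whiskerRight (Φ.m₁_sq rfl α α' β e e')
      (Φ.fr rfl α'' β e'')).comp ((Φ.m₁_sq rfl (tens α α') α'' β (e.mul₁ e') e'').comp
      (Φ.mp_sq rfl (Sq.associator α α' α'') (.id β) (Butterfly.Over.tr_eq_of_elt _ _ (α_ x x' x'').hom
        (Butterfly.Over.mul₁_assoc_val e e' e'') rfl rfl rfl)))).congr (by simp),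
    ((Sq.associator _ _ _).comp ((Sq.whiskerLeft (Φ.fr rfl α β e)
      (Φ.m₁_sq rfl α' α'' β e' e'')).comp (Φ.m₁_sq rfl α (tens α' α'') β e (e'.mul₁ e'')))).congr
      (by simp)⟩

variable (Y Y' Y'') in
lemma m₂_assoc : D.m₂ s X Y Y' ▷ D.val s X Y'' ≫ D.m₂ s X (Y ⊗ Y') Y'' ≫
    D.mp s (𝟙 X) (α_ Y Y' Y'').hom = (α_ _ _ _).hom ≫ D.val s X Y ◁ D.m₂ s X Y' Y'' ≫
      D.m₂ s X Y (Y' ⊗ Y'') := by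
  refine hom_ext_of_sq (π := πG) h𝓖 (J.intersection_covering (chartSieve_mem pH pK E s X Y)
    (J.intersection_covering (chartSieve_mem pH pK E s X Y') (chartSieve_mem pH pK E s X Y''))) ?_
  rintro V f ⟨⟨y, z, x, α, β, ⟨e⟩⟩, hf', hf''⟩
  obtain ⟨-, z', -, -, β', -⟩ := id hf'
  obtain ⟨x', ⟨e'⟩⟩ := exists_over pH pK rfl hf' α β'
  obtain ⟨-, z'', -, -, β'', -⟩ := id hf''
  obtain ⟨x'', ⟨e''⟩⟩ := exists_over pH pK rfl hf'' α β''
  exact ⟨_, _, _, _, (α_ x x' x'').hom, ((Sq.whiskerRight (Φ.m₂_sq rfl α β β' e e')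
      (Φ.fr rfl α β'' e'')).comp ((Φ.m₂_sq rfl α (tens β β') β'' (e.mul₂ e') e'').comp
      (Φ.mp_sq rfl (.id α) (Sq.associator β β' β'') (Butterfly.Over.tr_eq_of_elt _ _ (α_ x x' x'').hom
        (Butterfly.Over.mul₂_assoc_val e e' e'') rfl rfl rfl)))).congr (by simp),
    ((Sq.associator _ _ _).comp ((Sq.whiskerLeft (Φ.fr rfl α β e)
      (Φ.m₂_sq rfl α β' β'' e' e'')).comp (Φ.m₂_sq rfl α β (tens β' β'') e (e'.mul₂ e'')))).congr
      (by simp)⟩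

variable (X Y) in
lemma m₁_leftUnitor : (λ_ (D.val s X Y)).hom =
    D.e₁ s Y ▷ _ ≫ D.m₁ s (𝟙_ _) X Y ≫ D.mp s (λ_ X).hom (𝟙 Y) := by
  refine hom_ext_of_sq (π := πG) h𝓖 (chartSieve_mem pH pK E s X Y) ?_
  rintro V f ⟨y, z, x, α, β, ⟨e⟩⟩
  exact ⟨_, _, _, _, (λ_ x).hom, Sq.leftUnitor _, ((Sq.whiskerRight (Φ.e₁_sq rfl β) (Φ.fr rfl α β e)).comp
    ((Φ.m₁_sq rfl (unitFrame _ _) α β _ e).comp (Φ.mp_sq rfl (Sq.leftUnitor α) (.id β)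
      (Butterfly.Over.tr_eq_of_elt _ _ (λ_ x).hom (Butterfly.Over.one₁_mul₁_val e) rfl rfl rfl)))).congr
      (by simp)⟩

variable (X Y) in
lemma m₁_rightUnitor : (ρ_ (D.val s X Y)).hom =
    _ ◁ D.e₁ s Y ≫ D.m₁ s X (𝟙_ _) Y ≫ D.mp s (ρ_ X).hom (𝟙 Y) := by
  refine hom_ext_of_sq (π := πG) h𝓖 (chartSieve_mem pH pK E s X Y) ?_
  rintro V f ⟨y, z, x, α, β, ⟨e⟩⟩
  exact ⟨_, _, _, _, (ρ_ x).hom, Sq.rightUnitor _, ((Sq.whiskerLeft (Φ.fr rfl α β e) (Φ.e₁_sq rfl β)).comp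
    ((Φ.m₁_sq rfl α (unitFrame _ _) β e _).comp (Φ.mp_sq rfl (Sq.rightUnitor α) (.id β)
      (Butterfly.Over.tr_eq_of_elt _ _ (ρ_ x).hom (Butterfly.Over.mul₁_one₁_val e) rfl rfl rfl)))).congr
      (by simp)⟩

variable (X Y) in
lemma m₂_leftUnitor : (λ_ (D.val s X Y)).hom =
    D.e₂ s X ▷ _ ≫ D.m₂ s X (𝟙_ _) Y ≫ D.mp s (𝟙 X) (λ_ Y).hom := by
  refine hom_ext_of_sq (π := πG) h𝓖 (chartSieve_mem pH pK E s X Y) ?_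
  rintro V f ⟨y, z, x, α, β, ⟨e⟩⟩
  exact ⟨_, _, _, _, (λ_ x).hom, Sq.leftUnitor _, ((Sq.whiskerRight (Φ.e₂_sq rfl α) (Φ.fr rfl α β e)).comp
    ((Φ.m₂_sq rfl α (unitFrame _ _) β _ e).comp (Φ.mp_sq rfl (.id α) (Sq.leftUnitor β)
      (Butterfly.Over.tr_eq_of_elt _ _ (λ_ x).hom (Butterfly.Over.one₂_mul₂_val e) rfl rfl rfl)))).congr
      (by simp)⟩

variable (X Y) in
lemma m₂_rightUnitor : (ρ_ (D.val s X Y)).hom =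
    _ ◁ D.e₂ s X ≫ D.m₂ s X Y (𝟙_ _) ≫ D.mp s (𝟙 X) (ρ_ Y).hom := by
  refine hom_ext_of_sq (π := πG) h𝓖 (chartSieve_mem pH pK E s X Y) ?_
  rintro V f ⟨y, z, x, α, β, ⟨e⟩⟩
  exact ⟨_, _, _, _, (ρ_ x).hom, Sq.rightUnitor _, ((Sq.whiskerLeft (Φ.fr rfl α β e) (Φ.e₂_sq rfl α)).comp
    ((Φ.m₂_sq rfl α β (unitFrame _ _) e _).comp (Φ.mp_sq rfl (.id α) (Sq.rightUnitor β)
      (Butterfly.Over.tr_eq_of_elt _ _ (ρ_ x).hom (Butterfly.Over.mul₂_one₂_val e) rfl rfl rfl)))).congr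
      (by simp)⟩

variable (X X' Y Y') in
lemma interchange (hb : ∀ {V : C} (x x' : G.Pt V), μ (πG.fn V) x x' ≫ (πG.fn V).map (β_ x x').hom =
      (β_ _ _).hom ≫ μ (πG.fn V) x' x) :
    (D.m₁ s X X' Y ⊗ₘ D.m₁ s X X' Y') ≫ D.m₂ s (X ⊗ X') Y Y' =
      tensorμ _ _ _ _ ≫ (D.m₂ s X Y Y' ⊗ₘ D.m₂ s X' Y Y') ≫ D.m₁ s X X' (Y ⊗ Y') := by
  refine hom_ext_of_sq (π := πG) h𝓖 (J.intersection_covering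
    (J.intersection_covering (chartSieve_mem pH pK E s X Y) (chartSieve_mem pH pK E s X' Y))
    (J.intersection_covering (chartSieve_mem pH pK E s X Y') (chartSieve_mem pH pK E s X' Y'))) ?_
  rintro V f ⟨⟨⟨y, z, x, α, β, ⟨a⟩⟩, hf₁⟩, hf₂, hf₃⟩
  obtain ⟨y', -, -, α', -, -⟩ := id hf₁
  obtain ⟨x₁, ⟨a'⟩⟩ := exists_over pH pK rfl hf₁ α' β
  obtain ⟨-, z', -, -, β', -⟩ := id hf₂
  obtain ⟨x₂, ⟨b⟩⟩ := exists_over pH pK rfl hf₂ α β'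
  obtain ⟨x₃, ⟨b'⟩⟩ := exists_over pH pK rfl hf₃ α' β'
  have h₁ := (Sq.tens (Φ.m₁_sq rfl α α' β a a') (Φ.m₁_sq rfl α α' β' b b')).comp
    (Φ.m₂_sq rfl (tens α α') β β' (a.mul₁ a') (b.mul₁ b'))
  have h₂ : Sq (𝓖.res f) (πG.fn V) (𝟙 _) (tensorμ x x₁ x₂ x₃)
      (Φ.fr (s := s) rfl (tens α α') (tens β β') ((a.mul₁ a').mul₂ (b.mul₁ b')))
      (Φ.fr (s := s) rfl (tens α α') (tens β β') ((a.mul₂ b).mul₁ (a'.mul₂ b'))) := by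
    rw [← Butterfly.Over.interchange, ← Butterfly.Over.tr_id_id]
    have h := Φ.fr_tr (s := s) rfl (tens α α') (tens β β') ((a.mul₁ a').mul₂ (b.mul₁ b')) (𝟙 _)
      (𝟙 _) (tensorμ x x₁ x₂ x₃)
    rw [CategoryTheory.Functor.map_id, CategoryTheory.Functor.map_id, Category.comp_id,
      Category.comp_id] at h
    unfold Sq
    rw [CategoryTheory.Functor.map_id, Category.id_comp]
    exact h
  have h₃ := h₁.comp h₂
  rw [Category.comp_id] at h₃
  exact ⟨_, _, _, _, tensorμ x x₁ x₂ x₃, h₃.congr (by simp),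
    ((Sq.tensorμ (𝓖.res_braided f) hb _ _ _ _).comp
      ((Sq.tens (Φ.m₂_sq rfl α β β' a b) (Φ.m₂_sq rfl α' β β' a' b')).comp
      (Φ.m₁_sq rfl α α' (tens β β') (a.mul₂ b) (a'.mul₂ b')))).congr (by simp)⟩

omit pH pK in
lemma unit_eq : D.e₁ s (𝟙_ _) = D.e₂ s (𝟙_ _) := by
  refine hom_ext_of_sq (π := πG) h𝓖 (J.top_mem U) ?_
  rintro V f -
  have h := Φ.e₁_sq (s := s) (f := f) rfl (unitFrame (𝓚.res f) (πK.fn V))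
  rw [Butterfly.Over.one₁_one₂] at h
  exact ⟨_, _, _, _, _, h, Φ.e₂_sq rfl (unitFrame (𝓗.res f) (πH.fn V))⟩

variable {s} (g : V ⟶ U) {t : S.obj.obj (op V)} (ht : S.obj.map g.op s = t)

lemma rs_natural (a : X ⟶ X') (b : Y ⟶ Y') :
    (𝓖.res g).map (D.mp s a b) ≫ D.rs g ht X' Y' =
      D.rs g ht X Y ≫ D.mp t ((𝓗.res g).map a) ((𝓚.res g).map b) := by
  refine hom_ext_of_sq (π := πG) h𝓖 (J.pullback_stable g (J.intersection_covering
    (chartSieve_mem pH pK E s X Y) (J.intersection_covering (pH.frameSieve_mem X')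
      (pK.frameSieve_mem Y')))) ?_
  rintro W f ⟨⟨y, z, x, α, β, ⟨e⟩⟩, ⟨y', ⟨α'⟩⟩, ⟨z', ⟨β'⟩⟩⟩
  have hr : S.obj.map f.op t = S.obj.map (f ≫ g).op s := by rw [← ht]; simp
  obtain ⟨h, hh⟩ := exists_sq pH.loc pH.stack a α α'
  obtain ⟨k, hk⟩ := exists_sq pK.loc pK.stack b β β'
  exact ⟨_, _, _, _, 𝟙 _, ((down_sq rfl (Φ.mp_sq rfl hh hk rfl)).comp
      (Φ.rs_sq rfl ht hr rfl α' β' (e.tr h k (𝟙 _)))).congr (Category.comp_id _),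
    ((Φ.rs_sq rfl ht hr rfl α β e).comp
      (Φ.mp_sq hr (down_sq rfl hh) (down_sq rfl hk) rfl)).congr (Category.comp_id _)⟩

variable (X X' Y) in
lemma rs_mul₁ : μ (𝓖.res g) _ _ ≫ (𝓖.res g).map (D.m₁ s X X' Y) ≫ D.rs g ht (X ⊗ X') Y =
    (D.rs g ht X Y ⊗ₘ D.rs g ht X' Y) ≫ D.m₁ t _ _ _ ≫ D.mp t (μ (𝓗.res g) X X') (𝟙 _) := by
  refine hom_ext_of_sq (π := πG) h𝓖 (J.pullback_stable g (J.intersection_covering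
    (chartSieve_mem pH pK E s X Y) (chartSieve_mem pH pK E s X' Y))) ?_
  rintro W f ⟨⟨y, z, x, α, β, ⟨e⟩⟩, hf'⟩
  obtain ⟨y', -, -, α', -, -⟩ := id hf'
  obtain ⟨x', ⟨e'⟩⟩ := exists_over pH pK rfl hf' α' β
  have hr : S.obj.map f.op t = S.obj.map (f ≫ g).op s := by rw [← ht]; simp
  exact ⟨_, _, _, _, 𝟙 _, ((μ_down rfl _ _).comp ((down_sq rfl (Φ.m₁_sq rfl α α' β e e')).comp
      (Φ.rs_sq rfl ht hr rfl (tens α α') β (e.mul₁ e')))).congr (by simp),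
    (((Φ.rs_sq rfl ht hr rfl α β e).tens (Φ.rs_sq rfl ht hr rfl α' β e')).comp
      ((Φ.m₁_sq hr (down rfl α) (down rfl α') (down rfl β) e e').comp
        (Φ.mp_sq hr (μ_down rfl α α') (.id _) (Butterfly.Over.tr_id _)))).congr (by simp)⟩

variable (X Y Y') in
lemma rs_mul₂ : μ (𝓖.res g) _ _ ≫ (𝓖.res g).map (D.m₂ s X Y Y') ≫ D.rs g ht X (Y ⊗ Y') =
    (D.rs g ht X Y ⊗ₘ D.rs g ht X Y') ≫ D.m₂ t _ _ _ ≫ D.mp t (𝟙 _) (μ (𝓚.res g) Y Y') := by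
  refine hom_ext_of_sq (π := πG) h𝓖 (J.pullback_stable g (J.intersection_covering
    (chartSieve_mem pH pK E s X Y) (chartSieve_mem pH pK E s X Y'))) ?_
  rintro W f ⟨⟨y, z, x, α, β, ⟨e⟩⟩, hf'⟩
  obtain ⟨-, z', -, -, β', -⟩ := id hf'
  obtain ⟨x', ⟨e'⟩⟩ := exists_over pH pK rfl hf' α β'
  have hr : S.obj.map f.op t = S.obj.map (f ≫ g).op s := by rw [← ht]; simp
  exact ⟨_, _, _, _, 𝟙 _, ((μ_down rfl _ _).comp ((down_sq rfl (Φ.m₂_sq rfl α β β' e e')).comp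
      (Φ.rs_sq rfl ht hr rfl α (tens β β') (e.mul₂ e')))).congr (by simp),
    (((Φ.rs_sq rfl ht hr rfl α β e).tens (Φ.rs_sq rfl ht hr rfl α β' e')).comp
      ((Φ.m₂_sq hr (down rfl α) (down rfl β) (down rfl β') e e').comp
        (Φ.mp_sq hr (.id _) (μ_down rfl β β') (Butterfly.Over.tr_id _)))).congr (by simp)⟩

variable (Y) in
omit pH in
lemma rs_one₁ : ε (𝓖.res g) ≫ (𝓖.res g).map (D.e₁ s Y) ≫ D.rs g ht (𝟙_ _) Y =
    D.e₁ t _ ≫ D.mp t (ε (𝓗.res g)) (𝟙 _) := by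
  refine hom_ext_of_sq (π := πG) h𝓖 (J.pullback_stable g (pK.frameSieve_mem Y)) ?_
  rintro W f ⟨z, ⟨β⟩⟩
  have hr : S.obj.map f.op t = S.obj.map (f ≫ g).op s := by rw [← ht]; simp
  exact ⟨_, _, _, _, 𝟙 _, ((ε_down rfl).comp ((down_sq rfl (Φ.e₁_sq rfl β)).comp
      (Φ.rs_sq rfl ht hr rfl (unitFrame _ _) β _))).congr (by simp),
    ((Φ.e₁_sq hr (down rfl β)).comp (Φ.mp_sq hr (ε_down rfl) (.id _)
      (Butterfly.Over.tr_id _))).congr (by simp)⟩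

variable (X) in
omit pK in
lemma rs_one₂ : ε (𝓖.res g) ≫ (𝓖.res g).map (D.e₂ s X) ≫ D.rs g ht X (𝟙_ _) =
    D.e₂ t _ ≫ D.mp t (𝟙 _) (ε (𝓚.res g)) := by
  refine hom_ext_of_sq (π := πG) h𝓖 (J.pullback_stable g (pH.frameSieve_mem X)) ?_
  rintro W f ⟨y, ⟨α⟩⟩
  have hr : S.obj.map f.op t = S.obj.map (f ≫ g).op s := by rw [← ht]; simp
  exact ⟨_, _, _, _, 𝟙 _, ((ε_down rfl).comp ((down_sq rfl (Φ.e₂_sq rfl α)).comp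
      (Φ.rs_sq rfl ht hr rfl α (unitFrame _ _) _))).congr (by simp),
    ((Φ.e₂_sq hr (down rfl α)).comp (Φ.mp_sq hr (.id _) (ε_down rfl)
      (Butterfly.Over.tr_id _))).congr (by simp)⟩

variable (X Y) in
lemma rs_id (hs : S.obj.map (𝟙 U).op s = s) :
    D.rs (𝟙 U) hs X Y ≫ D.mp s ((𝓗.resId U).hom.app X) ((𝓚.resId U).hom.app Y) =
      (𝓖.resId U).hom.app (D.val s X Y) := by
  refine hom_ext_of_sq (π := πG) h𝓖 (chartSieve_mem pH pK E s X Y) ?_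
  rintro V f ⟨y, z, x, α, β, ⟨e⟩⟩
  exact ⟨_, _, _, _, 𝟙 _, ((Φ.rs_sq (Category.comp_id f) hs rfl rfl α β e).comp
    (Φ.mp_sq rfl (resId_down (Category.comp_id f) α) (resId_down (Category.comp_id f) β)
      (Butterfly.Over.tr_id _))).congr (by simp), resId_down (Category.comp_id f) _⟩

variable (X Y) in
lemma rs_comp (k : W ⟶ V) {r : S.obj.obj (op W)} (hr : S.obj.map k.op t = r)
    (hr' : S.obj.map (k ≫ g).op s = r) :
    D.rs (k ≫ g) hr' X Y ≫ D.mp r ((𝓗.resComp g k).hom.app X) ((𝓚.resComp g k).hom.app Y) =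
      (𝓖.resComp g k).hom.app (D.val s X Y) ≫ (𝓖.res k).map (D.rs g ht X Y) ≫
        D.rs k hr ((𝓗.res g).obj X) ((𝓚.res g).obj Y) := by
  refine hom_ext_of_sq (π := πG) h𝓖 (J.pullback_stable (k ≫ g) (chartSieve_mem pH pK E s X Y)) ?_
  rintro Z f ⟨y, z, x, α, β, ⟨e⟩⟩
  have hr₁ : S.obj.map f.op r = S.obj.map (f ≫ k ≫ g).op s := by rw [← hr']; simp
  have hr₂ : S.obj.map (f ≫ k).op t = S.obj.map (f ≫ k ≫ g).op s := by rw [← ht]; simp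
  have hq : (f ≫ k) ≫ g = f ≫ k ≫ g := Category.assoc _ _ _
  exact ⟨_, _, _, _, 𝟙 _, ((Φ.rs_sq rfl hr' hr₁ rfl α β e).comp
      (Φ.mp_sq hr₁ (resComp_down rfl hq rfl α) (resComp_down rfl hq rfl β)
        (Butterfly.Over.tr_id _))).congr (by simp),
    ((resComp_down rfl hq rfl (Φ.fr rfl α β e)).comp
      ((down_sq rfl (Φ.rs_sq hq ht hr₂ rfl α β e)).comp
        (Φ.rs_sq rfl hr hr₁ hr₂ (down hq α) (down hq β) e))).congr (by simp)⟩

end Framing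

end BiaddBfl

namespace BiaddBfl

open Functor.LaxMonoidal CrossedModule MonoidalMorphism

variable {C : Type u} [Category.{v} C] {J : GrothendieckTopology C} {S S' S'' : Sheaf J (Type w)}
  {H K : CrossedModule.{v, u, w} J} {G : BraidedCrossedModule.{v, u, w} J}
  {𝓗 : MonoidalPrestack.{v, u, v₁, u₁} C} {𝓚 : MonoidalPrestack.{v, u, v₂, u₂} C}
  {𝓖 : BraidedPrestack.{v, u, w, u₃} C}
  {πH : MonoidalMorphism H.prestack 𝓗} {πK : MonoidalMorphism K.prestack 𝓚}
  {πG : MonoidalMorphism G.toCrossedModule.prestack 𝓖.toMonoidalPrestack}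
  {E : Butterfly S H K G} {D : PreBiadd S 𝓗 𝓚 𝓖}

namespace Framing

variable (Φ : Framing πH πK πG E D) (pH : πH.IsPresentation) (pK : πK.IsPresentation)
  (h𝓖 : 𝓖.toMonoidalPrestack.IsGroupLikeStack J)

/-- The bifunctors of a framed family of objects. -/
@[reducible]
def bifunctor {U : C} (s : S.obj.obj (op U)) : 𝓗.Fib U ⥤ 𝓚.Fib U ⥤ 𝓖.Fib U where
  obj X :=
    { obj := fun Y => D.val s X Y
      map := fun b => D.mp s (𝟙 X) b
      map_id := fun Y => Φ.mp_id pH pK h𝓖 s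
      map_comp := fun b b' => by rw [← Φ.mp_comp pH pK h𝓖 s, Category.comp_id] }
  map a :=
    { app := fun Y => D.mp s a (𝟙 Y)
      naturality := fun Y Y' b => by
        rw [← Φ.mp_comp pH pK h𝓖 s, ← Φ.mp_comp pH pK h𝓖 s]
        simp }
  map_id X := NatTrans.ext (funext fun Y => Φ.mp_id pH pK h𝓖 s)
  map_comp a a' := NatTrans.ext (funext fun Y => by
    have h := Φ.mp_comp pH pK h𝓖 s a (𝟙 Y) a' (𝟙 Y)
    rw [Category.comp_id] at h
    exact h)

lemma bimap_bifunctor {U : C} (s : S.obj.obj (op U)) {X X' : 𝓗.Fib U} {Y Y' : 𝓚.Fib U} (a : X ⟶ X')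
    (b : Y ⟶ Y') : bimap (Φ.bifunctor pH pK h𝓖 s) a b = D.mp s a b := by
  change D.mp s a (𝟙 _) ≫ D.mp s (𝟙 _) b = _
  rw [← Φ.mp_comp pH pK h𝓖 s, Category.comp_id, Category.id_comp]

/-- The monoidal structure in the first variable. -/
@[reducible]
noncomputable def monoidal₁ {U : C} (s : S.obj.obj (op U)) (Y : 𝓚.Fib U) :
    ((Φ.bifunctor pH pK h𝓖 s).flip.obj Y).Monoidal :=
  Functor.CoreMonoidal.toMonoidal
    { εIso := @asIso _ _ _ _ (D.e₁ s Y) (h𝓖.isIso _)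
      μIso := fun X X' => @asIso _ _ _ _ (D.m₁ s X X' Y) (h𝓖.isIso _)
      μIso_hom_natural_left := fun a X' => by
        have h := Φ.m₁_natural pH pK h𝓖 s a (𝟙 X') (𝟙 Y)
        rw [tensorHom_id, Φ.mp_id pH pK h𝓖 s, tensorHom_id] at h
        exact h.symm
      μIso_hom_natural_right := fun X' a => by
        have h := Φ.m₁_natural pH pK h𝓖 s (𝟙 X') a (𝟙 Y)
        rw [id_tensorHom, Φ.mp_id pH pK h𝓖 s, id_tensorHom] at h
        exact h.symm
      associativity := fun X X' X'' => Φ.m₁_assoc pH pK h𝓖 s X X' X''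
      left_unitality := fun X => Φ.m₁_leftUnitor pH pK h𝓖 s X Y
      right_unitality := fun X => Φ.m₁_rightUnitor pH pK h𝓖 s X Y }

/-- The monoidal structure in the second variable. -/
@[reducible]
noncomputable def monoidal₂ {U : C} (s : S.obj.obj (op U)) (X : 𝓗.Fib U) :
    ((Φ.bifunctor pH pK h𝓖 s).obj X).Monoidal :=
  Functor.CoreMonoidal.toMonoidal
    { εIso := @asIso _ _ _ _ (D.e₂ s X) (h𝓖.isIso _)
      μIso := fun Y Y' => @asIso _ _ _ _ (D.m₂ s X Y Y') (h𝓖.isIso _)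
      μIso_hom_natural_left := fun b Y' => by
        have h := Φ.m₂_natural pH pK h𝓖 s (𝟙 X) b (𝟙 Y')
        rw [tensorHom_id, Φ.mp_id pH pK h𝓖 s, tensorHom_id] at h
        exact h.symm
      μIso_hom_natural_right := fun Y' b => by
        have h := Φ.m₂_natural pH pK h𝓖 s (𝟙 X) (𝟙 Y') b
        rw [id_tensorHom, Φ.mp_id pH pK h𝓖 s, id_tensorHom] at h
        exact h.symm
      associativity := fun Y Y' Y'' => Φ.m₂_assoc pH pK h𝓖 s Y Y' Y''
      left_unitality := fun Y => Φ.m₂_leftUnitor pH pK h𝓖 s X Y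
      right_unitality := fun Y => Φ.m₂_rightUnitor pH pK h𝓖 s X Y }

variable (hb : ∀ {V : C} (x x' : G.Pt V), μ (πG.fn V) x x' ≫ (πG.fn V).map (β_ x x').hom =
      (β_ _ _).hom ≫ μ (πG.fn V) x' x)

/-- The biadditive structure of a framed family of objects. -/
@[reducible]
noncomputable def biadditive {U : C} (s : S.obj.obj (op U)) : Biadditive (Φ.bifunctor pH pK h𝓖 s) where
  mon₁ := Φ.monoidal₁ pH pK h𝓖 s
  mon₂ := Φ.monoidal₂ pH pK h𝓖 s
  natural₁ {Y Y'} b :=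
    letI := Φ.monoidal₁ pH pK h𝓖 s
    { unit := Φ.e₁_natural pK h𝓖 s b
      tensor := fun X X' => by
        have h := Φ.m₁_natural pH pK h𝓖 s (𝟙 X) (𝟙 X') b
        rw [id_tensorHom_id] at h
        exact h }
  natural₂ {X X'} a :=
    letI := Φ.monoidal₂ pH pK h𝓖 s
    { unit := Φ.e₂_natural pH h𝓖 s a
      tensor := fun Y Y' => by
        have h := Φ.m₂_natural pH pK h𝓖 s a (𝟙 Y) (𝟙 Y')
        rw [id_tensorHom_id] at h
        exact h }
  interchange X X' Y Y' := Φ.interchange pH pK h𝓖 s X X' Y Y' hb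
  unit_eq := Φ.unit_eq h𝓖 s

/-- The biadditive functor of a framed family of objects. -/
@[reducible]
noncomputable def toBiaddFunctor : BiaddFunctor S 𝓗 𝓚 𝓖 :=
  letI := fun {U : C} (s : S.obj.obj (op U)) => Φ.biadditive pH pK h𝓖 hb s
  { functor := fun s => Φ.bifunctor pH pK h𝓖 s
    biadditive := fun s => Φ.biadditive pH pK h𝓖 hb s
    resIso := fun {U V} f s t h => NatIso.ofComponents
      (fun X => NatIso.ofComponents (fun Y => @asIso _ _ _ _ (D.rs f h X Y) (h𝓖.isIso _))
        (fun {Y Y'} b => by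
          have h := Φ.rs_natural pH pK h𝓖 f h (𝟙 X) b
          rw [CategoryTheory.Functor.map_id] at h
          exact h))
      (fun {X X'} a => NatTrans.ext (funext fun Y => by
        have h := Φ.rs_natural pH pK h𝓖 f h a (𝟙 Y)
        rw [CategoryTheory.Functor.map_id] at h
        exact h))
    resIso_isMonoidal₁ := fun f s t h Y =>
      { unit := (Category.assoc _ _ _).trans (Φ.rs_one₁ pK h𝓖 Y f h)
        tensor := fun X X' => (Category.assoc _ _ _).trans (Φ.rs_mul₁ pH pK h𝓖 X X' Y f h) }
    resIso_isMonoidal₂ := fun {U V} f s t h X =>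
      letI := Φ.monoidal₂ pH pK h𝓖 s
      letI := Φ.monoidal₂ pH pK h𝓖 t
      { unit := (Category.assoc _ _ _).trans (Φ.rs_one₂ pH h𝓖 X f h)
        tensor := fun Y Y' => (Category.assoc _ _ _).trans (Φ.rs_mul₂ pH pK h𝓖 X Y Y' f h) }
    resIso_id := fun {U} s h X Y => by
      have h₁ := Φ.rs_id pH pK h𝓖 X Y h
      rw [← Φ.bimap_bifunctor pH pK h𝓖] at h₁
      exact h₁
    resIso_comp := fun {U V W} f g s t r h h' h'' X Y => by
      have h₁ := Φ.rs_comp pH pK h𝓖 X Y f h g h' h''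
      rw [← Φ.bimap_bifunctor pH pK h𝓖] at h₁
      exact h₁ }

/-- The framing of the biadditive functor of a framed family of objects. -/
noncomputable def toFraming : Framing πH πK πG E (Φ.toBiaddFunctor pH pK h𝓖 hb).pre where
  toFrameSystem := Φ.toFrameSystem
  mp_sq {U V f s t} ht {X X' Y Y' y y' z z' x x' a b α α' β β' h k m e e'} h₁ h₂ h₃ := by
    have h := Φ.mp_sq ht h₁ h₂ h₃
    rw [← Φ.bimap_bifunctor pH pK h𝓖] at h
    exact h
  m₁_sq := Φ.m₁_sq
  m₂_sq := Φ.m₂_sq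
  e₁_sq := Φ.e₁_sq
  e₂_sq := Φ.e₂_sq
  rs_sq := Φ.rs_sq

end Framing

end BiaddBfl

namespace BiaddBfl

open Functor.LaxMonoidal CrossedModule MonoidalMorphism

variable {C : Type u} [Category.{v} C] {J : GrothendieckTopology C} {S S' S'' : Sheaf J (Type w)}
  {H K : CrossedModule.{v, u, w} J} {G : BraidedCrossedModule.{v, u, w} J}
  {𝓗 : MonoidalPrestack.{v, u, v₁, u₁} C} {𝓚 : MonoidalPrestack.{v, u, v₂, u₂} C}
  {𝓖 : BraidedPrestack.{v, u, w, u₃} C}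
  {πH : MonoidalMorphism H.prestack 𝓗} {πK : MonoidalMorphism K.prestack 𝓚}
  {πG : MonoidalMorphism G.toCrossedModule.prestack 𝓖.toMonoidalPrestack}
  {E : Butterfly S H K G}

/-! ### Frames over the identity -/

namespace MonoidalMorphism

variable {M : CrossedModule.{v, u, w} J} {Q : MonoidalPrestack.{v, u, v₁, u₁} C}
  {π : MonoidalMorphism M.prestack Q} {U V : C}

/-- A frame over the identity. -/
def idFrame {X : Q.Fib U} {y : M.Pt U} (a : X ⟶ (π.fn U).obj y) : π.Frame (𝟙 U) X y :=
  (Q.resId U).hom.app X ≫ a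

lemma sq_idFrame {X X' : Q.Fib U} {y y' : M.Pt U} {φ : X ⟶ X'} {m : y ⟶ y'}
    {a : X ⟶ (π.fn U).obj y} {b : X' ⟶ (π.fn U).obj y'} :
    Sq (Q.res (𝟙 U)) (π.fn U) φ m (idFrame a) (idFrame b) ↔ φ ≫ b = a ≫ (π.fn U).map m := by
  have h := (Q.resId U).hom.naturality φ
  unfold Sq idFrame
  rw [← cancel_epi ((Q.resId U).hom.app X), reassoc_of% h, Category.assoc]

lemma tens_idFrame {X X' : Q.Fib U} {y y' : M.Pt U} (a : X ⟶ (π.fn U).obj y)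
    (a' : X' ⟶ (π.fn U).obj y') :
    tens (L := Q.res (𝟙 U)) (R := π.fn U) (idFrame a) (idFrame a') =
      idFrame ((a ⊗ₘ a') ≫ μ (π.fn U) y y') := by
  have h := NatTrans.IsMonoidal.tensor (τ := (Q.resId U).hom) X X'
  refine (eq_tens ?_).symm
  unfold idFrame
  rw [reassoc_of% h, ← tensorHom_comp_tensorHom]
  simp

lemma unitFrame_eq_idFrame :
    unitFrame (Q.res (𝟙 U)) (π.fn U) = idFrame (ε (π.fn U)) := by
  have h := NatTrans.IsMonoidal.unit (τ := (Q.resId U).hom)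
  refine (eq_unitFrame ?_).symm
  unfold idFrame
  rw [reassoc_of% h]
  simp

lemma down_eq_idFrame {f : V ⟶ U} (h : 𝟙 V ≫ f = f) {X : Q.Fib U} {y : M.Pt V}
    (a : π.Frame f X y) : down h a = idFrame a := by
  have e := Q.toPrestack.resCompEq_id_right f h X
  unfold down idFrame
  rw [← cancel_epi ((Q.toPrestack.resCompEq h).hom.app X), Iso.hom_inv_id_app_assoc, reassoc_of% e]

lemma fres_idFrame {f : V ⟶ U} (h : f ≫ 𝟙 U = f) {X : Q.Fib U} {y : M.Pt U}
    (a : X ⟶ (π.fn U).obj y) :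
    fres h (idFrame a) = (Q.res f).map a ≫ (π.fnRes f).hom.app y := by
  have e := Q.toPrestack.resCompEq_id_left f h X
  unfold fres idFrame
  rw [Functor.map_comp, Category.assoc, reassoc_of% e]

end MonoidalMorphism

/-! ### Biadditive functors represented by a given butterfly -/

/-- A butterfly represents a biadditive functor if its points give compatible isomorphisms. -/
def Represents.ofPoints {F : BiaddFunctor S 𝓗 𝓚 𝓖}
    (q : ∀ {U : C} {s : S.obj.obj (op U)} {y : H.Pt U} {z : K.Pt U} {x : G.Pt U},
      E.Over s y z x → (((F.functor s).obj ((πH.fn U).obj y)).obj ((πK.fn U).obj z) ⟶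
        (πG.fn U).obj x))
    (tr : ∀ {U : C} {s : S.obj.obj (op U)} {y y' : H.Pt U} {z z' : K.Pt U} {x x' : G.Pt U}
      (e : E.Over s y z x) (h : y ⟶ y') (k : z ⟶ z') (m : x ⟶ x'),
      bimap (F.functor s) ((πH.fn U).map h) ((πK.fn U).map k) ≫ q (e.tr h k m) =
        q e ≫ (πG.fn U).map m)
    (res : ∀ {U V : C} (f : V ⟶ U) {s : S.obj.obj (op U)} {t : S.obj.obj (op V)}
      (ht : S.obj.map f.op s = t) {y : H.Pt U} {z : K.Pt U} {x : G.Pt U} (e : E.Over s y z x),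
      F.rs f ht _ _ ≫ bimap (F.functor t) ((πH.fnRes f).hom.app y) ((πK.fnRes f).hom.app z) ≫
        q (e.res f ht) = (𝓖.res f).map (q e) ≫ (πG.fnRes f).hom.app x)
    (mul₁ : ∀ {U : C} {s : S.obj.obj (op U)} {y y' : H.Pt U} {z : K.Pt U} {x x' : G.Pt U}
      (e : E.Over s y z x) (e' : E.Over s y' z x'),
      bμ₁ (F.functor s) _ _ _ ≫ bimap (F.functor s) (μ (πH.fn U) y y') (𝟙 _) ≫ q (e.mul₁ e') =
        (q e ⊗ₘ q e') ≫ μ (πG.fn U) x x')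
    (mul₂ : ∀ {U : C} {s : S.obj.obj (op U)} {y : H.Pt U} {z z' : K.Pt U} {x x' : G.Pt U}
      (e : E.Over s y z x) (e' : E.Over s y z' x'),
      bμ₂ (F.functor s) _ _ _ ≫ bimap (F.functor s) (𝟙 _) (μ (πK.fn U) z z') ≫ q (e.mul₂ e') =
        (q e ⊗ₘ q e') ≫ μ (πG.fn U) x x')
    (one₁ : ∀ {U : C} (s : S.obj.obj (op U)) (z : K.Pt U),
      bε₁ (F.functor s) _ ≫ bimap (F.functor s) (ε (πH.fn U)) (𝟙 _) ≫ q (.one₁ E s z) =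
        ε (πG.fn U))
    (one₂ : ∀ {U : C} (s : S.obj.obj (op U)) (y : H.Pt U),
      bε₂ (F.functor s) _ ≫ bimap (F.functor s) (𝟙 _) (ε (πK.fn U)) ≫ q (.one₂ E s y) =
        ε (πG.fn U)) :
    Represents πH πK πG E F where
  iso e s y z x h₁ h₂ h₃ h₄ := q (⟨e, h₁, h₂, h₃, h₄⟩ : E.Over s ⟨y⟩ ⟨z⟩ ⟨x⟩)
  iso_act {U} e g s y z x x' h₁ h₂ h₃ h₄ h₁' h₂' h₃' h₄' h := by
    have h := tr (⟨e, h₁, h₂, h₃, h₄⟩ : E.Over s ⟨y⟩ ⟨z⟩ ⟨x⟩) (𝟙 _) (𝟙 _)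
      (⟨g, h⟩ : (⟨x⟩ : G.Pt U) ⟶ ⟨x'⟩)
    rw [CategoryTheory.Functor.map_id, CategoryTheory.Functor.map_id, bimap_id, Category.id_comp,
      Butterfly.Over.tr_id_id] at h
    exact h
  iso_res {U V} f e s y z x h₁ h₂ h₃ h₄ h₁' h₂' h₃' h₄' := by
    refine (res f rfl (⟨e, h₁, h₂, h₃, h₄⟩ : E.Over s ⟨y⟩ ⟨z⟩ ⟨x⟩)).symm.trans ?_
    exact congrArg (_ ≫ ·) (Category.assoc _ _ _)
  iso_mul₁ {U} e e' c s y y' z x x' h₁ h₂ h₃ h₄ h₁' h₂' h₃' h₄' _ _ _ _ := by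
    have h := mul₁ (⟨e, h₁, h₂, h₃, h₄⟩ : E.Over s ⟨y⟩ ⟨z⟩ ⟨x⟩)
      (⟨e', h₁', h₂', h₃', h₄'⟩ : E.Over s ⟨y'⟩ ⟨z⟩ ⟨x'⟩)
    rw [bimap_id_right] at h
    exact h
  iso_mul₂ {U} e e' c s y z z' x x' h₁ h₂ h₃ h₄ h₁' h₂' h₃' h₄' _ _ _ _ := by
    have h := mul₂ (⟨e, h₁, h₂, h₃, h₄⟩ : E.Over s ⟨y⟩ ⟨z⟩ ⟨x⟩)
      (⟨e', h₁', h₂', h₃', h₄'⟩ : E.Over s ⟨y⟩ ⟨z'⟩ ⟨x'⟩)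
    rw [bimap_id_left] at h
    exact h
  iso_s₁ {U} s h z h₁ := by
    let m : 𝟙_ (H.Pt U) ⟶ ⟨H.d h⟩ := ⟨h, h₁⟩
    have h₂ := tr (.one₁ E s ⟨z⟩) m (𝟙 _) (𝟙 _)
    rw [Butterfly.Over.tr, Butterfly.Over.act_id, Butterfly.Over.move₂_id,
      CategoryTheory.Functor.map_id, CategoryTheory.Functor.map_id, Category.comp_id] at h₂
    have h₃ := one₁ s ⟨z⟩
    rw [← h₂, ← Category.assoc (bimap _ _ _), ← bimap_comp, Category.comp_id, bimap_id_right,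
      ← Butterfly.Over.triv₁_eq_move₁] at h₃
    exact h₃
  iso_s₂ {U} s y k h₁ := by
    let m : 𝟙_ (K.Pt U) ⟶ ⟨K.d k⟩ := ⟨k, h₁⟩
    have h₂ := tr (.one₂ E s ⟨y⟩) (𝟙 _) m (𝟙 _)
    rw [Butterfly.Over.tr, Butterfly.Over.act_id, Butterfly.Over.move₁_id,
      CategoryTheory.Functor.map_id, CategoryTheory.Functor.map_id, Category.comp_id] at h₂
    have h₃ := one₂ s ⟨y⟩
    rw [← h₂, ← Category.assoc (bimap _ _ _), ← bimap_comp, Category.comp_id, bimap_id_left,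
      ← Butterfly.Over.triv₂_eq_move₂] at h₃
    exact h₃

namespace Framing

variable {F : BiaddFunctor S 𝓗 𝓚 𝓖} (Φ : Framing πH πK πG E F.pre)

/-- The isomorphism given by a point of the butterfly. -/
def pointIso {U : C} {s : S.obj.obj (op U)} {y : H.Pt U} {z : K.Pt U} {x : G.Pt U}
    (e : E.Over s y z x) :
    ((F.functor s).obj ((πH.fn U).obj y)).obj ((πK.fn U).obj z) ⟶ (πG.fn U).obj x :=
  (𝓖.resId U).inv.app _ ≫ Φ.fr (f := 𝟙 U) (s := s) (by simp) (idFrame (𝟙 ((πH.fn U).obj y)))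
    (idFrame (𝟙 ((πK.fn U).obj z))) e

lemma fr_idFrame_id {U : C} {s : S.obj.obj (op U)} (hs : S.obj.map (𝟙 U).op s = s) {y : H.Pt U}
    {z : K.Pt U} {x : G.Pt U} (e : E.Over s y z x) :
    Φ.fr hs (idFrame (𝟙 ((πH.fn U).obj y))) (idFrame (𝟙 ((πK.fn U).obj z))) e =
      idFrame (Φ.pointIso e) :=
  (Iso.hom_inv_id_app_assoc (𝓖.resId U) _ _).symm

lemma fr_idFrame {U : C} {s : S.obj.obj (op U)} (hs : S.obj.map (𝟙 U).op s = s) {y : H.Pt U}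
    {z : K.Pt U} {x : G.Pt U} (e : E.Over s y z x) {X : 𝓗.Fib U} {Y : 𝓚.Fib U}
    (a : X ⟶ (πH.fn U).obj y) (b : Y ⟶ (πK.fn U).obj z) :
    Φ.fr hs (idFrame a) (idFrame b) e = idFrame (bimap (F.functor s) a b ≫ Φ.pointIso e) := by
  have h := Φ.mp_sq (a := a) (b := b) (h := 𝟙 y) (k := 𝟙 z) (m := 𝟙 x) hs
    (sq_idFrame.mpr (show a ≫ 𝟙 _ = a ≫ _ by simp)) (sq_idFrame.mpr (show b ≫ 𝟙 _ = b ≫ _ by simp))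
    e.tr_id
  rw [fr_idFrame_id] at h
  have h₁ := (𝓖.resId U).hom.naturality (bimap (F.functor s) a b)
  unfold Sq at h
  rw [CategoryTheory.Functor.map_id, Category.comp_id] at h
  rw [← h]
  exact (Category.assoc _ _ _).symm.trans ((congrArg (· ≫ Φ.pointIso e) h₁).trans (Category.assoc _ _ _))

/-- A framed biadditive functor is represented by the butterfly. -/
def represents : Represents πH πK πG E F := by
  refine .ofPoints (fun e => Φ.pointIso e) ?_ ?_ ?_ ?_ ?_ ?_
  · intro U s y y' z z' x x' e h k m
    have hs : S.obj.map (𝟙 U).op s = s := by simp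
    have h₁ := Φ.mp_sq (a := (πH.fn U).map h) (b := (πK.fn U).map k) (h := h) (k := k) (m := m) hs
      (sq_idFrame.mpr ((Category.comp_id _).trans (Category.id_comp _).symm))
      (sq_idFrame.mpr ((Category.comp_id _).trans (Category.id_comp _).symm)) (e := e) rfl
    rw [fr_idFrame_id, fr_idFrame_id] at h₁
    exact sq_idFrame.mp h₁
  · intro U V f s t ht y z x e
    have hs : S.obj.map (𝟙 U).op s = s := by simp
    have ht' : S.obj.map (𝟙 V).op t = t := by simp
    have h₁ := Φ.rs_sq (Category.id_comp f) ht ht' ht ((πH.fnRes f).hom.app y)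
      ((πK.fnRes f).hom.app z) (e.res f ht)
    rw [down_eq_idFrame, down_eq_idFrame, down_eq_idFrame, fr_idFrame] at h₁
    have h₂ := sq_idFrame.mp h₁
    rw [CategoryTheory.Functor.map_id, Category.comp_id] at h₂
    refine h₂.trans ?_
    have h₃ := Φ.fr_res (Category.comp_id f) hs ht ht (idFrame (𝟙 ((πH.fn U).obj y)))
      (idFrame (𝟙 ((πK.fn U).obj z))) e
    rw [fr_idFrame_id, fres_idFrame, fres_idFrame, fres_idFrame, CategoryTheory.Functor.map_id,
      CategoryTheory.Functor.map_id, Category.id_comp, Category.id_comp] at h₃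
    exact h₃
  · intro U s y y' z x x' e e'
    have hs : S.obj.map (𝟙 U).op s = s := by simp
    have h₁ := Φ.m₁_sq hs (idFrame (𝟙 ((πH.fn U).obj y))) (idFrame (𝟙 ((πH.fn U).obj y')))
      (idFrame (𝟙 ((πK.fn U).obj z))) e e'
    rw [fr_idFrame_id, fr_idFrame_id, tens_idFrame, tens_idFrame, fr_idFrame, id_tensorHom_id,
      Category.id_comp] at h₁
    have h₄ := sq_idFrame.mp h₁
    rwa [CategoryTheory.Functor.map_id, Category.comp_id] at h₄
  · intro U s y z z' x x' e e'
    have hs : S.obj.map (𝟙 U).op s = s := by simp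
    have h₁ := Φ.m₂_sq hs (idFrame (𝟙 ((πH.fn U).obj y))) (idFrame (𝟙 ((πK.fn U).obj z)))
      (idFrame (𝟙 ((πK.fn U).obj z'))) e e'
    rw [fr_idFrame_id, fr_idFrame_id, tens_idFrame, tens_idFrame, fr_idFrame, id_tensorHom_id,
      Category.id_comp] at h₁
    have h₄ := sq_idFrame.mp h₁
    rwa [CategoryTheory.Functor.map_id, Category.comp_id] at h₄
  · intro U s z
    have hs : S.obj.map (𝟙 U).op s = s := by simp
    have h₁ := Φ.e₁_sq hs (idFrame (𝟙 ((πK.fn U).obj z)))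
    rw [unitFrame_eq_idFrame, unitFrame_eq_idFrame, fr_idFrame] at h₁
    have h₄ := sq_idFrame.mp h₁
    rwa [CategoryTheory.Functor.map_id, Category.comp_id] at h₄
  · intro U s y
    have hs : S.obj.map (𝟙 U).op s = s := by simp
    have h₁ := Φ.e₂_sq hs (idFrame (𝟙 ((πH.fn U).obj y)))
    rw [unitFrame_eq_idFrame, unitFrame_eq_idFrame, fr_idFrame] at h₁
    have h₄ := sq_idFrame.mp h₁
    rwa [CategoryTheory.Functor.map_id, Category.comp_id] at h₄

end Framing

lemma exists_represents (E : Butterfly S H K G) (pH : πH.IsPresentation) (pK : πK.IsPresentation)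
    (h𝓖 : 𝓖.toMonoidalPrestack.IsGroupLikeStack J)
    (hb : ∀ {V : C} (x x' : G.Pt V), μ (πG.fn V) x x' ≫ (πG.fn V).map (β_ x x').hom =
      (β_ _ _).hom ≫ μ (πG.fn V) x' x) :
    ∃ F : BiaddFunctor S 𝓗 𝓚 𝓖, Nonempty (Represents πH πK πG E F) := by
  obtain ⟨D, ⟨Φ⟩⟩ := exists_preBiadd πG E pH pK h𝓖
  exact ⟨_, ⟨(Φ.toFraming pH pK h𝓖 hb).represents⟩⟩

end BiaddBfl

namespace BiaddBfl

open Functor.LaxMonoidal CrossedModule MonoidalMorphism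

variable {C : Type u} [Category.{v} C] {J : GrothendieckTopology C} {S S' S'' : Sheaf J (Type w)}
  {H K : CrossedModule.{v, u, w} J} {G : BraidedCrossedModule.{v, u, w} J}
  {𝓗 : MonoidalPrestack.{v, u, v₁, u₁} C} {𝓚 : MonoidalPrestack.{v, u, v₂, u₂} C}
  {𝓖 : BraidedPrestack.{v, u, w, u₃} C}
  {πH : MonoidalMorphism H.prestack 𝓗} {πK : MonoidalMorphism K.prestack 𝓚}
  {πG : MonoidalMorphism G.toCrossedModule.prestack 𝓖.toMonoidalPrestack}

/-! ### The points of a biadditive functor -/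

namespace BiaddFunctor

variable (F : BiaddFunctor S 𝓗 𝓚 𝓖) {U V W : C} {f : V ⟶ U} {s : S.obj.obj (op U)}
  {t : S.obj.obj (op V)} (ht : S.obj.map f.op s = t) {y : H.Pt U} {z : K.Pt U} {x : G.Pt U}

/-- The frame, over `f`, of a value of a biadditive functor given by an isomorphism over `V`. -/
def frame (ht : S.obj.map f.op s = t) {x : G.Pt V}
    (b : ((F.functor t).obj ((πH.fn V).obj ((H.ptRes f).obj y))).obj
      ((πK.fn V).obj ((K.ptRes f).obj z)) ⟶ (πG.fn V).obj x) :
    πG.Frame f (((F.functor s).obj ((πH.fn U).obj y)).obj ((πK.fn U).obj z)) x :=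
  F.rs f ht _ _ ≫ bimap (F.functor t) ((πH.fnRes f).hom.app y) ((πK.fnRes f).hom.app z) ≫ b

lemma frame_comp {x : G.Pt V} {x' : G.Pt V}
    (b : ((F.functor t).obj ((πH.fn V).obj ((H.ptRes f).obj y))).obj
      ((πK.fn V).obj ((K.ptRes f).obj z)) ⟶ (πG.fn V).obj x) (m : x ⟶ x') :
    F.frame ht (b ≫ (πG.fn V).map m) = F.frame ht b ≫ (πG.fn V).map m := by
  unfold frame
  simp only [Category.assoc]

/-- The isomorphism over `V` given by a frame over `f` of a value of a biadditive functor. -/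
def ofFrame {x : G.Pt V}
    (a : πG.Frame f (((F.functor s).obj ((πH.fn U).obj y)).obj ((πK.fn U).obj z)) x) :
    ((F.functor t).obj ((πH.fn V).obj ((H.ptRes f).obj y))).obj
      ((πK.fn V).obj ((K.ptRes f).obj z)) ⟶ (πG.fn V).obj x :=
  bimap (F.functor t) ((πH.fnRes f).inv.app y) ((πK.fnRes f).inv.app z) ≫
    ((F.resIso f s t ht).inv.app _).app _ ≫ a

lemma frame_ofFrame {x : G.Pt V}
    (a : πG.Frame f (((F.functor s).obj ((πH.fn U).obj y)).obj ((πK.fn U).obj z)) x) :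
    F.frame ht (F.ofFrame ht a) = a := by
  have h₁ : F.rs f ht ((πH.fn U).obj y) ((πK.fn U).obj z) ≫
      ((F.resIso f s t ht).inv.app _).app _ = 𝟙 _ :=
    NatTrans.congr_app (Iso.hom_inv_id_app (F.resIso f s t ht) _) _
  unfold frame ofFrame
  refine (congrArg (_ ≫ ·) ((Category.assoc _ _ _).symm.trans
    (congrArg (· ≫ _) (bimap_comp _ _ _ _ _).symm))).trans ?_
  rw [Iso.hom_inv_id_app, Iso.hom_inv_id_app]
  refine (congrArg (_ ≫ ·) ((congrArg (· ≫ _) (bimap_id _ _ _)).trans (Category.id_comp _))).trans ?_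
  exact (Category.assoc _ _ _).symm.trans ((congrArg (· ≫ a) h₁).trans (Category.id_comp a))

lemma frame_injective {x : G.Pt V} {b b' : ((F.functor t).obj ((πH.fn V).obj ((H.ptRes f).obj y))).obj
      ((πK.fn V).obj ((K.ptRes f).obj z)) ⟶ (πG.fn V).obj x}
    (h : F.frame ht b = F.frame ht b') : b = b' := by
  have h₁ : ((F.resIso f s t ht).inv.app _).app _ ≫
      F.rs f ht ((πH.fn U).obj y) ((πK.fn U).obj z) = 𝟙 _ :=
    NatTrans.congr_app (Iso.inv_hom_id_app (F.resIso f s t ht) _) _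
  have key (c : ((F.functor t).obj ((πH.fn V).obj ((H.ptRes f).obj y))).obj
      ((πK.fn V).obj ((K.ptRes f).obj z)) ⟶ (πG.fn V).obj x) :
      F.ofFrame ht (F.frame ht c) = c := by
    unfold frame ofFrame
    refine (congrArg (_ ≫ ·) ((Category.assoc _ _ _).symm.trans
      ((congrArg (· ≫ _) h₁).trans (Category.id_comp _)))).trans ?_
    refine (Category.assoc _ _ _).symm.trans ((congrArg (· ≫ _) (bimap_comp _ _ _ _ _).symm).trans ?_)
    rw [Iso.inv_hom_id_app, Iso.inv_hom_id_app]
    exact (congrArg (· ≫ _) (bimap_id _ _ _)).trans (Category.id_comp _)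
  rw [← key b, h, key]

/-- The restriction of an isomorphism. -/
def resPoint (a : ((F.functor s).obj ((πH.fn U).obj y)).obj ((πK.fn U).obj z) ⟶ (πG.fn U).obj x) :
    ((F.functor t).obj ((πH.fn V).obj ((H.ptRes f).obj y))).obj
      ((πK.fn V).obj ((K.ptRes f).obj z)) ⟶ (πG.fn V).obj ((G.ptRes f).obj x) :=
  F.ofFrame ht ((𝓖.res f).map a ≫ πG.ptFrame f x)

lemma frame_resPoint
    (a : ((F.functor s).obj ((πH.fn U).obj y)).obj ((πK.fn U).obj z) ⟶ (πG.fn U).obj x) :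
    F.frame ht (F.resPoint ht a) = (𝓖.res f).map a ≫ πG.ptFrame f x :=
  F.frame_ofFrame ht _

lemma fres_frame {g : W ⟶ V} {r : S.obj.obj (op W)} (hr : S.obj.map g.op t = r)
    (hr' : S.obj.map (g ≫ f).op s = r) {x : G.Pt V}
    (b : ((F.functor t).obj ((πH.fn V).obj ((H.ptRes f).obj y))).obj
      ((πK.fn V).obj ((K.ptRes f).obj z)) ⟶ (πG.fn V).obj x) :
    fres rfl (F.frame ht b) = F.frame hr' (bimap (F.functor r)
      ((πH.fn W).map ((H.ptResComp f g).hom.app y)) ((πK.fn W).map ((K.ptResComp f g).hom.app z)) ≫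
        F.resPoint hr b) := by
  have h₁ := F.frame_resPoint hr b
  have h₂ := F.rs_comp f g ht hr hr' ((πH.fn U).obj y) ((πK.fn U).obj z)
  unfold frame at h₁ ⊢
  unfold fres
  rw [Prestack.resCompEq_rfl]
  refine Eq.trans ?_ (congrArg (_ ≫ ·) ((Category.assoc _ _ _).symm.trans
    (congrArg (· ≫ _) (bimap_comp _ _ _ _ _).symm)).symm)
  rw [fnRes_comp, fnRes_comp, bimap_comp]
  refine Eq.trans ?_ (congrArg (_ ≫ ·) (Category.assoc _ _ _)).symm
  refine Eq.trans ?_ (Category.assoc _ _ _)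
  refine Eq.trans ?_ (congrArg (· ≫ _) h₂).symm
  refine Eq.trans ?_ (Category.assoc _ _ _).symm
  refine congrArg (_ ≫ ·) ?_
  rw [bimap_comp]
  simp only [Functor.map_comp, Category.assoc] at h₁ ⊢
  rw [← reassoc_of% F.rs_natural g hr]
  exact congrArg (_ ≫ ·) (congrArg (_ ≫ ·) h₁.symm)

lemma resPoint_id (hs : S.obj.map (𝟙 U).op s = s)
    (a : ((F.functor s).obj ((πH.fn U).obj y)).obj ((πK.fn U).obj z) ⟶ (πG.fn U).obj x) :
    bimap (F.functor s) ((πH.fn U).map ((H.ptResId U).hom.app y))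
        ((πK.fn U).map ((K.ptResId U).hom.app z)) ≫ a =
      F.resPoint hs a ≫ (πG.fn U).map ((G.ptResId U).hom.app x) := by
  refine F.frame_injective hs ?_
  rw [frame_comp, frame_resPoint]
  have h₁ := F.rs_id hs ((πH.fn U).obj y) ((πK.fn U).obj z)
  have h₂ := (𝓖.resId U).hom.naturality a
  unfold ptFrame frame
  rw [Category.assoc, fnRes_id]
  refine Eq.trans ?_ h₂.symm
  refine Eq.trans (congrArg (_ ≫ ·) ((Category.assoc _ _ _).symm.trans
    (congrArg (· ≫ _) (bimap_comp _ _ _ _ _).symm))) ?_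
  rw [fnRes_id, fnRes_id, reassoc_of% h₁]
  rfl

lemma resPoint_comp {g : W ⟶ V} {r : S.obj.obj (op W)} (hr : S.obj.map g.op t = r)
    (hr' : S.obj.map (g ≫ f).op s = r)
    (a : ((F.functor s).obj ((πH.fn U).obj y)).obj ((πK.fn U).obj z) ⟶ (πG.fn U).obj x) :
    bimap (F.functor r) ((πH.fn W).map ((H.ptResComp f g).hom.app y))
        ((πK.fn W).map ((K.ptResComp f g).hom.app z)) ≫ F.resPoint hr (F.resPoint ht a) =
      F.resPoint hr' a ≫ (πG.fn W).map ((G.ptResComp f g).hom.app x) := by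
  refine F.frame_injective hr' ?_
  rw [← fres_frame F ht, frame_resPoint, frame_comp, frame_resPoint, fres_res_map_comp, fres_ptFrame,
    Category.assoc]

end BiaddFunctor

end BiaddBfl

namespace BiaddBfl

open Functor.LaxMonoidal CrossedModule MonoidalMorphism

variable {C : Type u} [Category.{v} C] {J : GrothendieckTopology C} {S S' S'' : Sheaf J (Type w)}
  {H K : CrossedModule.{v, u, w} J} {G : BraidedCrossedModule.{v, u, w} J}
  {𝓗 : MonoidalPrestack.{v, u, v₁, u₁} C} {𝓚 : MonoidalPrestack.{v, u, v₂, u₂} C}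
  {𝓖 : BraidedPrestack.{v, u, w, u₃} C}

/-- The points of a biadditive functor `F` over `U`: the isomorphisms `F(π y, π z) ⟶ π x`. -/
structure Point (πH : MonoidalMorphism H.prestack 𝓗) (πK : MonoidalMorphism K.prestack 𝓚)
    (πG : MonoidalMorphism G.toCrossedModule.prestack 𝓖.toMonoidalPrestack)
    (F : BiaddFunctor S 𝓗 𝓚 𝓖) (U : C) : Type w where
  base : S.obj.obj (op U)
  fst : H.G₀.obj (op U)
  snd : K.G₀.obj (op U)
  sec : G.G₀.obj (op U)
  iso : F.val πH πK base fst snd ⟶ πG.pt sec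

variable {πH : MonoidalMorphism H.prestack 𝓗} {πK : MonoidalMorphism K.prestack 𝓚}
  {πG : MonoidalMorphism G.toCrossedModule.prestack 𝓖.toMonoidalPrestack}
  {F : BiaddFunctor S 𝓗 𝓚 𝓖}

namespace Point

variable {U V W : C} {s : S.obj.obj (op U)} {y y' : H.Pt U} {z z' : K.Pt U} {x x' : G.Pt U}

/-- The point given by an isomorphism. -/
abbrev of (s : S.obj.obj (op U)) (y : H.Pt U) (z : K.Pt U) (x : G.Pt U)
    (a : ((F.functor s).obj ((πH.fn U).obj y)).obj ((πK.fn U).obj z) ⟶ (πG.fn U).obj x) :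
    Point πH πK πG F U :=
  ⟨s, y.pt, z.pt, x.pt, a⟩

lemma exists_eq_of (v : Point πH πK πG F U) (hs : v.base = s) (hy : v.fst = y.pt)
    (hz : v.snd = z.pt) (hx : v.sec = x.pt) :
    ∃ a : ((F.functor s).obj ((πH.fn U).obj y)).obj ((πK.fn U).obj z) ⟶ (πG.fn U).obj x,
      v = of s y z x a := by
  obtain ⟨y⟩ := y
  obtain ⟨z⟩ := z
  obtain ⟨x⟩ := x
  obtain ⟨s', y', z', x', a⟩ := v
  dsimp only at hs hy hz hx
  subst hs hy hz hx
  exact ⟨a, rfl⟩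

lemma of_injective {a b : ((F.functor s).obj ((πH.fn U).obj y)).obj ((πK.fn U).obj z) ⟶
    (πG.fn U).obj x} (h : of s y z x a = of s y z x b) : a = b := by
  injection h

/-- Equality of points, along morphisms with trivial underlying elements. -/
lemma of_eq_iff
    {a : ((F.functor s).obj ((πH.fn U).obj y)).obj ((πK.fn U).obj z) ⟶ (πG.fn U).obj x}
    {a' : ((F.functor s).obj ((πH.fn U).obj y')).obj ((πK.fn U).obj z') ⟶ (πG.fn U).obj x'}
    (h : y ⟶ y') (k : z ⟶ z') (m : x ⟶ x') (hh : h.elt = 1) (hk : k.elt = 1) (hm : m.elt = 1) :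
    of s y z x a = of s y' z' x' a' ↔
      bimap (F.functor s) ((πH.fn U).map h) ((πK.fn U).map k) ≫ a' = a ≫ (πG.fn U).map m := by
  have hy : y'.pt = y.pt := by rw [h.eq, hh, map_one, mul_one]
  have hz : z'.pt = z.pt := by rw [k.eq, hk, map_one, mul_one]
  have hx : x'.pt = x.pt := by rw [m.eq, hm, map_one, mul_one]
  obtain ⟨y⟩ := y
  obtain ⟨z⟩ := z
  obtain ⟨x⟩ := x
  obtain ⟨y'⟩ := y'
  obtain ⟨z'⟩ := z'
  obtain ⟨x'⟩ := x'
  dsimp only at hy hz hx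
  subst hy hz hx
  obtain rfl : h = 𝟙 _ := Pt.hom_ext hh
  obtain rfl : k = 𝟙 _ := Pt.hom_ext hk
  obtain rfl : m = 𝟙 _ := Pt.hom_ext hm
  rw [CategoryTheory.Functor.map_id, CategoryTheory.Functor.map_id, CategoryTheory.Functor.map_id,
    bimap_id, Category.id_comp, Category.comp_id]
  exact ⟨fun h => (of_injective h).symm, fun h => h ▸ rfl⟩

/-- Restriction of points. -/
def res (v : Point πH πK πG F U) (f : V ⟶ U) : Point πH πK πG F V :=
  of (S.obj.map f.op v.base) ((H.ptRes f).obj ⟨v.fst⟩) ((K.ptRes f).obj ⟨v.snd⟩)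
    ((G.ptRes f).obj ⟨v.sec⟩) (F.resPoint rfl v.iso)

lemma of_res (f : V ⟶ U) {t : S.obj.obj (op V)} (ht : S.obj.map f.op s = t)
    (a : ((F.functor s).obj ((πH.fn U).obj y)).obj ((πK.fn U).obj z) ⟶ (πG.fn U).obj x) :
    (of s y z x a).res f = of t ((H.ptRes f).obj y) ((K.ptRes f).obj z) ((G.ptRes f).obj x)
      (F.resPoint ht a) := by
  subst ht
  rfl

lemma res_id (v : Point πH πK πG F U) : v.res (𝟙 U) = v := by
  obtain ⟨s, y, z, x, a⟩ := v
  have hs : S.obj.map (𝟙 U).op s = s := by simp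
  refine (of_res (y := ⟨y⟩) (z := ⟨z⟩) (x := ⟨x⟩) (𝟙 U) hs a).trans ?_
  exact (of_eq_iff ((H.ptResId U).hom.app ⟨y⟩) ((K.ptResId U).hom.app ⟨z⟩)
    ((G.ptResId U).hom.app ⟨x⟩) rfl rfl rfl).mpr (F.resPoint_id hs a)

lemma res_comp (v : Point πH πK πG F U) (f : V ⟶ U) (g : W ⟶ V) :
    v.res (g ≫ f) = (v.res f).res g := by
  obtain ⟨s, y, z, x, a⟩ := v
  have hr : S.obj.map (g ≫ f).op s = S.obj.map g.op (S.obj.map f.op s) := by simp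
  refine (of_res (y := ⟨y⟩) (z := ⟨z⟩) (x := ⟨x⟩) (g ≫ f) hr a).trans ?_
  exact (of_eq_iff ((H.ptResComp f g).hom.app ⟨y⟩) ((K.ptResComp f g).hom.app ⟨z⟩)
    ((G.ptResComp f g).hom.app ⟨x⟩) rfl rfl rfl).mpr (F.resPoint_comp rfl rfl hr a)

variable (πH πK πG F) in
/-- The presheaf of points. -/
def presheaf : Cᵒᵖ ⥤ Type w where
  obj U := Point πH πK πG F U.unop
  map f := ↾fun v => v.res f.unop
  map_id U := by
    ext v
    exact v.res_id
  map_comp f g := by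
    ext v
    exact v.res_comp f.unop g.unop

lemma eq_of_res_eq (h𝓖 : 𝓖.toMonoidalPrestack.IsGroupLikeStack J) {v v' : Point πH πK πG F U}
    {R : Sieve U} (hR : R ∈ J U) (h : ∀ {V : C} (f : V ⟶ U), R.arrows f → v.res f = v'.res f) :
    v = v' := by
  obtain ⟨s, y, z, x, a⟩ := v
  obtain ⟨s', y', z', x', a'⟩ := v'
  obtain rfl : s = s' := eq_of_locally_eq S.property hR fun f hf => congrArg Point.base (h f hf)
  obtain rfl : y = y' := eq_of_locally_eq H.isSheaf₀ hR fun f hf => congrArg Point.fst (h f hf)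
  obtain rfl : z = z' := eq_of_locally_eq K.isSheaf₀ hR fun f hf => congrArg Point.snd (h f hf)
  obtain rfl : x = x' := eq_of_locally_eq G.isSheaf₀ hR fun f hf => congrArg Point.sec (h f hf)
  obtain rfl : a = a' := h𝓖.hom_ext hR fun {V} f hf => by
    have h₁ := of_injective (y := (H.ptRes f).obj ⟨y⟩) (z := (K.ptRes f).obj ⟨z⟩)
      (x := (G.ptRes f).obj ⟨x⟩) (h f hf)
    have h₂ := F.frame_resPoint (y := ⟨y⟩) (z := ⟨z⟩) (x := ⟨x⟩) (f := f) rfl a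
    have h₃ := F.frame_resPoint (y := ⟨y⟩) (z := ⟨z⟩) (x := ⟨x⟩) (f := f) rfl a'
    have h₄ := @IsIso.mono_of_iso _ _ _ _ _ (h𝓖.isIso (πG.ptFrame f ⟨x⟩))
    exact (@cancel_mono _ _ _ _ _ _ h₄ _ _).mp (h₂.symm.trans ((congrArg (F.frame rfl) h₁).trans h₃))
  rfl

lemma presheaf_isSheaf (h𝓖 : 𝓖.toMonoidalPrestack.IsGroupLikeStack J) :
    Presheaf.IsSheaf J (presheaf πH πK πG F) := by
  rw [isSheaf_iff_isSheaf_of_type]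
  intro U R hR v hv
  have hv' {V W : C} (f : V ⟶ U) (hf : R.arrows f) (g : W ⟶ V) (hgf : R.arrows (g ≫ f)) :
      v (g ≫ f) hgf = Point.res (v f hf) g :=
    ((presheaf πH πK πG F).map_id_apply _ _).symm.trans
      (hv (𝟙 W) g hgf hf (Category.id_comp _))
  have glue {P : Cᵒᵖ ⥤ Type w} (hP : Presheaf.IsSheaf J P)
      (q : ∀ {V : C}, Point πH πK πG F V → P.obj (op V))
      (hq : ∀ {V W : C} (g : W ⟶ V) (a : Point πH πK πG F V), q (a.res g) = P.map g.op (q a)) :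
      ∃ a : P.obj (op U), ∀ {V : C} (f : V ⟶ U) (hf : R.arrows f), q (v f hf) = P.map f.op a := by
    rw [isSheaf_iff_isSheaf_of_type] at hP
    obtain ⟨a, ha, -⟩ := hP R hR (fun V f hf => q (v f hf)) (by
      intro Y₁ Y₂ Z g₁ g₂ f₁ f₂ h₁ h₂ e
      exact (hq g₁ _).symm.trans ((congrArg q (hv g₁ g₂ h₁ h₂ e)).trans (hq g₂ _)))
    exact ⟨a, fun f hf => (ha f hf).symm⟩
  obtain ⟨s, hs⟩ := glue S.property Point.base fun _ _ => rfl
  obtain ⟨y, hy⟩ := glue H.isSheaf₀ Point.fst fun _ _ => rfl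
  obtain ⟨z, hz⟩ := glue K.isSheaf₀ Point.snd fun _ _ => rfl
  obtain ⟨x, hx⟩ := glue G.isSheaf₀ Point.sec fun _ _ => rfl
  have key {V : C} (f : V ⟶ U) (hf : R.arrows f) :=
    exists_eq_of (v f hf) (hs f hf) (y := (H.ptRes f).obj ⟨y⟩) (hy f hf)
      (z := (K.ptRes f).obj ⟨z⟩) (hz f hf) (x := (G.ptRes f).obj ⟨x⟩) (hx f hf)
  choose b hb using @key
  obtain ⟨a, ha, -⟩ := existsUnique_of_frames (π := πG) h𝓖
    (A := ((F.functor s).obj ((πH.fn U).obj ⟨y⟩)).obj ((πK.fn U).obj ⟨z⟩))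
    (B := (πG.fn U).obj ⟨x⟩)
    (fun {V} f => PLift (R.arrows f)) (fun {V f} _ => (G.ptRes f).obj ⟨x⟩)
    (fun {V f} τ => F.frame rfl (b f τ.down)) (fun {V f} _ => πG.ptFrame f ⟨x⟩)
    (fun {V f} τ τ' => ⟨𝟙 _, by rw [CategoryTheory.Functor.map_id, Category.comp_id], by
      rw [CategoryTheory.Functor.map_id, Category.comp_id]⟩)
    (fun {V W f} τ g q hq => by
      subst hq
      refine ⟨⟨R.downward_closed τ.down g⟩, (G.ptResComp f g).hom.app ⟨x⟩, ?_,
        fres_ptFrame (π := πG) (⟨x⟩ : G.Pt U) |>.symm⟩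
      have hr : S.obj.map g.op (S.obj.map f.op s) = S.obj.map (g ≫ f).op s := by simp
      have h₁ := hv' f τ.down g (R.downward_closed τ.down g)
      rw [hb f, hb (g ≫ f), of_res g hr] at h₁
      have h₂ := (of_eq_iff ((H.ptResComp f g).hom.app ⟨y⟩) ((K.ptResComp f g).hom.app ⟨z⟩)
        ((G.ptResComp f g).hom.app ⟨x⟩) rfl rfl rfl).mp h₁
      rw [F.fres_frame rfl hr rfl, h₂, F.frame_comp])
    ⟨R, hR, fun f hf => ⟨⟨hf⟩⟩⟩
  have hfin {V : C} (f : V ⟶ U) (hf : R.arrows f) :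
      Point.res (of s ⟨y⟩ ⟨z⟩ ⟨x⟩ a : Point πH πK πG F U) f = v f hf := by
    rw [hb f hf]
    have h₁ := ha (f := f) ⟨hf⟩
    rw [← F.frame_resPoint rfl] at h₁
    exact congrArg (of _ _ _ _) (F.frame_injective rfl h₁)
  refine ⟨of s ⟨y⟩ ⟨z⟩ ⟨x⟩ a, fun V f hf => hfin f hf, fun v' hv' => ?_⟩
  exact eq_of_res_eq h𝓖 hR fun f hf => (hv' f hf).trans (hfin f hf).symm

end Point

end BiaddBfl

namespace BiaddBfl

open Functor.LaxMonoidal CrossedModule MonoidalMorphism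

variable {C : Type u} [Category.{v} C] {J : GrothendieckTopology C} {S S' S'' : Sheaf J (Type w)}
  {H K : CrossedModule.{v, u, w} J} {G : BraidedCrossedModule.{v, u, w} J}
  {𝓗 : MonoidalPrestack.{v, u, v₁, u₁} C} {𝓚 : MonoidalPrestack.{v, u, v₂, u₂} C}
  {𝓖 : BraidedPrestack.{v, u, w, u₃} C}
  {πH : MonoidalMorphism H.prestack 𝓗} {πK : MonoidalMorphism K.prestack 𝓚}
  {πG : MonoidalMorphism G.toCrossedModule.prestack 𝓖.toMonoidalPrestack}

namespace MonoidalMorphism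

variable {M : CrossedModule.{v, u, w} J} {Q : MonoidalPrestack.{v, u, v₁, u₁} C}
  (π : MonoidalMorphism M.prestack Q) {U V : C} (f : V ⟶ U)

lemma ptFrame_tens (y y' : M.Pt U) :
    (Q.res f).map (μ (π.fn U) y y') ≫ π.ptFrame f (y ⊗ y') =
      tens (π.ptFrame f y) (π.ptFrame f y') ≫ (π.fn V).map (μ (M.ptRes f) y y') := by
  have e := NatTrans.IsMonoidal.tensor (τ := (π.fnRes f).hom) y y'
  rw [Functor.LaxMonoidal.comp_μ, Functor.LaxMonoidal.comp_μ, Category.assoc] at e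
  rw [← cancel_epi (μ (Q.res f) ((π.fn U).obj y) ((π.fn U).obj y')),
    reassoc_of% μ_tens (π.ptFrame f y) (π.ptFrame f y')]
  exact e

lemma ptFrame_unit :
    (Q.res f).map (ε (π.fn U)) ≫ π.ptFrame f (𝟙_ (M.Pt U)) =
      unitFrame (Q.res f) (π.fn V) ≫ (π.fn V).map (ε (M.ptRes f)) := by
  have e := NatTrans.IsMonoidal.unit (τ := (π.fnRes f).hom)
  rw [Functor.LaxMonoidal.comp_ε, Functor.LaxMonoidal.comp_ε, Category.assoc] at e
  rw [← cancel_epi (ε (Q.res f)), reassoc_of% ε_unitFrame (L := Q.res f) (R := π.fn V)]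
  exact e

end MonoidalMorphism

namespace BiaddFunctor

variable (F : BiaddFunctor S 𝓗 𝓚 𝓖) {U V W : C} {f : V ⟶ U} {s : S.obj.obj (op U)}
  {t : S.obj.obj (op V)} (ht : S.obj.map f.op s = t) {y y' : H.Pt U} {z z' : K.Pt U}
  {x x' x₁ x₁' : G.Pt U}

/-! ### Products of isomorphisms -/

variable {F}

/-- The first product of isomorphisms. -/
def tens₁ (a : ((F.functor s).obj ((πH.fn U).obj y)).obj ((πK.fn U).obj z) ⟶ (πG.fn U).obj x)
    (a' : ((F.functor s).obj ((πH.fn U).obj y')).obj ((πK.fn U).obj z) ⟶ (πG.fn U).obj x') :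
    ((F.functor s).obj ((πH.fn U).obj (y ⊗ y'))).obj ((πK.fn U).obj z) ⟶
      (πG.fn U).obj (x ⊗ x') :=
  tens (L := F.along₁ πH πK s z) (R := πG.fn U) a a'

/-- The second product of isomorphisms. -/
def tens₂ (a : ((F.functor s).obj ((πH.fn U).obj y)).obj ((πK.fn U).obj z) ⟶ (πG.fn U).obj x)
    (a' : ((F.functor s).obj ((πH.fn U).obj y)).obj ((πK.fn U).obj z') ⟶ (πG.fn U).obj x') :
    ((F.functor s).obj ((πH.fn U).obj y)).obj ((πK.fn U).obj (z ⊗ z')) ⟶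
      (πG.fn U).obj (x ⊗ x') :=
  tens (L := F.along₂ πH πK s y) (R := πG.fn U) a a'

variable (πH πK πG F s z) in
/-- The neutral isomorphism for the first product. -/
def unit₁ : ((F.functor s).obj ((πH.fn U).obj (𝟙_ (H.Pt U)))).obj ((πK.fn U).obj z) ⟶
    (πG.fn U).obj (𝟙_ (G.Pt U)) :=
  unitFrame (F.along₁ πH πK s z) (πG.fn U)

variable (πH πK πG F s y) in
/-- The neutral isomorphism for the second product. -/
def unit₂ : ((F.functor s).obj ((πH.fn U).obj y)).obj ((πK.fn U).obj (𝟙_ (K.Pt U))) ⟶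
    (πG.fn U).obj (𝟙_ (G.Pt U)) :=
  unitFrame (F.along₂ πH πK s y) (πG.fn U)

section

variable (a : ((F.functor s).obj ((πH.fn U).obj y)).obj ((πK.fn U).obj z) ⟶ (πG.fn U).obj x)
  (a' : ((F.functor s).obj ((πH.fn U).obj y')).obj ((πK.fn U).obj z) ⟶ (πG.fn U).obj x')
  (b : ((F.functor s).obj ((πH.fn U).obj y)).obj ((πK.fn U).obj z') ⟶ (πG.fn U).obj x₁)
  (b' : ((F.functor s).obj ((πH.fn U).obj y')).obj ((πK.fn U).obj z') ⟶ (πG.fn U).obj x₁')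

lemma bμ₁_tens₁ : bμ₁ (F.functor s) _ _ _ ≫ bimap (F.functor s) (μ (πH.fn U) y y') (𝟙 _) ≫
    tens₁ a a' = (a ⊗ₘ a') ≫ μ (πG.fn U) x x' := by
  rw [bimap_id_right]
  exact (Category.assoc _ _ _).symm.trans (μ_tens (L := F.along₁ πH πK s z) (R := πG.fn U) a a')

lemma bμ₂_tens₂ : bμ₂ (F.functor s) _ _ _ ≫ bimap (F.functor s) (𝟙 _) (μ (πK.fn U) z z') ≫
    tens₂ a b = (a ⊗ₘ b) ≫ μ (πG.fn U) x x₁ := by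
  rw [bimap_id_left]
  exact (Category.assoc _ _ _).symm.trans (μ_tens (L := F.along₂ πH πK s y) (R := πG.fn U) a b)

lemma bε₁_unit₁ : bε₁ (F.functor s) _ ≫ bimap (F.functor s) (ε (πH.fn U)) (𝟙 _) ≫
    unit₁ πH πK πG F s z = ε (πG.fn U) := by
  rw [bimap_id_right]
  exact (Category.assoc _ _ _).symm.trans (ε_unitFrame (L := F.along₁ πH πK s z) (R := πG.fn U))

lemma bε₂_unit₂ : bε₂ (F.functor s) _ ≫ bimap (F.functor s) (𝟙 _) (ε (πK.fn U)) ≫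
    unit₂ πH πK πG F s y = ε (πG.fn U) := by
  rw [bimap_id_left]
  exact (Category.assoc _ _ _).symm.trans (ε_unitFrame (L := F.along₂ πH πK s y) (R := πG.fn U))

variable (h𝓖 : 𝓖.toMonoidalPrestack.IsGroupLikeStack J)
include h𝓖

lemma tens₁_interchange
    (hb : ∀ {V : C} (x x' : G.Pt V), μ (πG.fn V) x x' ≫ (πG.fn V).map (β_ x x').hom =
      (β_ _ _).hom ≫ μ (πG.fn V) x' x) :
    tens₂ (tens₁ a a') (tens₁ b b') ≫ (πG.fn U).map (tensorμ x x' x₁ x₁') =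
      tens₁ (tens₂ a b) (tens₂ a' b') := by
  let j := ((bμ₁ (F.functor s) ((πH.fn U).obj y) ((πH.fn U).obj y') ((πK.fn U).obj z) ⊗ₘ
    bμ₁ (F.functor s) ((πH.fn U).obj y) ((πH.fn U).obj y') ((πK.fn U).obj z')) ≫
    bμ₂ (F.functor s) _ _ _) ≫ bimap (F.functor s) (μ (πH.fn U) y y') (μ (πK.fn U) z z')
  have := h𝓖.isIso j
  rw [← cancel_epi j]
  have e₁ : bimap (F.functor s) (μ (πH.fn U) y y') (μ (πK.fn U) z z') =
      bimap (F.functor s) (μ (πH.fn U) y y') (𝟙 _ ⊗ₘ 𝟙 _) ≫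
        bimap (F.functor s) (𝟙 _) (μ (πK.fn U) z z') := by
    rw [← bimap_comp, id_tensorHom_id, Category.comp_id, Category.id_comp]
  have e₂ : bimap (F.functor s) (μ (πH.fn U) y y') (μ (πK.fn U) z z') =
      bimap (F.functor s) (𝟙 _ ⊗ₘ 𝟙 _) (μ (πK.fn U) z z') ≫
        bimap (F.functor s) (μ (πH.fn U) y y') (𝟙 _) := by
    rw [← bimap_comp, id_tensorHom_id, Category.comp_id, Category.id_comp]
  have l : j ≫ tens₂ (tens₁ a a') (tens₁ b b') =
      (((a ⊗ₘ a') ≫ μ (πG.fn U) x x') ⊗ₘ ((b ⊗ₘ b') ≫ μ (πG.fn U) x₁ x₁')) ≫ μ (πG.fn U) _ _ := by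
    dsimp only [j]
    rw [e₁, Category.assoc, Category.assoc, Category.assoc, reassoc_of% bμ₂_natural, bμ₂_tens₂,
      tensorHom_comp_tensorHom_assoc, tensorHom_comp_tensorHom_assoc, Category.assoc, Category.assoc, bμ₁_tens₁, bμ₁_tens₁]
  have r : j ≫ tens₁ (tens₂ a b) (tens₂ a' b') =
      tensorμ _ _ _ _ ≫ (((a ⊗ₘ b) ≫ μ (πG.fn U) x x₁) ⊗ₘ ((a' ⊗ₘ b') ≫ μ (πG.fn U) x' x₁')) ≫
        μ (πG.fn U) _ _ := by
    have hi := Biadditive.interchange (F := F.functor s) ((πH.fn U).obj y) ((πH.fn U).obj y')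
      ((πK.fn U).obj z) ((πK.fn U).obj z')
    change (bμ₁ (F.functor s) _ _ _ ⊗ₘ bμ₁ (F.functor s) _ _ _) ≫ bμ₂ (F.functor s) _ _ _ =
      tensorμ _ _ _ _ ≫ (bμ₂ (F.functor s) _ _ _ ⊗ₘ bμ₂ (F.functor s) _ _ _) ≫
        bμ₁ (F.functor s) _ _ _ at hi
    dsimp only [j]
    rw [hi, e₂, Category.assoc, Category.assoc, Category.assoc, Category.assoc,
      reassoc_of% bμ₁_natural, bμ₁_tens₁,
      tensorHom_comp_tensorHom_assoc, tensorHom_comp_tensorHom_assoc, Category.assoc, Category.assoc, bμ₂_tens₂, bμ₂_tens₂]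
  have q := Sq.tensorμ (L := 𝟭 (𝓖.Fib U)) (R := πG.fn U) (by simp) hb a a' b b'
  unfold Sq at q
  simp only [tens, Functor.id_obj, Functor.OplaxMonoidal.id_δ, Category.id_comp, Functor.id_map, Category.assoc] at q
  rw [reassoc_of% l, r]
  exact q.symm

omit h𝓖 in
lemma tens₁_bimap {y₁ y₁' : H.Pt U} {z₁ : K.Pt U} (h : y₁ ⟶ y) (h' : y₁' ⟶ y') (k : z₁ ⟶ z)
    (m : x ⟶ x₁) (m' : x' ⟶ x₁') :
    tens₁ (bimap (F.functor s) ((πH.fn U).map h) ((πK.fn U).map k) ≫ a ≫ (πG.fn U).map m)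
        (bimap (F.functor s) ((πH.fn U).map h') ((πK.fn U).map k) ≫ a' ≫ (πG.fn U).map m') =
      bimap (F.functor s) ((πH.fn U).map (h ⊗ₘ h')) ((πK.fn U).map k) ≫ tens₁ a a' ≫
        (πG.fn U).map (m ⊗ₘ m') := by
  refine (eq_tens (L := F.along₁ πH πK s z₁) (R := πG.fn U) ?_).symm
  have e₁ : bimap (F.functor s) (μ (πH.fn U) y₁ y₁') (𝟙 _) ≫
      bimap (F.functor s) ((πH.fn U).map (h ⊗ₘ h')) ((πK.fn U).map k) =
      bimap (F.functor s) ((πH.fn U).map h ⊗ₘ (πH.fn U).map h') ((πK.fn U).map k) ≫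
        bimap (F.functor s) (μ (πH.fn U) y y') (𝟙 _) := by
    rw [← bimap_comp, ← bimap_comp, ← μ_natural, Category.id_comp, Category.comp_id]
  have e₂ : μ (F.along₁ πH πK s z₁) y₁ y₁' = bμ₁ (F.functor s) _ _ _ ≫
      bimap (F.functor s) (μ (πH.fn U) y₁ y₁') (𝟙 _) := by
    rw [bimap_id_right]
    rfl
  rw [e₂, Category.assoc, reassoc_of% e₁, reassoc_of% bμ₁_natural, reassoc_of% bμ₁_tens₁,
    ← μ_natural, tensorHom_comp_tensorHom_assoc, tensorHom_comp_tensorHom_assoc]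
  simp only [Category.assoc]

omit h𝓖 in
lemma tens₂_bimap {y₁ : H.Pt U} {z₁ z₁' : K.Pt U} (h : y₁ ⟶ y) (k : z₁ ⟶ z) (k' : z₁' ⟶ z')
    {x₂ x₂' : G.Pt U} (m : x ⟶ x₂) (m' : x₁ ⟶ x₂') :
    tens₂ (bimap (F.functor s) ((πH.fn U).map h) ((πK.fn U).map k) ≫ a ≫ (πG.fn U).map m)
        (bimap (F.functor s) ((πH.fn U).map h) ((πK.fn U).map k') ≫ b ≫ (πG.fn U).map m') =
      bimap (F.functor s) ((πH.fn U).map h) ((πK.fn U).map (k ⊗ₘ k')) ≫ tens₂ a b ≫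
        (πG.fn U).map (m ⊗ₘ m') := by
  refine (eq_tens (L := F.along₂ πH πK s y₁) (R := πG.fn U) ?_).symm
  have e₁ : bimap (F.functor s) (𝟙 _) (μ (πK.fn U) z₁ z₁') ≫
      bimap (F.functor s) ((πH.fn U).map h) ((πK.fn U).map (k ⊗ₘ k')) =
      bimap (F.functor s) ((πH.fn U).map h) ((πK.fn U).map k ⊗ₘ (πK.fn U).map k') ≫
        bimap (F.functor s) (𝟙 _) (μ (πK.fn U) z z') := by
    rw [← bimap_comp, ← bimap_comp, ← μ_natural, Category.id_comp, Category.comp_id]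
  have e₂ : μ (F.along₂ πH πK s y₁) z₁ z₁' = bμ₂ (F.functor s) _ _ _ ≫
      bimap (F.functor s) (𝟙 _) (μ (πK.fn U) z₁ z₁') := by
    rw [bimap_id_left]
    rfl
  rw [e₂, Category.assoc, reassoc_of% e₁, reassoc_of% bμ₂_natural, reassoc_of% bμ₂_tens₂,
    ← μ_natural, tensorHom_comp_tensorHom_assoc, tensorHom_comp_tensorHom_assoc]
  simp only [Category.assoc]

omit h𝓖 in
lemma unit₁_natural (k : z ⟶ z') :
    bimap (F.functor s) (𝟙 _) ((πK.fn U).map k) ≫ unit₁ πH πK πG F s z' =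
      unit₁ πH πK πG F s z := by
  refine eq_unitFrame (L := F.along₁ πH πK s z) (R := πG.fn U) ?_
  have e₂ : ε (F.along₁ πH πK s z) = bε₁ (F.functor s) _ ≫
      bimap (F.functor s) (ε (πH.fn U)) (𝟙 _) := by
    rw [bimap_id_right]
    rfl
  have e₁ : bimap (F.functor s) (ε (πH.fn U)) (𝟙 _) ≫
      bimap (F.functor s) (𝟙 _) ((πK.fn U).map k) =
      bimap (F.functor s) (𝟙 _) ((πK.fn U).map k) ≫ bimap (F.functor s) (ε (πH.fn U)) (𝟙 _) := by
    rw [← bimap_comp, ← bimap_comp, Category.id_comp, Category.comp_id, Category.id_comp,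
      Category.comp_id]
  rw [e₂, Category.assoc, reassoc_of% e₁, reassoc_of% bε₁_natural, bε₁_unit₁]

omit h𝓖 in
lemma unit₂_natural (h : y ⟶ y') :
    bimap (F.functor s) ((πH.fn U).map h) (𝟙 _) ≫ unit₂ πH πK πG F s y' =
      unit₂ πH πK πG F s y := by
  refine eq_unitFrame (L := F.along₂ πH πK s y) (R := πG.fn U) ?_
  have e₂ : ε (F.along₂ πH πK s y) = bε₂ (F.functor s) _ ≫
      bimap (F.functor s) (𝟙 _) (ε (πK.fn U)) := by
    rw [bimap_id_left]
    rfl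
  have e₁ : bimap (F.functor s) (𝟙 _) (ε (πK.fn U)) ≫
      bimap (F.functor s) ((πH.fn U).map h) (𝟙 _) =
      bimap (F.functor s) ((πH.fn U).map h) (𝟙 _) ≫ bimap (F.functor s) (𝟙 _) (ε (πK.fn U)) := by
    rw [← bimap_comp, ← bimap_comp, Category.id_comp, Category.comp_id, Category.id_comp,
      Category.comp_id]
  rw [e₂, Category.assoc, reassoc_of% e₁, reassoc_of% bε₂_natural, bε₂_unit₂]

omit h𝓖 in
lemma unit₁_eq_unit₂ :
    unit₁ πH πK πG F s (𝟙_ (K.Pt U)) = unit₂ πH πK πG F s (𝟙_ (H.Pt U)) := by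
  refine (eq_unitFrame (L := F.along₁ πH πK s (𝟙_ (K.Pt U))) (R := πG.fn U) ?_).symm
  have e₂ : ε (F.along₁ πH πK s (𝟙_ (K.Pt U))) = bε₁ (F.functor s) _ ≫
      bimap (F.functor s) (ε (πH.fn U)) (𝟙 _) := by
    rw [bimap_id_right]
    rfl
  have e₃ : bε₁ (F.functor s) ((πK.fn U).obj (𝟙_ (K.Pt U))) =
      bε₁ (F.functor s) (𝟙_ _) ≫ bimap (F.functor s) (𝟙 _) (ε (πK.fn U)) :=
    (bε₁_natural _ _).symm
  have e₄ : bε₁ (F.functor s) (𝟙_ (𝓚.Fib U)) = bε₂ (F.functor s) (𝟙_ (𝓗.Fib U)) :=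
    Biadditive.unit_eq (F := F.functor s)
  have e₁ : bimap (F.functor s) (𝟙 _) (ε (πK.fn U)) ≫
      bimap (F.functor s) (ε (πH.fn U)) (𝟙 _) =
      bimap (F.functor s) (ε (πH.fn U)) (𝟙 _) ≫ bimap (F.functor s) (𝟙 _) (ε (πK.fn U)) := by
    rw [← bimap_comp, ← bimap_comp, Category.id_comp, Category.comp_id, Category.id_comp,
      Category.comp_id]
  rw [e₂, e₃, e₄, Category.assoc, Category.assoc, reassoc_of% e₁, reassoc_of% bε₂_natural, bε₂_unit₂]

end

/-! ### Restriction of products -/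

section

variable (a : ((F.functor s).obj ((πH.fn U).obj y)).obj ((πK.fn U).obj z) ⟶ (πG.fn U).obj x)
  (a' : ((F.functor s).obj ((πH.fn U).obj y')).obj ((πK.fn U).obj z) ⟶ (πG.fn U).obj x')
  (b : ((F.functor s).obj ((πH.fn U).obj y)).obj ((πK.fn U).obj z') ⟶ (πG.fn U).obj x₁)

lemma rs_resPoint : F.rs f ht _ _ ≫ bimap (F.functor t) ((πH.fnRes f).hom.app y)
    ((πK.fnRes f).hom.app z) ≫ F.resPoint ht a = (𝓖.res f).map a ≫ (πG.fnRes f).hom.app x :=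
  F.frame_resPoint ht a

lemma resPoint_map (m : x ⟶ x₁) : F.resPoint ht (a ≫ (πG.fn U).map m) =
    F.resPoint ht a ≫ (πG.fn V).map ((G.ptRes f).map m) := by
  refine F.frame_injective ht ?_
  have h := (πG.fnRes f).hom.naturality m
  rw [frame_resPoint, frame_comp, frame_resPoint, Functor.map_comp, Category.assoc, Category.assoc]
  exact congrArg (_ ≫ ·) h

lemma resPoint_bimap {y₁ : H.Pt U} {z₁ : K.Pt U} (h : y₁ ⟶ y) (k : z₁ ⟶ z) :
    F.resPoint ht (bimap (F.functor s) ((πH.fn U).map h) ((πK.fn U).map k) ≫ a) =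
      bimap (F.functor t) ((πH.fn V).map ((H.ptRes f).map h)) ((πK.fn V).map ((K.ptRes f).map k)) ≫
        F.resPoint ht a := by
  refine F.frame_injective ht ?_
  have h₁ := (πH.fnRes f).hom.naturality h
  have h₂ := (πK.fnRes f).hom.naturality k
  dsimp only [Functor.comp_map] at h₁ h₂
  rw [frame_resPoint, Functor.map_comp, Category.assoc]
  unfold frame ptFrame
  rw [← rs_resPoint ht a, reassoc_of% F.rs_natural f ht]
  refine congrArg (_ ≫ ·) ?_
  refine (Category.assoc _ _ _).symm.trans (Eq.trans ?_ (Category.assoc _ _ _))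
  refine congrArg (· ≫ _) ?_
  refine (bimap_comp _ _ _ _ _).symm.trans (Eq.trans ?_ (bimap_comp _ _ _ _ _))
  rw [h₁, h₂]

section

variable {X X' : 𝓗.Fib U} {Y Y' : 𝓚.Fib U} {p p' : H.Pt V} {q q' : K.Pt V} {m m' : G.Pt V}

lemma rs_tens₁ (α : πH.Frame f X p) (α' : πH.Frame f X' p') (β : πK.Frame f Y q)
    (c : ((F.functor t).obj ((πH.fn V).obj p)).obj ((πK.fn V).obj q) ⟶ (πG.fn V).obj m)
    (c' : ((F.functor t).obj ((πH.fn V).obj p')).obj ((πK.fn V).obj q) ⟶ (πG.fn V).obj m') :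
    μ (𝓖.res f) _ _ ≫ (𝓖.res f).map (bμ₁ (F.functor s) X X' Y) ≫ F.rs f ht (X ⊗ X') Y ≫
        bimap (F.functor t) (tens α α') β ≫ tens₁ c c' =
      ((F.rs f ht X Y ≫ bimap (F.functor t) α β ≫ c) ⊗ₘ
        (F.rs f ht X' Y ≫ bimap (F.functor t) α' β ≫ c')) ≫ μ (πG.fn V) m m' := by
  have h₁ := F.rs_mul₁ f ht X X' Y
  have h₃ : bimap (F.functor t) (μ (𝓗.res f) X X') (𝟙 _) ≫ bimap (F.functor t) (tens α α') β =
      bimap (F.functor t) (α ⊗ₘ α') β ≫ bimap (F.functor t) (μ (πH.fn V) p p') (𝟙 _) := by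
    rw [← bimap_comp, ← bimap_comp, μ_tens, Category.id_comp, Category.comp_id]
  rw [reassoc_of% h₁, reassoc_of% h₃, reassoc_of% bμ₁_natural, bμ₁_tens₁,
    tensorHom_comp_tensorHom_assoc, tensorHom_comp_tensorHom_assoc]
  simp only [Category.assoc]

lemma rs_tens₂ (α : πH.Frame f X p) (β : πK.Frame f Y q) (β' : πK.Frame f Y' q')
    (c : ((F.functor t).obj ((πH.fn V).obj p)).obj ((πK.fn V).obj q) ⟶ (πG.fn V).obj m)
    (c' : ((F.functor t).obj ((πH.fn V).obj p)).obj ((πK.fn V).obj q') ⟶ (πG.fn V).obj m') :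
    μ (𝓖.res f) _ _ ≫ (𝓖.res f).map (bμ₂ (F.functor s) X Y Y') ≫ F.rs f ht X (Y ⊗ Y') ≫
        bimap (F.functor t) α (tens β β') ≫ tens₂ c c' =
      ((F.rs f ht X Y ≫ bimap (F.functor t) α β ≫ c) ⊗ₘ
        (F.rs f ht X Y' ≫ bimap (F.functor t) α β' ≫ c')) ≫ μ (πG.fn V) m m' := by
  have h₁ := F.rs_mul₂ f ht X Y Y'
  have h₃ : bimap (F.functor t) (𝟙 _) (μ (𝓚.res f) Y Y') ≫ bimap (F.functor t) α (tens β β') =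
      bimap (F.functor t) α (β ⊗ₘ β') ≫ bimap (F.functor t) (𝟙 _) (μ (πK.fn V) q q') := by
    rw [← bimap_comp, ← bimap_comp, μ_tens, Category.id_comp, Category.comp_id]
  rw [reassoc_of% h₁, reassoc_of% h₃, reassoc_of% bμ₂_natural, bμ₂_tens₂,
    tensorHom_comp_tensorHom_assoc, tensorHom_comp_tensorHom_assoc]
  simp only [Category.assoc]

lemma rs_unit₁ (β : πK.Frame f Y q) :
    ε (𝓖.res f) ≫ (𝓖.res f).map (bε₁ (F.functor s) Y) ≫ F.rs f ht (𝟙_ _) Y ≫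
        bimap (F.functor t) (unitFrame (𝓗.res f) (πH.fn V)) β ≫ unit₁ πH πK πG F t q =
      ε (πG.fn V) := by
  have h₁ := F.rs_one₁ f ht Y
  have h₃ : bimap (F.functor t) (ε (𝓗.res f)) (𝟙 _) ≫
      bimap (F.functor t) (unitFrame (𝓗.res f) (πH.fn V)) β =
      bimap (F.functor t) (𝟙 _) β ≫ bimap (F.functor t) (ε (πH.fn V)) (𝟙 _) := by
    rw [← bimap_comp, ← bimap_comp, ε_unitFrame, Category.id_comp, Category.comp_id,
      Category.id_comp]
  rw [reassoc_of% h₁, reassoc_of% h₃, reassoc_of% bε₁_natural, bε₁_unit₁]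

lemma rs_unit₂ (α : πH.Frame f X p) :
    ε (𝓖.res f) ≫ (𝓖.res f).map (bε₂ (F.functor s) X) ≫ F.rs f ht X (𝟙_ _) ≫
        bimap (F.functor t) α (unitFrame (𝓚.res f) (πK.fn V)) ≫ unit₂ πH πK πG F t p =
      ε (πG.fn V) := by
  have h₁ := F.rs_one₂ f ht X
  have h₃ : bimap (F.functor t) (𝟙 _) (ε (𝓚.res f)) ≫
      bimap (F.functor t) α (unitFrame (𝓚.res f) (πK.fn V)) =
      bimap (F.functor t) α (𝟙 _) ≫ bimap (F.functor t) (𝟙 _) (ε (πK.fn V)) := by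
    rw [← bimap_comp, ← bimap_comp, ε_unitFrame, Category.id_comp, Category.comp_id,
      Category.id_comp]
  rw [reassoc_of% h₁, reassoc_of% h₃, reassoc_of% bε₂_natural, bε₂_unit₂]

end

variable (h𝓖 : 𝓖.toMonoidalPrestack.IsGroupLikeStack J)
include h𝓖

lemma resPoint_tens₁ :
    bimap (F.functor t) ((πH.fn V).map (μ (H.ptRes f) y y')) (𝟙 _) ≫ F.resPoint ht (tens₁ a a') =
      tens₁ (F.resPoint ht a) (F.resPoint ht a') ≫ (πG.fn V).map (μ (G.ptRes f) x x') := by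
  let j := μ (𝓖.res f) _ _ ≫ (𝓖.res f).map (bμ₁ (F.functor s) ((πH.fn U).obj y)
    ((πH.fn U).obj y') ((πK.fn U).obj z)) ≫ F.rs f ht _ _ ≫
      bimap (F.functor t) (tens (πH.ptFrame f y) (πH.ptFrame f y')) (πK.ptFrame f z)
  have := h𝓖.isIso j
  rw [← cancel_epi j]
  have r := F.rs_tens₁ ht (πH.ptFrame f y) (πH.ptFrame f y') (πK.ptFrame f z)
    (F.resPoint ht a) (F.resPoint ht a')
  have e : bimap (F.functor t) (tens (πH.ptFrame f y) (πH.ptFrame f y')) (πK.ptFrame f z) ≫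
      bimap (F.functor t) ((πH.fn V).map (μ (H.ptRes f) y y')) (𝟙 _) =
      bimap (F.functor t) ((𝓗.res f).map (μ (πH.fn U) y y')) ((𝓚.res f).map (𝟙 _)) ≫
        bimap (F.functor t) (πH.ptFrame f (y ⊗ y')) (πK.ptFrame f z) := by
    rw [← bimap_comp, ← bimap_comp, ptFrame_tens, CategoryTheory.Functor.map_id,
      Category.id_comp, Category.comp_id]
  have h₁ := F.frame_resPoint ht (tens₁ a a')
  have h₂ := F.frame_resPoint ht a
  have h₃ := F.frame_resPoint ht a'
  change F.rs f ht _ _ ≫ bimap (F.functor t) (πH.ptFrame f _) (πK.ptFrame f _) ≫ _ = _ at h₁ h₂ h₃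
  rw [h₂, h₃] at r
  dsimp only [j]
  simp only [Category.assoc]
  rw [reassoc_of% r, reassoc_of% e, ← reassoc_of% F.rs_natural f ht, h₁]
  have h₄ := congrArg (𝓖.res f).map (bμ₁_tens₁ a a')
  rw [Functor.map_comp, Functor.map_comp, Functor.map_comp] at h₄
  rw [reassoc_of% h₄, ptFrame_tens,
    ← μ_natural_assoc, reassoc_of% μ_tens (πG.ptFrame f x) (πG.ptFrame f x'),
    tensorHom_comp_tensorHom_assoc]

lemma resPoint_tens₂ :
    bimap (F.functor t) (𝟙 _) ((πK.fn V).map (μ (K.ptRes f) z z')) ≫ F.resPoint ht (tens₂ a b) =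
      tens₂ (F.resPoint ht a) (F.resPoint ht b) ≫ (πG.fn V).map (μ (G.ptRes f) x x₁) := by
  let j := μ (𝓖.res f) _ _ ≫ (𝓖.res f).map (bμ₂ (F.functor s) ((πH.fn U).obj y)
    ((πK.fn U).obj z) ((πK.fn U).obj z')) ≫ F.rs f ht _ _ ≫
      bimap (F.functor t) (πH.ptFrame f y) (tens (πK.ptFrame f z) (πK.ptFrame f z'))
  have := h𝓖.isIso j
  rw [← cancel_epi j]
  have r := F.rs_tens₂ ht (πH.ptFrame f y) (πK.ptFrame f z) (πK.ptFrame f z')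
    (F.resPoint ht a) (F.resPoint ht b)
  have e : bimap (F.functor t) (πH.ptFrame f y) (tens (πK.ptFrame f z) (πK.ptFrame f z')) ≫
      bimap (F.functor t) (𝟙 _) ((πK.fn V).map (μ (K.ptRes f) z z')) =
      bimap (F.functor t) ((𝓗.res f).map (𝟙 _)) ((𝓚.res f).map (μ (πK.fn U) z z')) ≫
        bimap (F.functor t) (πH.ptFrame f y) (πK.ptFrame f (z ⊗ z')) := by
    rw [← bimap_comp, ← bimap_comp, ptFrame_tens, CategoryTheory.Functor.map_id,
      Category.id_comp, Category.comp_id]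
  have h₁ := F.frame_resPoint ht (tens₂ a b)
  have h₂ := F.frame_resPoint ht a
  have h₃ := F.frame_resPoint ht b
  change F.rs f ht _ _ ≫ bimap (F.functor t) (πH.ptFrame f _) (πK.ptFrame f _) ≫ _ = _ at h₁ h₂ h₃
  rw [h₂, h₃] at r
  dsimp only [j]
  simp only [Category.assoc]
  rw [reassoc_of% r, reassoc_of% e, ← reassoc_of% F.rs_natural f ht, h₁]
  have h₄ := congrArg (𝓖.res f).map (bμ₂_tens₂ a b)
  rw [Functor.map_comp, Functor.map_comp, Functor.map_comp] at h₄
  rw [reassoc_of% h₄, ptFrame_tens,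
    ← μ_natural_assoc, reassoc_of% μ_tens (πG.ptFrame f x) (πG.ptFrame f x₁),
    tensorHom_comp_tensorHom_assoc]

lemma resPoint_unit₁ :
    bimap (F.functor t) ((πH.fn V).map (ε (H.ptRes f))) (𝟙 _) ≫
        F.resPoint ht (unit₁ πH πK πG F s z) =
      unit₁ πH πK πG F t ((K.ptRes f).obj z) ≫ (πG.fn V).map (ε (G.ptRes f)) := by
  let j := ε (𝓖.res f) ≫ (𝓖.res f).map (bε₁ (F.functor s) ((πK.fn U).obj z)) ≫ F.rs f ht _ _ ≫
      bimap (F.functor t) (unitFrame (𝓗.res f) (πH.fn V)) (πK.ptFrame f z)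
  have := h𝓖.isIso j
  rw [← cancel_epi j]
  have r := F.rs_unit₁ (πH := πH) (πG := πG) ht (πK.ptFrame f z)
  have e : bimap (F.functor t) (unitFrame (𝓗.res f) (πH.fn V)) (πK.ptFrame f z) ≫
      bimap (F.functor t) ((πH.fn V).map (ε (H.ptRes f))) (𝟙 _) =
      bimap (F.functor t) ((𝓗.res f).map (ε (πH.fn U))) ((𝓚.res f).map (𝟙 _)) ≫
        bimap (F.functor t) (πH.ptFrame f (𝟙_ _)) (πK.ptFrame f z) := by
    rw [← bimap_comp, ← bimap_comp, ptFrame_unit, CategoryTheory.Functor.map_id,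
      Category.id_comp, Category.comp_id]
  have h₁ := F.frame_resPoint ht (unit₁ πH πK πG F s z)
  change F.rs f ht _ _ ≫ bimap (F.functor t) (πH.ptFrame f _) (πK.ptFrame f _) ≫ _ = _ at h₁
  dsimp only [j]
  simp only [Category.assoc]
  rw [reassoc_of% r, reassoc_of% e, ← reassoc_of% F.rs_natural f ht, h₁]
  have h₄ := congrArg (𝓖.res f).map (bε₁_unit₁ (πH := πH) (πK := πK) (πG := πG) (F := F) (s := s) (z := z))
  rw [Functor.map_comp, Functor.map_comp] at h₄
  rw [reassoc_of% h₄, ptFrame_unit, reassoc_of% ε_unitFrame (L := 𝓖.res f) (R := πG.fn V)]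

lemma resPoint_unit₂ :
    bimap (F.functor t) (𝟙 _) ((πK.fn V).map (ε (K.ptRes f))) ≫
        F.resPoint ht (unit₂ πH πK πG F s y) =
      unit₂ πH πK πG F t ((H.ptRes f).obj y) ≫ (πG.fn V).map (ε (G.ptRes f)) := by
  let j := ε (𝓖.res f) ≫ (𝓖.res f).map (bε₂ (F.functor s) ((πH.fn U).obj y)) ≫ F.rs f ht _ _ ≫
      bimap (F.functor t) (πH.ptFrame f y) (unitFrame (𝓚.res f) (πK.fn V))
  have := h𝓖.isIso j
  rw [← cancel_epi j]
  have r := F.rs_unit₂ (πK := πK) (πG := πG) ht (πH.ptFrame f y)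
  have e : bimap (F.functor t) (πH.ptFrame f y) (unitFrame (𝓚.res f) (πK.fn V)) ≫
      bimap (F.functor t) (𝟙 _) ((πK.fn V).map (ε (K.ptRes f))) =
      bimap (F.functor t) ((𝓗.res f).map (𝟙 _)) ((𝓚.res f).map (ε (πK.fn U))) ≫
        bimap (F.functor t) (πH.ptFrame f y) (πK.ptFrame f (𝟙_ _)) := by
    rw [← bimap_comp, ← bimap_comp, ptFrame_unit, CategoryTheory.Functor.map_id,
      Category.id_comp, Category.comp_id]
  have h₁ := F.frame_resPoint ht (unit₂ πH πK πG F s y)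
  change F.rs f ht _ _ ≫ bimap (F.functor t) (πH.ptFrame f _) (πK.ptFrame f _) ≫ _ = _ at h₁
  dsimp only [j]
  simp only [Category.assoc]
  rw [reassoc_of% r, reassoc_of% e, ← reassoc_of% F.rs_natural f ht, h₁]
  have h₄ := congrArg (𝓖.res f).map (bε₂_unit₂ (πH := πH) (πK := πK) (πG := πG) (F := F) (s := s) (y := y))
  rw [Functor.map_comp, Functor.map_comp] at h₄
  rw [reassoc_of% h₄, ptFrame_unit, reassoc_of% ε_unitFrame (L := 𝓖.res f) (R := πG.fn V)]

end

end BiaddFunctor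

end BiaddBfl

namespace BiaddBfl

open Functor.LaxMonoidal CrossedModule MonoidalMorphism

variable {C : Type u} [Category.{v} C] {J : GrothendieckTopology C} {S S' S'' : Sheaf J (Type w)}
  {H K : CrossedModule.{v, u, w} J} {G : BraidedCrossedModule.{v, u, w} J}
  {𝓗 : MonoidalPrestack.{v, u, v₁, u₁} C} {𝓚 : MonoidalPrestack.{v, u, v₂, u₂} C}
  {𝓖 : BraidedPrestack.{v, u, w, u₃} C}
  {πH : MonoidalMorphism H.prestack 𝓗} {πK : MonoidalMorphism K.prestack 𝓚}
  {πG : MonoidalMorphism G.toCrossedModule.prestack 𝓖.toMonoidalPrestack}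

/-- An idempotent for the first product is determined by its image in the base. -/
lemma Biextension.eq_of_mul₁_self {A B : Cᵒᵖ ⥤ GrpCat.{w}} (E : Biextension S A B G) {U : C}
    {e o : E.Sec U} (hb : E.base o = E.base e) (hz : E.snd o = E.snd e) {c : E.Comp₁ e e}
    {c' : E.Comp₁ o o} (he : E.mul₁ e e c = e) (ho : E.mul₁ o o c' = o) : e = o := by
  have fst_one {e : E.Sec U} {c : E.Comp₁ e e} (he : E.mul₁ e e c = e) : E.fst e = 1 := by
    have h := E.fst_mul₁ e e c
    rw [he] at h
    exact left_eq_mul.mp h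
  obtain ⟨g, rfl, -⟩ := E.simply_transitive o e hb ((fst_one ho).trans (fst_one he).symm) hz
  have h₁ : E.act o (G.act g (E.sec o) * g) = E.act o g := by
    have c'' : E.Comp₁ (E.act o g) o := ⟨E.base_act _ _, E.snd_act _ _⟩
    rw [E.act_mul, ← he, E.mul₁_act _ _ _ c'', E.act_mul₁ o o g c', ho]
  have h₂ : G.act g (E.sec o) * g = g :=
    (E.simply_transitive o (E.act o g) hb (E.fst_act _ _).symm hz).unique h₁ rfl
  have h₃ := congrArg (fun a => G.act a (E.sec o)⁻¹) (mul_eq_right.mp h₂)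
  rw [← G.act_mul, mul_inv_cancel, G.act_one, G.one_act] at h₃
  rw [h₃, E.act_one]

/-- An idempotent for the second product is determined by its image in the base. -/
lemma Biextension.eq_of_mul₂_self {A B : Cᵒᵖ ⥤ GrpCat.{w}} (E : Biextension S A B G) {U : C}
    {e o : E.Sec U} (hb : E.base o = E.base e) (hy : E.fst o = E.fst e) {c : E.Comp₂ e e}
    {c' : E.Comp₂ o o} (he : E.mul₂ e e c = e) (ho : E.mul₂ o o c' = o) : e = o := by
  have snd_one {e : E.Sec U} {c : E.Comp₂ e e} (he : E.mul₂ e e c = e) : E.snd e = 1 := by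
    have h := E.snd_mul₂ e e c
    rw [he] at h
    exact left_eq_mul.mp h
  obtain ⟨g, rfl, -⟩ := E.simply_transitive o e hb hy ((snd_one ho).trans (snd_one he).symm)
  have h₁ : E.act o (G.act g (E.sec o) * g) = E.act o g := by
    have c'' : E.Comp₂ (E.act o g) o := ⟨E.base_act _ _, E.fst_act _ _⟩
    rw [E.act_mul, ← he, E.mul₂_act _ _ _ c'', E.act_mul₂ o o g c', ho]
  have h₂ : G.act g (E.sec o) * g = g :=
    (E.simply_transitive o (E.act o g) hb hy (E.snd_act _ _).symm).unique h₁ rfl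
  have h₃ := congrArg (fun a => G.act a (E.sec o)⁻¹) (mul_eq_right.mp h₂)
  rw [← G.act_mul, mul_inv_cancel, G.act_one, G.one_act] at h₃
  rw [h₃, E.act_one]

namespace BiaddFunctor

variable {F : BiaddFunctor S 𝓗 𝓚 𝓖} {U : C} {s : S.obj.obj (op U)} {y y' y₁ y₁' : H.Pt U}
  {z z' z₁ z₁' : K.Pt U} {x x' x₁ x₁' : G.Pt U}

lemma tens₁_map
    (a : ((F.functor s).obj ((πH.fn U).obj y)).obj ((πK.fn U).obj z) ⟶ (πG.fn U).obj x)
    (a' : ((F.functor s).obj ((πH.fn U).obj y')).obj ((πK.fn U).obj z) ⟶ (πG.fn U).obj x')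
    (m : x ⟶ x₁) (m' : x' ⟶ x₁') :
    tens₁ (a ≫ (πG.fn U).map m) (a' ≫ (πG.fn U).map m') =
      tens₁ a a' ≫ (πG.fn U).map (m ⊗ₘ m') := by
  have h := tens₁_bimap a a' (𝟙 _) (𝟙 _) (𝟙 _) m m'
  simpa only [CategoryTheory.Functor.map_id, id_tensorHom_id, bimap_id, Category.id_comp] using h

lemma tens₂_map
    (a : ((F.functor s).obj ((πH.fn U).obj y)).obj ((πK.fn U).obj z) ⟶ (πG.fn U).obj x)
    (a' : ((F.functor s).obj ((πH.fn U).obj y)).obj ((πK.fn U).obj z') ⟶ (πG.fn U).obj x')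
    (m : x ⟶ x₁) (m' : x' ⟶ x₁') :
    tens₂ (a ≫ (πG.fn U).map m) (a' ≫ (πG.fn U).map m') =
      tens₂ a a' ≫ (πG.fn U).map (m ⊗ₘ m') := by
  have h := tens₂_bimap a a' (𝟙 _) (𝟙 _) (𝟙 _) m m'
  simpa only [CategoryTheory.Functor.map_id, id_tensorHom_id, bimap_id, Category.id_comp] using h

lemma bimap_tens₁
    (a : ((F.functor s).obj ((πH.fn U).obj y)).obj ((πK.fn U).obj z) ⟶ (πG.fn U).obj x)
    (a' : ((F.functor s).obj ((πH.fn U).obj y')).obj ((πK.fn U).obj z) ⟶ (πG.fn U).obj x')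
    (h : y₁ ⟶ y) (h' : y₁' ⟶ y') (k : z₁ ⟶ z) :
    tens₁ (bimap (F.functor s) ((πH.fn U).map h) ((πK.fn U).map k) ≫ a)
        (bimap (F.functor s) ((πH.fn U).map h') ((πK.fn U).map k) ≫ a') =
      bimap (F.functor s) ((πH.fn U).map (h ⊗ₘ h')) ((πK.fn U).map k) ≫ tens₁ a a' := by
  have h := tens₁_bimap a a' h h' k (𝟙 _) (𝟙 _)
  simpa only [CategoryTheory.Functor.map_id, id_tensorHom_id, Category.comp_id] using h

lemma bimap_tens₂
    (a : ((F.functor s).obj ((πH.fn U).obj y)).obj ((πK.fn U).obj z) ⟶ (πG.fn U).obj x)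
    (a' : ((F.functor s).obj ((πH.fn U).obj y)).obj ((πK.fn U).obj z') ⟶ (πG.fn U).obj x')
    (h : y₁ ⟶ y) (k : z₁ ⟶ z) (k' : z₁' ⟶ z') :
    tens₂ (bimap (F.functor s) ((πH.fn U).map h) ((πK.fn U).map k) ≫ a)
        (bimap (F.functor s) ((πH.fn U).map h) ((πK.fn U).map k') ≫ a') =
      bimap (F.functor s) ((πH.fn U).map h) ((πK.fn U).map (k ⊗ₘ k')) ≫ tens₂ a a' := by
  have h := tens₂_bimap a a' h k k' (𝟙 _) (𝟙 _)
  simpa only [CategoryTheory.Functor.map_id, id_tensorHom_id, Category.comp_id] using h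

end BiaddFunctor

namespace Point

variable {F : BiaddFunctor S 𝓗 𝓚 𝓖} {U V : C} {s : S.obj.obj (op U)} {y y' y'' : H.Pt U}
  {z z' z'' : K.Pt U} {x x' x'' : G.Pt U}

/-- The isomorphism of a point, along identifications of its components. -/
def isoOf (v : Point πH πK πG F U) {s : S.obj.obj (op U)} {y : H.G₀.obj (op U)}
    {z : K.G₀.obj (op U)} {x : G.G₀.obj (op U)} (hs : v.base = s) (hy : v.fst = y)
    (hz : v.snd = z) (hx : v.sec = x) : F.val πH πK s y z ⟶ πG.pt x := by
  subst hs hy hz hx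
  exact v.iso

/-- The action on points. -/
def act (v : Point πH πK πG F U) (g : G.G₁.obj (op U)) : Point πH πK πG F U :=
  ⟨v.base, v.fst, v.snd, v.sec * G.d g, v.iso ≫ πG.ptMap g rfl⟩

/-- The first product of points. -/
def mul₁ (v v' : Point πH πK πG F U) (hs : v.base = v'.base) (hz : v.snd = v'.snd) :
    Point πH πK πG F U :=
  ⟨v.base, v.fst * v'.fst, v.snd, v.sec * v'.sec, BiaddFunctor.tens₁ (y := ⟨v.fst⟩)
    (y' := ⟨v'.fst⟩) (z := ⟨v.snd⟩) (x := ⟨v.sec⟩) (x' := ⟨v'.sec⟩) v.iso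
    (v'.isoOf hs.symm rfl hz.symm rfl)⟩

/-- The second product of points. -/
def mul₂ (v v' : Point πH πK πG F U) (hs : v.base = v'.base) (hy : v.fst = v'.fst) :
    Point πH πK πG F U :=
  ⟨v.base, v.fst, v.snd * v'.snd, v.sec * v'.sec, BiaddFunctor.tens₂ (y := ⟨v.fst⟩)
    (z := ⟨v.snd⟩) (z' := ⟨v'.snd⟩) (x := ⟨v.sec⟩) (x' := ⟨v'.sec⟩) v.iso
    (v'.isoOf hs.symm hy.symm rfl rfl)⟩

lemma of_act (a : ((F.functor s).obj ((πH.fn U).obj y)).obj ((πK.fn U).obj z) ⟶ (πG.fn U).obj x)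
    (m : x ⟶ x') : (of s y z x a).act m.elt = of s y z x' (a ≫ (πG.fn U).map m) := by
  obtain ⟨x'⟩ := x'
  obtain ⟨g, hg⟩ := m
  dsimp only at hg
  subst hg
  rfl

lemma of_mul₁ (a : ((F.functor s).obj ((πH.fn U).obj y)).obj ((πK.fn U).obj z) ⟶ (πG.fn U).obj x)
    (a' : ((F.functor s).obj ((πH.fn U).obj y')).obj ((πK.fn U).obj z) ⟶ (πG.fn U).obj x') :
    (of s y z x a).mul₁ (of s y' z x' a') rfl rfl = of s (y ⊗ y') z (x ⊗ x') (F.tens₁ a a') :=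
  rfl

lemma of_mul₂ (a : ((F.functor s).obj ((πH.fn U).obj y)).obj ((πK.fn U).obj z) ⟶ (πG.fn U).obj x)
    (a' : ((F.functor s).obj ((πH.fn U).obj y)).obj ((πK.fn U).obj z') ⟶ (πG.fn U).obj x') :
    (of s y z x a).mul₂ (of s y z' x' a') rfl rfl = of s y (z ⊗ z') (x ⊗ x') (F.tens₂ a a') :=
  rfl

lemma exists_of (v : Point πH πK πG F U) : ∃ s y z x a, v = of s y z x a :=
  ⟨v.base, ⟨v.fst⟩, ⟨v.snd⟩, ⟨v.sec⟩, v.iso, rfl⟩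

lemma act_one (v : Point πH πK πG F U) : v.act 1 = v := by
  obtain ⟨s, y, z, x, a, rfl⟩ := v.exists_of
  exact (of_act a (𝟙 x)).trans (by rw [CategoryTheory.Functor.map_id, Category.comp_id])

lemma act_mul (v : Point πH πK πG F U) (g g' : G.G₁.obj (op U)) :
    v.act (g * g') = (v.act g).act g' := by
  obtain ⟨s, y, z, x, a, rfl⟩ := v.exists_of
  let m : x ⟶ ⟨x.pt * G.d g⟩ := ⟨g, rfl⟩
  let m' : (⟨x.pt * G.d g⟩ : G.Pt U) ⟶ ⟨x.pt * G.d g * G.d g'⟩ := ⟨g', rfl⟩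
  refine (of_act a (m ≫ m')).trans ?_
  rw [Functor.map_comp, ← Category.assoc]
  rfl

lemma act_res (f : V ⟶ U) (v : Point πH πK πG F U) (g : G.G₁.obj (op U)) :
    (v.res f).act (G.G₁.map f.op g) = (v.act g).res f := by
  obtain ⟨s, y, z, x, a, rfl⟩ := v.exists_of
  let m : x ⟶ ⟨x.pt * G.d g⟩ := ⟨g, rfl⟩
  refine (of_act (F.resPoint rfl a) ((G.ptRes f).map m)).trans ?_
  rw [← F.resPoint_map]
  rfl

lemma existsUnique_act (pG : πG.IsPresentation) (v v' : Point πH πK πG F U)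
    (hs : v.base = v'.base) (hy : v.fst = v'.fst) (hz : v.snd = v'.snd) :
    ∃! g : G.G₁.obj (op U), v.act g = v' := by
  obtain ⟨s, y, z, x, a, rfl⟩ := v.exists_of
  obtain ⟨a', ha'⟩ := v'.exists_eq_of hs.symm hy.symm hz.symm (x := ⟨v'.sec⟩) rfl
  generalize (⟨v'.sec⟩ : G.Pt U) = x' at a' ha'
  subst ha'
  have := fn_full pG.loc U
  have := fn_faithful pG.loc U
  have := pG.stack.isIso a
  obtain ⟨m, hm⟩ := (πG.fn U).map_surjective (inv a ≫ a')
  refine ⟨m.elt, ?_, fun g hg => ?_⟩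
  · dsimp only
    rw [of_act, hm, IsIso.hom_inv_id_assoc]
  · let m' : x ⟶ x' := ⟨g, (congrArg Point.sec hg).symm⟩
    have h := of_injective ((of_act a m').symm.trans hg)
    have : m' = m := (πG.fn U).map_injective (by rw [hm, ← h, IsIso.inv_hom_id_assoc])
    exact congrArg Pt.Hom.elt this

lemma locally_nonempty (pG : πG.IsPresentation) (s : S.obj.obj (op U)) (y : H.G₀.obj (op U))
    (z : K.G₀.obj (op U)) :
    ∃ R ∈ J U, ∀ {V : C} (f : V ⟶ U), R.arrows f → ∃ v : Point πH πK πG F V,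
      v.base = S.obj.map f.op s ∧ v.fst = H.G₀.map f.op y ∧ v.snd = K.G₀.map f.op z := by
  obtain ⟨R, hR, h⟩ := exists_frame pG.loc (((F.functor s).obj ((πH.fn U).obj ⟨y⟩)).obj
    ((πK.fn U).obj ⟨z⟩))
  refine ⟨R, hR, fun f hf => ?_⟩
  obtain ⟨x, ⟨a⟩⟩ := h f hf
  exact ⟨of _ ((H.ptRes f).obj ⟨y⟩) ((K.ptRes f).obj ⟨z⟩) x (F.ofFrame rfl a), rfl, rfl, rfl⟩

lemma exists_of₁ {v : Point πH πK πG F U} (hs : s = v.base) (hz : z.pt = v.snd) :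
    ∃ y x a, v = of s y z x a := by
  obtain ⟨a, ha⟩ := v.exists_eq_of hs.symm (y := ⟨v.fst⟩) rfl hz.symm (x := ⟨v.sec⟩) rfl
  exact ⟨_, _, a, ha⟩

lemma exists_of₂ {v : Point πH πK πG F U} (hs : s = v.base) (hy : y.pt = v.fst) :
    ∃ z x a, v = of s y z x a := by
  obtain ⟨a, ha⟩ := v.exists_eq_of hs.symm hy.symm (z := ⟨v.snd⟩) rfl (x := ⟨v.sec⟩) rfl
  exact ⟨_, _, a, ha⟩

section

variable {v v' v'' : Point πH πK πG F U}

lemma mul₁_assoc (hs : v.base = v'.base) (hz : v.snd = v'.snd) (hs' : v'.base = v''.base)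
    (hz' : v'.snd = v''.snd) :
    (v.mul₁ v' hs hz).mul₁ v'' (hs.trans hs') (hz.trans hz') =
      v.mul₁ (v'.mul₁ v'' hs' hz') hs hz := by
  obtain ⟨s, y, z, x, a, rfl⟩ := v.exists_of
  obtain ⟨y', x', a', rfl⟩ := exists_of₁ hs hz
  obtain ⟨y'', x'', a'', rfl⟩ := exists_of₁ hs' hz'
  refine (of_eq_iff (α_ y y' y'').hom (𝟙 z) (α_ x x' x'').hom rfl rfl rfl).mpr ?_
  rw [CategoryTheory.Functor.map_id, bimap_id_right]
  exact Sq.associator (L := F.along₁ πH πK s z) (R := πG.fn U) a a' a''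

lemma mul₂_assoc (hs : v.base = v'.base) (hy : v.fst = v'.fst) (hs' : v'.base = v''.base)
    (hy' : v'.fst = v''.fst) :
    (v.mul₂ v' hs hy).mul₂ v'' (hs.trans hs') (hy.trans hy') =
      v.mul₂ (v'.mul₂ v'' hs' hy') hs hy := by
  obtain ⟨s, y, z, x, a, rfl⟩ := v.exists_of
  obtain ⟨z', x', a', rfl⟩ := exists_of₂ hs hy
  obtain ⟨z'', x'', a'', rfl⟩ := exists_of₂ hs' hy'
  refine (of_eq_iff (𝟙 y) (α_ z z' z'').hom (α_ x x' x'').hom rfl rfl rfl).mpr ?_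
  rw [CategoryTheory.Functor.map_id, bimap_id_left]
  exact Sq.associator (L := F.along₂ πH πK s y) (R := πG.fn U) a a' a''

lemma mul₁_act (hs : v.base = v'.base) (hz : v.snd = v'.snd) (g : G.G₁.obj (op U)) :
    v.mul₁ (v'.act g) hs hz = (v.mul₁ v' hs hz).act g := by
  obtain ⟨s, y, z, x, a, rfl⟩ := v.exists_of
  obtain ⟨y', x', a', rfl⟩ := exists_of₁ hs hz
  let m : x' ⟶ ⟨x'.pt * G.d g⟩ := ⟨g, rfl⟩
  have h := BiaddFunctor.tens₁_map a a' (𝟙 x) m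
  rw [CategoryTheory.Functor.map_id, Category.comp_id] at h
  have e : Pt.Hom.elt (𝟙 x ⊗ₘ m) = g := by
    rw [Pt.tensorHom_elt, Pt.id_elt, G.one_act, one_mul]
  have h' := of_act (F.tens₁ a a') (𝟙 x ⊗ₘ m)
  rw [e, ← h] at h'
  exact h'.symm

lemma act_mul₁ (hs : v.base = v'.base) (hz : v.snd = v'.snd) (g : G.G₁.obj (op U)) :
    (v.act g).mul₁ v' hs hz = (v.mul₁ v' hs hz).act (G.act g v'.sec) := by
  obtain ⟨s, y, z, x, a, rfl⟩ := v.exists_of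
  obtain ⟨y', x', a', rfl⟩ := exists_of₁ hs hz
  let m : x ⟶ ⟨x.pt * G.d g⟩ := ⟨g, rfl⟩
  have h := BiaddFunctor.tens₁_map a a' m (𝟙 x')
  rw [CategoryTheory.Functor.map_id, Category.comp_id] at h
  have e : Pt.Hom.elt (m ⊗ₘ 𝟙 x') = G.act g x'.pt := by
    rw [Pt.tensorHom_elt, Pt.id_elt, mul_one]
  have h' := of_act (F.tens₁ a a') (m ⊗ₘ 𝟙 x')
  rw [e, ← h] at h'
  exact h'.symm

lemma mul₂_act (hs : v.base = v'.base) (hy : v.fst = v'.fst) (g : G.G₁.obj (op U)) :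
    v.mul₂ (v'.act g) hs hy = (v.mul₂ v' hs hy).act g := by
  obtain ⟨s, y, z, x, a, rfl⟩ := v.exists_of
  obtain ⟨z', x', a', rfl⟩ := exists_of₂ hs hy
  let m : x' ⟶ ⟨x'.pt * G.d g⟩ := ⟨g, rfl⟩
  have h := BiaddFunctor.tens₂_map a a' (𝟙 x) m
  rw [CategoryTheory.Functor.map_id, Category.comp_id] at h
  have e : Pt.Hom.elt (𝟙 x ⊗ₘ m) = g := by
    rw [Pt.tensorHom_elt, Pt.id_elt, G.one_act, one_mul]
  have h' := of_act (F.tens₂ a a') (𝟙 x ⊗ₘ m)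
  rw [e, ← h] at h'
  exact h'.symm

lemma act_mul₂ (hs : v.base = v'.base) (hy : v.fst = v'.fst) (g : G.G₁.obj (op U)) :
    (v.act g).mul₂ v' hs hy = (v.mul₂ v' hs hy).act (G.act g v'.sec) := by
  obtain ⟨s, y, z, x, a, rfl⟩ := v.exists_of
  obtain ⟨z', x', a', rfl⟩ := exists_of₂ hs hy
  let m : x ⟶ ⟨x.pt * G.d g⟩ := ⟨g, rfl⟩
  have h := BiaddFunctor.tens₂_map a a' m (𝟙 x')
  rw [CategoryTheory.Functor.map_id, Category.comp_id] at h
  have e : Pt.Hom.elt (m ⊗ₘ 𝟙 x') = G.act g x'.pt := by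
    rw [Pt.tensorHom_elt, Pt.id_elt, mul_one]
  have h' := of_act (F.tens₂ a a') (m ⊗ₘ 𝟙 x')
  rw [e, ← h] at h'
  exact h'.symm

variable (h𝓖 : 𝓖.toMonoidalPrestack.IsGroupLikeStack J)
include h𝓖

lemma mul₁_res (f : V ⟶ U) (hs : v.base = v'.base) (hz : v.snd = v'.snd)
    (hs' : (v.res f).base = (v'.res f).base) (hz' : (v.res f).snd = (v'.res f).snd) :
    (v.res f).mul₁ (v'.res f) hs' hz' = (v.mul₁ v' hs hz).res f := by
  obtain ⟨s, y, z, x, a, rfl⟩ := v.exists_of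
  obtain ⟨y', x', a', rfl⟩ := exists_of₁ hs hz
  refine (of_eq_iff (μ (H.ptRes f) y y') (𝟙 _) (μ (G.ptRes f) x x') rfl rfl rfl).mpr ?_
  rw [CategoryTheory.Functor.map_id]
  exact BiaddFunctor.resPoint_tens₁ rfl a a' h𝓖

lemma mul₂_res (f : V ⟶ U) (hs : v.base = v'.base) (hy : v.fst = v'.fst)
    (hs' : (v.res f).base = (v'.res f).base) (hy' : (v.res f).fst = (v'.res f).fst) :
    (v.res f).mul₂ (v'.res f) hs' hy' = (v.mul₂ v' hs hy).res f := by
  obtain ⟨s, y, z, x, a, rfl⟩ := v.exists_of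
  obtain ⟨z', x', a', rfl⟩ := exists_of₂ hs hy
  refine (of_eq_iff (𝟙 _) (μ (K.ptRes f) z z') (μ (G.ptRes f) x x') rfl rfl rfl).mpr ?_
  rw [CategoryTheory.Functor.map_id]
  exact BiaddFunctor.resPoint_tens₂ rfl a a' h𝓖

lemma interchange
    (hb : ∀ {V : C} (x x' : G.Pt V), μ (πG.fn V) x x' ≫ (πG.fn V).map (β_ x x').hom =
      (β_ _ _).hom ≫ μ (πG.fn V) x' x)
    {a a' b b' : Point πH πK πG F U} (ha : a.base = a'.base) (hz : a.snd = a'.snd)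
    (hs : b.base = b'.base) (hz' : b.snd = b'.snd) (hab : a.base = b.base) (hy : a.fst = b.fst)
    (hab' : a'.base = b'.base) (hy' : a'.fst = b'.fst) (hm : a.fst * a'.fst = b.fst * b'.fst)
    (hn : a.snd * b.snd = a'.snd * b'.snd) :
    (a.mul₁ a' ha hz).mul₂ (b.mul₁ b' hs hz') hab hm =
      ((a.mul₂ b hab hy).mul₁ (a'.mul₂ b' hab' hy') ha hn).act
        (G.act (G.br a'.sec b.sec) b'.sec)⁻¹ := by
  obtain ⟨s, y, z, x, a, rfl⟩ := a.exists_of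
  obtain ⟨y', x', a', rfl⟩ := exists_of₁ ha hz
  obtain ⟨z', x₁, b, rfl⟩ := exists_of₂ hab hy
  obtain ⟨x₁', b', rfl⟩ : ∃ x₁' a, b' = of s y' z' x₁' a := by
    obtain ⟨a, ha⟩ := b'.exists_eq_of hab'.symm hy'.symm hz'.symm (x := ⟨b'.sec⟩) rfl
    exact ⟨_, a, ha⟩
  have h := of_act (F.tens₂ (F.tens₁ a a') (F.tens₁ b b')) (tensorμ x x' x₁ x₁')
  have e : Pt.Hom.elt (tensorμ x x' x₁ x₁') = G.act (G.br x'.pt x₁.pt) x₁'.pt := by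
    change 1 * (1 * (G.act (G.br x'.pt x₁.pt) x₁'.pt * (1 * 1))) = _
    simp only [one_mul, mul_one]
  rw [BiaddFunctor.tens₁_interchange a a' b b' h𝓖 hb, e] at h
  change _ = act (of s (y ⊗ y') (z ⊗ z') _ (F.tens₁ (F.tens₂ a b) (F.tens₂ a' b'))) _
  rw [← h, ← act_mul, mul_inv_cancel, act_one]
  rfl

end

/-! ### The neutral points -/

/-- The trivial point over `(y, z)`, for a morphism `m : y ⟶ 1`. -/
abbrev triv₁ (F : BiaddFunctor S 𝓗 𝓚 𝓖) (s : S.obj.obj (op U)) (m : y ⟶ 𝟙_ (H.Pt U)) (z : K.Pt U) :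
    Point πH πK πG F U :=
  of s y z (𝟙_ (G.Pt U)) (bimap (F.functor s) ((πH.fn U).map m) ((πK.fn U).map (𝟙 z)) ≫
    BiaddFunctor.unit₁ πH πK πG F s z)

/-- The trivial point over `(y, z)`, for a morphism `m : z ⟶ 1`. -/
abbrev triv₂ (F : BiaddFunctor S 𝓗 𝓚 𝓖) (s : S.obj.obj (op U)) (y : H.Pt U) (m : z ⟶ 𝟙_ (K.Pt U)) :
    Point πH πK πG F U :=
  of s y z (𝟙_ (G.Pt U)) (bimap (F.functor s) ((πH.fn U).map (𝟙 y)) ((πK.fn U).map m) ≫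
    BiaddFunctor.unit₂ πH πK πG F s y)

lemma triv₁_congr (m : y ⟶ 𝟙_ (H.Pt U)) (m' : y' ⟶ 𝟙_ (H.Pt U)) (hm : m.elt = m'.elt)
    (hz : z.pt = z'.pt) : (triv₁ F s m z : Point πH πK πG F U) = triv₁ F s m' z' := by
  have hy : y = y' := by
    have h := m.eq.symm.trans m'.eq
    rw [hm] at h
    obtain ⟨y⟩ := y
    obtain ⟨y'⟩ := y'
    exact congrArg Pt.mk (mul_right_cancel h)
  obtain ⟨z⟩ := z
  obtain ⟨z'⟩ := z'
  dsimp only at hz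
  subst hz hy
  rw [Pt.hom_ext hm]

lemma triv₂_congr (m : z ⟶ 𝟙_ (K.Pt U)) (m' : z' ⟶ 𝟙_ (K.Pt U)) (hm : m.elt = m'.elt)
    (hy : y.pt = y'.pt) : (triv₂ F s y m : Point πH πK πG F U) = triv₂ F s y' m' := by
  have hz : z = z' := by
    have h := m.eq.symm.trans m'.eq
    rw [hm] at h
    obtain ⟨z⟩ := z
    obtain ⟨z'⟩ := z'
    exact congrArg Pt.mk (mul_right_cancel h)
  obtain ⟨y⟩ := y
  obtain ⟨y'⟩ := y'
  dsimp only at hy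
  subst hy hz
  rw [Pt.hom_ext hm]

lemma triv₁_mul₁ (m : y ⟶ 𝟙_ (H.Pt U))
    (a : ((F.functor s).obj ((πH.fn U).obj y')).obj ((πK.fn U).obj z) ⟶ (πG.fn U).obj x) :
    (triv₁ F s m z : Point πH πK πG F U).mul₁ (of s y' z x a) rfl rfl =
      of s (y ⊗ y') z x (bimap (F.functor s) ((πH.fn U).map ((m ⊗ₘ 𝟙 y') ≫ (λ_ y').hom))
        ((πK.fn U).map (𝟙 z)) ≫ a) := by
  have h := BiaddFunctor.bimap_tens₁ (BiaddFunctor.unit₁ πH πK πG F s z) a m (𝟙 y') (𝟙 z)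
  have e : bimap (F.functor s) ((πH.fn U).map (𝟙 y')) ((πK.fn U).map (𝟙 z)) ≫ a = a := by
    rw [CategoryTheory.Functor.map_id, CategoryTheory.Functor.map_id, bimap_id, Category.id_comp]
  have h' := Sq.leftUnitor (L := F.along₁ πH πK s z) (R := πG.fn U) a
  change ((F.functor s).map ((πH.fn U).map (λ_ y').hom)).app _ ≫ a =
    F.tens₁ (BiaddFunctor.unit₁ πH πK πG F s z) a ≫ _ at h'
  rw [← bimap_id_right] at h'
  rw [e] at h
  refine (of_eq_iff (𝟙 _) (𝟙 _) (λ_ x).hom rfl rfl rfl).mpr ?_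
  refine Eq.trans ?_ (congrArg (· ≫ _) h.symm)
  rw [Category.assoc, ← h', Functor.map_comp, CategoryTheory.Functor.map_id, CategoryTheory.Functor.map_id,
    bimap_id, Category.id_comp, ← Category.assoc, ← bimap_comp, Category.comp_id]

lemma triv₂_mul₂ (m : z ⟶ 𝟙_ (K.Pt U))
    (a : ((F.functor s).obj ((πH.fn U).obj y)).obj ((πK.fn U).obj z') ⟶ (πG.fn U).obj x) :
    (triv₂ F s y m : Point πH πK πG F U).mul₂ (of s y z' x a) rfl rfl =
      of s y (z ⊗ z') x (bimap (F.functor s) ((πH.fn U).map (𝟙 y))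
        ((πK.fn U).map ((m ⊗ₘ 𝟙 z') ≫ (λ_ z').hom)) ≫ a) := by
  have h := BiaddFunctor.bimap_tens₂ (BiaddFunctor.unit₂ πH πK πG F s y) a (𝟙 y) m (𝟙 z')
  have e : bimap (F.functor s) ((πH.fn U).map (𝟙 y)) ((πK.fn U).map (𝟙 z')) ≫ a = a := by
    rw [CategoryTheory.Functor.map_id, CategoryTheory.Functor.map_id, bimap_id, Category.id_comp]
  have h' := Sq.leftUnitor (L := F.along₂ πH πK s y) (R := πG.fn U) a
  change ((F.functor s).obj ((πH.fn U).obj y)).map ((πK.fn U).map (λ_ z').hom) ≫ a =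
    F.tens₂ (BiaddFunctor.unit₂ πH πK πG F s y) a ≫ _ at h'
  rw [← bimap_id_left] at h'
  rw [e] at h
  refine (of_eq_iff (𝟙 _) (𝟙 _) (λ_ x).hom rfl rfl rfl).mpr ?_
  refine Eq.trans ?_ (congrArg (· ≫ _) h.symm)
  rw [Category.assoc, ← h', Functor.map_comp, CategoryTheory.Functor.map_id, CategoryTheory.Functor.map_id,
    bimap_id, Category.id_comp, ← Category.assoc, ← bimap_comp, Category.comp_id]

lemma mul₁_triv₁ (m : y ⟶ 𝟙_ (H.Pt U))
    (a : ((F.functor s).obj ((πH.fn U).obj y')).obj ((πK.fn U).obj z) ⟶ (πG.fn U).obj x) :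
    (of s y' z x a).mul₁ (triv₁ F s m z : Point πH πK πG F U) rfl rfl =
      of s (y' ⊗ y) z x (bimap (F.functor s) ((πH.fn U).map ((𝟙 y' ⊗ₘ m) ≫ (ρ_ y').hom))
        ((πK.fn U).map (𝟙 z)) ≫ a) := by
  have h := BiaddFunctor.bimap_tens₁ a (BiaddFunctor.unit₁ πH πK πG F s z) (𝟙 y') m (𝟙 z)
  have e : bimap (F.functor s) ((πH.fn U).map (𝟙 y')) ((πK.fn U).map (𝟙 z)) ≫ a = a := by
    rw [CategoryTheory.Functor.map_id, CategoryTheory.Functor.map_id, bimap_id, Category.id_comp]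
  have h' := Sq.rightUnitor (L := F.along₁ πH πK s z) (R := πG.fn U) a
  change ((F.functor s).map ((πH.fn U).map (ρ_ y').hom)).app _ ≫ a =
    F.tens₁ a (BiaddFunctor.unit₁ πH πK πG F s z) ≫ _ at h'
  rw [← bimap_id_right] at h'
  rw [e] at h
  refine (of_eq_iff (𝟙 _) (𝟙 _) (ρ_ x).hom rfl rfl rfl).mpr ?_
  refine Eq.trans ?_ (congrArg (· ≫ _) h.symm)
  rw [Category.assoc, ← h', Functor.map_comp, CategoryTheory.Functor.map_id, CategoryTheory.Functor.map_id,
    bimap_id, Category.id_comp, ← Category.assoc, ← bimap_comp, Category.comp_id]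

lemma mul₂_triv₂ (m : z ⟶ 𝟙_ (K.Pt U))
    (a : ((F.functor s).obj ((πH.fn U).obj y)).obj ((πK.fn U).obj z') ⟶ (πG.fn U).obj x) :
    (of s y z' x a).mul₂ (triv₂ F s y m : Point πH πK πG F U) rfl rfl =
      of s y (z' ⊗ z) x (bimap (F.functor s) ((πH.fn U).map (𝟙 y))
        ((πK.fn U).map ((𝟙 z' ⊗ₘ m) ≫ (ρ_ z').hom)) ≫ a) := by
  have h := BiaddFunctor.bimap_tens₂ a (BiaddFunctor.unit₂ πH πK πG F s y) (𝟙 y) (𝟙 z') m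
  have e : bimap (F.functor s) ((πH.fn U).map (𝟙 y)) ((πK.fn U).map (𝟙 z')) ≫ a = a := by
    rw [CategoryTheory.Functor.map_id, CategoryTheory.Functor.map_id, bimap_id, Category.id_comp]
  have h' := Sq.rightUnitor (L := F.along₂ πH πK s y) (R := πG.fn U) a
  change ((F.functor s).obj ((πH.fn U).obj y)).map ((πK.fn U).map (ρ_ z').hom) ≫ a =
    F.tens₂ a (BiaddFunctor.unit₂ πH πK πG F s y) ≫ _ at h'
  rw [← bimap_id_left] at h'
  rw [e] at h
  refine (of_eq_iff (𝟙 _) (𝟙 _) (ρ_ x).hom rfl rfl rfl).mpr ?_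
  refine Eq.trans ?_ (congrArg (· ≫ _) h.symm)
  rw [Category.assoc, ← h', Functor.map_comp, CategoryTheory.Functor.map_id, CategoryTheory.Functor.map_id,
    bimap_id, Category.id_comp, ← Category.assoc, ← bimap_comp, Category.comp_id]

end Point

end BiaddBfl

namespace BiaddBfl

open Functor.LaxMonoidal CrossedModule MonoidalMorphism

variable {C : Type u} [Category.{v} C] {J : GrothendieckTopology C} {S S' S'' : Sheaf J (Type w)}
  {H K : CrossedModule.{v, u, w} J} {G : BraidedCrossedModule.{v, u, w} J}
  {𝓗 : MonoidalPrestack.{v, u, v₁, u₁} C} {𝓚 : MonoidalPrestack.{v, u, v₂, u₂} C}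
  {𝓖 : BraidedPrestack.{v, u, w, u₃} C}
  {πH : MonoidalMorphism H.prestack 𝓗} {πK : MonoidalMorphism K.prestack 𝓚}
  {πG : MonoidalMorphism G.toCrossedModule.prestack 𝓖.toMonoidalPrestack}

/-- The morphism from `∂h` to the unit object. -/
def CrossedModule.toUnit (M : CrossedModule.{v, u, w} J) {U : C} (h : M.G₁.obj (op U)) :
    (⟨M.d h⟩ : M.Pt U) ⟶ 𝟙_ (M.Pt U) :=
  ⟨h⁻¹, by rw [Pt.unit_pt, map_inv, mul_inv_cancel]⟩

namespace BiaddFunctor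

variable (F : BiaddFunctor S 𝓗 𝓚 𝓖)

variable (πH πK) in
/-- The torsor of points of a biadditive functor. -/
def pointTorsor (pG : πG.IsPresentation) : Torsor S H.G₀ K.G₀ G.toCrossedModule where
  E := ⟨Point.presheaf πH πK πG F, Point.presheaf_isSheaf pG.stack⟩
  base := Point.base
  fst := Point.fst
  snd := Point.snd
  act := Point.act
  sec := Point.sec
  base_res _ _ := rfl
  fst_res _ _ := rfl
  snd_res _ _ := rfl
  act_res := Point.act_res
  sec_res _ _ := rfl
  base_act _ _ := rfl
  fst_act _ _ := rfl
  snd_act _ _ := rfl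
  act_one := Point.act_one
  act_mul := Point.act_mul
  simply_transitive := Point.existsUnique_act pG
  locally_nonempty := Point.locally_nonempty pG
  sec_act _ _ := rfl

variable (πH πK) in
/-- The biextension of points of a biadditive functor. -/
def pointBiextension (pG : πG.IsPresentation)
    (hb : ∀ {V : C} (x x' : G.Pt V), μ (πG.fn V) x x' ≫ (πG.fn V).map (β_ x x').hom =
      (β_ _ _).hom ≫ μ (πG.fn V) x' x) : Biextension S H.G₀ K.G₀ G where
  toTorsor := F.pointTorsor πH πK pG
  mul₁ v v' c := Point.mul₁ v v' c.1 c.2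
  base_mul₁ _ _ _ := rfl
  fst_mul₁ _ _ _ := rfl
  snd_mul₁ _ _ _ := rfl
  mul₁_res f _ _ c c' := Point.mul₁_res pG.stack f c.1 c.2 c'.1 c'.2
  mul₁_assoc _ _ _ c c' _ _ := Point.mul₁_assoc c.1 c.2 c'.1 c'.2
  sec_mul₁ _ _ _ := rfl
  mul₁_act _ _ g c _ := Point.mul₁_act c.1 c.2 g
  act_mul₁ _ _ g c _ := Point.act_mul₁ c.1 c.2 g
  mul₂ v v' c := Point.mul₂ v v' c.1 c.2
  base_mul₂ _ _ _ := rfl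
  fst_mul₂ _ _ _ := rfl
  snd_mul₂ _ _ _ := rfl
  mul₂_res f _ _ c c' := Point.mul₂_res pG.stack f c.1 c.2 c'.1 c'.2
  mul₂_assoc _ _ _ c c' _ _ := Point.mul₂_assoc c.1 c.2 c'.1 c'.2
  sec_mul₂ _ _ _ := rfl
  mul₂_act _ _ g c _ := Point.mul₂_act c.1 c.2 g
  act_mul₂ _ _ g c _ := Point.act_mul₂ c.1 c.2 g
  interchange _ _ _ _ c₁ c₂ c₃ c₄ c₅ c₆ := Point.interchange pG.stack hb c₁.1 c₁.2 c₂.1 c₂.2 c₃.1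
    c₄.2 c₅.1 c₅.2 c₃.2 c₆.2

end BiaddFunctor

namespace Point

variable {F : BiaddFunctor S 𝓗 𝓚 𝓖} {U V : C} {s : S.obj.obj (op U)} {y y' y'' : H.Pt U}
  {z z' z'' : K.Pt U} {x x' x'' : G.Pt U}

lemma triv₁_mul₁_triv₁ (m : y ⟶ 𝟙_ (H.Pt U)) (m' : y' ⟶ 𝟙_ (H.Pt U)) :
    (triv₁ F s m z : Point πH πK πG F U).mul₁ (triv₁ F s m' z) rfl rfl =
      triv₁ F s (((m ⊗ₘ 𝟙 y') ≫ (λ_ y').hom) ≫ m') z := by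
  rw [triv₁_mul₁, ← Category.assoc, ← bimap_comp, ← Functor.map_comp, ← Functor.map_comp,
    Category.comp_id]

lemma triv₂_mul₂_triv₂ (m : z ⟶ 𝟙_ (K.Pt U)) (m' : z' ⟶ 𝟙_ (K.Pt U)) :
    (triv₂ F s y m : Point πH πK πG F U).mul₂ (triv₂ F s y m') rfl rfl =
      triv₂ F s y (((m ⊗ₘ 𝟙 z') ≫ (λ_ z').hom) ≫ m') := by
  rw [triv₂_mul₂, ← Category.assoc, ← bimap_comp, ← Functor.map_comp, ← Functor.map_comp,
    Category.comp_id]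

lemma unit₁_mul₁_unit₁ :
    (triv₁ F s (𝟙 _) z : Point πH πK πG F U).mul₁ (triv₁ F s (𝟙 _) z) rfl rfl =
      triv₁ F s (𝟙 _) z := by
  rw [triv₁_mul₁_triv₁]
  refine triv₁_congr _ _ ?_ rfl
  change H.act 1 _ * 1 * 1 * 1 = 1
  simp [CrossedModule.one_act]

lemma unit₂_mul₂_unit₂ :
    (triv₂ F s y (𝟙 _) : Point πH πK πG F U).mul₂ (triv₂ F s y (𝟙 _)) rfl rfl =
      triv₂ F s y (𝟙 _) := by
  rw [triv₂_mul₂_triv₂]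
  refine triv₂_congr _ _ ?_ rfl
  change K.act 1 _ * 1 * 1 * 1 = 1
  simp [CrossedModule.one_act]

variable (pG : πG.IsPresentation)
    (hb : ∀ {V : C} (x x' : G.Pt V), μ (πG.fn V) x x' ≫ (πG.fn V).map (β_ x x').hom =
      (β_ _ _).hom ≫ μ (πG.fn V) x' x)
include pG hb

lemma unit₁_mul₂_unit₁ :
    (triv₁ F s (𝟙 _) z : Point πH πK πG F U).mul₂ (triv₁ F s (𝟙 _) z') rfl rfl =
      triv₁ F s (𝟙 _) (z ⊗ z') := by
  refine ((F.pointBiextension πH πK pG hb).eq_of_mul₁_self rfl rfl (c := ⟨rfl, rfl⟩)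
    (c' := ⟨rfl, rfl⟩) ?_ ?_)
  · have h := interchange (πH := πH) (πK := πK) pG.stack hb (a := triv₁ F s (𝟙 _) z) (a' := triv₁ F s (𝟙 _) z)
      (b := triv₁ F s (𝟙 _) z') (b' := triv₁ F s (𝟙 _) z') rfl rfl rfl rfl rfl rfl rfl rfl rfl rfl
    change _ = act _ (G.act (G.br 1 1) 1)⁻¹ at h
    rw [G.br_one, G.one_act, inv_one, act_one] at h
    refine h.symm.trans ?_
    congr 1 <;> exact unit₁_mul₁_unit₁
  · exact unit₁_mul₁_unit₁

lemma unit₂_mul₁_unit₂ :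
    (triv₂ F s y (𝟙 _) : Point πH πK πG F U).mul₁ (triv₂ F s y' (𝟙 _)) rfl rfl =
      triv₂ F s (y ⊗ y') (𝟙 _) := by
  refine ((F.pointBiextension πH πK pG hb).eq_of_mul₂_self rfl rfl (c := ⟨rfl, rfl⟩)
    (c' := ⟨rfl, rfl⟩) ?_ ?_)
  · have h := interchange (πH := πH) (πK := πK) pG.stack hb (a := triv₂ F s y (𝟙 _)) (a' := triv₂ F s y' (𝟙 _))
      (b := triv₂ F s y (𝟙 _)) (b' := triv₂ F s y' (𝟙 _)) rfl rfl rfl rfl rfl rfl rfl rfl rfl rfl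
    change _ = act _ (G.act (G.br 1 1) 1)⁻¹ at h
    rw [G.br_one, G.one_act, inv_one, act_one] at h
    refine h.trans ?_
    congr 1 <;> exact unit₂_mul₂_unit₂
  · exact unit₂_mul₂_unit₂

lemma triv₁_mul₂_triv₁ (m : y ⟶ 𝟙_ (H.Pt U)) :
    (triv₁ F s m z : Point πH πK πG F U).mul₂ (triv₁ F s m z') rfl rfl =
      triv₁ F s m (z ⊗ z') := by
  have h := unit₁_mul₂_unit₁ (F := F) (πH := πH) (πK := πK) (s := s) (z := z) (z' := z') pG hb
  have h' := (of_eq_iff (𝟙 _) (𝟙 _) (λ_ (𝟙_ _)).hom rfl rfl rfl).mp ((of_mul₂ _ _).symm.trans h)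
  simp only [CategoryTheory.Functor.map_id, bimap_id, Category.id_comp] at h'
  have h'' := BiaddFunctor.bimap_tens₂ (BiaddFunctor.unit₁ πH πK πG F s z)
    (BiaddFunctor.unit₁ πH πK πG F s z') m (𝟙 z) (𝟙 z')
  rw [of_mul₂, h'']
  refine (of_eq_iff (𝟙 _) (𝟙 _) (λ_ (𝟙_ _)).hom rfl rfl rfl).mpr ?_
  rw [CategoryTheory.Functor.map_id, CategoryTheory.Functor.map_id, bimap_id, Category.id_comp]
  rw [Category.assoc, ← h', id_tensorHom_id, CategoryTheory.Functor.map_id]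

lemma triv₂_mul₁_triv₂ (m : z ⟶ 𝟙_ (K.Pt U)) :
    (triv₂ F s y m : Point πH πK πG F U).mul₁ (triv₂ F s y' m) rfl rfl =
      triv₂ F s (y ⊗ y') m := by
  have h := unit₂_mul₁_unit₂ (F := F) (πH := πH) (πK := πK) (s := s) (y := y) (y' := y') pG hb
  have h' := (of_eq_iff (𝟙 _) (𝟙 _) (λ_ (𝟙_ _)).hom rfl rfl rfl).mp ((of_mul₁ _ _).symm.trans h)
  simp only [CategoryTheory.Functor.map_id, bimap_id, Category.id_comp] at h'
  have h'' := BiaddFunctor.bimap_tens₁ (BiaddFunctor.unit₂ πH πK πG F s y)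
    (BiaddFunctor.unit₂ πH πK πG F s y') (𝟙 y) (𝟙 y') m
  rw [of_mul₁, h'']
  refine (of_eq_iff (𝟙 _) (𝟙 _) (λ_ (𝟙_ _)).hom rfl rfl rfl).mpr ?_
  rw [CategoryTheory.Functor.map_id, CategoryTheory.Functor.map_id, bimap_id, Category.id_comp]
  rw [Category.assoc, ← h', id_tensorHom_id, CategoryTheory.Functor.map_id]

omit pG hb

lemma triv₁_eq_triv₂ (m : y ⟶ 𝟙_ (H.Pt U)) (n : z ⟶ 𝟙_ (K.Pt U)) :
    (triv₁ F s m z : Point πH πK πG F U) = triv₂ F s y n := by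
  unfold triv₁ triv₂
  rw [← BiaddFunctor.unit₁_natural n, ← BiaddFunctor.unit₂_natural m, BiaddFunctor.unit₁_eq_unit₂,
    ← Category.assoc, ← Category.assoc, CategoryTheory.Functor.map_id,
    CategoryTheory.Functor.map_id, ← bimap_comp, ← bimap_comp, Category.comp_id, Category.comp_id,
    Category.id_comp, Category.id_comp]

include pG in
lemma triv₁_res (f : V ⟶ U) (m : y ⟶ 𝟙_ (H.Pt U)) (m' : (H.ptRes f).obj y ⟶ 𝟙_ (H.Pt V))
    (hm : m'.elt = H.G₁.map f.op m.elt) :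
    (triv₁ F s m z : Point πH πK πG F U).res f =
      triv₁ F (S.obj.map f.op s) m' ((K.ptRes f).obj z) := by
  have e : m' ≫ ε (H.ptRes f) = (H.ptRes f).map m :=
    Pt.hom_ext ((mul_one _).trans hm)
  refine ((of_eq_iff (𝟙 _) (𝟙 _) (ε (G.ptRes f)) rfl rfl rfl).mpr ?_).symm
  have h := BiaddFunctor.resPoint_unit₁ (πH := πH) (πK := πK) (πG := πG) (F := F) (s := s) (z := z)
    (f := f) rfl pG.stack
  rw [BiaddFunctor.resPoint_bimap, Category.assoc, ← h, ← e]
  simp only [CategoryTheory.Functor.map_id, bimap_id, Category.id_comp, Functor.map_comp]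
  rw [← Category.assoc, ← bimap_comp, Category.comp_id]

include pG in
lemma triv₂_res (f : V ⟶ U) (m : z ⟶ 𝟙_ (K.Pt U)) (m' : (K.ptRes f).obj z ⟶ 𝟙_ (K.Pt V))
    (hm : m'.elt = K.G₁.map f.op m.elt) :
    (triv₂ F s y m : Point πH πK πG F U).res f =
      triv₂ F (S.obj.map f.op s) ((H.ptRes f).obj y) m' := by
  have e : m' ≫ ε (K.ptRes f) = (K.ptRes f).map m :=
    Pt.hom_ext ((mul_one _).trans hm)
  refine ((of_eq_iff (𝟙 _) (𝟙 _) (ε (G.ptRes f)) rfl rfl rfl).mpr ?_).symm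
  have h := BiaddFunctor.resPoint_unit₂ (πH := πH) (πK := πK) (πG := πG) (F := F) (s := s) (y := y)
    (f := f) rfl pG.stack
  rw [BiaddFunctor.resPoint_bimap, Category.assoc, ← h, ← e]
  simp only [CategoryTheory.Functor.map_id, bimap_id, Category.id_comp, Functor.map_comp]
  rw [← Category.assoc, ← bimap_comp, Category.comp_id]

lemma triv₁_mul₁_eq {m : y ⟶ 𝟙_ (H.Pt U)} {m' : y' ⟶ 𝟙_ (H.Pt U)}
    (a : ((F.functor s).obj ((πH.fn U).obj y'')).obj ((πK.fn U).obj z) ⟶ (πG.fn U).obj x)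
    (hm : H.act m.elt y''.pt = m'.elt) :
    (triv₁ F s m z : Point πH πK πG F U).mul₁ (of s y'' z x a) rfl rfl =
      (of s y'' z x a).mul₁ (triv₁ F s m' z) rfl rfl := by
  rw [triv₁_mul₁, mul₁_triv₁]
  have hy : (y ⊗ y'').pt = (y'' ⊗ y').pt := by
    have h₁ := (m ⊗ₘ 𝟙 y'').eq
    have h₂ := (𝟙 y'' ⊗ₘ m').eq
    rw [Pt.tensorHom_elt, Pt.id_elt, mul_one, hm] at h₁
    rw [Pt.tensorHom_elt, Pt.id_elt, H.one_act, one_mul] at h₂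
    refine mul_right_cancel (h₁.symm.trans (Eq.trans ?_ h₂))
    exact (one_mul _).trans (mul_one _).symm
  refine (of_eq_iff (Pt.isoOfEq hy).hom (𝟙 _) (𝟙 _) rfl rfl rfl).mpr ?_
  rw [← Category.assoc, ← bimap_comp, CategoryTheory.Functor.map_id, CategoryTheory.Functor.map_id,
    Category.comp_id, Category.comp_id, ← Functor.map_comp]
  congr 3
  refine Pt.hom_ext ?_
  change 1 * (H.act 1 _ * m'.elt * 1) = H.act m.elt _ * 1 * 1
  rw [H.one_act, hm]
  simp only [one_mul, mul_one]

lemma triv₂_mul₂_eq {m : z ⟶ 𝟙_ (K.Pt U)} {m' : z' ⟶ 𝟙_ (K.Pt U)}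
    (a : ((F.functor s).obj ((πH.fn U).obj y)).obj ((πK.fn U).obj z'') ⟶ (πG.fn U).obj x)
    (hm : K.act m.elt z''.pt = m'.elt) :
    (triv₂ F s y m : Point πH πK πG F U).mul₂ (of s y z'' x a) rfl rfl =
      (of s y z'' x a).mul₂ (triv₂ F s y m') rfl rfl := by
  rw [triv₂_mul₂, mul₂_triv₂]
  have hz : (z ⊗ z'').pt = (z'' ⊗ z').pt := by
    have h₁ := (m ⊗ₘ 𝟙 z'').eq
    have h₂ := (𝟙 z'' ⊗ₘ m').eq
    rw [Pt.tensorHom_elt, Pt.id_elt, mul_one, hm] at h₁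
    rw [Pt.tensorHom_elt, Pt.id_elt, K.one_act, one_mul] at h₂
    refine mul_right_cancel (h₁.symm.trans (Eq.trans ?_ h₂))
    exact (one_mul _).trans (mul_one _).symm
  refine (of_eq_iff (𝟙 _) (Pt.isoOfEq hz).hom (𝟙 _) rfl rfl rfl).mpr ?_
  rw [← Category.assoc, ← bimap_comp, CategoryTheory.Functor.map_id, CategoryTheory.Functor.map_id,
    Category.comp_id, Category.comp_id, ← Functor.map_comp]
  congr 3
  refine Pt.hom_ext ?_
  change 1 * (K.act 1 _ * m'.elt * 1) = K.act m.elt _ * 1 * 1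
  rw [K.one_act, hm]
  simp only [one_mul, mul_one]

end Point

lemma CrossedModule.inv_act (M : CrossedModule.{v, u, w} J) {U : C} (h : M.G₁.obj (op U))
    (y : M.G₀.obj (op U)) : M.act h⁻¹ y = (M.act h y)⁻¹ :=
  eq_inv_of_mul_eq_one_left (by rw [← M.mul_act, inv_mul_cancel, M.one_act])

/-- The restriction of the morphism from `∂h` to the unit object. -/
def CrossedModule.resToUnit (M : CrossedModule.{v, u, w} J) {U V : C} (f : V ⟶ U)
    (h : M.G₁.obj (op U)) : (M.ptRes f).obj ⟨M.d h⟩ ⟶ 𝟙_ (M.Pt V) :=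
  ⟨(M.G₁.map f.op h)⁻¹, by rw [Pt.unit_pt, map_inv, M.d_res, ptRes_obj_pt, mul_inv_cancel]⟩

variable (πH πK) in
/-- The butterfly of points of a biadditive functor. -/
def BiaddFunctor.points (F : BiaddFunctor S 𝓗 𝓚 𝓖) (pG : πG.IsPresentation)
    (hb : ∀ {V : C} (x x' : G.Pt V), μ (πG.fn V) x x' ≫ (πG.fn V).map (β_ x x').hom =
      (β_ _ _).hom ≫ μ (πG.fn V) x' x) : Butterfly S H K G where
  toBiextension := F.pointBiextension πH πK pG hb
  s₁ s h z := Point.triv₁ F s (H.toUnit h) ⟨z⟩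
  s₁_res f s h z := by
    refine Eq.trans ?_ (Point.triv₁_res pG f (H.toUnit h) (H.resToUnit f h)
      (map_inv (H.G₁.map f.op).hom h).symm).symm
    exact Point.triv₁_congr _ _ rfl rfl
  base_s₁ _ _ _ := rfl
  fst_s₁ _ _ _ := rfl
  snd_s₁ _ _ _ := rfl
  sec_s₁ _ _ _ := rfl
  s₁_mul₁ s h h' z _ := (Point.triv₁_mul₁_triv₁ _ _).trans (Point.triv₁_congr _ _ (by
    change H.act h⁻¹ (H.d h') * 1 * 1 * h'⁻¹ = (h * h')⁻¹
    rw [H.act_d]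
    group) rfl)
  s₁_mul₂ s h z z' _ := Point.triv₁_mul₂_triv₁ pG hb (H.toUnit h)
  s₂ s y k := Point.triv₂ F s ⟨y⟩ (K.toUnit k)
  s₂_res f s y k := by
    refine Eq.trans ?_ (Point.triv₂_res pG f (K.toUnit k) (K.resToUnit f k)
      (map_inv (K.G₁.map f.op).hom k).symm).symm
    exact Point.triv₂_congr _ _ rfl rfl
  base_s₂ _ _ _ := rfl
  fst_s₂ _ _ _ := rfl
  snd_s₂ _ _ _ := rfl
  sec_s₂ _ _ _ := rfl
  s₂_mul₁ s y y' k _ := Point.triv₂_mul₁_triv₂ pG hb (K.toUnit k)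
  s₂_mul₂ s y k k' _ := (Point.triv₂_mul₂_triv₂ _ _).trans (Point.triv₂_congr _ _ (by
    change K.act k⁻¹ (K.d k') * 1 * 1 * k'⁻¹ = (k * k')⁻¹
    rw [K.act_d]
    group) rfl)
  restriction s h k := Point.triv₁_eq_triv₂ (H.toUnit h) (K.toUnit k)
  compatibility₁ h e c c' := Point.triv₁_mul₁_eq (m := H.toUnit h) (m' := H.toUnit _)
    (Point.iso e) (H.inv_act h _)
  compatibility₂ k e c c' := Point.triv₂_mul₂_eq (m := K.toUnit k) (m' := K.toUnit _)
    (Point.iso e) (K.inv_act k _)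

end BiaddBfl

namespace BiaddBfl

open Functor.LaxMonoidal CrossedModule MonoidalMorphism

variable {C : Type u} [Category.{v} C] {J : GrothendieckTopology C} {S S' S'' : Sheaf J (Type w)}
  {H K : CrossedModule.{v, u, w} J} {G : BraidedCrossedModule.{v, u, w} J}
  {𝓗 : MonoidalPrestack.{v, u, v₁, u₁} C} {𝓚 : MonoidalPrestack.{v, u, v₂, u₂} C}
  {𝓖 : BraidedPrestack.{v, u, w, u₃} C}
  {πH : MonoidalMorphism H.prestack 𝓗} {πK : MonoidalMorphism K.prestack 𝓚}
  {πG : MonoidalMorphism G.toCrossedModule.prestack 𝓖.toMonoidalPrestack}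

variable (πH πK) in
/-- The butterfly of points represents the biadditive functor. -/
def BiaddFunctor.representsPoints (F : BiaddFunctor S 𝓗 𝓚 𝓖) (pG : πG.IsPresentation)
    (hb : ∀ {V : C} (x x' : G.Pt V), μ (πG.fn V) x x' ≫ (πG.fn V).map (β_ x x').hom =
      (β_ _ _).hom ≫ μ (πG.fn V) x' x) : Represents πH πK πG (F.points πH πK pG hb) F where
  iso v _ _ _ _ hs hy hz hx := Point.isoOf v hs hy hz hx
  iso_act v g s y z x x' hs hy hz hx _ _ _ _ h := by
    subst hs hy hz hx h
    rfl
  iso_res f v s y z x hs hy hz hx _ _ _ _ := by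
    subst hs hy hz hx
    refine (F.rs_resPoint (y := ⟨_⟩) (z := ⟨_⟩) (x := ⟨_⟩) rfl (Point.iso v)).symm.trans ?_
    exact congrArg (_ ≫ ·) (Category.assoc _ _ _)
  iso_mul₁ v v' c s y y' z x x' hs hy hz hx hs' hy' hz' hx' _ _ _ _ := by
    subst hs hy hz hx hy' hx'
    have h := F.bμ₁_tens₁ (y := ⟨_⟩) (y' := ⟨_⟩) (z := ⟨_⟩) (x := ⟨_⟩) (x' := ⟨_⟩) (Point.iso v)
      (Point.isoOf v' hs' rfl hz' rfl)
    rw [bimap_id_right] at h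
    exact h
  iso_mul₂ v v' c s y z z' x x' hs hy hz hx hs' hy' hz' hx' _ _ _ _ := by
    subst hs hy hz hx hz' hx'
    have h := F.bμ₂_tens₂ (y := ⟨_⟩) (z := ⟨_⟩) (z' := ⟨_⟩) (x := ⟨_⟩) (x₁ := ⟨_⟩) (Point.iso v)
      (Point.isoOf v' hs' hy' rfl rfl)
    rw [bimap_id_left] at h
    exact h
  iso_s₁ {U} s h z h₁ := by
    let m : 𝟙_ (H.Pt U) ⟶ ⟨H.d h⟩ := ⟨h, h₁⟩
    have e : m ≫ H.toUnit h = 𝟙 _ := Pt.hom_ext (mul_inv_cancel h)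
    have h₂ := F.bε₁_unit₁ (πH := πH) (πK := πK) (πG := πG) (s := s) (z := ⟨z⟩)
    refine Eq.trans (congrArg (_ ≫ ·) ?_) h₂
    have h₃ : bimap (F.functor s) (ε (πH.fn U) ≫ (πH.fn U).map m) (𝟙 ((πK.fn U).obj ⟨z⟩)) ≫
        bimap (F.functor s) ((πH.fn U).map (H.toUnit h)) ((πK.fn U).map (𝟙 (⟨z⟩ : K.Pt U))) =
        bimap (F.functor s) (ε (πH.fn U)) (𝟙 _) := by
      rw [← bimap_comp, Category.id_comp, CategoryTheory.Functor.map_id, Category.assoc,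
        ← Functor.map_comp, e, CategoryTheory.Functor.map_id, Category.comp_id]
    refine Eq.trans (congrArg (· ≫ _) (bimap_id_right _ _ _).symm) ?_
    exact (Category.assoc _ _ _).symm.trans (congrArg (· ≫ _) h₃)
  iso_s₂ {U} s y k h₁ := by
    let m : 𝟙_ (K.Pt U) ⟶ ⟨K.d k⟩ := ⟨k, h₁⟩
    have e : m ≫ K.toUnit k = 𝟙 _ := Pt.hom_ext (mul_inv_cancel k)
    have h₂ := F.bε₂_unit₂ (πH := πH) (πK := πK) (πG := πG) (s := s) (y := ⟨y⟩)
    refine Eq.trans (congrArg (_ ≫ ·) ?_) h₂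
    have h₃ : bimap (F.functor s) (𝟙 ((πH.fn U).obj ⟨y⟩)) (ε (πK.fn U) ≫ (πK.fn U).map m) ≫
        bimap (F.functor s) ((πH.fn U).map (𝟙 (⟨y⟩ : H.Pt U))) ((πK.fn U).map (K.toUnit k)) =
        bimap (F.functor s) (𝟙 _) (ε (πK.fn U)) := by
      rw [← bimap_comp, Category.id_comp, CategoryTheory.Functor.map_id, Category.assoc,
        ← Functor.map_comp, e, CategoryTheory.Functor.map_id, Category.comp_id]
    refine Eq.trans (congrArg (· ≫ _) (bimap_id_left _ _ _).symm) ?_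
    exact (Category.assoc _ _ _).symm.trans (congrArg (· ≫ _) h₃)

namespace Represents

lemma riso_injective {E : Butterfly S H K G} {F : BiaddFunctor S 𝓗 𝓚 𝓖}
    (r : Represents πH πK πG E F) (pG : πG.IsPresentation) {U : C} {s : S.obj.obj (op U)}
    {y : H.Pt U} {z : K.Pt U} {x : G.Pt U} {e e' : E.Over s y z x} (h : r.riso e = r.riso e') :
    e = e' := by
  obtain ⟨m, rfl, -⟩ := e.existsUnique_act e'
  have := fn_faithful pG.loc U
  have := pG.stack.isIso (r.riso e)
  rw [riso_act] at h
  have hm : m = 𝟙 x := (πG.fn U).map_injective (by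
    rw [← cancel_epi (r.riso e), ← h, CategoryTheory.Functor.map_id, Category.comp_id])
  rw [hm, Butterfly.Over.act_id]

variable {p : S' ⟶ S} {E' : Butterfly S' H K G} {E : Butterfly S H K G}
  {F' : BiaddFunctor S' 𝓗 𝓚 𝓖} {F : BiaddFunctor S 𝓗 𝓚 𝓖} (r' : Represents πH πK πG E' F')
  (r : Represents πH πK πG E F) (Θ : BiaddFunctor.HomOver p F' F) {U V : C}
  {s : S'.obj.obj (op U)} {y y' : H.Pt U} {z z' : K.Pt U} {x x' : G.Pt U}

/-- Points of two butterflies related by a morphism of the biadditive functors they represent. -/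
def Rel (e : E'.Over s y z x) (v : E.Over (p.hom.app (op U) s) y z x) : Prop :=
  ((Θ.app s).app ((πH.fn U).obj y)).app ((πK.fn U).obj z) ≫ r.riso v = r'.riso e

variable {r r' Θ} {e : E'.Over s y z x} {v : E.Over (p.hom.app (op U) s) y z x}

lemma Rel.unique (pG : πG.IsPresentation) {v' : E.Over (p.hom.app (op U) s) y z x}
    (h : Rel r' r Θ e v) (h' : Rel r' r Θ e v') : v = v' := by
  refine r.riso_injective pG ?_
  exact (@cancel_epi _ _ _ _ _ _ (@IsIso.epi_of_iso _ _ _ _ _ (pG.stack.isIso _)) _ _).mp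
    (h.trans h'.symm)

lemma Rel.act (h : Rel r' r Θ e v) (m : x ⟶ x') : Rel r' r Θ (e.act m) (v.act m) := by
  unfold Rel at *
  rw [riso_act, riso_act, reassoc_of% h]

lemma Rel.res (pG : πG.IsPresentation) (h : Rel r' r Θ e v) (f : V ⟶ U) {t : S'.obj.obj (op V)}
    (ht : S'.obj.map f.op s = t) :
    Rel r' r Θ (e.res f ht) (v.res f (BiaddFunctor.hom_res f ht)) := by
  unfold Rel at *
  have h₁ := r'.riso_res f ht e
  have h₂ := r.riso_res f (BiaddFunctor.hom_res f ht) v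
  have h₃ := Θ.res f s t ht (BiaddFunctor.hom_res f ht) ((πH.fn U).obj y) ((πK.fn U).obj z)
  have h₄ := Θ.bimap_app t (πH.ptFrame f y) (πK.ptFrame f z)
  refine (@cancel_epi _ _ _ _ _ _ (@IsIso.epi_of_iso _ _ _ _ _ (pG.stack.isIso
    (F'.rs f ht _ _ ≫ bimap (F'.functor t) (πH.ptFrame f y) (πK.ptFrame f z)))) _ _).mp ?_
  refine Eq.trans ?_ ((Category.assoc _ _ _).trans h₁).symm
  rw [← h, Functor.map_comp, Category.assoc, reassoc_of% h₄]
  refine Eq.trans ?_ ((congrArg (_ ≫ ·) h₂).trans (Category.assoc _ _ _).symm)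
  exact (Category.assoc _ _ _).symm.trans ((congrArg (· ≫ _) h₃).trans (Category.assoc _ _ _))

lemma Rel.mul₁ (pG : πG.IsPresentation) (h : Rel r' r Θ e v) {e' : E'.Over s y' z x'}
    {v' : E.Over (p.hom.app (op U) s) y' z x'} (h' : Rel r' r Θ e' v') :
    Rel r' r Θ (e.mul₁ e') (v.mul₁ v') := by
  unfold Rel at *
  have h₁ := r'.riso_mul₁ e e'
  have h₂ := r.riso_mul₁ v v'
  have h₃ := (Θ.isMonoidal₁ s ((πK.fn U).obj z)).tensor ((πH.fn U).obj y) ((πH.fn U).obj y')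
  change bμ₁ (F'.functor s) _ _ _ ≫ ((Θ.app s).app _).app _ =
    (((Θ.app s).app _).app _ ⊗ₘ ((Θ.app s).app _).app _) ≫ bμ₁ (F.functor _) _ _ _ at h₃
  have h₄ := Θ.bimap_app s (μ (πH.fn U) y y') (𝟙 ((πK.fn U).obj z))
  rw [← bimap_id_right] at h₁ h₂
  refine (@cancel_epi _ _ _ _ _ _ (@IsIso.epi_of_iso _ _ _ _ _ (pG.stack.isIso
    (bμ₁ (F'.functor s) _ _ _ ≫ bimap (F'.functor s) (μ (πH.fn U) y y') (𝟙 _)))) _ _).mp ?_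
  rw [Category.assoc, Category.assoc, h₁, reassoc_of% h₄, reassoc_of% h₃, h₂,
    tensorHom_comp_tensorHom_assoc, h, h']

lemma Rel.mul₂ (pG : πG.IsPresentation) (h : Rel r' r Θ e v) {e' : E'.Over s y z' x'}
    {v' : E.Over (p.hom.app (op U) s) y z' x'} (h' : Rel r' r Θ e' v') :
    Rel r' r Θ (e.mul₂ e') (v.mul₂ v') := by
  unfold Rel at *
  have h₁ := r'.riso_mul₂ e e'
  have h₂ := r.riso_mul₂ v v'
  have h₃ := (Θ.isMonoidal₂ s ((πH.fn U).obj y)).tensor ((πK.fn U).obj z) ((πK.fn U).obj z')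
  change bμ₂ (F'.functor s) _ _ _ ≫ ((Θ.app s).app _).app _ =
    (((Θ.app s).app _).app _ ⊗ₘ ((Θ.app s).app _).app _) ≫ bμ₂ (F.functor _) _ _ _ at h₃
  have h₄ := Θ.bimap_app s (𝟙 ((πH.fn U).obj y)) (μ (πK.fn U) z z')
  rw [← bimap_id_left] at h₁ h₂
  refine (@cancel_epi _ _ _ _ _ _ (@IsIso.epi_of_iso _ _ _ _ _ (pG.stack.isIso
    (bμ₂ (F'.functor s) _ _ _ ≫ bimap (F'.functor s) (𝟙 _) (μ (πK.fn U) z z')))) _ _).mp ?_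
  rw [Category.assoc, Category.assoc, h₁, reassoc_of% h₄, reassoc_of% h₃, h₂,
    tensorHom_comp_tensorHom_assoc, h, h']

lemma rel_triv₁ (pG : πG.IsPresentation) (h : H.G₁.obj (op U)) :
    Rel r' r Θ (.triv₁ E' s h z) (.triv₁ E _ h z) := by
  unfold Rel
  have h₁ := r'.iso_s₁ s h z.pt (one_mul _).symm
  have h₂ := r.iso_s₁ (p.hom.app (op U) s) h z.pt (one_mul _).symm
  have h₃ := (Θ.isMonoidal₁ s ((πK.fn U).obj z)).unit
  change bε₁ (F'.functor s) _ ≫ ((Θ.app s).app _).app _ = bε₁ (F.functor _) _ at h₃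
  let m : 𝟙_ (H.Pt U) ⟶ ⟨H.d h⟩ := ⟨h, (one_mul _).symm⟩
  have h₄ := Θ.bimap_app s (ε (πH.fn U) ≫ (πH.fn U).map m) (𝟙 ((πK.fn U).obj z))
  rw [← bimap_id_right] at h₁ h₂
  refine (@cancel_epi _ _ _ _ _ _ (@IsIso.epi_of_iso _ _ _ _ _ (pG.stack.isIso
    (bε₁ (F'.functor s) _ ≫
      bimap (F'.functor s) (ε (πH.fn U) ≫ (πH.fn U).map m) (𝟙 _)))) _ _).mp ?_
  refine Eq.trans ?_ ((Category.assoc _ _ _).trans h₁).symm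
  rw [Category.assoc, reassoc_of% h₄, reassoc_of% h₃]
  exact h₂

lemma rel_triv₂ (pG : πG.IsPresentation) (k : K.G₁.obj (op U)) :
    Rel r' r Θ (.triv₂ E' s y k) (.triv₂ E _ y k) := by
  unfold Rel
  have h₁ := r'.iso_s₂ s y.pt k (one_mul _).symm
  have h₂ := r.iso_s₂ (p.hom.app (op U) s) y.pt k (one_mul _).symm
  have h₃ := (Θ.isMonoidal₂ s ((πH.fn U).obj y)).unit
  change bε₂ (F'.functor s) _ ≫ ((Θ.app s).app _).app _ = bε₂ (F.functor _) _ at h₃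
  let m : 𝟙_ (K.Pt U) ⟶ ⟨K.d k⟩ := ⟨k, (one_mul _).symm⟩
  have h₄ := Θ.bimap_app s (𝟙 ((πH.fn U).obj y)) (ε (πK.fn U) ≫ (πK.fn U).map m)
  rw [← bimap_id_left] at h₁ h₂
  refine (@cancel_epi _ _ _ _ _ _ (@IsIso.epi_of_iso _ _ _ _ _ (pG.stack.isIso
    (bε₂ (F'.functor s) _ ≫
      bimap (F'.functor s) (𝟙 _) (ε (πK.fn U) ≫ (πK.fn U).map m)))) _ _).mp ?_
  refine Eq.trans ?_ ((Category.assoc _ _ _).trans h₁).symm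
  rw [Category.assoc, reassoc_of% h₄, reassoc_of% h₃]
  exact h₂

end Represents

end BiaddBfl

namespace BiaddBfl

open Functor.LaxMonoidal CrossedModule MonoidalMorphism

variable {C : Type u} [Category.{v} C] {J : GrothendieckTopology C} {S S' S'' : Sheaf J (Type w)}
  {H K : CrossedModule.{v, u, w} J} {G : BraidedCrossedModule.{v, u, w} J}
  {𝓗 : MonoidalPrestack.{v, u, v₁, u₁} C} {𝓚 : MonoidalPrestack.{v, u, v₂, u₂} C}
  {𝓖 : BraidedPrestack.{v, u, w, u₃} C}
  {πH : MonoidalMorphism H.prestack 𝓗} {πK : MonoidalMorphism K.prestack 𝓚}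
  {πG : MonoidalMorphism G.toCrossedModule.prestack 𝓖.toMonoidalPrestack}

namespace Represents

variable {p : S' ⟶ S} {E' : Butterfly S' H K G} {E : Butterfly S H K G}
  {F' : BiaddFunctor S' 𝓗 𝓚 𝓖} {F : BiaddFunctor S 𝓗 𝓚 𝓖}

/-- Pointwise images under a morphism of the represented functors assemble to a morphism of
butterflies. -/
lemma exists_compat_of_rel {r' : Represents πH πK πG E' F'} {r : Represents πH πK πG E F}
    (pG : πG.IsPresentation) {Θ : BiaddFunctor.HomOver p F' F}
    (ex : ∀ {U : C} {s : S'.obj.obj (op U)} {y : H.Pt U} {z : K.Pt U} {x : G.Pt U}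
      (e : E'.Over s y z x), ∃ v, Rel r' r Θ e v) :
    ∃ φ : Butterfly.HomOver p E' E, r'.Compat φ r Θ := by
  choose v hv using @ex
  let full {U : C} (a : E'.Sec U) : E'.Over (E'.base a) ⟨E'.fst a⟩ ⟨E'.snd a⟩ ⟨E'.sec a⟩ :=
    ⟨a, rfl, rfl, rfl, rfl⟩
  have key {U : C} {s : S'.obj.obj (op U)} {y : H.Pt U} {z : K.Pt U} {x : G.Pt U}
      (e : E'.Over s y z x) (w : E.Over (p.hom.app (op U) s) y z x) (hw : Rel r' r Θ e w) :
      (v (full e.val)).val = w.val := by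
    rw [← (hv e).unique pG hw]
    obtain ⟨y⟩ := y
    obtain ⟨z⟩ := z
    obtain ⟨x⟩ := x
    obtain ⟨a, hs, hy, hz, hx⟩ := e
    dsimp only at hs hy hz hx
    subst hs hy hz hx
    rfl
  refine ⟨{
    app a := (v (full a)).val
    res f a := key ((full a).res f rfl) _ ((hv (full a)).res pG f rfl)
    base a := (v (full a)).base_eq
    fst a := (v (full a)).fst_eq
    snd a := (v (full a)).snd_eq
    act a g := key ((full a).act (⟨g, rfl⟩ : _ ⟶ (⟨E'.sec a * G.d g⟩ : G.Pt _))) _ ((hv (full a)).act _)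
    sec a := (v (full a)).sec_eq
    mul₁ a a' c c' := by
      let a₁ : E'.Over (E'.base a) ⟨E'.fst a'⟩ ⟨E'.snd a⟩ ⟨E'.sec a'⟩ :=
        ⟨a', c.1.symm, rfl, c.2.symm, rfl⟩
      refine (key ((full a).mul₁ a₁) _ ((hv (full a)).mul₁ pG (hv a₁))).trans ?_
      have h := key a₁ _ (hv a₁)
      dsimp only [Butterfly.Over.mul₁]
      congr 1
      exact h.symm
    mul₂ a a' c c' := by
      let a₁ : E'.Over (E'.base a) ⟨E'.fst a⟩ ⟨E'.snd a'⟩ ⟨E'.sec a'⟩ :=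
        ⟨a', c.1.symm, c.2.symm, rfl, rfl⟩
      refine (key ((full a).mul₂ a₁) _ ((hv (full a)).mul₂ pG (hv a₁))).trans ?_
      have h := key a₁ _ (hv a₁)
      dsimp only [Butterfly.Over.mul₂]
      congr 1
      exact h.symm
    s₁ s h z := key (z := ⟨z⟩) (.triv₁ E' s h _) _ (rel_triv₁ pG h)
    s₂ s y k := key (y := ⟨y⟩) (.triv₂ E' s _ k) _ (rel_triv₂ pG k) }, fun {U s y z x} e => ?_⟩
  refine Eq.trans (congrArg (fun w => _ ≫ r.riso w) ?_) (hv e)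
  exact Butterfly.Over.ext (key e _ (hv e))

/-- Every morphism into a biadditive functor comes from one into its butterfly of points. -/
lemma exists_compat_representsPoints (r' : Represents πH πK πG E' F') (pG : πG.IsPresentation)
    (hb : ∀ {V : C} (x x' : G.Pt V), μ (πG.fn V) x x' ≫ (πG.fn V).map (β_ x x').hom =
      (β_ _ _).hom ≫ μ (πG.fn V) x' x) (Θ : BiaddFunctor.HomOver p F' F) :
    ∃ χ : Butterfly.HomOver p E' (F.points πH πK pG hb),
      r'.Compat χ (F.representsPoints πH πK pG hb) Θ := by
  refine exists_compat_of_rel pG fun {U s y z x} e => ?_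
  have i := pG.stack.isIso (((Θ.app s).app ((πH.fn U).obj y)).app ((πK.fn U).obj z))
  refine ⟨⟨Point.of (p.hom.app (op U) s) y z x
    (inv (((Θ.app s).app ((πH.fn U).obj y)).app ((πK.fn U).obj z)) ≫ r'.riso e),
    rfl, rfl, rfl, rfl⟩, ?_⟩
  exact IsIso.hom_inv_id_assoc (((Θ.app s).app ((πH.fn U).obj y)).app ((πK.fn U).obj z))
    (r'.riso e)

/-- Morphisms of represented functors come from unique morphisms of butterflies. -/
lemma existsUnique_homOver (r' : Represents πH πK πG E' F') (r : Represents πH πK πG E F)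
    (pG : πG.IsPresentation)
    (hb : ∀ {V : C} (x x' : G.Pt V), μ (πG.fn V) x x' ≫ (πG.fn V).map (β_ x x').hom =
      (β_ _ _).hom ≫ μ (πG.fn V) x' x) (Θ : BiaddFunctor.HomOver p F' F) :
    ∃! φ : Butterfly.HomOver p E' E, r'.Compat φ r Θ := by
  obtain ⟨c, hc⟩ := r.exists_compat_representsPoints pG hb (BiaddFunctor.HomOver.id F)
  obtain ⟨χ, hχ⟩ := r'.exists_compat_representsPoints pG hb Θ
  obtain ⟨φ, hφ, -⟩ := Butterfly.HomOver.existsUnique_comp (p := p) (q := 𝟙 S) c χ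
  have h : r'.Compat φ r Θ := fun {U s y z x} e => by
    have h₁ := hc (φ.onOver e)
    have h₂ : c.onOver (φ.onOver e) = χ.onOver e :=
      Butterfly.Over.ext (congrArg (fun ψ => Butterfly.HomOver.app ψ e.val) hφ)
    refine Eq.trans (congrArg (_ ≫ ·) ?_) (hχ e)
    rw [← h₂]
    exact h₁.symm.trans (Category.id_comp _)
  refine ⟨φ, h, fun φ' h' => Butterfly.HomOver.ext (funext fun U => funext fun a => ?_)⟩
  let e : E'.Over (E'.base a) ⟨E'.fst a⟩ ⟨E'.snd a⟩ ⟨E'.sec a⟩ := ⟨a, rfl, rfl, rfl, rfl⟩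
  exact congrArg Butterfly.Over.val (Rel.unique (e := e) pG (h' e) (h e))

end Represents

end BiaddBfl

namespace BiaddBfl

open Functor.LaxMonoidal CrossedModule MonoidalMorphism

variable {C : Type u} [Category.{v} C] {J : GrothendieckTopology C} {S S' S'' : Sheaf J (Type w)}
  {H K : CrossedModule.{v, u, w} J} {G : BraidedCrossedModule.{v, u, w} J}
  {𝓗 : MonoidalPrestack.{v, u, v₁, u₁} C} {𝓚 : MonoidalPrestack.{v, u, v₂, u₂} C}
  {𝓖 : BraidedPrestack.{v, u, w, u₃} C}
  {πH : MonoidalMorphism H.prestack 𝓗} {πK : MonoidalMorphism K.prestack 𝓚}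
  {πG : MonoidalMorphism G.toCrossedModule.prestack 𝓖.toMonoidalPrestack}


section FromUnit

variable {M : CrossedModule.{v, u, w} J} {Q : MonoidalPrestack.{v, u, v₁, u₁} C}
  (π : MonoidalMorphism M.prestack Q) {U V : C}

/-- The morphism `1 ⟶ π x` given by a section `g` with `∂g = x`. -/
def MonoidalMorphism.fromUnit {x : M.Pt U} (m : 𝟙_ (M.Pt U) ⟶ x) : 𝟙_ (Q.Fib U) ⟶ (π.fn U).obj x :=
  ε (π.fn U) ≫ (π.fn U).map m

lemma MonoidalMorphism.fromUnit_tens {x x' : M.Pt U} (m : 𝟙_ (M.Pt U) ⟶ x) (m' : 𝟙_ (M.Pt U) ⟶ x')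
    (n : 𝟙_ (M.Pt U) ⟶ x ⊗ x') (h : n.elt = m.elt * m'.elt) :
    (λ_ (𝟙_ (Q.Fib U))).hom ≫ π.fromUnit n =
      (π.fromUnit m ⊗ₘ π.fromUnit m') ≫ μ (π.fn U) x x' := by
  have e : n = (λ_ (𝟙_ (M.Pt U))).inv ≫ (m ⊗ₘ m') := Pt.hom_ext (by
    change n.elt = 1 * (M.act m.elt 1 * m'.elt)
    rw [h, M.act_one, one_mul])
  have h₁ : (ε (π.fn U) ⊗ₘ ε (π.fn U)) ≫ μ (π.fn U) (𝟙_ _) (𝟙_ _) =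
      (λ_ _).hom ≫ ε (π.fn U) ≫ (π.fn U).map (λ_ (𝟙_ (M.Pt U))).inv := by
    rw [← left_unitality_inv, MonoidalCategory.tensorHom_def', Category.assoc,
      ← leftUnitor_naturality_assoc, Iso.hom_inv_id_assoc]
  unfold MonoidalMorphism.fromUnit
  rw [e, ← tensorHom_comp_tensorHom, Category.assoc, μ_natural, Functor.map_comp, reassoc_of% h₁]

lemma MonoidalMorphism.fromUnit_res (f : V ⟶ U) {x : M.Pt U} (m : 𝟙_ (M.Pt U) ⟶ x)
    (n : 𝟙_ (M.Pt V) ⟶ (M.ptRes f).obj x) (h : n.elt = M.G₁.map f.op m.elt) :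
    (Q.res f).map (π.fromUnit m) ≫ π.ptFrame f x =
      Functor.OplaxMonoidal.η (Q.res f) ≫ π.fromUnit n := by
  have e : n = ε (M.ptRes f) ≫ (M.ptRes f).map m := Pt.hom_ext (h.trans (one_mul _).symm)
  have h₁ := NatTrans.IsMonoidal.unit (τ := (π.fnRes f).hom)
  rw [Functor.LaxMonoidal.comp_ε, Functor.LaxMonoidal.comp_ε, Category.assoc] at h₁
  have h₂ := (π.fnRes f).hom.naturality m
  unfold MonoidalMorphism.fromUnit
  rw [e, Functor.map_comp, Functor.map_comp, ← cancel_epi (ε (Q.res f)),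
    Functor.Monoidal.ε_η_assoc, Category.assoc]
  refine Eq.trans (congrArg (fun a => _ ≫ _ ≫ a) h₂) ?_
  refine Eq.trans ?_ ((congrArg (· ≫ _) h₁).trans (Category.assoc _ _ _))
  exact (congrArg (_ ≫ ·) (Category.assoc _ _ _).symm).trans (Category.assoc _ _ _).symm

end FromUnit

variable (S πH πK πG) in
/-- The trivial butterfly represents the trivial biadditive functor. -/
def representsTrivial :
    Represents πH πK πG (Butterfly.trivial S H K G) (BiaddFunctor.trivial S 𝓗 𝓚 𝓖) where
  iso {U} e _ _ _ x _ _ _ hx := πG.fromUnit (U := U) (x := ⟨x⟩)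
    ⟨e.2.2.2, hx.symm.trans (one_mul _).symm⟩
  iso_act {U} e g s y z x x' hs hy hz hx hs' hy' hz' hx' h := by
    refine Eq.trans ?_ (Category.assoc _ _ _).symm
    refine congrArg (_ ≫ ·) (Eq.trans ?_ ((πG.fn U).map_comp _ _))
    rfl
  iso_res f e s y z x hs hy hz hx hs' hy' hz' hx' := by
    refine (πG.fromUnit_res f (x := ⟨x⟩) ⟨e.2.2.2, _⟩
      ⟨_, hx'.symm.trans (one_mul _).symm⟩ rfl).trans ?_
    refine congrArg (_ ≫ ·) ?_
    exact ((Category.id_comp _).trans (Category.id_comp _)).symm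
  iso_mul₁ e e' c s y y' z x x' hs hy hz hx hs' hy' hz' hx' hs'' hy'' hz'' hx'' := by
    refine Eq.trans (congrArg (_ ≫ ·) (Category.id_comp _)) ?_
    exact πG.fromUnit_tens (x := ⟨x⟩) (x' := ⟨x'⟩) _ _ _ rfl
  iso_mul₂ e e' c s y z z' x x' hs hy hz hx hs' hy' hz' hx' hs'' hy'' hz'' hx'' := by
    refine Eq.trans (congrArg (_ ≫ ·) (Category.id_comp _)) ?_
    exact πG.fromUnit_tens (x := ⟨x⟩) (x' := ⟨x'⟩) _ _ _ rfl
  iso_s₁ {U} s h z h₁ := by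
    refine (Category.id_comp _).trans ((Category.id_comp _).trans ?_)
    refine Eq.trans (congrArg (_ ≫ ·) ((πG.fn U).map_id (𝟙_ (G.Pt U)))) (Category.comp_id _)
  iso_s₂ {U} s y k h₁ := by
    refine (Category.id_comp _).trans ((Category.id_comp _).trans ?_)
    refine Eq.trans (congrArg (_ ≫ ·) ((πG.fn U).map_id (𝟙_ (G.Pt U)))) (Category.comp_id _)

lemma compat_trivialMap (p : S' ⟶ S) :
    (representsTrivial S' πH πK πG).Compat (Butterfly.trivialMap p H K G)
      (representsTrivial S πH πK πG) (BiaddFunctor.trivialMap p 𝓗 𝓚 𝓖) :=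
  fun _ => Category.id_comp _

namespace Represents

lemma compat_id {E : Butterfly S H K G} {F : BiaddFunctor S 𝓗 𝓚 𝓖}
    (r : Represents πH πK πG E F) :
    r.Compat (Butterfly.HomOver.id E) r (BiaddFunctor.HomOver.id F) :=
  fun _ => Category.id_comp _

lemma Compat.comp {p : S'' ⟶ S'} {q : S' ⟶ S} {E'' : Butterfly S'' H K G}
    {E' : Butterfly S' H K G} {E : Butterfly S H K G} {F'' : BiaddFunctor S'' 𝓗 𝓚 𝓖}
    {F' : BiaddFunctor S' 𝓗 𝓚 𝓖} {F : BiaddFunctor S 𝓗 𝓚 𝓖} {r'' : Represents πH πK πG E'' F''}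
    {r' : Represents πH πK πG E' F'} {r : Represents πH πK πG E F}
    {φ : Butterfly.HomOver p E'' E'} {ψ : Butterfly.HomOver q E' E}
    {Θ : BiaddFunctor.HomOver p F'' F'} {Ξ : BiaddFunctor.HomOver q F' F}
    (h : r''.Compat φ r' Θ) (h' : r'.Compat ψ r Ξ) :
    r''.Compat (φ.comp ψ) r (Θ.comp Ξ) := fun e =>
  (Category.assoc _ _ _).trans ((congrArg (_ ≫ ·) (h' (φ.onOver e))).trans (h e))

end Represents

end BiaddBfl

namespace BiaddBfl

open Functor.LaxMonoidal CrossedModule MonoidalMorphism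

variable {C : Type u} [Category.{v} C] {J : GrothendieckTopology C} {S S' S'' : Sheaf J (Type w)}
  {H K : CrossedModule.{v, u, w} J} {G : BraidedCrossedModule.{v, u, w} J}
  {𝓗 : MonoidalPrestack.{v, u, v₁, u₁} C} {𝓚 : MonoidalPrestack.{v, u, v₂, u₂} C}
  {𝓖 : BraidedPrestack.{v, u, w, u₃} C}
  {πH : MonoidalMorphism H.prestack 𝓗} {πK : MonoidalMorphism K.prestack 𝓚}
  {πG : MonoidalMorphism G.toCrossedModule.prestack 𝓖.toMonoidalPrestack}

/-- Two biadditive functors represented by the same butterfly are isomorphic. -/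
lemma Represents.exists_iso (pH : πH.IsPresentation) (pK : πK.IsPresentation)
    (pG : πG.IsPresentation) {E : Butterfly S H K G} {F F' : BiaddFunctor S 𝓗 𝓚 𝓖}
    (r' : Represents πH πK πG E F') (r : Represents πH πK πG E F) :
    ∃ i : F' ≅ F, r'.Compat (Butterfly.HomOver.id E) r i.hom := by
  obtain ⟨Θ, h, -⟩ := Represents.existsUnique_compat pH pK pG.stack (Butterfly.HomOver.id E) r' r
  have := BiaddFunctor.isGroupoid (𝓗 := 𝓗) (𝓚 := 𝓚) pG.stack S
  exact ⟨@asIso _ _ _ _ Θ (IsGroupoid.all_isIso _), h⟩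

section Equivalence

variable (pH : πH.IsPresentation) (pK : πK.IsPresentation) (pG : πG.IsPresentation)
  (hb : ∀ {V : C} (x x' : G.Pt V), μ (πG.fn V) x x' ≫ (πG.fn V).map (β_ x x').hom =
    (β_ _ _).hom ≫ μ (πG.fn V) x' x)

include pH pK pG hb in
/-- The functor sending a butterfly to the biadditive functor that it represents. -/
lemma exists_fiberedFunctor : ∃ (u : FiberedFunctor H K G 𝓗 𝓚 𝓖)
    (r : ∀ {S : Sheaf J (Type w)} (E : Butterfly S H K G), Represents πH πK πG E (u.obj E)),
    ∀ {S' S : Sheaf J (Type w)} {p : S' ⟶ S} {E' : Butterfly S' H K G} {E : Butterfly S H K G}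
      (φ : Butterfly.HomOver p E' E), (r E').Compat φ (r E) (u.map φ) := by
  have ex {S : Sheaf J (Type w)} (E : Butterfly S H K G) :=
    exists_represents (πG := πG) E pH pK pG.stack hb
  choose F r using @ex
  have ex' {S' S : Sheaf J (Type w)} {p : S' ⟶ S} {E' : Butterfly S' H K G}
      {E : Butterfly S H K G} (φ : Butterfly.HomOver p E' E) :=
    Represents.existsUnique_compat pH pK pG.stack φ (r E').some (r E).some
  choose m hm hu using @ex'
  exact ⟨{
    obj := F
    map := m
    map_id E := (hu _ _ (Represents.compat_id _)).symm
    map_comp φ ψ := (hu _ _ (Represents.Compat.comp (hm φ) (hm ψ))).symm }, fun E => (r E).some, hm⟩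

namespace FiberedFunctor

variable {u : FiberedFunctor H K G 𝓗 𝓚 𝓖}
  {r : ∀ {S : Sheaf J (Type w)} (E : Butterfly S H K G), Represents πH πK πG E (u.obj E)}
  (hu : ∀ {S' S : Sheaf J (Type w)} {p : S' ⟶ S} {E' : Butterfly S' H K G}
    {E : Butterfly S H K G} (φ : Butterfly.HomOver p E' E), (r E').Compat φ (r E) (u.map φ))

include pH pK pG hb hu in
lemma isEquivalence_of_compat : u.IsEquivalence where
  bijective p E' E := by
    refine ⟨fun φ ψ h => ?_, fun Θ => ?_⟩
    · exact ((r E').existsUnique_homOver (r E) pG hb (u.map φ)).unique (hu φ) (h ▸ hu ψ)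
    · obtain ⟨φ, h, -⟩ := (r E').existsUnique_homOver (r E) pG hb Θ
      exact ⟨φ, (Represents.existsUnique_compat pH pK pG.stack φ (r E') (r E)).unique (hu φ) h⟩
  essSurj S F := by
    obtain ⟨i, -⟩ := Represents.exists_iso pH pK pG (r (F.points πH πK pG hb))
      (F.representsPoints πH πK pG hb)
    exact ⟨_, ⟨i⟩⟩

include pH pK pG hu in
lemma isPointed_of_compat : u.IsPointed := by
  choose i hi using fun S : Sheaf J (Type w) => Represents.exists_iso pH pK pG
    (r (Butterfly.trivial S H K G)) (representsTrivial S πH πK πG)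
  refine ⟨i, fun {S' S} p => ?_⟩
  exact (Represents.existsUnique_compat pH pK pG.stack (Butterfly.trivialMap p H K G)
    (r (Butterfly.trivial S' H K G)) (representsTrivial S πH πK πG)).unique
      (Represents.Compat.comp (hu (Butterfly.trivialMap p H K G)) (hi S))
      (Represents.Compat.comp (hi S') (compat_trivialMap p))

lemma IsEquivalence.onFiber (h : u.IsEquivalence) (S : Sheaf J (Type w)) :
    (u.onFiber S).IsEquivalence where
  faithful := ⟨fun {E' E} _ _ e => (h.bijective (𝟙 S) E' E).1 e⟩
  full := ⟨fun {E' E} Θ => (h.bijective (𝟙 S) E' E).2 Θ⟩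
  essSurj := ⟨fun F => h.essSurj S F⟩

end FiberedFunctor

end Equivalence

end BiaddBfl

theorem theorem1 {C : Type u} [Category.{v} C] (J : GrothendieckTopology C)
    (H K : BiaddBfl.CrossedModule.{v, u, w} J) (G : BiaddBfl.BraidedCrossedModule.{v, u, w} J)
    (𝓗 : BiaddBfl.MonoidalPrestack.{v, u, v₁, u₁} C)
    (𝓚 : BiaddBfl.MonoidalPrestack.{v, u, v₂, u₂} C)
    (𝓖 : BiaddBfl.BraidedPrestack.{v, u, w, u₃} C)
    (h𝓗 : 𝓗.IsGroupLikeStack J) (h𝓚 : 𝓚.IsGroupLikeStack J)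
    (h𝓖 : 𝓖.toMonoidalPrestack.IsGroupLikeStack J)
    (πH : BiaddBfl.MonoidalMorphism H.prestack 𝓗) (hπH : πH.IsLocalEquivalence J)
    (πK : BiaddBfl.MonoidalMorphism K.prestack 𝓚) (hπK : πK.IsLocalEquivalence J)
    (πG : BiaddBfl.MonoidalMorphism G.braidedPrestack.toMonoidalPrestack 𝓖.toMonoidalPrestack)
    (hπG : πG.IsLocalEquivalence J) (hπG_braided : πG.IsBraided) :
    (∀ S : Sheaf J (Type w), IsGroupoid (BiaddBfl.Butterfly S H K G) ∧
      IsGroupoid (BiaddBfl.BiaddFunctor S 𝓗 𝓚 𝓖)) ∧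
    BiaddBfl.Butterfly.IsFibredInGroupoids H K G ∧
    BiaddBfl.BiaddFunctor.IsFibredInGroupoids 𝓗 𝓚 𝓖 J ∧
    ∃ u : BiaddBfl.FiberedFunctor H K G 𝓗 𝓚 𝓖,
      u.IsEquivalence ∧ u.IsPointed ∧ u.Realizes πH πK πG ∧
      ∃ u₀ : BiaddBfl.Bfl H K G ⥤ BiaddBfl.Biadd 𝓗 𝓚 𝓖 J,
        u₀ = u.onFiber (BiaddBfl.point J) ∧ u₀.IsEquivalence ∧
        Nonempty (u₀.obj (BiaddBfl.Butterfly.trivial (BiaddBfl.point J) H K G) ≅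
          BiaddBfl.BiaddFunctor.trivial (BiaddBfl.point J) 𝓗 𝓚 𝓖) := by
  have pH : πH.IsPresentation := ⟨hπH, h𝓗⟩
  have pK : πK.IsPresentation := ⟨hπK, h𝓚⟩
  have pG : BiaddBfl.MonoidalMorphism.IsPresentation (M := G.toCrossedModule) πG := ⟨hπG, h𝓖⟩
  obtain ⟨u, r, hu⟩ := BiaddBfl.exists_fiberedFunctor (πG := πG) pH pK pG hπG_braided
  have he := BiaddBfl.FiberedFunctor.isEquivalence_of_compat pH pK pG hπG_braided hu
  have hp := BiaddBfl.FiberedFunctor.isPointed_of_compat pH pK pG hu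
  refine ⟨fun S => ⟨BiaddBfl.Butterfly.isGroupoid S H K G, BiaddBfl.BiaddFunctor.isGroupoid h𝓖 S⟩,
    BiaddBfl.Butterfly.isFibredInGroupoids H K G, BiaddBfl.BiaddFunctor.isFibredInGroupoids h𝓖,
    u, he, hp, ⟨r, ?_⟩, _, rfl, he.onFiber _, ⟨hp.choose _⟩⟩
  intro S' S p E' E φ U e s y z x hs hy hz hx hs' hy' hz' hx'
  exact hu φ (y := ⟨y⟩) (z := ⟨z⟩) (x := ⟨x⟩) ⟨e, hs, hy, hz, hx⟩
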